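/- Let $k$ be an algebraically closed field, $V$ a finite-dimensional $k$-vector space, $R\subseteq V\otimes V$, and let $A=TV/(R)$ be a Koszul Artin–Schelter regular algebra of global dimension $d\ge 1$. Let $\underline{\mathrm{aut}}(A)$ be the universal Hopf algebra coacting on $A$ (through graded algebra morphisms $A_n\to \underline{\mathrm{aut}}(A)\otimes A_n$). All comodules are finite-dimensional left comodules over it. For $1\le a\le d$ put $R_a=\bigcap_{i+j+2=a}V^{\otimes i}\otimes R\otimes V^{\otimes j}\subseteq V^{\otimes a}$ (so $R_1=V$, $R_2=R$). Each $R_a$ is a comodule, and $R_d$ is one-dimensional. Let $\Lambda$ be the monoid $\langle r_1,\dots,r_{d-1},r_d^{\pm1}\rangle$, and for $\lambda\in\Lambda$ let $M(\lambda)$ be the comodule obtained from $M(r_a)=R_a$, $M(r_d^{-1})=R_d^*$ by sending products to tensor products. Equip $\Lambda$ with the left and right invariant partial order generated by $r_{a+b}<r_ar_b$ (for $a,b\ge1$, $a+b\le d$) and $r_{a+b-d}<r_ar_d^{-1}r_b$ (for $a,b<d$, $a+b\ge d$, with $r_0=1$). Let $\mathcal U$ be the monoidal category with objects $\Lambda$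 whose morphisms are generated by $\phi_{a,b}:r_{a+b}\to r_ar_b$ and $\theta_{a,b}:r_ar_d^{-1}r_b\to r_{a+b-d}$. The functor $M$ sends $\phi_{a,b}$ to the inclusion $R_{a+b}\subseteq R_a\otimes R_b$. For $a+b=d$ it sends $\theta_{a,b}$ to the pairing $R_a\otimes R_d^*\otimes R_b\to k$ inverse to the inclusion $R_d\subseteq R_b\otimes R_a$, and for $a+b>d$ it sends $\theta_{a,b}$ to the map induced by this pairing of $R_a$ with $R_{d-a}$ through $R_b\subseteq R_{d-a}\otimes R_{a+b-d}$. Put $$\nabla(\lambda)=\operatorname{coker}\Big(\bigoplus_{\mu\to\lambda\text{ in }\mathcal U,\ \mu<\lambda}M(\mu)\to M(\lambda)\Big),\qquad \Delta(\lambda)=\ker\Big(M(\lambda)\to\bigoplus_{\lambda\to\mu\text{ in }\mathcal U,\ \mu<\lambda}M(\mu)\Big).$$ Let $\mathcal F(\Delta)$ (resp. $\mathcal F(\nabla)$) be the class of comodules having a finite filtration by subcomodules all of whose subquotients are isomorphic to some $\Delta(\lambda)$ (resp. $\nabla(\lambda)$). Then: 1. $\mathcal F(\Delta)$ and $\mathcal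 F(\nabla)$ are closed under tensor products. 2. $M(\lambda)\in\mathcal F(\Delta)\cap\mathcal F(\nabla)$ for all $\lambda\in\Lambda$. 3. Let $u,v\in\Lambda$. If $u=wr_ar_d^{-x}$ and $v=r_d^{x}r_bw'$ with $w,w'\in\Lambda$, $x\in\mathbb Z$, $a,b\ge1$ and $a+b\le d$, then there is a short exact sequence of comodules $$0\to K\to\nabla(u)\otimes\nabla(v)\to\nabla(uv)\to0,$$ where $K=\nabla(wr_{a+b}w')$ if $a+b<d$, and $K=\nabla(w)\otimes R_d\otimes\nabla(w')$ if $a+b=d$. If $u,v$ have no such expressions, then $\nabla(u)\otimes\nabla(v)\cong\nabla(uv)$. 4. Dually, if $u=wr_ar_d^{-x-1}$ and $v=r_d^{x}r_bw'$ with $w,w'\in\Lambda$, $x\in\mathbb Z$, $1\le a,b<d$ and $a+b\ge d$, then there is a short exact sequence of comodules $$0\to\Delta(uv)\to\Delta(u)\otimes\Delta(v)\to C\to0,$$ where $C=\Delta(wr_{a+b-d}w')$ if $a+b>d$, and $C=\Delta(w)\otimes\Delta(w')$ if $a+b=d$. If $u,v$ have no such expressions, then $\Delta(u)\otimes\Delta(v)\cong\Delta(uv)$.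 -/

import Mathlib

open scoped TensorProduct

universe u

noncomputable section

namespace KoszulAS

section Slices

variable {k : Type u} [Field k] {H X Y : Type u} [AddCommGroup H] [Module k H]
  [AddCommGroup X] [Module k X] [AddCommGroup Y] [Module k Y]

/-- Contraction of the first tensor factor with a linear functional. -/
def slice (φ : Module.Dual k H) : H ⊗[k] X →ₗ[k] X :=
  (TensorProduct.lid k X).toLinearMap ∘ₗ φ.rTensor X

@[simp] lemma slice_tmul (φ : Module.Dual k H) (h : H) (x : X) :
    slice φ (h ⊗ₜ[k] x) = φ h • x := by simp [slice]

lemma slice_lTensor (φ : Module.Dual k H) (f : X →ₗ[k] Y) (z : H ⊗[k] X) :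
    slice φ (f.lTensor H z) = f (slice φ z) := by
  induction z with
  | zero => simp
  | tmul h x => simp
  | add a b ha hb => simp [ha, hb]

lemma mem_range_lTensor_iff (N : Submodule k X) (z : H ⊗[k] X) :
    z ∈ LinearMap.range (N.subtype.lTensor H) ↔ ∀ φ : Module.Dual k H, slice φ z ∈ N := by
  constructor
  · rintro ⟨y, rfl⟩ φ
    rw [slice_lTensor]
    exact (slice φ y).2
  · intro h
    classical
    let b := Module.Basis.ofVectorSpace k H
    have hz : z = ((TensorProduct.equivFinsuppOfBasisLeft b z).sum
        fun i x => b i ⊗ₜ[k] x) := by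
      conv_lhs => rw [← (TensorProduct.equivFinsuppOfBasisLeft b).symm_apply_apply z]
      rw [TensorProduct.equivFinsuppOfBasisLeft_symm_apply]
    have hs : ∀ i, TensorProduct.equivFinsuppOfBasisLeft b z i = slice (b.coord i) z := by
      intro i
      clear hz h
      induction z with
      | zero => simp
      | tmul h x => simp
      | add a b ha hb => simp [ha, hb]
    rw [hz]
    refine Submodule.sum_mem _ fun i _ => ?_
    have := h (b.coord i)
    rw [← hs i] at this
    exact ⟨b i ⊗ₜ[k] ⟨_, this⟩, by simp⟩

lemma lTensor_subtype_injective (N : Submodule k X) :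
    Function.Injective (N.subtype.lTensor H) :=
  Module.Flat.lTensor_preserves_injective_linearMap _ N.injective_subtype

end Slices

section Comodules

variable (k : Type u) [Field k] (H : Type u) [Ring H] [HopfAlgebra k H]

/-- Finite dimensional left comodules over `H`. -/
structure Comod where
  /-- the underlying vector space -/
  carrier : Type u
  [addCommGroup : AddCommGroup carrier]
  [module : Module k carrier]
  [finite : Module.Finite k carrier]
  /-- the coaction -/
  ρ : carrier →ₗ[k] H ⊗[k] carrier
  coassoc : ∀ x, TensorProduct.assoc k H H carrier
    ((Coalgebra.comul (R := k) (A := H)).rTensor carrier (ρ x)) = ρ.lTensor H (ρ x)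
  counit : ∀ x, TensorProduct.lid k carrier
    ((Coalgebra.counit (R := k) (A := H)).rTensor carrier (ρ x)) = x

attribute [instance] Comod.addCommGroup Comod.module Comod.finite

variable {k H}

lemma assoc_comul_lTensor {X Y : Type u} [AddCommGroup X] [Module k X] [AddCommGroup Y]
    [Module k Y] (f : X →ₗ[k] Y) (z : H ⊗[k] X) :
    TensorProduct.assoc k H H Y
      ((Coalgebra.comul (R := k) (A := H)).rTensor Y (f.lTensor H z)) =
    (f.lTensor H).lTensor H (TensorProduct.assoc k H H X
      ((Coalgebra.comul (R := k) (A := H)).rTensor X z)) := by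
  induction z with
  | zero => simp
  | add a b ha hb => simp only [map_add, ha, hb]
  | tmul a n =>
    simp only [LinearMap.rTensor_tmul, LinearMap.lTensor_tmul]
    induction Coalgebra.comul (R := k) a with
    | zero => simp
    | add a b ha hb => simp only [TensorProduct.add_tmul, map_add, ha, hb]
    | tmul a b => simp

lemma lid_counit_lTensor {X Y : Type u} [AddCommGroup X] [Module k X] [AddCommGroup Y]
    [Module k Y] (f : X →ₗ[k] Y) (z : H ⊗[k] X) :
    TensorProduct.lid k Y
      ((Coalgebra.counit (R := k) (A := H)).rTensor Y (f.lTensor H z)) =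
    f (TensorProduct.lid k X ((Coalgebra.counit (R := k) (A := H)).rTensor X z)) := by
  induction z with
  | zero => simp
  | add a b ha hb => simp only [map_add, ha, hb]
  | tmul a n => simp

namespace Comod

instance : CoeSort (Comod k H) (Type u) := ⟨Comod.carrier⟩

/-- A linear map between comodules is a comodule morphism. -/
def IsHom {X Y : Comod k H} (f : X →ₗ[k] Y) : Prop :=
  ∀ x, Y.ρ (f x) = f.lTensor H (X.ρ x)

/-- Isomorphism of comodules. -/
def Iso (X Y : Comod k H) : Prop := ∃ e : X ≃ₗ[k] Y, IsHom (e : X →ₗ[k] Y)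

/-- There is a short exact sequence of comodules `0 → X → Y → Z → 0`. -/
def ShortExact (X Y Z : Comod k H) : Prop :=
  ∃ (i : X →ₗ[k] Y) (p : Y →ₗ[k] Z), IsHom i ∧ IsHom p ∧ Function.Injective i ∧
    LinearMap.range i = LinearMap.ker p ∧ Function.Surjective p

/-- The coaction maps the subspace `N` into `H ⊗ N`. -/
def Stable (X : Comod k H) (N : Submodule k X) : Prop :=
  ∀ x ∈ N, X.ρ x ∈ LinearMap.range (N.subtype.lTensor H)

lemma stable_iff (X : Comod k H) (N : Submodule k X) :
    X.Stable N ↔ ∀ x ∈ N, ∀ φ : Module.Dual k H, slice φ (X.ρ x) ∈ N := by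
  simp only [Stable, mem_range_lTensor_iff]

/-- The restriction of a linear map `ρ : X → H ⊗ X` to a subspace `N` with `ρ N ⊆ H ⊗ N`. -/
def restrict {X : Type u} [AddCommGroup X] [Module k X] (ρ : X →ₗ[k] H ⊗[k] X)
    (N : Submodule k X) (h : ∀ x ∈ N, ρ x ∈ LinearMap.range (N.subtype.lTensor H)) :
    N →ₗ[k] H ⊗[k] N :=
  (LinearEquiv.ofInjective _ (lTensor_subtype_injective (H := H) N)).symm.toLinearMap ∘ₗ
    (ρ ∘ₗ N.subtype).codRestrict _ fun x => h x x.2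

lemma restrict_spec {X : Type u} [AddCommGroup X] [Module k X] (ρ : X →ₗ[k] H ⊗[k] X)
    (N : Submodule k X) (h : ∀ x ∈ N, ρ x ∈ LinearMap.range (N.subtype.lTensor H)) (x : N) :
    N.subtype.lTensor H (restrict ρ N h x) = ρ x := by
  have := congrArg Subtype.val ((LinearEquiv.ofInjective _
    (lTensor_subtype_injective (H := H) N)).apply_symm_apply
      ((ρ ∘ₗ N.subtype).codRestrict _ (fun x => h x x.2) x))
  exact this

/-- A finite dimensional subspace `N` with `ρ N ⊆ H ⊗ N` of a (possibly infinite dimensional)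
comodule `(X, ρ)`, as a comodule. -/
@[reducible] def ofSubspace {X : Type u} [AddCommGroup X] [Module k X] (ρ : X →ₗ[k] H ⊗[k] X)
    (hco : ∀ x, TensorProduct.assoc k H H X
      ((Coalgebra.comul (R := k) (A := H)).rTensor X (ρ x)) = ρ.lTensor H (ρ x))
    (hcu : ∀ x, TensorProduct.lid k X
      ((Coalgebra.counit (R := k) (A := H)).rTensor X (ρ x)) = x)
    (N : Submodule k X) [Module.Finite k N]
    (h : ∀ x ∈ N, ρ x ∈ LinearMap.range (N.subtype.lTensor H)) : Comod k H where
  carrier := N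
  ρ := restrict ρ N h
  coassoc x := by
    have inj : Function.Injective ((N.subtype.lTensor H).lTensor H) :=
      Module.Flat.lTensor_preserves_injective_linearMap _ (lTensor_subtype_injective N)
    apply inj
    have h2 : ∀ z : H ⊗[k] N, (N.subtype.lTensor H).lTensor H ((restrict ρ N h).lTensor H z) =
        ρ.lTensor H (N.subtype.lTensor H z) := by
      intro z
      induction z with
      | zero => simp
      | add a b ha hb => simp only [map_add, ha, hb]
      | tmul a n => simp [restrict_spec]
    rw [← assoc_comul_lTensor, h2, restrict_spec, hco]
  counit x := by
    apply N.injective_subtype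
    rw [← lid_counit_lTensor, restrict_spec, hcu]
    rfl

/-- A subcomodule, as a comodule. -/
@[reducible] def sub (X : Comod k H) (N : Submodule k X) (h : X.Stable N) : Comod k H :=
  ofSubspace X.ρ X.coassoc X.counit N h

lemma quot_aux (X : Comod k H) (N : Submodule k X) (h : X.Stable N) :
    N ≤ LinearMap.ker (N.mkQ.lTensor H ∘ₗ X.ρ) := by
  intro x hx
  obtain ⟨y, hy⟩ := h x hx
  rw [LinearMap.mem_ker, LinearMap.comp_apply, ← hy, ← LinearMap.comp_apply,
    ← LinearMap.lTensor_comp]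
  have : N.mkQ ∘ₗ N.subtype = 0 := by ext; simp
  simp [this]

/-- The quotient of a comodule by a subcomodule. -/
@[reducible] def quot (X : Comod k H) (N : Submodule k X) (h : X.Stable N) : Comod k H where
  carrier := X ⧸ N
  ρ := N.liftQ (N.mkQ.lTensor H ∘ₗ X.ρ) (quot_aux X N h)
  coassoc x := by
    obtain ⟨x, rfl⟩ := N.mkQ_surjective x
    have h2 : ∀ z : H ⊗[k] X, (N.liftQ (N.mkQ.lTensor H ∘ₗ X.ρ) (quot_aux X N h)).lTensor H
        (N.mkQ.lTensor H z) = (N.mkQ.lTensor H).lTensor H (X.ρ.lTensor H z) := by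
      intro z
      induction z with
      | zero => simp
      | add a b ha hb => simp only [map_add, ha, hb]
      | tmul a n => simp
    rw [Submodule.mkQ_apply, Submodule.liftQ_apply, LinearMap.comp_apply, assoc_comul_lTensor, h2,
      X.coassoc]
  counit x := by
    obtain ⟨x, rfl⟩ := N.mkQ_surjective x
    rw [Submodule.mkQ_apply, Submodule.liftQ_apply, LinearMap.comp_apply, lid_counit_lTensor, X.counit,
      Submodule.mkQ_apply]

lemma stable_iSup (X : Comod k H) {ι : Sort*} (N : ι → Submodule k X)
    (h : ∀ i, X.Stable (N i)) : X.Stable (⨆ i, N i) := by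
  rw [stable_iff]
  intro x hx φ
  have : (⨆ i, N i) ≤ (⨆ i, N i).comap (slice φ ∘ₗ X.ρ) := by
    refine iSup_le fun i y hy => ?_
    exact (le_iSup N i) ((stable_iff X (N i)).1 (h i) y hy φ)
  exact this hx

lemma stable_iInf (X : Comod k H) {ι : Sort*} (N : ι → Submodule k X)
    (h : ∀ i, X.Stable (N i)) : X.Stable (⨅ i, N i) := by
  rw [stable_iff]
  intro x hx φ
  rw [Submodule.mem_iInf] at hx ⊢
  exact fun i => (stable_iff X (N i)).1 (h i) x (hx i) φ

lemma stable_range {X Y : Comod k H} (f : X →ₗ[k] Y) (h : IsHom f) :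
    Y.Stable (LinearMap.range f) := by
  rw [stable_iff]
  rintro _ ⟨x, rfl⟩ φ
  rw [h x, slice_lTensor]
  exact ⟨_, rfl⟩

lemma stable_ker {X Y : Comod k H} (f : X →ₗ[k] Y) (h : IsHom f) :
    X.Stable (LinearMap.ker f) := by
  rw [stable_iff]
  intro x hx φ
  rw [LinearMap.mem_ker] at hx ⊢
  rw [← slice_lTensor, ← h x, hx, map_zero, map_zero]

variable (k H) in
/-- The trivial one-dimensional comodule `k`. -/
@[reducible] def unit : Comod k H where
  carrier := k
  ρ := TensorProduct.mk k H k 1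
  coassoc x := by simp [Algebra.TensorProduct.one_def]
  counit x := by simp

/-- The multiplication `(H ⊗ X) × (H ⊗ Y) → H ⊗ (X ⊗ Y)`, `(h ⊗ x, h' ⊗ y) ↦ hh' ⊗ (x ⊗ y)`. -/
def mulTensor (X Y : Type u) [AddCommGroup X] [Module k X] [AddCommGroup Y] [Module k Y] :
    (H ⊗[k] X) ⊗[k] (H ⊗[k] Y) →ₗ[k] H ⊗[k] (X ⊗[k] Y) :=
  (LinearMap.mul' k H).rTensor (X ⊗[k] Y) ∘ₗ
    (TensorProduct.tensorTensorTensorComm k H X H Y).toLinearMap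

@[simp] lemma mulTensor_tmul {X Y : Type u} [AddCommGroup X] [Module k X] [AddCommGroup Y]
    [Module k Y] (h h' : H) (x : X) (y : Y) :
    mulTensor X Y ((h ⊗ₜ[k] x) ⊗ₜ[k] (h' ⊗ₜ[k] y)) = (h * h') ⊗ₜ[k] (x ⊗ₜ[k] y) := by
  simp [mulTensor]

/-- The tensor product of two comodules, `x ⊗ y ↦ x₍₋₁₎y₍₋₁₎ ⊗ (x₍₀₎ ⊗ y₍₀₎)`. -/
@[reducible] def tensor (X Y : Comod k H) : Comod k H where
  carrier := X ⊗[k] Y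
  ρ := mulTensor X Y ∘ₗ TensorProduct.map X.ρ Y.ρ
  coassoc z := by
    have h1 : ∀ (z : H ⊗[k] X) (w : H ⊗[k] Y),
        TensorProduct.assoc k H H (X ⊗[k] Y) ((Coalgebra.comul (R := k) (A := H)).rTensor _
          (mulTensor X Y (z ⊗ₜ w))) =
        (mulTensor X Y).lTensor H (mulTensor (H ⊗[k] X) (H ⊗[k] Y)
          ((TensorProduct.assoc k H H X ((Coalgebra.comul (R := k) (A := H)).rTensor X z)) ⊗ₜ
          (TensorProduct.assoc k H H Y ((Coalgebra.comul (R := k) (A := H)).rTensor Y w)))) := by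
      intro z w
      induction z with
      | zero => simp
      | add a b ha hb => simp only [map_add, TensorProduct.add_tmul, ha, hb]
      | tmul a x =>
        induction w with
        | zero => simp
        | add a b ha hb => simp only [map_add, TensorProduct.tmul_add, ha, hb]
        | tmul b y =>
          simp only [mulTensor_tmul, LinearMap.rTensor_tmul, Bialgebra.comul_mul]
          induction Coalgebra.comul (R := k) a with
          | zero => simp
          | add a b ha hb => simp only [map_add, add_mul, TensorProduct.add_tmul, ha, hb]
          | tmul a a' =>
            induction Coalgebra.comul (R := k) b with
            | zero => simp
            | add a b ha hb =>
              simp only [map_add, mul_add, TensorProduct.add_tmul, TensorProduct.tmul_add, ha, hb]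
            | tmul b b' => simp
    have h2 : ∀ (z : H ⊗[k] X) (w : H ⊗[k] Y),
        (mulTensor X Y ∘ₗ TensorProduct.map X.ρ Y.ρ).lTensor H (mulTensor X Y (z ⊗ₜ w)) =
        (mulTensor X Y).lTensor H (mulTensor (H ⊗[k] X) (H ⊗[k] Y)
          (X.ρ.lTensor H z ⊗ₜ Y.ρ.lTensor H w)) := by
      intro z w
      induction z with
      | zero => simp
      | add a b ha hb => simp only [map_add, TensorProduct.add_tmul, ha, hb]
      | tmul a x =>
        induction w with
        | zero => simp
        | add a b ha hb => simp only [map_add, TensorProduct.tmul_add, ha, hb]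
        | tmul b y => simp
    induction z with
    | zero => simp
    | add a b ha hb => simp only [map_add, ha, hb]
    | tmul x y =>
      simp only [LinearMap.comp_apply, TensorProduct.map_tmul]
      rw [h1, X.coassoc, Y.coassoc]
      exact (h2 _ _).symm
  counit z := by
    have h1 : ∀ (z : H ⊗[k] X) (w : H ⊗[k] Y),
        TensorProduct.lid k (X ⊗[k] Y) ((Coalgebra.counit (R := k) (A := H)).rTensor _
          (mulTensor X Y (z ⊗ₜ w))) =
        (TensorProduct.lid k X ((Coalgebra.counit (R := k) (A := H)).rTensor X z)) ⊗ₜ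
          (TensorProduct.lid k Y ((Coalgebra.counit (R := k) (A := H)).rTensor Y w)) := by
      intro z w
      induction z with
      | zero => simp
      | add a b ha hb => simp only [map_add, TensorProduct.add_tmul, ha, hb]
      | tmul a x =>
        induction w with
        | zero => simp
        | add a b ha hb => simp only [map_add, TensorProduct.tmul_add, ha, hb]
        | tmul b y => simp [TensorProduct.smul_tmul', TensorProduct.tmul_smul, smul_smul, mul_comm]
    induction z with
    | zero => simp
    | add a b ha hb => simp only [map_add, ha, hb]
    | tmul x y =>
      simp only [LinearMap.comp_apply, TensorProduct.map_tmul]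
      rw [h1, X.counit, Y.counit]

/-- The matrix coefficient `⟨f, x⟩ = f(x₍₀₎) x₍₋₁₎`. -/
def coeff (X : Comod k H) (f : Module.Dual k X) (x : X) : H :=
  TensorProduct.rid k H (f.lTensor H (X.ρ x))

/-- The matrix of a comodule with respect to a basis: `ρ (b i) = ∑ j, c i j ⊗ b j`. -/
def mat (X : Comod k H) :
    Matrix (Fin (Module.finrank k X)) (Fin (Module.finrank k X)) H :=
  fun i j => X.coeff ((Module.finBasis k X).coord j) (Module.finBasis k X i)

lemma rho_basis (X : Comod k H) (i) :
    X.ρ (Module.finBasis k X i) = ∑ j, X.mat i j ⊗ₜ[k] Module.finBasis k X j := by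
  have : ∀ z : H ⊗[k] X, z = ∑ j, TensorProduct.rid k H
      (((Module.finBasis k X).coord j).lTensor H z) ⊗ₜ[k] Module.finBasis k X j := by
    intro z
    induction z with
    | zero => simp
    | add a b ha hb =>
      conv_lhs => rw [ha, hb]
      simp only [map_add, TensorProduct.add_tmul, Finset.sum_add_distrib]
    | tmul h x =>
      conv_lhs => rw [← (Module.finBasis k X).sum_repr x]
      rw [TensorProduct.tmul_sum]
      refine Finset.sum_congr rfl fun j _ => ?_
      simp [TensorProduct.smul_tmul]
  exact this _

lemma comul_mat (X : Comod k H) (i j) :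
    Coalgebra.comul (R := k) (X.mat i j) = ∑ l, X.mat i l ⊗ₜ[k] X.mat l j := by
  have h := X.coassoc (Module.finBasis k X i)
  rw [rho_basis] at h
  simp only [map_sum, LinearMap.rTensor_tmul, LinearMap.lTensor_tmul, rho_basis] at h
  have h' := congrArg (fun z => TensorProduct.rid k (H ⊗[k] H)
    ((((Module.finBasis k X).coord j).lTensor (H ⊗[k] H))
      ((TensorProduct.assoc k H H X).symm z))) h
  simpa [TensorProduct.tmul_sum, Finsupp.single_apply] using h'

lemma counit_mat (X : Comod k H) (i j) :
    Coalgebra.counit (R := k) (X.mat i j) = (1 : Matrix _ _ k) i j := by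
  have h := X.counit (Module.finBasis k X i)
  rw [rho_basis] at h
  have h' := congrArg ((Module.finBasis k X).coord j) h
  simpa [Finsupp.single_apply, Matrix.one_apply] using h'

end Comod
end Comodules

section Comodules
variable {k : Type u} [Field k] {H : Type u} [Ring H] [HopfAlgebra k H]
namespace Comod

lemma antipode_mat (X : Comod k H) :
    (X.mat.map (HopfAlgebra.antipode k)) * X.mat = 1 ∧
      X.mat * (X.mat.map (HopfAlgebra.antipode k)) = 1 := by
  constructor
  · ext i j
    have h := HopfAlgebra.mul_antipode_rTensor_comul_apply (R := k) (X.mat i j)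
    rw [comul_mat, counit_mat] at h
    simp only [map_sum, LinearMap.rTensor_tmul, LinearMap.mul'_apply] at h
    simp only [Matrix.mul_apply, Matrix.map_apply]
    rw [h]
    by_cases hij : i = j <;> simp [hij, Matrix.one_apply]
  · ext i j
    have h := HopfAlgebra.mul_antipode_lTensor_comul_apply (R := k) (X.mat i j)
    rw [comul_mat, counit_mat] at h
    simp only [map_sum, LinearMap.lTensor_tmul, LinearMap.mul'_apply] at h
    simp only [Matrix.mul_apply, Matrix.map_apply]
    rw [h]
    by_cases hij : i = j <;> simp [hij, Matrix.one_apply]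

lemma comul_antipode_mat (X : Comod k H) (i j) :
    Coalgebra.comul (R := k) (HopfAlgebra.antipode k (X.mat i j)) =
      ∑ l, HopfAlgebra.antipode k (X.mat l j) ⊗ₜ[k] HopfAlgebra.antipode k (X.mat i l) := by
  set S := X.mat.map (HopfAlgebra.antipode k) with hS
  let D : H →+* H ⊗[k] H := (Bialgebra.comulAlgHom k H).toRingHom
  let L : H →+* H ⊗[k] H := (Algebra.TensorProduct.includeLeft (R := k) (S := k)
    (A := H) (B := H)).toRingHom
  let M : H →+* H ⊗[k] H := (Algebra.TensorProduct.includeRight (R := k)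
    (A := H) (B := H)).toRingHom
  have hD : X.mat.map D = X.mat.map L * X.mat.map M := by
    ext i j
    simp only [Matrix.map_apply, Matrix.mul_apply]
    have : D (X.mat i j) = Coalgebra.comul (R := k) (X.mat i j) := rfl
    rw [this, comul_mat]
    refine Finset.sum_congr rfl fun l _ => ?_
    simp [L, M]
  have h1 : S.map D * X.mat.map D = 1 := by
    rw [← Matrix.map_mul, X.antipode_mat.1, Matrix.map_one _ (map_zero _) (map_one _)]
  have h2 : X.mat.map D * (S.map M * S.map L) = 1 := by
    rw [hD, Matrix.mul_assoc, ← Matrix.mul_assoc (X.mat.map M), ← Matrix.map_mul,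
      X.antipode_mat.2, Matrix.map_one _ (map_zero _) (map_one _), Matrix.one_mul,
      ← Matrix.map_mul, X.antipode_mat.2, Matrix.map_one _ (map_zero _) (map_one _)]
  have h3 : S.map D = S.map M * S.map L := left_inv_eq_right_inv h1 h2
  have h4 := congrFun (congrFun h3 i) j
  simp only [Matrix.map_apply, Matrix.mul_apply, hS] at h4
  have : D (HopfAlgebra.antipode k (X.mat i j)) =
    Coalgebra.comul (R := k) (HopfAlgebra.antipode k (X.mat i j)) := rfl
  rw [← this, h4]
  refine Finset.sum_congr rfl fun l _ => ?_
  simp [L, M]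

/-- The coaction on the linear dual: `⟨ρ f, x⟩ = S(x₍₋₁₎) f(x₍₀₎)`. -/
def dualρ (X : Comod k H) : Module.Dual k X →ₗ[k] H ⊗[k] Module.Dual k X :=
  ∑ i, (TensorProduct.mk k H (Module.Dual k X)).flip ((Module.finBasis k X).coord i) ∘ₗ
    HopfAlgebra.antipode k ∘ₗ (TensorProduct.rid k H).toLinearMap ∘ₗ
      (LinearMap.lTensorHom H).flip (X.ρ (Module.finBasis k X i))

lemma dualρ_apply (X : Comod k H) (f : Module.Dual k X) :
    X.dualρ f = ∑ i, HopfAlgebra.antipode k (X.coeff f (Module.finBasis k X i)) ⊗ₜ[k]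
      (Module.finBasis k X).coord i := by
  simp [dualρ, coeff, LinearMap.sum_apply]

/-- The dual comodule. -/
@[reducible] def dual (X : Comod k H) : Comod k H where
  carrier := Module.Dual k X
  ρ := X.dualρ
  coassoc f := by
    have key : ∀ j, TensorProduct.assoc k H H (Module.Dual k X)
        ((Coalgebra.comul (R := k) (A := H)).rTensor _ (X.dualρ ((Module.finBasis k X).coord j))) =
        X.dualρ.lTensor H (X.dualρ ((Module.finBasis k X).coord j)) := by
      intro j
      have hc : ∀ i j, X.coeff ((Module.finBasis k X).coord j) (Module.finBasis k X i) =
        X.mat i j := fun _ _ => rfl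
      simp only [dualρ_apply, hc, map_sum, LinearMap.rTensor_tmul, LinearMap.lTensor_tmul,
        comul_antipode_mat, TensorProduct.sum_tmul, TensorProduct.tmul_sum,
        TensorProduct.assoc_tmul]
      rw [Finset.sum_comm]
    have : (TensorProduct.assoc k H H (Module.Dual k X)).toLinearMap ∘ₗ
        ((Coalgebra.comul (R := k) (A := H)).rTensor _) ∘ₗ X.dualρ =
        X.dualρ.lTensor H ∘ₗ X.dualρ :=
      (Module.finBasis k X).dualBasis.ext fun j => by simpa using key j
    exact LinearMap.congr_fun this f
  counit f := by
    have key : ∀ j, TensorProduct.lid k (Module.Dual k X)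
        ((Coalgebra.counit (R := k) (A := H)).rTensor _ (X.dualρ ((Module.finBasis k X).coord j))) =
        (Module.finBasis k X).coord j := by
      intro j
      have hc : ∀ i j, X.coeff ((Module.finBasis k X).coord j) (Module.finBasis k X i) =
        X.mat i j := fun _ _ => rfl
      simp only [dualρ_apply, hc, map_sum, LinearMap.rTensor_tmul, HopfAlgebra.counit_antipode,
        counit_mat, TensorProduct.lid_tmul]
      simp [Matrix.one_apply]
    have : (TensorProduct.lid k (Module.Dual k X)).toLinearMap ∘ₗ
        ((Coalgebra.counit (R := k) (A := H)).rTensor _) ∘ₗ X.dualρ = LinearMap.id :=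
      (Module.finBasis k X).dualBasis.ext fun j => by simpa using key j
    exact LinearMap.congr_fun this f

end Comod
end Comodules

/-! ### Quadratic algebras -/
section Quadratic
variable {k : Type u} [Field k] {V : Type u} [AddCommGroup V] [Module k V]

/-- The linear map `V ⊗ V → T(V)`. -/
def quadMap (k V : Type u) [Field k] [AddCommGroup V] [Module k V] :
    V ⊗[k] V →ₗ[k] TensorAlgebra k V :=
  LinearMap.mul' k (TensorAlgebra k V) ∘ₗ
    TensorProduct.map (TensorAlgebra.ι k) (TensorAlgebra.ι k)

@[simp] lemma quadMap_tmul (v w : V) : quadMap k V (v ⊗ₜ w) =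
    TensorAlgebra.ι k v * TensorAlgebra.ι k w := by simp [quadMap]

/-- The defining relations of `TV/(R)`. -/
inductive QRel (R : Submodule k (V ⊗[k] V)) : TensorAlgebra k V → TensorAlgebra k V → Prop
  | of (t : V ⊗[k] V) (ht : t ∈ R) : QRel R (quadMap k V t) 0

/-- The quadratic algebra `A = TV/(R)`. -/
abbrev QAlg (R : Submodule k (V ⊗[k] V)) : Type u := RingQuot (QRel R)

/-- The quotient map `TV → A`. -/
abbrev QAlg.mk (R : Submodule k (V ⊗[k] V)) : TensorAlgebra k V →ₐ[k] QAlg R :=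
  RingQuot.mkAlgHom k (QRel R)

/-- The degree `n` part `A_n` of `A`: the image of `V^{⊗ n}`. -/
def QAlg.deg (R : Submodule k (V ⊗[k] V)) (n : ℕ) : Submodule k (QAlg R) :=
  (LinearMap.range (TensorAlgebra.ι k (M := V)) ^ n).map (QAlg.mk R).toLinearMap

/-- The augmentation `A → k`, which kills `V`. -/
def QAlg.aug (R : Submodule k (V ⊗[k] V)) : QAlg R →ₐ[k] k :=
  RingQuot.liftAlgHom k ⟨TensorAlgebra.algebraMapInv, by
    rintro _ _ ⟨t, -⟩
    rw [map_zero]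
    induction t with
    | zero => simp
    | add a b ha hb => simp [ha, hb]
    | tmul v w => simp [TensorAlgebra.algebraMapInv]⟩

/-- The trivial left `A`-module `k = A/A_{>0}`. -/
def Triv (_R : Submodule k (V ⊗[k] V)) : Type u := k

instance (R : Submodule k (V ⊗[k] V)) : AddCommGroup (Triv R) := inferInstanceAs (AddCommGroup k)

instance (R : Submodule k (V ⊗[k] V)) : Module (QAlg R) (Triv R) :=
  Module.compHom k (QAlg.aug R).toRingHom

/-- `A` is Koszul: the trivial module has a linear free resolution
`⋯ → A(-2)^{I 2} → A(-1)^{I 1} → A → k → 0`. -/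
def IsKoszul (R : Submodule k (V ⊗[k] V)) : Prop :=
  ∃ (I : ℕ → Type u) (ε : (I 0 →₀ QAlg R) →ₗ[QAlg R] Triv R)
    (δ : ∀ n, (I (n + 1) →₀ QAlg R) →ₗ[QAlg R] (I n →₀ QAlg R)),
    Nonempty (Unique (I 0)) ∧
    (∀ n i j, δ n (Finsupp.single i 1) j ∈ QAlg.deg R 1) ∧
    Function.Surjective ε ∧
    LinearMap.range (δ 0) = LinearMap.ker ε ∧
    ∀ n, LinearMap.range (δ (n + 1)) = LinearMap.ker (δ n)

instance (R : Submodule k (V ⊗[k] V)) : CategoryTheory.HasExt.{u} (ModuleCat.{u} (QAlg R)) :=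
  CategoryTheory.hasExt_of_enoughProjectives.{u} _

/-- `A` is Artin–Schelter regular of dimension `d`: it has global dimension `d`,
`Ext^i_A(k, A) = 0` for `i ≠ d` and `Ext^d_A(k, A)` is one-dimensional. -/
structure IsASRegular (R : Submodule k (V ⊗[k] V)) (d : ℕ) : Prop where
  globalDim : (⨆ M : ModuleCat.{u} (QAlg R), CategoryTheory.projectiveDimension M) = d
  ext_eq_zero : ∀ i ≠ d, Subsingleton (CategoryTheory.Abelian.Ext.{u}
    (ModuleCat.of (QAlg R) (Triv R)) (ModuleCat.of (QAlg R) (QAlg R)) i)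
  finrank_ext : Module.finrank k (CategoryTheory.Abelian.Ext.{u}
    (ModuleCat.of (QAlg R) (Triv R)) (ModuleCat.of (QAlg R) (QAlg R)) d) = 1

end Quadratic

section Coaction
variable {k : Type u} [Field k] {V : Type u} [AddCommGroup V] [Module k V]

/-- A Hopf algebra `H` coacting on `A = TV/(R)`: an algebra morphism `δ : A → H ⊗ A` that makes `A`
into a left `H`-comodule, with `δ(A_n) ⊆ H ⊗ A_n`. -/
structure Coaction (R : Submodule k (V ⊗[k] V)) (H : Type u) [Ring H] [HopfAlgebra k H] where
  /-- the coaction -/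
  δ : QAlg R →ₐ[k] H ⊗[k] QAlg R
  coassoc : ∀ a, TensorProduct.assoc k H H (QAlg R)
    ((Coalgebra.comul (R := k) (A := H)).rTensor (QAlg R) (δ a)) = δ.toLinearMap.lTensor H (δ a)
  counit : ∀ a, TensorProduct.lid k (QAlg R)
    ((Coalgebra.counit (R := k) (A := H)).rTensor (QAlg R) (δ a)) = a
  graded : ∀ n, ∀ a ∈ QAlg.deg R n,
    δ a ∈ LinearMap.range ((QAlg.deg R n).subtype.lTensor H)

/-- `H`, with its coaction on `A`, is the universal coacting Hopf algebra `aut(A)` of `A`: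
every Hopf algebra coacting on `A` receives a unique compatible Hopf algebra morphism from `H`. -/
def Coaction.IsUniversal {R : Submodule k (V ⊗[k] V)} {H : Type u} [Ring H] [HopfAlgebra k H]
    (c : Coaction R H) : Prop :=
  ∀ (H' : Type u) [Ring H'] [HopfAlgebra k H'] (c' : Coaction R H'),
    ∃! g : H →ₐc[k] H', ∀ a, (g : H →ₗ[k] H').rTensor (QAlg R) (c.δ a) = c'.δ a

variable (R : Submodule k (V ⊗[k] V))

/-- The representation of `A` on its truncation `A/A_{≥ 3}`, spelled out on generators. -/
def truncL (v : V) : Module.End k (k × V × ((V ⊗[k] V) ⧸ R)) :=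
  LinearMap.prod 0 (LinearMap.prod (LinearMap.toSpanSingleton k V v ∘ₗ LinearMap.fst _ _ _)
    (R.mkQ ∘ₗ TensorProduct.mk k V V v ∘ₗ LinearMap.fst _ _ _ ∘ₗ LinearMap.snd _ _ _))

@[simp] lemma truncL_apply (v : V) (x : k × V × ((V ⊗[k] V) ⧸ R)) :
    truncL R v x = (0, x.1 • v, R.mkQ (v ⊗ₜ x.2.1)) := rfl

/-- The linear version of `truncL`. -/
def truncLin : V →ₗ[k] Module.End k (k × V × ((V ⊗[k] V) ⧸ R)) where
  toFun := truncL R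
  map_add' v w := by
    refine LinearMap.ext fun x => ?_
    simp [TensorProduct.add_tmul]
  map_smul' a v := by
    refine LinearMap.ext fun x => ?_
    simp only [truncL_apply, LinearMap.smul_apply, RingHom.id_apply, Prod.smul_mk, smul_zero,
      smul_comm x.1 a v, ← TensorProduct.smul_tmul', map_smul]

lemma trunc_quad (t : V ⊗[k] V) (x : k × V × ((V ⊗[k] V) ⧸ R)) :
    TensorAlgebra.lift k (truncLin R) (quadMap k V t) x = (0, 0, x.1 • R.mkQ t) := by
  induction t with
  | zero => simp; rfl
  | add a b ha hb => simp [ha, hb]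
  | tmul v w =>
    simp only [quadMap_tmul, map_mul, TensorAlgebra.lift_ι_apply, Module.End.mul_apply]
    change truncL R v (truncL R w x) = _
    simp

/-- The projection `A → A/A_{≥ 3}`. -/
def trunc : QAlg R →ₗ[k] k × V × ((V ⊗[k] V) ⧸ R) :=
  LinearMap.applyₗ (1, 0, 0) ∘ₗ (RingQuot.liftAlgHom k ⟨TensorAlgebra.lift k (truncLin R), by
    rintro _ _ ⟨t, ht⟩
    refine LinearMap.ext fun x => ?_
    rw [trunc_quad, map_zero, R.mkQ_apply, (Submodule.Quotient.mk_eq_zero R).2 ht]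
    simp⟩ : QAlg R →ₐ[k] _).toLinearMap

/-- The projection `A → A_1 = V`. -/
def pr1 : QAlg R →ₗ[k] V := LinearMap.fst _ _ _ ∘ₗ LinearMap.snd _ _ _ ∘ₗ trunc R

/-- The inclusion `V → A`. -/
abbrev QAlg.ι : V →ₗ[k] QAlg R := (QAlg.mk R).toLinearMap ∘ₗ TensorAlgebra.ι k

lemma pr1_ι (v : V) : pr1 R (QAlg.ι R v) = v := by
  simp only [pr1, trunc, LinearMap.comp_apply, AlgHom.toLinearMap_apply,
    RingQuot.liftAlgHom_mkAlgHom_apply, TensorAlgebra.lift_ι_apply, LinearMap.applyₗ_apply_apply]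
  change (truncL R v (1, 0, 0)).2.1 = v
  simp

lemma mem_of_mk_quad {t : V ⊗[k] V} (h : QAlg.mk R (quadMap k V t) = 0) : t ∈ R := by
  have h' := congrArg (fun a => (trunc R a).2.2) h
  simp only [trunc, LinearMap.comp_apply, AlgHom.toLinearMap_apply,
    RingQuot.liftAlgHom_mkAlgHom_apply, LinearMap.applyₗ_apply_apply, trunc_quad] at h'
  simpa using h'

/-- `V^{⊗ n}` as a subspace of `TV`. -/
abbrev Vpow (k V : Type u) [Field k] [AddCommGroup V] [Module k V] (n : ℕ) :
    Submodule k (TensorAlgebra k V) := LinearMap.range (TensorAlgebra.ι k (M := V)) ^ n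

/-- `R_a = ⋂_{i+j+2=a} V^{⊗ i} ⊗ R ⊗ V^{⊗ j}` as a subspace of `V^{⊗ a} ⊆ TV`; in particular
`R_1 = V` and `R_2 = R`. -/
def Rsub (a : ℕ) : Submodule k (TensorAlgebra k V) :=
  Vpow k V a ⊓ ⨅ (i : ℕ) (j : ℕ) (_ : i + j + 2 = a),
    Vpow k V i * R.map (quadMap k V) * Vpow k V j

instance [FiniteDimensional k V] (a : ℕ) : Module.Finite k (Rsub R a) := by
  have h : (Vpow k V a).FG := Submodule.FG.pow (Module.Finite.iff_fg.1 inferInstance) _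
  have : Module.Finite k (Vpow k V a) := Module.Finite.of_fg h
  exact Submodule.finiteDimensional_of_le (inf_le_left : Rsub R a ≤ Vpow k V a)

end Coaction

namespace Coaction
variable {k : Type u} [Field k] {V : Type u} [AddCommGroup V] [Module k V]
variable {R : Submodule k (V ⊗[k] V)} {H : Type u} [Ring H] [HopfAlgebra k H] (c : Coaction R H)

/-- The coaction on `V = A_1`. -/
def δV : V →ₗ[k] H ⊗[k] V := (pr1 R).lTensor H ∘ₗ c.δ.toLinearMap ∘ₗ QAlg.ι R

lemma δV_spec (v : V) : (QAlg.ι R).lTensor H (c.δV v) = c.δ (QAlg.ι R v) := by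
  have h1 : QAlg.ι R v ∈ QAlg.deg R 1 := ⟨TensorAlgebra.ι k v, by simp, rfl⟩
  obtain ⟨y, hy⟩ := c.graded 1 _ h1
  have h2 : ∀ a ∈ QAlg.deg R 1, QAlg.ι R (pr1 R a) = a := by
    rintro _ ⟨x, hx, rfl⟩
    rw [pow_one] at hx
    obtain ⟨w, rfl⟩ := hx
    exact congrArg (QAlg.ι R) (pr1_ι R w)
  have h3 : ∀ y : H ⊗[k] QAlg.deg R 1, (QAlg.ι R).lTensor H ((pr1 R).lTensor H
      ((QAlg.deg R 1).subtype.lTensor H y)) = (QAlg.deg R 1).subtype.lTensor H y := by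
    intro y
    induction y with
    | zero => simp
    | add a b ha hb => simp only [map_add, ha, hb]
    | tmul h a =>
      simp only [LinearMap.lTensor_tmul, Submodule.subtype_apply]
      rw [h2 a a.2]
  simp only [δV, LinearMap.comp_apply, AlgHom.toLinearMap_apply]
  rw [LinearMap.comp_apply] at hy
  exact (congrArg _ (congrArg _ hy.symm)).trans ((h3 y).trans hy)

lemma lTensor_ι_injective : Function.Injective ((QAlg.ι R).lTensor H) :=
  Module.Flat.lTensor_preserves_injective_linearMap _
    (Function.LeftInverse.injective (pr1_ι R))

lemma δV_coassoc (v : V) : TensorProduct.assoc k H H V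
    ((Coalgebra.comul (R := k) (A := H)).rTensor V (c.δV v)) = c.δV.lTensor H (c.δV v) := by
  apply Module.Flat.lTensor_preserves_injective_linearMap (M := H) _ (lTensor_ι_injective (R := R))
  rw [← assoc_comul_lTensor, δV_spec, c.coassoc, ← c.δV_spec, ← LinearMap.lTensor_comp_apply,
    ← LinearMap.lTensor_comp_apply]
  congr 2
  ext v
  exact (c.δV_spec v).symm

lemma δV_counit (v : V) : TensorProduct.lid k V
    ((Coalgebra.counit (R := k) (A := H)).rTensor V (c.δV v)) = v := by
  apply Function.LeftInverse.injective (pr1_ι R)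
  rw [← lid_counit_lTensor, δV_spec, c.counit]

/-- The induced coaction on the tensor algebra `TV`. -/
def δT : TensorAlgebra k V →ₐ[k] H ⊗[k] TensorAlgebra k V :=
  TensorAlgebra.lift k ((TensorAlgebra.ι k).lTensor H ∘ₗ c.δV)

lemma δT_ι (v : V) : c.δT (TensorAlgebra.ι k v) = (TensorAlgebra.ι k).lTensor H (c.δV v) := by
  simp [δT]

lemma δT_coassoc (x : TensorAlgebra k V) : TensorProduct.assoc k H H (TensorAlgebra k V)
    ((Coalgebra.comul (R := k) (A := H)).rTensor _ (c.δT x)) =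
      c.δT.toLinearMap.lTensor H (c.δT x) := by
  have h : (Algebra.TensorProduct.assoc k k k H H (TensorAlgebra k V)).toAlgHom.comp
      ((Algebra.TensorProduct.map (Bialgebra.comulAlgHom k H)
        (AlgHom.id k (TensorAlgebra k V))).comp c.δT) =
      (Algebra.TensorProduct.map (AlgHom.id k H) c.δT).comp c.δT := by
    apply TensorAlgebra.hom_ext
    ext v
    change TensorProduct.assoc k H H (TensorAlgebra k V)
      ((Coalgebra.comul (R := k) (A := H)).rTensor _ (c.δT (TensorAlgebra.ι k v))) =
      c.δT.toLinearMap.lTensor H (c.δT (TensorAlgebra.ι k v))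
    rw [δT_ι, assoc_comul_lTensor, δV_coassoc, ← LinearMap.lTensor_comp_apply,
      ← LinearMap.lTensor_comp_apply]
    congr 2
    ext v
    exact (c.δT_ι v).symm
  exact DFunLike.congr_fun h x

lemma δT_counit (x : TensorAlgebra k V) : TensorProduct.lid k (TensorAlgebra k V)
    ((Coalgebra.counit (R := k) (A := H)).rTensor _ (c.δT x)) = x := by
  have h : (Algebra.TensorProduct.lid k (TensorAlgebra k V)).toAlgHom.comp
      ((Algebra.TensorProduct.map (Bialgebra.counitAlgHom k H)
        (AlgHom.id k (TensorAlgebra k V))).comp c.δT) = AlgHom.id k _ := by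
    apply TensorAlgebra.hom_ext
    ext v
    change TensorProduct.lid k (TensorAlgebra k V)
      ((Coalgebra.counit (R := k) (A := H)).rTensor _ (c.δT (TensorAlgebra.ι k v))) =
      TensorAlgebra.ι k v
    rw [δT_ι, lid_counit_lTensor, δV_counit]
  exact DFunLike.congr_fun h x

lemma δT_mk (x : TensorAlgebra k V) :
    (QAlg.mk R).toLinearMap.lTensor H (c.δT x) = c.δ (QAlg.mk R x) := by
  have h : (Algebra.TensorProduct.map (AlgHom.id k H) (QAlg.mk R)).comp c.δT =
      c.δ.comp (QAlg.mk R) := by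
    apply TensorAlgebra.hom_ext
    ext v
    change (QAlg.mk R).toLinearMap.lTensor H (c.δT (TensorAlgebra.ι k v)) =
      c.δ (QAlg.ι R v)
    rw [δT_ι, ← δV_spec, ← LinearMap.comp_apply, ← LinearMap.lTensor_comp]
  exact DFunLike.congr_fun h x

/-- The subspace `N ⊆ TV` satisfies `δT N ⊆ H ⊗ N`. -/
def StableT (N : Submodule k (TensorAlgebra k V)) : Prop :=
  ∀ x ∈ N, c.δT x ∈ LinearMap.range (N.subtype.lTensor H)

lemma stableT_mul {N N' : Submodule k (TensorAlgebra k V)} (h : c.StableT N)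
    (h' : c.StableT N') : c.StableT (N * N') := by
  intro z hz
  refine Submodule.mul_induction_on hz (fun x hx y hy => ?_) (fun x y hx hy => ?_)
  · obtain ⟨a, ha⟩ := h x hx
    obtain ⟨b, hb⟩ := h' y hy
    rw [map_mul, ← ha, ← hb]
    clear ha hb
    induction a with
    | zero => simp
    | add a a' ha ha' => rw [map_add, add_mul]; exact Submodule.add_mem _ ha ha'
    | tmul g n =>
      induction b with
      | zero => simp
      | add a a' ha ha' => rw [map_add, mul_add]; exact Submodule.add_mem _ ha ha'
      | tmul g' n' => exact ⟨(g * g') ⊗ₜ ⟨n * n', Submodule.mul_mem_mul n.2 n'.2⟩, by simp⟩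
  · rw [map_add]; exact Submodule.add_mem _ hx hy

lemma stableT_pow (n : ℕ) : c.StableT (Vpow k V n) := by
  induction n with
  | zero =>
    rintro x hx
    rw [Vpow, pow_zero] at hx
    obtain ⟨a, rfl⟩ := Submodule.mem_one.1 hx
    refine ⟨1 ⊗ₜ ⟨algebraMap k _ a, by simp [Vpow]⟩, ?_⟩
    simp [Algebra.algebraMap_eq_smul_one, Algebra.TensorProduct.one_def]
  | succ n ih =>
    have h1 : c.StableT (LinearMap.range (TensorAlgebra.ι k (M := V))) := by
      rintro _ ⟨v, rfl⟩
      rw [δT_ι, mem_range_lTensor_iff]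
      intro φ
      rw [slice_lTensor]
      exact ⟨_, rfl⟩
    rw [Vpow, pow_succ]
    exact c.stableT_mul ih h1

lemma stableT_rel : c.StableT (R.map (quadMap k V)) := by
  rintro _ ⟨t, ht, rfl⟩
  have h1 : ∃ z : H ⊗[k] (V ⊗[k] V), c.δT (quadMap k V t) = (quadMap k V).lTensor H z := by
    clear ht
    induction t with
    | zero => exact ⟨0, by simp⟩
    | add a b ha hb =>
      obtain ⟨x, hx⟩ := ha
      obtain ⟨y, hy⟩ := hb
      exact ⟨x + y, by simp only [map_add, hx, hy]⟩
    | tmul v w =>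
      refine ⟨Comod.mulTensor V V (c.δV v ⊗ₜ c.δV w), ?_⟩
      rw [quadMap_tmul, map_mul, δT_ι, δT_ι]
      induction c.δV v with
      | zero => simp
      | add a b ha hb => simp only [map_add, add_mul, TensorProduct.add_tmul, ha, hb]
      | tmul g x =>
        induction c.δV w with
        | zero => simp
        | add a b ha hb => simp only [map_add, mul_add, TensorProduct.tmul_add, ha, hb]
        | tmul g' x' => simp
  obtain ⟨z, hz⟩ := h1
  rw [mem_range_lTensor_iff]
  intro φ
  rw [hz, slice_lTensor]
  refine ⟨_, mem_of_mk_quad R ?_, rfl⟩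
  have h2 : QAlg.mk R (quadMap k V t) = 0 := by
    rw [← map_zero (QAlg.mk R)]
    exact RingQuot.mkAlgHom_rel k (QRel.of t ht)
  have h3 := c.δT_mk (quadMap k V t)
  rw [h2, map_zero, hz] at h3
  have h4 := congrArg (slice φ) h3
  rw [slice_lTensor, slice_lTensor, map_zero] at h4
  exact h4

lemma stableT_Rsub (a : ℕ) : c.StableT (Rsub R a) := by
  intro x hx
  rw [mem_range_lTensor_iff]
  intro φ
  refine ⟨(mem_range_lTensor_iff _ _).1 (c.stableT_pow a x hx.1) φ, ?_⟩
  have hx2 := hx.2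
  simp only [SetLike.mem_coe, Submodule.mem_iInf] at hx2 ⊢
  exact fun i j h => (mem_range_lTensor_iff _ _).1
    (c.stableT_mul (c.stableT_mul (c.stableT_pow i) c.stableT_rel) (c.stableT_pow j) x
      (hx2 i j h)) φ

/-- The comodule `R_a`. -/
@[reducible] def RComod [FiniteDimensional k V] (a : ℕ) : Comod k H :=
  Comod.ofSubspace c.δT.toLinearMap c.δT_coassoc c.δT_counit (Rsub R a) (c.stableT_Rsub a)

end Coaction

/-! ### The monoid `Λ`, its order, and the linear maps coming from the category `U` -/

/-- The letters `r_1, …, r_d` and `r_d⁻¹`. -/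
inductive Letter (d : ℕ) : Type
  | r (a : ℕ) (h : 1 ≤ a ∧ a ≤ d) : Letter d
  | rdInv : Letter d

/-- Words in the letters `r_1, …, r_d, r_d⁻¹`. A word is an expression for an element of `Λ`. -/
abbrev Word (d : ℕ) : Type := List (Letter d)

/-- The relations `r_d r_d⁻¹ = 1 = r_d⁻¹ r_d`. -/
inductive LambdaRel (d : ℕ) : FreeMonoid (Letter d) → FreeMonoid (Letter d) → Prop
  | mul_inv (h : 1 ≤ d ∧ d ≤ d) :
      LambdaRel d (FreeMonoid.of (.r d h) * FreeMonoid.of .rdInv) 1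
  | inv_mul (h : 1 ≤ d ∧ d ≤ d) :
      LambdaRel d (FreeMonoid.of .rdInv * FreeMonoid.of (.r d h)) 1

/-- The monoid `Λ = ⟨r_1, …, r_{d-1}, r_d^{±1}⟩`. -/
abbrev Lambda (d : ℕ) : Type := PresentedMonoid (LambdaRel d)

/-- The element of `Λ` that a word represents. -/
def cls {d : ℕ} (w : Word d) : Lambda d := PresentedMonoid.mk (LambdaRel d) (FreeMonoid.ofList w)

/-- The element `r_a` of `Λ` for `1 ≤ a ≤ d`, with the convention `r_0 = 1`. -/
def rr (d a : ℕ) : Lambda d := if h : 1 ≤ a ∧ a ≤ d then cls [.r a h] else 1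

/-- The generating inequalities `r_{a+b} < r_a r_b` and `r_{a+b-d} < r_a r_d⁻¹ r_b`, multiplied on
the left and on the right by arbitrary elements of `Λ`. -/
inductive LambdaStep (d : ℕ) : Lambda d → Lambda d → Prop
  | up (u v : Lambda d) (a b : ℕ) (ha : 1 ≤ a) (hb : 1 ≤ b) (h : a + b ≤ d) :
      LambdaStep d (u * rr d (a + b) * v) (u * (rr d a * rr d b) * v)
  | down (u v : Lambda d) (a b : ℕ) (ha : a < d) (hb : b < d) (h : d ≤ a + b) :
      LambdaStep d (u * rr d (a + b - d) * v) (u * (rr d a * cls [.rdInv] * rr d b) * v)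

/-- The strict order `<` on `Λ`: the smallest left and right invariant transitive relation
containing the generating inequalities. -/
def Lambda.LT {d : ℕ} : Lambda d → Lambda d → Prop := Relation.TransGen (LambdaStep d)

/-- The word `r_d^x`, `x ∈ ℤ`. -/
def rdPow {d : ℕ} (h : 1 ≤ d ∧ d ≤ d) : ℤ → Word d
  | Int.ofNat n => List.replicate n (.r d h)
  | Int.negSucc n => List.replicate (n + 1) .rdInv

section
variable {k : Type u} [Field k] {V : Type u} [AddCommGroup V] [Module k V]
  [FiniteDimensional k V]

/-- `g` is the inclusion `R_c ⊆ R_a ⊗ R_b`, `c = a + b`: multiplying out in `TV` gives back the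
given element. -/
def IsIncl (R : Submodule k (V ⊗[k] V)) {a b c : ℕ}
    (g : Rsub R c →ₗ[k] Rsub R a ⊗[k] Rsub R b) : Prop :=
  ∀ x, Submodule.mulMap (Rsub R a) (Rsub R b) (g x) = x

/-- For `a + b = d`, `e` is the pairing `θ_{a,b} : R_a ⊗ R_d⁻¹ ⊗ R_b → k` which is inverse to the
inclusion `φ_{b,a} : R_d → R_b ⊗ R_a`, i.e. `(r_b θ_{a,b}) ∘ (φ_{b,a} r_d⁻¹ r_b) = id` and
`(θ_{a,b} r_a) ∘ (r_a r_d⁻¹ φ_{b,a}) = id`. -/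
def IsPairing (R : Submodule k (V ⊗[k] V)) {a b d : ℕ}
    (e : Rsub R a →ₗ[k] Module.Dual k (Rsub R d) →ₗ[k] Rsub R b →ₗ[k] k) : Prop :=
  ∃ g : Rsub R d →ₗ[k] Rsub R b ⊗[k] Rsub R a, IsIncl R g ∧
    (∀ (t : Rsub R d) (ξ : Module.Dual k (Rsub R d)) (x : Rsub R b),
      TensorProduct.rid k (Rsub R b) (((e.flip ξ).flip x).lTensor (Rsub R b) (g t)) = ξ t • x) ∧
    (∀ (t : Rsub R d) (ξ : Module.Dual k (Rsub R d)) (y : Rsub R a),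
      TensorProduct.lid k (Rsub R a) ((e y ξ).rTensor (Rsub R a) (g t)) = ξ t • y)

namespace Coaction
variable {R : Submodule k (V ⊗[k] V)} {H : Type u} [Ring H] [HopfAlgebra k H] (c : Coaction R H)
  {d : ℕ}

/-- `M(r_a) = R_a` and `M(r_d⁻¹) = R_d^*`. -/
@[reducible] def L : Letter d → Comod k H
  | .r a _ => c.RComod a
  | .rdInv => (c.RComod d).dual

/-- The comodule `M(w)`: the tensor product of the comodules of the letters of `w`. -/
@[reducible] def M : Word d → Comod k H
  | [] => Comod.unit k H
  | l :: w => (c.L l).tensor (M w)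

/-- `InU w w' f` says that `f : M(w) → M(w')` is the value of the monoidal functor `M` at some
morphism `w → w'` of the monoidal category `U`. The category `U` has the elements of `Λ` as objects
and is generated by morphisms `φ_{a,b} : r_{a+b} → r_a r_b` and
`θ_{a,b} : r_a r_d⁻¹ r_b → r_{a+b-d}`, subject to relations that hold for their values
under `M`, so the values of `M` are exactly the linear maps obtained from those of the generators by
composition and tensoring with identities. For `a + b > d` one has
`θ_{a,b} = (θ_{a,d-a} r_{a+b-d}) ∘ (r_a r_d⁻¹ φ_{d-a,a+b-d})`, so that only the `θ_{a,b}` with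
`a + b = d` are listed. Words that represent the same element of `Λ` are linked by the canonical
cancellation isomorphisms `R_d ⊗ R_d^* ≅ k ≅ R_d^* ⊗ R_d`. -/
inductive InU : (w w' : Word d) → (c.M w →ₗ[k] c.M w') → Prop
  | id (w : Word d) : InU w w LinearMap.id
  | comp {w w' w'' : Word d} {f : c.M w →ₗ[k] c.M w'} {g : c.M w' →ₗ[k] c.M w''} :
      InU w w' f → InU w' w'' g → InU w w'' (g ∘ₗ f)
  | whisker (l : Letter d) {w w' : Word d} {f : c.M w →ₗ[k] c.M w'} :
      InU w w' f → InU (l :: w) (l :: w') (f.lTensor (c.L l))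
  | phi (a b : ℕ) (ha : 1 ≤ a ∧ a ≤ d) (hb : 1 ≤ b ∧ b ≤ d) (hab : 1 ≤ a + b ∧ a + b ≤ d)
      (w : Word d) (g : Rsub R (a + b) →ₗ[k] Rsub R a ⊗[k] Rsub R b) (hg : IsIncl R g)
      (f : c.M (.r (a + b) hab :: w) →ₗ[k] c.M (.r a ha :: .r b hb :: w))
      (hf : ∀ (x : Rsub R (a + b)) (m : c.M w),
        f (x ⊗ₜ[k] m) = TensorProduct.assoc k (Rsub R a) (Rsub R b) (c.M w) (g x ⊗ₜ[k] m)) :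
      InU (.r (a + b) hab :: w) (.r a ha :: .r b hb :: w) f
  | theta (a b : ℕ) (ha : 1 ≤ a ∧ a ≤ d) (hb : 1 ≤ b ∧ b ≤ d) (hab : a + b = d) (w : Word d)
      (e : Rsub R a →ₗ[k] Module.Dual k (Rsub R d) →ₗ[k] Rsub R b →ₗ[k] k) (he : IsPairing R e)
      (f : c.M (.r a ha :: .rdInv :: .r b hb :: w) →ₗ[k] c.M w)
      (hf : ∀ (x : Rsub R a) (ξ : Module.Dual k (Rsub R d)) (y : Rsub R b) (m : c.M w),
        f (x ⊗ₜ[k] (ξ ⊗ₜ[k] (y ⊗ₜ[k] m))) = e x ξ y • m) :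
      InU (.r a ha :: .rdInv :: .r b hb :: w) w f
  | mulInv (h : 1 ≤ d ∧ d ≤ d) (w : Word d) (f : c.M (.r d h :: .rdInv :: w) ≃ₗ[k] c.M w)
      (hf : ∀ (t : Rsub R d) (ξ : Module.Dual k (Rsub R d)) (m : c.M w),
        f (t ⊗ₜ[k] (ξ ⊗ₜ[k] m)) = ξ t • m) :
      InU (.r d h :: .rdInv :: w) w f
  | mulInv_symm (h : 1 ≤ d ∧ d ≤ d) (w : Word d) (f : c.M (.r d h :: .rdInv :: w) ≃ₗ[k] c.M w)
      (hf : ∀ (t : Rsub R d) (ξ : Module.Dual k (Rsub R d)) (m : c.M w),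
        f (t ⊗ₜ[k] (ξ ⊗ₜ[k] m)) = ξ t • m) :
      InU w (.r d h :: .rdInv :: w) f.symm
  | invMul (h : 1 ≤ d ∧ d ≤ d) (w : Word d) (f : c.M (.rdInv :: .r d h :: w) ≃ₗ[k] c.M w)
      (hf : ∀ (t : Rsub R d) (ξ : Module.Dual k (Rsub R d)) (m : c.M w),
        f (ξ ⊗ₜ[k] (t ⊗ₜ[k] m)) = ξ t • m) :
      InU (.rdInv :: .r d h :: w) w f
  | invMul_symm (h : 1 ≤ d ∧ d ≤ d) (w : Word d) (f : c.M (.rdInv :: .r d h :: w) ≃ₗ[k] c.M w)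
      (hf : ∀ (t : Rsub R d) (ξ : Module.Dual k (Rsub R d)) (m : c.M w),
        f (ξ ⊗ₜ[k] (t ⊗ₜ[k] m)) = ξ t • m) :
      InU w (.rdInv :: .r d h :: w) f.symm

/-- The morphisms `M(w') → M(w)` of comodules coming from `U`. (All maps in `InU` are morphisms of
comodules, because `φ_{a,b}` and `θ_{a,b}` are.) -/
def UHom (w' w : Word d) : Type u :=
  {f : c.M w' →ₗ[k] c.M w // c.InU w' w f ∧ Comod.IsHom f}

/-- The image of `⨁ M(μ) → M(λ)`, over the morphisms `μ → λ` of `U` with `μ < λ`. -/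
def imSub (w : Word d) : Submodule k (c.M w) :=
  ⨆ i : Σ w' : {w' : Word d // (cls w').LT (cls w)}, c.UHom w' w, LinearMap.range i.2.1

/-- The kernel of `M(λ) → ⨁ M(μ)`, over the morphisms `λ → μ` of `U` with `μ < λ`. -/
def kerSub (w : Word d) : Submodule k (c.M w) :=
  ⨅ i : Σ w' : {w' : Word d // (cls w').LT (cls w)}, c.UHom w w', LinearMap.ker i.2.1

lemma stable_imSub (w : Word d) : (c.M w).Stable (c.imSub w) :=
  Comod.stable_iSup _ _ fun i => Comod.stable_range _ i.2.2.2

lemma stable_kerSub (w : Word d) : (c.M w).Stable (c.kerSub w) :=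
  Comod.stable_iInf _ _ fun i => Comod.stable_ker _ i.2.2.2

/-- The costandard comodule `∇(λ)`. -/
@[reducible] def nabla (w : Word d) : Comod k H := (c.M w).quot (c.imSub w) (c.stable_imSub w)

/-- The standard comodule `Δ(λ)`. -/
@[reducible] def delta (w : Word d) : Comod k H := (c.M w).sub (c.kerSub w) (c.stable_kerSub w)

end Coaction

/-- `X` has a finite filtration `0 = N_0 ⊆ N_1 ⊆ ⋯ ⊆ N_n = X` by subcomodules such that every
`N_{i+1}/N_i` is isomorphic to a member of the family `S`. -/
def Comod.HasFiltration {H : Type u} [Ring H] [HopfAlgebra k H] {ι : Type*} (S : ι → Comod k H)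
    (X : Comod k H) : Prop :=
  ∃ (n : ℕ) (N : ℕ → Submodule k X) (hN : ∀ i, X.Stable (N i)), N 0 = ⊥ ∧ N n = ⊤ ∧
    ∀ i < n, N i ≤ N (i + 1) ∧ ∃ (j : ι) (p : X.sub (N (i + 1)) (hN (i + 1)) →ₗ[k] S j),
      Comod.IsHom p ∧ Function.Surjective p ∧
        LinearMap.ker p = (N i).comap (N (i + 1)).subtype

end

/-- The word `w r_a r_d^x`. -/
abbrev wordL {d : ℕ} (hd : 1 ≤ d) (w : Word d) (a : ℕ) (ha : 1 ≤ a ∧ a ≤ d) (x : ℤ) : Word d :=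
  w ++ .r a ha :: rdPow ⟨hd, le_rfl⟩ x

/-- The word `r_d^x r_b w`. -/
abbrev wordR {d : ℕ} (hd : 1 ≤ d) (x : ℤ) (b : ℕ) (hb : 1 ≤ b ∧ b ≤ d) (w : Word d) : Word d :=
  rdPow ⟨hd, le_rfl⟩ x ++ .r b hb :: w

/-- `u = w r_a r_d^{-x}` and `v = r_d^x r_b w'` in `Λ`, with `1 ≤ a, b` and `a + b ≤ d`. -/
def Meets {d : ℕ} (hd : 1 ≤ d) (u v : Word d) : Prop :=
  ∃ (w w' : Word d) (x : ℤ) (a b : ℕ) (ha : 1 ≤ a ∧ a ≤ d) (hb : 1 ≤ b ∧ b ≤ d), a + b ≤ d ∧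
    cls u = cls (wordL hd w a ha (-x)) ∧ cls v = cls (wordR hd x b hb w')

/-- `u = w r_a r_d^{-x-1}` and `v = r_d^x r_b w'` in `Λ`, with `1 ≤ a, b < d` and
`a + b ≥ d`. -/
def Joins {d : ℕ} (hd : 1 ≤ d) (u v : Word d) : Prop :=
  ∃ (w w' : Word d) (x : ℤ) (a b : ℕ) (ha : 1 ≤ a ∧ a ≤ d) (hb : 1 ≤ b ∧ b ≤ d),
    a < d ∧ b < d ∧ d ≤ a + b ∧
    cls u = cls (wordL hd w a ha (-x - 1)) ∧ cls v = cls (wordR hd x b hb w')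

end KoszulAS

end

noncomputable section

namespace KoszulAS

set_option linter.unusedSectionVars false

/-! ### Products of homogeneous subspaces of the tensor algebra -/

section TensorAlgebraProducts
variable {k V : Type u} [Field k] [AddCommGroup V] [Module k V]

/-! A generator `t` of the line `R_d` trivialises all powers of `R_d`. If `r_d^{x₀} r_{a₁} r_d^{x₁}
r_{a₂} r_d^{x₂} ⋯` with all `aᵢ < d` is the normal form of a word `w`, then `toT` embeds `M(w)` into
the tensor algebra with image `R_{a₁} R_{a₂} ⋯`. All assertions become statements about subspaces of
tensor powers; the gaps `xᵢ` only decide which generators of `U` are available. A map `φ` lands on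
neighbouring letters with gap `0`, a map `θ` starts at neighbouring letters with gap `-1`.

Regularity enters through Ext: `R_d` is a line, `R_n = 0` for `n > d`, and `t` induces perfect
pairings of `R_a` with `R_{d-a}` (`LinRes.exists_isFrob`, `IsFrob.apply_eq_zero`). These pairings
define the contractions `D` that realise the maps `θ`. Using them, a `φ` followed by a `θ` can be
rewritten as at most one `θ` followed by at most one `φ` (`IsFrob.exchange`). Hence every morphism
of `U` is a composite of maps `θ` followed by a composite of maps `φ`. The maps `φ` lengthen the
normal form, the maps `θ` shorten it, and `μ < λ` forces `μ` to be shorter than `λ`. So a morphism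
from a smaller object ends with a `φ`, and one to a smaller object starts with a `θ`: it suffices to
consider single generators (`imSub_eq`, `kerSub_eq`), which gives the explicit subspaces `imT` and
`annT`.

Koszulness enters through the distributivity of the lattice generated by the subspaces `V^{⊗ i} ⊗ R
⊗ V^{⊗ j}` (`LinRes.distrib`), deduced from the linear resolution. Inside `M(u) ⊗ M(v)` the kernel
of the projection to `∇(u) ⊗ ∇(v)` is `imT` with a nonzero gap at the junction. The kernel of the
projection to `∇(uv)` has, for gap `0`, one more summand, in which the two letters `a` and `b` are
merged into `R_{a+b}` (`imT_gap_zero`). The kernel of `∇(u) ⊗ ∇(v) → ∇(uv)` is thus the merged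
product modulo its intersection with the first subspace, and distributivity identifies that
intersection with `imT` of the merged word (`LinRes.merge_inf_imT`). If `a + b = d`, the merged
letter cannot merge further because `R_n = 0` for `n > d`, so the quotient splits as a tensor
product (`IsFrob.imT_top`).

The statements for `Δ` follow by duality in the tensor algebra: reversing a list, replacing `a` by
`d - a` and raising the inner gaps by one gives a dual list whose product is in perfect pairing with
the original one. This pairing turns contractions into inclusions, so that `annT` is the annihilator
of `imT` of the dual list (`IsFrob.mem_annT_iff`, `IsFrob.annT_contract`).

Finally, by induction on the number of letters the exact sequences filter the tensor product of two
(co)standard comodules. Exactness of the tensor product extends this to all filtered comodules.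
Every `M(λ)` is a tensor product of letters, each of which is both standard and costandard. -/

lemma toTensorAlgebra_injective (n : ℕ) :
    Function.Injective (TensorPower.toTensorAlgebra (R := k) (M := V) (n := n)) := by
  intro x y h
  have h2 : ∀ z : ⨂[k]^n V, TensorPower.toTensorAlgebra z =
      TensorAlgebra.ofDirectSum (DirectSum.of (fun n => ⨂[k]^n V) n z) := fun z => by
    simp [TensorAlgebra.ofDirectSum, DirectSum.toAlgebra, DirectSum.toSemiring]
  rw [h2, h2] at h
  exact DirectSum.of_injective (β := fun n => ⨂[k]^n V) n
    (TensorAlgebra.equivDirectSum.symm.injective h)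

lemma range_toTensorAlgebra (n : ℕ) :
    LinearMap.range (TensorPower.toTensorAlgebra (R := k) (M := V) (n := n)) = Vpow k V n := by
  apply le_antisymm
  · rintro _ ⟨z, rfl⟩
    induction z using PiTensorProduct.induction_on with
    | smul_tprod r f =>
      rw [map_smul, TensorPower.toTensorAlgebra_tprod, TensorAlgebra.tprod_apply]
      refine Submodule.smul_mem _ _ ?_
      rw [Vpow]
      have : ∀ (m : ℕ) (f : Fin m → V), (List.ofFn fun i => TensorAlgebra.ι k (f i)).prod ∈
          LinearMap.range (TensorAlgebra.ι k (M := V)) ^ m := by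
        intro m
        induction m with
        | zero => intro f; simp
        | succ m ih =>
          intro f
          rw [List.ofFn_succ, List.prod_cons, pow_succ']
          exact Submodule.mul_mem_mul ⟨_, rfl⟩ (ih _)
      exact this n f
    | add x y hx hy => rw [map_add]; exact Submodule.add_mem _ hx hy
  · induction n with
    | zero =>
      rw [Vpow, pow_zero]
      intro x hx
      obtain ⟨a, rfl⟩ := Submodule.mem_one.1 hx
      exact ⟨DirectSum.GAlgebra.toFun (R := k) (A := fun n => ⨂[k]^n V) a,
        TensorPower.toTensorAlgebra_galgebra_toFun a⟩
    | succ n ih =>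
      rw [Vpow, pow_succ]
      refine Submodule.mul_le.2 fun x hx y hy => ?_
      obtain ⟨a, rfl⟩ := ih hx
      obtain ⟨b, rfl⟩ := hy
      refine ⟨GradedMonoid.GMul.mul (A := fun n => ⨂[k]^n V) a
        (PiTensorProduct.tprod k fun _ : Fin 1 => b), ?_⟩
      rw [TensorPower.toTensorAlgebra_gMul, TensorPower.toTensorAlgebra_tprod]
      simp [TensorAlgebra.tprod_apply]

/-- Concatenation of tensor powers is an isomorphism, and both factors are images of tensor powers.
This is why products of homogeneous subspaces of `TV` can be treated as tensor products throughout.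
-/
lemma mulMap_Vpow_injective (l m : ℕ) :
    Function.Injective (Submodule.mulMap (Vpow k V l) (Vpow k V m)) := by
  let f (n : ℕ) : (⨂[k]^n V) →ₗ[k] Vpow k V n :=
    (TensorPower.toTensorAlgebra (R := k) (M := V) (n := n)).codRestrict _ fun x => by
      rw [← range_toTensorAlgebra]; exact ⟨x, rfl⟩
  have hf (n : ℕ) : Function.Surjective (f n) := by
    rintro ⟨y, hy⟩
    rw [← range_toTensorAlgebra] at hy
    obtain ⟨x, rfl⟩ := hy
    exact ⟨x, rfl⟩
  have h1 : Submodule.mulMap (Vpow k V l) (Vpow k V m) ∘ₗ TensorProduct.map (f l) (f m) =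
      (TensorPower.toTensorAlgebra (R := k) (M := V) (n := l + m)) ∘ₗ
        (TensorPower.mulEquiv (R := k) (M := V) (n := l) (m := m)).toLinearMap := by
    refine TensorProduct.ext' fun x y => ?_
    exact (TensorPower.toTensorAlgebra_gMul x y).symm
  have h2 : Function.Surjective (TensorProduct.map (f l) (f m)) :=
    TensorProduct.map_surjective (hf l) (hf m)
  intro x y hxy
  obtain ⟨x, rfl⟩ := h2 x
  obtain ⟨y, rfl⟩ := h2 y
  congr 1
  apply (TensorPower.mulEquiv (R := k) (M := V) (n := l) (m := m)).injective
  apply toTensorAlgebra_injective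
  exact (LinearMap.congr_fun h1 x).symm.trans (hxy.trans (LinearMap.congr_fun h1 y))

/-- The map `x ⊗ y ↦ f x * g y` into the tensor algebra. -/
def tmul {X Y : Type*} [AddCommGroup X] [Module k X] [AddCommGroup Y] [Module k Y]
    (f : X →ₗ[k] TensorAlgebra k V) (g : Y →ₗ[k] TensorAlgebra k V) :
    X ⊗[k] Y →ₗ[k] TensorAlgebra k V :=
  LinearMap.mul' k (TensorAlgebra k V) ∘ₗ TensorProduct.map f g

section tmul
variable {X Y : Type*} [AddCommGroup X] [Module k X] [AddCommGroup Y] [Module k Y]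
  {f : X →ₗ[k] TensorAlgebra k V} {g : Y →ₗ[k] TensorAlgebra k V}

@[simp] lemma tmul_tmul (x : X) (y : Y) : tmul f g (x ⊗ₜ[k] y) = f x * g y := by simp [tmul]

lemma range_tmul : LinearMap.range (tmul f g) = LinearMap.range f * LinearMap.range g := by
  apply le_antisymm
  · rintro _ ⟨z, rfl⟩
    induction z with
    | zero => simp
    | tmul x y => rw [tmul_tmul]; exact Submodule.mul_mem_mul ⟨x, rfl⟩ ⟨y, rfl⟩
    | add a b ha hb => rw [map_add]; exact Submodule.add_mem _ ha hb
  · refine Submodule.mul_le.2 ?_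
    rintro _ ⟨x, rfl⟩ _ ⟨y, rfl⟩
    exact ⟨x ⊗ₜ y, by simp⟩

lemma tmul_injective {l m : ℕ} (hf : Function.Injective f) (hg : Function.Injective g)
    (hfl : ∀ x, f x ∈ Vpow k V l) (hgm : ∀ y, g y ∈ Vpow k V m) :
    Function.Injective (tmul f g) := by
  have h1 : tmul f g = Submodule.mulMap (Vpow k V l) (Vpow k V m) ∘ₗ
      TensorProduct.map (f.codRestrict _ hfl) (g.codRestrict _ hgm) := by
    refine TensorProduct.ext' fun x y => ?_
    simp
  rw [h1, LinearMap.coe_comp]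
  refine (mulMap_Vpow_injective l m).comp ?_
  have hf' : Function.Injective (f.codRestrict _ hfl) := fun a b h =>
    hf (congrArg Subtype.val h)
  have hg' : Function.Injective (g.codRestrict _ hgm) := fun a b h =>
    hg (congrArg Subtype.val h)
  exact TensorProduct.map_injective_of_flat_flat _ _ hf' hg'

end tmul

/-- Surjectivity is not needed: over a field the tensor product of the two ranges embeds in `M ⊗ N`,
so `a` and `b` may be replaced by their corestrictions, where right exactness gives the kernel. -/
lemma mem_ker_sup_of_map_eq_zero {X Y M N : Type*} [AddCommGroup X] [Module k X] [AddCommGroup Y]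
    [Module k Y] [AddCommGroup M] [Module k M] [AddCommGroup N] [Module k N] (a : X →ₗ[k] M)
    (b : Y →ₗ[k] N) (z : X ⊗[k] Y) (hz : TensorProduct.map a b z = 0) :
    z ∈ LinearMap.range ((LinearMap.ker b).subtype.lTensor X) ⊔
      LinearMap.range ((LinearMap.ker a).subtype.rTensor Y) := by
  have e6 : TensorProduct.map a.rangeRestrict b.rangeRestrict z = 0 := by
    have hi : Function.Injective (TensorProduct.map (LinearMap.range a).subtype
        (LinearMap.range b).subtype) :=
      TensorProduct.map_injective_of_flat_flat _ _ (Submodule.subtype_injective _)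
        (Submodule.subtype_injective _)
    apply hi
    rw [map_zero, ← LinearMap.comp_apply, ← TensorProduct.map_comp]
    exact hz
  have e7 : z ∈ LinearMap.ker (TensorProduct.map a.rangeRestrict b.rangeRestrict) := e6
  have hA : Function.Exact (LinearMap.ker a).subtype a.rangeRestrict := by
    rw [LinearMap.exact_iff, LinearMap.ker_rangeRestrict, Submodule.range_subtype]
  have hB : Function.Exact (LinearMap.ker b).subtype b.rangeRestrict := by
    rw [LinearMap.exact_iff, LinearMap.ker_rangeRestrict, Submodule.range_subtype]
  rwa [TensorProduct.map_ker hA (LinearMap.surjective_rangeRestrict _)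
    hB (LinearMap.surjective_rangeRestrict _)] at e7

lemma tmul_mem_of_map_mkQ_eq_zero {A P B Q : Submodule k (TensorAlgebra k V)} (z : A ⊗[k] B)
    (hz : TensorProduct.map (P.mkQ ∘ₗ A.subtype) (Q.mkQ ∘ₗ B.subtype) z = 0) :
    tmul A.subtype B.subtype z ∈ (A ⊓ P) * B ⊔ A * (B ⊓ Q) := by
  have h1 (y) : tmul A.subtype B.subtype
      ((LinearMap.ker (Q.mkQ ∘ₗ B.subtype)).subtype.lTensor A y) ∈ A * (B ⊓ Q) := by
    induction y with
    | zero => simp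
    | add s t hs ht => rw [map_add, map_add]; exact Submodule.add_mem _ hs ht
    | tmul s t =>
      rw [LinearMap.lTensor_tmul, tmul_tmul]
      exact Submodule.mul_mem_mul s.2 ⟨t.1.2, (Submodule.Quotient.mk_eq_zero Q).1 t.2⟩
  have h2 (y) : tmul A.subtype B.subtype
      ((LinearMap.ker (P.mkQ ∘ₗ A.subtype)).subtype.rTensor B y) ∈ (A ⊓ P) * B := by
    induction y with
    | zero => simp
    | add s t hs ht => rw [map_add, map_add]; exact Submodule.add_mem _ hs ht
    | tmul s t =>
      rw [LinearMap.rTensor_tmul, tmul_tmul]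
      exact Submodule.mul_mem_mul ⟨s.1.2, (Submodule.Quotient.mk_eq_zero P).1 s.2⟩ t.2
  obtain ⟨_, ⟨y1, rfl⟩, _, ⟨y2, rfl⟩, rfl⟩ :=
    Submodule.mem_sup.1 (mem_ker_sup_of_map_eq_zero _ _ z hz)
  rw [map_add, add_comm]
  exact Submodule.add_mem_sup (h2 y2) (h1 y1)

/-- Intersections of products of subspaces of `V^{⊗ l}` and `V^{⊗ m}` inside `V^{⊗ (l+m)}`. -/
lemma mul_inf_sup_le {l m : ℕ} {A P B Q : Submodule k (TensorAlgebra k V)}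
    (hA : A ≤ Vpow k V l) (hP : P ≤ Vpow k V l) (hB : B ≤ Vpow k V m) (hQ : Q ≤ Vpow k V m) :
    A * B ⊓ (P * Vpow k V m ⊔ Vpow k V l * Q) ≤ (A ⊓ P) * B ⊔ A * (B ⊓ Q) := by
  rintro x ⟨hx, hx'⟩
  have hr (M N : Submodule k (TensorAlgebra k V)) :
      LinearMap.range (tmul M.subtype N.subtype) = M * N := by
    rw [range_tmul, Submodule.range_subtype, Submodule.range_subtype]
  rw [SetLike.mem_coe, ← hr] at hx
  obtain ⟨z, rfl⟩ := hx
  apply tmul_mem_of_map_mkQ_eq_zero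
  obtain ⟨p, hp, q, hq, hpq⟩ := Submodule.mem_sup.1 hx'
  clear hx'
  rw [← hr] at hp hq
  obtain ⟨p, rfl⟩ := hp
  obtain ⟨q, rfl⟩ := hq
  have hinj : Function.Injective (tmul (Vpow k V l).subtype (Vpow k V m).subtype) :=
    tmul_injective (Submodule.subtype_injective _)
      (Submodule.subtype_injective _) (fun x => x.2) (fun x => x.2)
  have e (M N : Submodule k (TensorAlgebra k V)) (hM : M ≤ Vpow k V l) (hN : N ≤ Vpow k V m)
      (y : M ⊗[k] N) : tmul (Vpow k V l).subtype (Vpow k V m).subtype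
        (TensorProduct.map (Submodule.inclusion hM) (Submodule.inclusion hN) y) =
      tmul M.subtype N.subtype y := by
    have : tmul (Vpow k V l).subtype (Vpow k V m).subtype ∘ₗ
      TensorProduct.map (Submodule.inclusion hM) (Submodule.inclusion hN) =
        tmul M.subtype N.subtype := TensorProduct.ext' fun x y => by simp
    exact LinearMap.congr_fun this y
  rw [← e P _ hP le_rfl, ← e _ Q le_rfl hQ, ← e A B hA hB, ← map_add] at hpq
  -- Modulo `P` and `Q` both summands on the right die, so `z` vanishes in `(V^{⊗ l}/P) ⊗ (V^{⊗
  -- m}/Q)`.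
  have e4 := congrArg (TensorProduct.map (P.mkQ ∘ₗ (Vpow k V l).subtype)
    (Q.mkQ ∘ₗ (Vpow k V m).subtype)) (hinj hpq)
  rw [map_add] at e4
  simp only [← LinearMap.comp_apply, ← TensorProduct.map_comp] at e4
  have h1 : (P.mkQ ∘ₗ (Vpow k V l).subtype) ∘ₗ Submodule.inclusion hP = 0 := by
    ext x; simp
  have h2 : (Q.mkQ ∘ₗ (Vpow k V m).subtype) ∘ₗ Submodule.inclusion hQ = 0 := by
    ext x; simp
  rw [h1, h2, TensorProduct.map_zero_left, TensorProduct.map_zero_right] at e4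
  simp only [LinearMap.zero_apply, add_zero] at e4
  exact e4.symm

lemma mul_inf_mul_Vpow {l m : ℕ} {A P B : Submodule k (TensorAlgebra k V)}
    (hA : A ≤ Vpow k V l) (hP : P ≤ Vpow k V l) (hB : B ≤ Vpow k V m) :
    A * B ⊓ P * Vpow k V m = (A ⊓ P) * B := by
  apply le_antisymm
  · have := mul_inf_sup_le hA hP hB (bot_le : ⊥ ≤ Vpow k V m)
    simpa using this
  · exact le_inf (mul_le_mul_left inf_le_left _) (mul_le_mul' inf_le_right hB)

lemma mul_inf_Vpow_mul {l m : ℕ} {A B Q : Submodule k (TensorAlgebra k V)}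
    (hA : A ≤ Vpow k V l) (hB : B ≤ Vpow k V m) (hQ : Q ≤ Vpow k V m) :
    A * B ⊓ Vpow k V l * Q = A * (B ⊓ Q) := by
  apply le_antisymm
  · have := mul_inf_sup_le hA (bot_le : ⊥ ≤ Vpow k V l) hB hQ
    simpa using this
  · exact le_inf (mul_le_mul_right inf_le_left _) (mul_le_mul' hA inf_le_right)

end TensorAlgebraProducts

/-! ### The ideal of relations and its homogeneous parts -/

section Relations
variable {k V : Type u} [Field k] [AddCommGroup V] [Module k V]

/-- The relations `R`, as a subspace of `V^{⊗ 2} ⊆ TV`. -/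
abbrev relSub (R : Submodule k (V ⊗[k] V)) : Submodule k (TensorAlgebra k V) :=
  R.map (quadMap k V)

/-- The degree `n` part `∑ V^{⊗ i} ⊗ R ⊗ V^{⊗ j}` of the ideal of relations. -/
def relDeg (R : Submodule k (V ⊗[k] V)) (n : ℕ) : Submodule k (TensorAlgebra k V) :=
  ⨆ (i : ℕ) (j : ℕ) (_ : i + j + 2 = n), Vpow k V i * relSub R * Vpow k V j

variable (R : Submodule k (V ⊗[k] V))

lemma mk_of_mem_relSub {x : TensorAlgebra k V} (hx : x ∈ relSub R) : QAlg.mk R x = 0 := by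
  obtain ⟨t, ht, rfl⟩ := hx
  rw [← map_zero (QAlg.mk R)]
  exact RingQuot.mkAlgHom_rel k (QRel.of t ht)

/-- Left multiplication makes `TV/N` a representation of `TV` in which the relations act by zero,
because `N` is a two-sided ideal containing them. It factors over `A`, so an element that dies in
`A` kills the class of `1` in `TV/N`. -/
lemma mem_ideal_of_mk_eq_zero {x : TensorAlgebra k V} (hx : QAlg.mk R x = 0) :
    x ∈ ⊤ * relSub R * ⊤ := by
  set N : Submodule k (TensorAlgebra k V) := ⊤ * relSub R * ⊤ with hN
  have hl (c y : TensorAlgebra k V) (hy : y ∈ N) : c * y ∈ N := by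
    have h := Submodule.mul_mem_mul (Submodule.mem_top : c ∈ (⊤ : Submodule k _)) hy
    rw [hN, ← mul_assoc, ← mul_assoc] at h
    exact (mul_le_mul_left (mul_le_mul_left (le_top : (⊤ : Submodule k _) * ⊤ ≤ ⊤) _) _) h
  let f : TensorAlgebra k V →ₐ[k] Module.End k (TensorAlgebra k V ⧸ N) :=
    AlgHom.ofLinearMap
      { toFun := fun c => N.mapQ N (LinearMap.mulLeft k c) fun y hy => hl c y hy
        map_add' := fun a b => Submodule.linearMap_qext _ (LinearMap.ext fun y =>
          congrArg Submodule.Quotient.mk (add_mul a b y))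
        map_smul' := fun a b => Submodule.linearMap_qext _ (LinearMap.ext fun y =>
          congrArg Submodule.Quotient.mk (smul_mul_assoc a b y)) }
      (Submodule.linearMap_qext _ (LinearMap.ext fun y => by simp))
      (fun a b => Submodule.linearMap_qext _ (LinearMap.ext fun y =>
        congrArg Submodule.Quotient.mk (mul_assoc a b y)))
  have hf : ∀ ⦃a b⦄, QRel R a b → f a = f b := by
    rintro _ _ ⟨t, ht⟩
    rw [map_zero]
    refine Submodule.linearMap_qext _ (LinearMap.ext fun y => ?_)
    refine (Submodule.Quotient.mk_eq_zero N).2 ?_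
    refine Submodule.mul_mem_mul ?_ Submodule.mem_top
    have h1 := Submodule.mul_mem_mul (Submodule.mem_top : (1 : TensorAlgebra k V) ∈ _)
        (Submodule.mem_map_of_mem (f := quadMap k V) ht)
    rwa [one_mul] at h1
  have h1 : RingQuot.liftAlgHom k ⟨f, hf⟩ (QAlg.mk R x) = f x :=
    RingQuot.liftAlgHom_mkAlgHom_apply ..
  rw [hx, map_zero] at h1
  have h2 : (Submodule.Quotient.mk (x * 1) : TensorAlgebra k V ⧸ N) = 0 :=
    (LinearMap.congr_fun h1 (Submodule.Quotient.mk 1)).symm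
  rwa [Submodule.Quotient.mk_eq_zero, mul_one] at h2

lemma relSub_le : relSub R ≤ Vpow k V 2 := by
  rintro _ ⟨t, -, rfl⟩
  induction t with
  | zero => simp
  | add a b ha hb => rw [map_add]; exact Submodule.add_mem _ ha hb
  | tmul v w =>
    rw [quadMap_tmul, Vpow, pow_two]
    exact Submodule.mul_mem_mul ⟨v, rfl⟩ ⟨w, rfl⟩

lemma mul_relSub_mul_le (i j : ℕ) : Vpow k V i * relSub R * Vpow k V j ≤ Vpow k V (i + j + 2) := by
  calc _ ≤ Vpow k V i * Vpow k V 2 * Vpow k V j :=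
        mul_le_mul_left (mul_le_mul_right (relSub_le R) _) _
    _ = Vpow k V (i + j + 2) := by rw [← pow_add, ← pow_add]; congr 1; omega

lemma relDeg_le (n : ℕ) : relDeg R n ≤ Vpow k V n := by
  refine iSup_le fun i => iSup_le fun j => iSup_le fun h => ?_
  rw [← h]
  exact mul_relSub_mul_le R i j

lemma relDeg_two : relDeg R 2 = relSub R := by
  apply le_antisymm
  · refine iSup_le fun i => iSup_le fun j => iSup_le fun h => ?_
    obtain ⟨rfl, rfl⟩ : i = 0 ∧ j = 0 := by omega
    simp [Vpow]
  · refine le_iSup_of_le 0 (le_iSup_of_le 0 (le_iSup_of_le rfl ?_))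
    simp [Vpow]

/-- The projection `TV → V^{⊗ n}`. -/
def projT (n : ℕ) : TensorAlgebra k V →ₗ[k] TensorAlgebra k V :=
  GradedAlgebra.proj (Vpow k V) n

lemma projT_mem (n : ℕ) (x : TensorAlgebra k V) : projT n x ∈ Vpow k V n :=
  (DirectSum.decompose (Vpow k V) x n).2

lemma projT_of_mem {n : ℕ} {x : TensorAlgebra k V} (hx : x ∈ Vpow k V n) : projT n x = x :=
  DirectSum.decompose_of_mem_same (Vpow k V) hx

lemma projT_of_mem_ne {n m : ℕ} (h : m ≠ n) {x : TensorAlgebra k V} (hx : x ∈ Vpow k V m) :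
    projT n x = 0 :=
  DirectSum.decompose_of_mem_ne (Vpow k V) hx h

lemma projT_mul {n m : ℕ} (x : TensorAlgebra k V) {y : TensorAlgebra k V} (hy : y ∈ Vpow k V m) :
    projT (n + m) (x * y) = projT n x * y :=
  DirectSum.coe_decompose_mul_add_of_right_mem (Vpow k V) hy

lemma projT_mul_of_lt {n m : ℕ} (h : n < m) (x : TensorAlgebra k V) {y : TensorAlgebra k V}
    (hy : y ∈ Vpow k V m) : projT n (x * y) = 0 :=
  DirectSum.coe_decompose_mul_of_right_mem_of_not_le (Vpow k V) hy (by omega)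

lemma iSup_Vpow : ⨆ n, Vpow k V n = ⊤ :=
  (DirectSum.Decomposition.isInternal (Vpow k V)).submodule_iSup_eq_top

/-- The ideal is a sum of homogeneous pieces `V^{⊗ i} R V^{⊗ j}`; the projection keeps those of
degree `n` and kills the others. -/
lemma projT_mem_relDeg {x : TensorAlgebra k V} (hx : QAlg.mk R x = 0) (n : ℕ) :
    projT n x ∈ relDeg R n := by
  have hx := mem_ideal_of_mk_eq_zero R hx
  have h1 : (⊤ : Submodule k (TensorAlgebra k V)) * relSub R * ⊤ =
      ⨆ (i : ℕ) (j : ℕ), Vpow k V i * relSub R * Vpow k V j := by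
    rw [← iSup_Vpow]
    simp only [Submodule.iSup_mul, Submodule.mul_iSup]
    exact iSup_comm
  rw [h1] at hx
  have h2 : (⨆ (i : ℕ) (j : ℕ), Vpow k V i * relSub R * Vpow k V j) ≤
      (relDeg R n).comap (projT n) := by
    refine iSup_le fun i => iSup_le fun j y hy => ?_
    rw [Submodule.mem_comap]
    by_cases h : i + j + 2 = n
    · rw [projT_of_mem (h ▸ mul_relSub_mul_le R i j hy)]
      exact (le_iSup_of_le i (le_iSup_of_le j (le_iSup_of_le h le_rfl)) :
        _ ≤ relDeg R n) hy
    · rw [projT_of_mem_ne h (mul_relSub_mul_le R i j hy)]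
      exact Submodule.zero_mem _
  exact h2 hx

lemma mk_of_mem_relDeg {n : ℕ} {x : TensorAlgebra k V} (hx : x ∈ relDeg R n) :
    QAlg.mk R x = 0 := by
  have h : relDeg R n ≤ LinearMap.ker (QAlg.mk R).toLinearMap := by
    refine iSup_le fun i => iSup_le fun j => iSup_le fun h => ?_
    refine Submodule.mul_le.2 fun x hx y hy => ?_
    refine Submodule.mul_induction_on hx (fun z hz w hw => ?_) (fun a b ha hb => ?_)
    · simp [mk_of_mem_relSub R hw]
    · rw [add_mul]; exact Submodule.add_mem _ ha hb
  exact h hx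

lemma mk_surjective : Function.Surjective (QAlg.mk R) := RingQuot.mkAlgHom_surjective k _

end Relations

/-! ### Intersections and sums of relations placed at given positions -/

section Positions
variable {k V : Type u} [Field k] [AddCommGroup V] [Module k V]
  (R : Submodule k (V ⊗[k] V))

/-- `V^{⊗ i} ⊗ R ⊗ V^{⊗ (n - 2 - i)}`. -/
def relAt (n i : ℕ) : Submodule k (TensorAlgebra k V) :=
  Vpow k V i * relSub R * Vpow k V (n - 2 - i)

/-- The intersection of the subspaces `relAt R n i` of `V^{⊗ n}` for `i ∈ S`. -/
def relInf (n : ℕ) (S : Finset ℕ) : Submodule k (TensorAlgebra k V) :=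
  Vpow k V n ⊓ ⨅ i ∈ S, relAt R n i

/-- The sum of the subspaces `relAt R n i` of `V^{⊗ n}` for `i ∈ T`. -/
def relSup (n : ℕ) (T : Finset ℕ) : Submodule k (TensorAlgebra k V) :=
  ⨆ i ∈ T, relAt R n i

variable {R}

/-- For `i + 2 > n` the truncated exponent would put `relAt R n i` in degree `i + 2`; hence the
bound on positions in all that follows. -/
lemma relAt_le {n i : ℕ} (h : i + 2 ≤ n) : relAt R n i ≤ Vpow k V n := by
  have := mul_relSub_mul_le R i (n - 2 - i)
  rwa [show i + (n - 2 - i) + 2 = n by omega] at this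

lemma relInf_le (n : ℕ) (S : Finset ℕ) : relInf R n S ≤ Vpow k V n := inf_le_left

lemma mem_relInf {n : ℕ} {S : Finset ℕ} {x : TensorAlgebra k V} :
    x ∈ relInf R n S ↔ x ∈ Vpow k V n ∧ ∀ i ∈ S, x ∈ relAt R n i := by
  simp [relInf, Submodule.mem_iInf]

lemma relInf_empty (n : ℕ) : relInf R n ∅ = Vpow k V n := by simp [relInf]

lemma relInf_union (n : ℕ) (S S' : Finset ℕ) :
    relInf R n (S ∪ S') = relInf R n S ⊓ relInf R n S' := by
  ext x
  simp only [mem_relInf, Submodule.mem_inf, Finset.mem_union]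
  exact ⟨fun h => ⟨⟨h.1, fun i hi => h.2 i (.inl hi)⟩, h.1, fun i hi => h.2 i (.inr hi)⟩,
    fun h => ⟨h.1.1, fun i hi => hi.elim (h.1.2 i) (h.2.2 i)⟩⟩

lemma relInf_anti {n : ℕ} {S S' : Finset ℕ} (h : S ⊆ S') : relInf R n S' ≤ relInf R n S := by
  intro x hx
  rw [mem_relInf] at hx ⊢
  exact ⟨hx.1, fun i hi => hx.2 i (h hi)⟩

lemma relInf_insert {n i : ℕ} (S : Finset ℕ) :
    relInf R n (insert i S) = relInf R n S ⊓ relAt R n i := by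
  ext x
  simp only [mem_relInf, Submodule.mem_inf, Finset.mem_insert, forall_eq_or_imp]
  tauto

lemma relAt_mul {l m i : ℕ} (h : i + 2 ≤ l) : relAt R l i * Vpow k V m = relAt R (l + m) i := by
  rw [relAt, relAt, mul_assoc, ← pow_add]
  congr 2
  omega

lemma mul_relAt {l m i : ℕ} (h : i + 2 ≤ m) :
    Vpow k V l * relAt R m i = relAt R (l + m) (l + i) := by
  rw [relAt, relAt, ← mul_assoc, ← mul_assoc, ← pow_add]
  congr 2
  omega

lemma relInf_mul_Vpow {l : ℕ} (m : ℕ) {S : Finset ℕ} (hS : ∀ i ∈ S, i + 2 ≤ l) :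
    relInf R l S * Vpow k V m = relInf R (l + m) S := by
  induction S using Finset.induction_on with
  | empty => rw [relInf_empty, relInf_empty, ← pow_add]
  | insert i S hi ih =>
    have h := hS i (by simp)
    rw [relInf_insert, relInf_insert, ← ih fun j hj => hS j (by simp [hj]), ← relAt_mul h]
    exact (mul_inf_mul_Vpow (relInf_le _ _) (relAt_le h) le_rfl).symm

lemma Vpow_mul_relInf (l : ℕ) {m : ℕ} {S : Finset ℕ} (hS : ∀ i ∈ S, i + 2 ≤ m) :
    Vpow k V l * relInf R m S = relInf R (l + m) (S.image (l + ·)) := by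
  induction S using Finset.induction_on with
  | empty => rw [Finset.image_empty, relInf_empty, relInf_empty, ← pow_add]
  | insert i S hi ih =>
    have h := hS i (by simp)
    rw [Finset.image_insert, relInf_insert, relInf_insert,
      ← ih fun j hj => hS j (by simp [hj]), ← mul_relAt h]
    exact (mul_inf_Vpow_mul le_rfl (relInf_le _ _) (relAt_le h)).symm

/-- For homogeneous `A` and `B` over a field, `A B` is the intersection of `A V^{⊗ m}` and `V^{⊗ l}
B`. So a product of intersections of positions is again one, the positions of the second factor
being shifted by `l`. -/
lemma relInf_mul {l m : ℕ} {S S' : Finset ℕ} (hS : ∀ i ∈ S, i + 2 ≤ l)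
    (hS' : ∀ i ∈ S', i + 2 ≤ m) :
    relInf R l S * relInf R m S' = relInf R (l + m) (S ∪ S'.image (l + ·)) := by
  rw [relInf_union, ← relInf_mul_Vpow m hS, ← Vpow_mul_relInf l hS', inf_comm,
    mul_inf_mul_Vpow le_rfl (relInf_le _ _) (relInf_le _ _), inf_eq_right.2 (relInf_le _ _)]

lemma relSup_union (n : ℕ) (T T' : Finset ℕ) :
    relSup R n (T ∪ T') = relSup R n T ⊔ relSup R n T' := by
  simp only [relSup, Finset.mem_union, iSup_or, iSup_sup_eq]

lemma relSup_le {n : ℕ} {T : Finset ℕ} (hT : ∀ i ∈ T, i + 2 ≤ n) :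
    relSup R n T ≤ Vpow k V n :=
  iSup₂_le fun i hi => relAt_le (hT i hi)

lemma relSup_mul_Vpow {l : ℕ} (m : ℕ) {T : Finset ℕ} (hT : ∀ i ∈ T, i + 2 ≤ l) :
    relSup R l T * Vpow k V m = relSup R (l + m) T := by
  simp only [relSup, Submodule.iSup_mul]
  exact iSup_congr fun i => iSup_congr fun hi => relAt_mul (hT i hi)

lemma Vpow_mul_relSup (l : ℕ) {m : ℕ} {T : Finset ℕ} (hT : ∀ i ∈ T, i + 2 ≤ m) :
    Vpow k V l * relSup R m T = relSup R (l + m) (T.image (l + ·)) := by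
  simp only [relSup, Submodule.mul_iSup]
  rw [Finset.iSup_finset_image]
  exact iSup_congr fun i => iSup_congr fun hi => mul_relAt (hT i hi)

lemma relDeg_eq_relSup (n : ℕ) : relDeg R n = relSup R n (Finset.range (n - 1)) := by
  apply le_antisymm
  · refine iSup_le fun i => iSup_le fun j => iSup_le fun h => ?_
    refine le_iSup₂_of_le i (by simp; omega) ?_
    rw [relAt, show n - 2 - i = j by omega]
  · refine iSup₂_le fun i hi => ?_
    rw [Finset.mem_range] at hi
    exact le_iSup_of_le i (le_iSup_of_le (n - 2 - i) (le_iSup_of_le (by omega) le_rfl))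

/-- A word of length `a` has the positions `0, …, a - 2`. For `a ≤ 1` the truncated range is empty,
which gives the correct `R_0 = k` and `R_1 = V`. -/
lemma Rsub_eq_relInf (a : ℕ) : Rsub R a = relInf R a (Finset.range (a - 1)) := by
  rw [Rsub, relInf]
  congr 1
  apply le_antisymm
  · refine le_iInf₂ fun i hi => ?_
    rw [Finset.mem_range] at hi
    exact iInf_le_of_le i (iInf_le_of_le (a - 2 - i) (iInf_le_of_le (by omega) le_rfl))
  · refine le_iInf fun i => le_iInf fun j => le_iInf fun h => ?_
    refine iInf₂_le_of_le i (by simp; omega) ?_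
    rw [relAt, show a - 2 - i = j by omega]

lemma Rsub_le (a : ℕ) : Rsub R a ≤ Vpow k V a := inf_le_left

lemma Rsub_zero : Rsub R 0 = 1 := by rw [Rsub_eq_relInf]; simp [relInf, Vpow]

lemma Rsub_one : Rsub R 1 = Vpow k V 1 := by rw [Rsub_eq_relInf]; simp [relInf]

lemma Vpow_mul_Rsub (m a : ℕ) :
    Vpow k V m * Rsub R a = relInf R (m + a) (Finset.Ico m (m + a - 1)) := by
  rw [Rsub_eq_relInf, Vpow_mul_relInf _ (by simp; omega)]
  congr 1
  ext i
  simp only [Finset.mem_image, Finset.mem_range, Finset.mem_Ico]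
  constructor
  · rintro ⟨j, hj, rfl⟩; omega
  · intro h; exact ⟨i - m, by omega, by omega⟩

lemma Rsub_mul_Rsub (a b : ℕ) :
    Rsub R a * Rsub R b = relInf R (a + b)
      (Finset.range (a - 1) ∪ (Finset.range (b - 1)).image (a + ·)) := by
  rw [Rsub_eq_relInf, Rsub_eq_relInf, relInf_mul (by simp; omega) (by simp; omega)]

lemma Rsub_add_le (a b : ℕ) : Rsub R (a + b) ≤ Rsub R a * Rsub R b := by
  rw [Rsub_mul_Rsub, Rsub_eq_relInf]
  apply relInf_anti
  intro i
  simp only [Finset.mem_union, Finset.mem_image, Finset.mem_range]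
  rintro (h | ⟨j, hj, rfl⟩) <;> omega

end Positions

/-! ### A linear resolution of the trivial module, lifted to the tensor algebra -/

section Resolution
variable {k V : Type u} [Field k] [AddCommGroup V] [Module k V]

/-- A linear free resolution of the trivial module. -/
structure LinRes (R : Submodule k (V ⊗[k] V)) where
  /-- the index sets of the bases -/
  I : ℕ → Type u
  /-- the augmentation -/
  ε : (I 0 →₀ QAlg R) →ₗ[QAlg R] Triv R
  /-- the differential -/
  δ : ∀ n, (I (n + 1) →₀ QAlg R) →ₗ[QAlg R] (I n →₀ QAlg R)
  uniq : Unique (I 0)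
  linear : ∀ n i j, δ n (Finsupp.single i 1) j ∈ QAlg.deg R 1
  surj : Function.Surjective ε
  exact_zero : LinearMap.range (δ 0) = LinearMap.ker ε
  exact : ∀ n, LinearMap.range (δ (n + 1)) = LinearMap.ker (δ n)

lemma IsKoszul.nonempty_linRes {R : Submodule k (V ⊗[k] V)} (h : IsKoszul R) :
    Nonempty (LinRes R) := by
  obtain ⟨I, ε, δ, ⟨u⟩, h1, h2, h3, h4⟩ := h
  exact ⟨⟨I, ε, δ, u, h1, h2, h3, h4⟩⟩

section basis
variable {I : Type u} {r : I → TensorAlgebra k V} {n : ℕ}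

/-- `∑ x_j ⊗ e_j ↦ ∑ x_j r_j`. -/
def evalT (r : I → TensorAlgebra k V) : (I →₀ TensorAlgebra k V) →ₗ[TensorAlgebra k V]
    TensorAlgebra k V :=
  Finsupp.linearCombination (TensorAlgebra k V) r

lemma evalT_apply (X : I →₀ TensorAlgebra k V) : evalT r X = X.sum fun j x => x * r j := by
  simp [evalT, Finsupp.linearCombination_apply]

/-- For independent homogeneous `r_j` the space `V^{⊗ m} ⊗ span(r)` embeds in `TV`, so `∑ x_j r_j`
determines its coefficients. Membership in `P ⊗ span(r)` can then be tested on each of them. -/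
lemma evalT_mem_mul (hli : LinearIndependent k r) (hr : ∀ i, r i ∈ Vpow k V n) {m : ℕ}
    {X : I →₀ TensorAlgebra k V} (hX : ∀ j, X j ∈ Vpow k V m) {P : Submodule k (TensorAlgebra k V)}
    (hP : P ≤ Vpow k V m) (h : evalT r X ∈ P * Submodule.span k (Set.range r)) (j : I) :
    X j ∈ P := by
  let e : (I →₀ k) →ₗ[k] TensorAlgebra k V := Finsupp.linearCombination k r
  have he : ∀ y, e y ∈ Vpow k V n := fun y => by
    simp only [e, Finsupp.linearCombination_apply]
    exact Submodule.sum_mem _ fun i _ => Submodule.smul_mem _ _ (hr i)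
  have hinj : Function.Injective (tmul (Vpow k V m).subtype e) :=
    tmul_injective (Submodule.subtype_injective _) hli (fun x => x.2) he
  rw [← Finsupp.range_linearCombination, show P = LinearMap.range P.subtype by simp,
    ← range_tmul] at h
  obtain ⟨y, hy⟩ := h
  let z : Vpow k V m ⊗[k] (I →₀ k) :=
    X.sum fun j _ => (⟨X j, hX j⟩ : Vpow k V m) ⊗ₜ[k] Finsupp.single j (1 : k)
  have hz : tmul (Vpow k V m).subtype e z = evalT r X := by
    simp [z, e, evalT_apply, Finsupp.sum, map_sum]
  have hyz : (Submodule.inclusion hP).rTensor _ y = z := by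
    apply hinj
    rw [hz, ← hy]
    have : tmul (Vpow k V m).subtype e ∘ₗ (Submodule.inclusion hP).rTensor _ =
      tmul P.subtype e := TensorProduct.ext' fun x y => by simp
    exact LinearMap.congr_fun this y
  let c : Vpow k V m ⊗[k] (I →₀ k) →ₗ[k] Vpow k V m :=
    (TensorProduct.rid k _).toLinearMap ∘ₗ (Finsupp.lapply j).lTensor _
  have h1 : c z = ⟨X j, hX j⟩ := by
    apply Subtype.ext
    by_cases hj : j ∈ X.support
    · simp only [c, z, Finsupp.sum, map_sum, LinearMap.comp_apply, LinearMap.lTensor_tmul,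
        LinearEquiv.coe_coe, TensorProduct.rid_tmul, Finsupp.lapply_apply]
      rw [Finset.sum_eq_single j]
      · simp
      · intro b _ hb; rw [Finsupp.single_eq_of_ne hb.symm, zero_smul]
      · intro h; exact absurd hj h
    · simp only [c, z, Finsupp.sum, map_sum, LinearMap.comp_apply, LinearMap.lTensor_tmul,
        LinearEquiv.coe_coe, TensorProduct.rid_tmul, Finsupp.lapply_apply]
      rw [Finset.sum_eq_zero]
      · simpa using (Finsupp.notMem_support_iff.1 hj).symm
      · intro b hb
        rw [Finsupp.single_eq_of_ne (by rintro rfl; exact hj hb), zero_smul]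
  have h2 (y : P ⊗[k] (I →₀ k)) : (c ((Submodule.inclusion hP).rTensor _ y) : TensorAlgebra k V) ∈
      P := by
    induction y with
    | zero => simp
    | add a b ha hb => simp only [map_add]; exact Submodule.add_mem _ ha hb
    | tmul a b => simp only [c, LinearMap.comp_apply, LinearMap.rTensor_tmul,
        LinearMap.lTensor_tmul, LinearEquiv.coe_coe, TensorProduct.rid_tmul]
                  exact Submodule.smul_mem _ _ a.2
  have := h2 y
  rwa [hyz, h1] at this

lemma eq_zero_of_evalT (hli : LinearIndependent k r) (hr : ∀ i, r i ∈ Vpow k V n) {m : ℕ}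
    {X : I →₀ TensorAlgebra k V} (hX : ∀ j, X j ∈ Vpow k V m) (h : evalT r X = 0) : X = 0 := by
  ext j
  have := evalT_mem_mul hli hr hX (bot_le : ⊥ ≤ _) (by simp [h]) j
  simpa using this

lemma exists_evalT {M : Submodule k (TensorAlgebra k V)} {x : TensorAlgebra k V}
    (hx : x ∈ M * Submodule.span k (Set.range r)) :
    ∃ X : I →₀ TensorAlgebra k V, (∀ j, X j ∈ M) ∧ evalT r X = x := by
  refine Submodule.mul_induction_on hx (fun m hm n hn => ?_) (fun x y hx hy => ?_)
  · rw [← Finsupp.range_linearCombination] at hn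
    obtain ⟨c, rfl⟩ := hn
    refine ⟨c.mapRange (fun a => a • m) (by simp), fun j => ?_, ?_⟩
    · simpa using Submodule.smul_mem _ _ hm
    · rw [evalT_apply, Finsupp.sum_mapRange_index (by simp), Finsupp.linearCombination_apply,
        Finsupp.mul_sum]
      simp
  · obtain ⟨X, hX, rfl⟩ := hx
    obtain ⟨Y, hY, rfl⟩ := hy
    exact ⟨X + Y, fun j => Submodule.add_mem _ (hX j) (hY j), by simp⟩

lemma evalT_mem {M : Submodule k (TensorAlgebra k V)} {X : I →₀ TensorAlgebra k V}
    (hX : ∀ j, X j ∈ M) : evalT r X ∈ M * Submodule.span k (Set.range r) := by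
  rw [evalT_apply]
  exact Submodule.sum_mem _ fun j _ => Submodule.mul_mem_mul (hX j) (Submodule.subset_span ⟨j, rfl⟩)

end basis

namespace LinRes
variable {R : Submodule k (V ⊗[k] V)} (K : LinRes R)

lemma exists_lift {a : QAlg R} (ha : a ∈ QAlg.deg R 1) : ∃ x ∈ Vpow k V 1, QAlg.mk R x = a := by
  obtain ⟨x, hx, rfl⟩ := ha
  exact ⟨x, hx, rfl⟩

open scoped Classical in
/-- The matrix of the differential, lifted to `V`. -/
def ent (n : ℕ) (i : K.I (n + 1)) : K.I n →₀ TensorAlgebra k V :=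
  Finsupp.onFinset (K.δ n (Finsupp.single i 1)).support
    -- A zero entry is lifted to zero, which keeps the support of the lifted row finite.
    (fun j => if K.δ n (Finsupp.single i 1) j = 0 then 0 else
      Classical.choose (exists_lift (K.linear n i j)))
    (fun j h => by
      rw [Finsupp.mem_support_iff]
      intro h'
      exact h (if_pos h'))

lemma ent_mem (n : ℕ) (i : K.I (n + 1)) (j : K.I n) : K.ent n i j ∈ Vpow k V 1 := by
  simp only [ent, Finsupp.onFinset_apply]
  split_ifs
  · exact Submodule.zero_mem _
  · exact (Classical.choose_spec (exists_lift (K.linear n i j))).1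

lemma mk_ent (n : ℕ) (i : K.I (n + 1)) (j : K.I n) :
    QAlg.mk R (K.ent n i j) = K.δ n (Finsupp.single i 1) j := by
  simp only [ent, Finsupp.onFinset_apply]
  split_ifs with h
  · rw [h, map_zero]
  · exact (Classical.choose_spec (exists_lift (K.linear n i j))).2

/-- The generators of the resolution, as elements of `TV`. -/
def gen : (n : ℕ) → K.I n → TensorAlgebra k V
  | 0, _ => 1
  | n + 1, i => evalT (gen n) (K.ent n i)

/-- The differential, lifted to `TV`. -/
def diff (n : ℕ) : (K.I (n + 1) →₀ TensorAlgebra k V) →ₗ[TensorAlgebra k V]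
    (K.I n →₀ TensorAlgebra k V) :=
  Finsupp.linearCombination (TensorAlgebra k V) (K.ent n)

lemma diff_apply (n : ℕ) (X : K.I (n + 1) →₀ TensorAlgebra k V) (j : K.I n) :
    K.diff n X j = X.sum fun i x => x * K.ent n i j := by
  simp [diff, Finsupp.linearCombination_apply, Finsupp.sum, Finsupp.finsetSum_apply]

lemma evalT_diff (n : ℕ) (X : K.I (n + 1) →₀ TensorAlgebra k V) :
    evalT (K.gen n) (K.diff n X) = evalT (K.gen (n + 1)) X := by
  have : evalT (K.gen n) ∘ₗ K.diff n = evalT (K.gen (n + 1)) :=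
    Finsupp.lhom_ext' fun i => LinearMap.ext_ring (by simp [diff, evalT, gen])
  exact LinearMap.congr_fun this X

/-- The projection from `TV` to `A` on coefficients. -/
def red (n : ℕ) (X : K.I n →₀ TensorAlgebra k V) : K.I n →₀ QAlg R :=
  X.mapRange (QAlg.mk R) (map_zero _)

lemma red_add (n : ℕ) (X Y) : K.red n (X + Y) = K.red n X + K.red n Y :=
  Finsupp.mapRange_add (fun _ _ => map_add _ _ _) X Y

lemma red_surjective (n : ℕ) : Function.Surjective (K.red n) :=
  Finsupp.mapRange_surjective _ (map_zero _) (mk_surjective R)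

lemma red_diff (n : ℕ) (X : K.I (n + 1) →₀ TensorAlgebra k V) :
    K.red n (K.diff n X) = K.δ n (K.red (n + 1) X) := by
  induction X using Finsupp.induction_linear with
  | zero => simp [red]
  | add X Y hX hY => rw [map_add, red_add, hX, hY, red_add, map_add]
  | single i x =>
    ext j
    have h1 : K.red (n + 1) (Finsupp.single i x) = QAlg.mk R x • Finsupp.single i 1 := by
      simp [red]
    rw [h1, map_smul, Finsupp.smul_apply, ← mk_ent, red, Finsupp.mapRange_apply, diff_apply,
      Finsupp.sum_single_index (by simp), map_mul, smul_eq_mul]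

lemma projT_diff (n m : ℕ) (X : K.I (n + 1) →₀ TensorAlgebra k V) (j : K.I n) :
    projT (m + 1) (K.diff n X j) = K.diff n (X.mapRange (projT m) (map_zero _)) j := by
  rw [diff_apply, diff_apply, Finsupp.sum_mapRange_index (by simp), Finsupp.sum, map_sum]
  exact Finset.sum_congr rfl fun i _ => projT_mul _ (K.ent_mem n i j)

lemma projT_zero_diff (n : ℕ) (X : K.I (n + 1) →₀ TensorAlgebra k V) (j : K.I n) :
    projT 0 (K.diff n X j) = 0 := by
  rw [diff_apply, Finsupp.sum, map_sum]
  exact Finset.sum_eq_zero fun i _ => projT_mul_of_lt (by omega) _ (K.ent_mem n i j)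

lemma aug_mk {m : ℕ} {x : TensorAlgebra k V} (hx : x ∈ Vpow k V (m + 1)) :
    QAlg.aug R (QAlg.mk R x) = 0 := by
  have h : ∀ x, QAlg.aug R (QAlg.mk R x) = TensorAlgebra.algebraMapInv x := fun x =>
    RingQuot.liftAlgHom_mkAlgHom_apply ..
  rw [h]
  rw [Vpow, pow_succ] at hx
  refine Submodule.mul_induction_on hx (fun a _ b hb => ?_) (fun a b ha hb => ?_)
  · obtain ⟨v, rfl⟩ := hb
    rw [map_mul]
    simp [TensorAlgebra.algebraMapInv]
  · rw [map_add, ha, hb, add_zero]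

/-- The cocycle condition for an element of the `n`-th term of the resolution. -/
def IsCycle : (n : ℕ) → (K.I n →₀ QAlg R) → Prop
  | 0, x => K.ε x = 0
  | n + 1, x => K.δ n x = 0

lemma exists_of_isCycle (n : ℕ) {x : K.I n →₀ QAlg R} (h : K.IsCycle n x) :
    ∃ y, K.δ n y = x := by
  cases n with
  | zero => exact LinearMap.mem_range.1 (K.exact_zero ▸ LinearMap.mem_ker.2 h)
  | succ n => exact LinearMap.mem_range.1 (K.exact n ▸ LinearMap.mem_ker.2 h)

/-- A preimage under the differential exists over `A`. Its lift to `TV` may be replaced by the part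
of degree `m`, since the differential raises degrees by one; what remains in degree `m + 1` lies in
the ideal of relations. -/
lemma exists_of_red (n m : ℕ) {X : K.I n →₀ TensorAlgebra k V} (hX : ∀ j, X j ∈ Vpow k V (m + 1))
    (h : K.IsCycle n (K.red n X)) : ∃ Z : K.I (n + 1) →₀ TensorAlgebra k V,
      (∀ j, Z j ∈ Vpow k V m) ∧ ∀ j, X j - K.diff n Z j ∈ relDeg R (m + 1) := by
  obtain ⟨y, hy⟩ := K.exists_of_isCycle n h
  obtain ⟨Y, rfl⟩ := K.red_surjective _ y
  refine ⟨Y.mapRange (projT m) (map_zero _), fun j => projT_mem _ _, fun j => ?_⟩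
  rw [← K.projT_diff]
  nth_rw 1 [← projT_of_mem (hX j)]
  rw [← map_sub]
  apply projT_mem_relDeg
  rw [← red_diff] at hy
  have := DFunLike.congr_fun hy j
  simp only [red, Finsupp.mapRange_apply] at this
  rw [map_sub, this, sub_self]

/-- Minimality of the resolution: a boundary has no part of degree `0`, and neither has the ideal of
relations. -/
lemma eq_zero_of_red (n : ℕ) {X : K.I n →₀ TensorAlgebra k V} (hX : ∀ j, X j ∈ Vpow k V 0)
    (h : K.IsCycle n (K.red n X)) : X = 0 := by
  obtain ⟨y, hy⟩ := K.exists_of_isCycle n h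
  obtain ⟨Y, rfl⟩ := K.red_surjective _ y
  ext j
  rw [← red_diff] at hy
  have := DFunLike.congr_fun hy j
  simp only [red, Finsupp.mapRange_apply] at this
  have h1 := projT_mem_relDeg R (x := X j - K.diff n Y j) (by rw [map_sub, this, sub_self]) 0
  rw [map_sub, projT_zero_diff, projT_of_mem (hX j), sub_zero] at h1
  simpa [relDeg] using h1

lemma isCycle_zero {m : ℕ} {X : K.I 0 →₀ TensorAlgebra k V} (hX : ∀ j, X j ∈ Vpow k V (m + 1)) :
    K.IsCycle 0 (K.red 0 X) := by
  change K.ε _ = 0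
  rw [← Finsupp.sum_single (K.red 0 X), Finsupp.sum, map_sum]
  refine Finset.sum_eq_zero fun j _ => ?_
  rw [← mul_one (K.red 0 X j), ← smul_eq_mul, ← Finsupp.smul_single, map_smul]
  have h1 : QAlg.aug R (K.red 0 X j) = 0 := aug_mk (hX j)
  have h2 (t : k) : (QAlg.aug R (K.red 0 X j) * t : k) = 0 := by rw [h1, zero_mul]
  exact h2 (K.ε (Finsupp.single j 1))

lemma isCycle_succ_iff (n : ℕ) {m : ℕ} {X : K.I (n + 1) →₀ TensorAlgebra k V}
    (hX : ∀ j, X j ∈ Vpow k V m) :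
    K.IsCycle (n + 1) (K.red (n + 1) X) ↔ ∀ j, K.diff n X j ∈ relDeg R (m + 1) := by
  change K.δ n _ = 0 ↔ _
  rw [← red_diff]
  have hd (j) : K.diff n X j ∈ Vpow k V (m + 1) := by
    rw [diff_apply, Vpow, pow_succ]
    refine Submodule.sum_mem _ fun i _ => Submodule.mul_mem_mul (hX i) ?_
    simpa [Vpow] using K.ent_mem n i j
  constructor
  · intro h j
    rw [← projT_of_mem (hd j)]
    exact projT_mem_relDeg R (by simpa [red] using DFunLike.congr_fun h j) _
  · intro h
    ext j
    simpa [red] using mk_of_mem_relDeg R (h j)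

lemma δ_δ (n : ℕ) (x) : K.δ n (K.δ (n + 1) x) = 0 := by
  have : K.δ (n + 1) x ∈ LinearMap.ker (K.δ n) := K.exact n ▸ LinearMap.mem_range_self _ x
  exact this

end LinRes

end Resolution

/-! ### The terms of the resolution are generated by the spaces `R_n` -/

section ResolutionBasis
variable {k V : Type u} [Field k] [AddCommGroup V] [Module k V] {R : Submodule k (V ⊗[k] V)}

lemma Rsub_two : Rsub R 2 = relSub R := by
  rw [Rsub_eq_relInf, ← relDeg_two, relDeg_eq_relSup]
  have : relAt R 2 0 ≤ Vpow k V 2 := relAt_le (by omega)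
  simpa [relInf, relSup] using this

/-- This recursion matches the resolution: that consecutive differentials compose to zero puts a
generator into `R · R_n`, and that the differential is linear puts it into `V · R_{n+1}`. -/
lemma relSub_mul_inf (n : ℕ) :
    relSub R * Rsub R n ⊓ Vpow k V 1 * Rsub R (n + 1) = Rsub R (n + 2) := by
  rw [← Rsub_two, Rsub_mul_Rsub, Vpow_mul_Rsub, show 1 + (n + 1) = 2 + n by omega, ← relInf_union,
    Rsub_eq_relInf, show n + 2 = 2 + n by omega]
  congr 1
  ext i
  simp only [Finset.mem_union, Finset.mem_image, Finset.mem_range, Finset.mem_Ico]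
  constructor
  · rintro ((h | ⟨j, hj, rfl⟩) | h) <;> omega
  · intro h
    by_cases hi : i = 0
    · exact .inl (.inl (by omega))
    · exact .inr (by omega)

namespace LinRes
variable (K : LinRes R)

lemma red_ent (n : ℕ) (i : K.I (n + 1)) :
    K.red n (K.ent n i) = K.δ n (Finsupp.single i 1) := by
  ext j
  simp [red, mk_ent]

lemma diff_mem (n m : ℕ) {X : K.I (n + 1) →₀ TensorAlgebra k V} (hX : ∀ j, X j ∈ Vpow k V m)
    (j : K.I n) : K.diff n X j ∈ Vpow k V (m + 1) := by
  rw [diff_apply, Vpow, pow_succ]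
  refine Submodule.sum_mem _ fun i _ => Submodule.mul_mem_mul (hX i) ?_
  simpa [Vpow] using K.ent_mem n i j

lemma gen_mem_Vpow (n : ℕ) (i : K.I n) : K.gen n i ∈ Vpow k V n := by
  induction n with
  | zero => simp [gen, Vpow]
  | succ n ih =>
    rw [gen, evalT_apply, Vpow, pow_succ']
    refine Submodule.sum_mem _ fun j _ => Submodule.mul_mem_mul ?_ (ih j)
    simpa [Vpow] using K.ent_mem n i j

lemma linearIndependent_gen_zero : LinearIndependent k (K.gen 0) := by
  have := K.uniq
  exact LinearIndependent.of_subsingleton default (by simp [gen])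

lemma span_gen_zero : Submodule.span k (Set.range (K.gen 0)) = Rsub R 0 := by
  have := K.uniq
  rw [Rsub_zero, Submodule.one_eq_span]
  congr 1
  ext x
  simp [gen]

/-- A linear relation between generators is a chain with constant coefficients. Independence one
step below shows that its lifted boundary vanishes, so it is a cycle, hence zero by minimality. -/
lemma linearIndependent_gen_succ (n : ℕ) (h : LinearIndependent k (K.gen n)) :
    LinearIndependent k (K.gen (n + 1)) := by
  rw [linearIndependent_iff]
  intro c hc
  let X : K.I (n + 1) →₀ TensorAlgebra k V := c.mapRange (algebraMap k _) (map_zero _)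
  have hX : ∀ j, X j ∈ Vpow k V 0 := fun j => by simp [X, Vpow]
  have h1 : evalT (K.gen n) (K.diff n X) = 0 := by
    rw [evalT_diff, evalT_apply, Finsupp.sum_mapRange_index (by simp), ← hc,
      Finsupp.linearCombination_apply]
    simp [Algebra.smul_def]
  have h2 := eq_zero_of_evalT h (K.gen_mem_Vpow n) (K.diff_mem n 0 hX) h1
  have h3 : X = 0 := K.eq_zero_of_red (n + 1) hX
    ((K.isCycle_succ_iff n hX).2 fun j => by rw [h2]; exact Submodule.zero_mem _)
  ext j
  have h4 := DFunLike.congr_fun h3 j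
  simpa [X] using h4

lemma relDeg_one : relDeg R 1 = ⊥ := by
  rw [relDeg_eq_relSup]; simp [relSup]

lemma span_gen_one : Submodule.span k (Set.range (K.gen 1)) = Rsub R 1 := by
  apply le_antisymm
  · rw [Submodule.span_le, Rsub_one]
    rintro _ ⟨i, rfl⟩
    exact K.gen_mem_Vpow 1 i
  · intro x hx
    have hx' : x ∈ Vpow k V 1 * Submodule.span k (Set.range (K.gen 0)) := by
      rwa [span_gen_zero, Rsub_zero, mul_one, ← Rsub_one (R := R)]
    obtain ⟨X, hX, rfl⟩ := exists_evalT hx'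
    obtain ⟨Z, hZ, h⟩ := K.exists_of_red 0 0 hX (K.isCycle_zero hX)
    have : X = K.diff 0 Z := by
      ext j
      have : X j - K.diff 0 Z j ∈ relDeg R 1 := h j
      rw [relDeg_one, Submodule.mem_bot, sub_eq_zero] at this
      exact this
    rw [this, evalT_diff]
    simpa [Vpow] using evalT_mem hZ (r := K.gen 1)

/-- Expanding an element of `R · R_n ∩ V · R_{n+1}` in the generators of level `n + 1` gives a cycle
with coefficients in `V`. Exactness makes it a boundary of a chain with constant coefficients, with
no error term because there are no relations in degree `1`. -/
lemma span_gen_add_two (n : ℕ) (h0 : Submodule.span k (Set.range (K.gen n)) = Rsub R n)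
    (h1 : Submodule.span k (Set.range (K.gen (n + 1))) = Rsub R (n + 1))
    (hli : LinearIndependent k (K.gen n)) :
    Submodule.span k (Set.range (K.gen (n + 2))) = Rsub R (n + 2) := by
  apply le_antisymm
  · rw [Submodule.span_le]
    rintro _ ⟨i, rfl⟩
    rw [SetLike.mem_coe, ← relSub_mul_inf]
    constructor
    · change evalT _ _ ∈ _
      rw [← evalT_diff, ← h0]
      refine evalT_mem fun j => ?_
      rw [← relDeg_two]
      refine (K.isCycle_succ_iff n (K.ent_mem (n + 1) i)).1 ?_ j
      change K.δ n _ = 0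
      rw [red_ent, δ_δ]
    · rw [← h1]
      exact evalT_mem (K.ent_mem (n + 1) i)
  · intro x hx
    rw [← relSub_mul_inf] at hx
    have h2 := hx.2
    rw [SetLike.mem_coe, ← h1] at h2
    obtain ⟨X, hX, rfl⟩ := exists_evalT h2
    have h3 := hx.1
    rw [SetLike.mem_coe, ← evalT_diff, ← h0] at h3
    have h4 := evalT_mem_mul hli (K.gen_mem_Vpow n) (K.diff_mem n 1 hX) (relSub_le R) h3
    obtain ⟨Z, hZ, h⟩ := K.exists_of_red (n + 1) 0 hX ((K.isCycle_succ_iff n hX).2 fun j => by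
      rw [one_add_one_eq_two, relDeg_two]; exact h4 j)
    have : X = K.diff (n + 1) Z := by
      ext j
      have := h j
      rw [zero_add, relDeg_one, Submodule.mem_bot, sub_eq_zero] at this
      exact this
    rw [this, evalT_diff]
    simpa [Vpow] using evalT_mem hZ (r := K.gen (n + 2))

lemma linearIndependent_gen (n : ℕ) : LinearIndependent k (K.gen n) := by
  induction n with
  | zero => exact K.linearIndependent_gen_zero
  | succ n ih => exact K.linearIndependent_gen_succ n ih

lemma span_gen (n : ℕ) : Submodule.span k (Set.range (K.gen n)) = Rsub R n := by
  induction n using Nat.strong_induction_on with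
  | _ n ih =>
    match n with
    | 0 => exact K.span_gen_zero
    | 1 => exact K.span_gen_one
    | n + 2 => exact K.span_gen_add_two n (ih n (by omega)) (ih (n + 1) (by omega))
                (K.linearIndependent_gen n)

/-- Exactness of the Koszul complex, as a statement about subspaces of tensor powers. -/
lemma koszul_exact (K : LinRes R) (m n : ℕ) :
    Vpow k V (m + 1) * Rsub R (n + 1) ⊓ relDeg R (m + 2) * Rsub R n ≤
      Vpow k V m * Rsub R (n + 2) ⊔ relDeg R (m + 1) * Rsub R (n + 1) := by
  rintro x ⟨hx, hx'⟩
  rw [SetLike.mem_coe, ← K.span_gen] at hx hx'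
  obtain ⟨X, hX, rfl⟩ := exists_evalT hx
  rw [← evalT_diff] at hx'
  -- Membership in `relDeg · R_n`, read on coefficients, is exactly the cycle condition over `A`.
  have h4 := evalT_mem_mul (K.linearIndependent_gen n) (K.gen_mem_Vpow n)
    (K.diff_mem n (m + 1) hX) (relDeg_le R _) hx'
  obtain ⟨Z, hZ, h⟩ := K.exists_of_red (n + 1) m hX ((K.isCycle_succ_iff n hX).2 h4)
  rw [← add_sub_cancel (evalT (K.gen (n + 1)) (K.diff (n + 1) Z)) (evalT (K.gen (n + 1)) X),
    ← map_sub]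
  refine Submodule.add_mem_sup ?_ ?_
  · rw [evalT_diff, ← K.span_gen]
    exact evalT_mem hZ
  · rw [← K.span_gen]
    exact evalT_mem h

end LinRes

end ResolutionBasis

/-! ### Distributivity of the lattice of relations (Koszulness) -/

section Distributive
variable {k V : Type u} [Field k] [AddCommGroup V] [Module k V] {R : Submodule k (V ⊗[k] V)}

/-- In a modular lattice a distributive law for a triple implies the dual law. The second form is
the one in which instances can be chained, which the induction for `LinRes.distrib` needs. -/
lemma modular_distrib_iff {M : Type*} [AddCommGroup M] [Module k M] (A B C : Submodule k M) :
    A ⊓ (B ⊔ C) ≤ A ⊓ B ⊔ A ⊓ C ↔ (C ⊔ A) ⊓ (C ⊔ B) ≤ C ⊔ A ⊓ B := by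
  constructor
  · rintro h x ⟨h1, h2⟩
    obtain ⟨c, hc, a, ha, rfl⟩ := Submodule.mem_sup.1 h1
    obtain ⟨c', hc', b, hb, hx⟩ := Submodule.mem_sup.1 h2
    have h3 : a ∈ A ⊓ (B ⊔ C) := by
      refine ⟨ha, ?_⟩
      rw [show a = b + (c' - c) by rw [eq_sub_of_add_eq' hx.symm]; abel]
      exact Submodule.add_mem_sup hb (Submodule.sub_mem _ hc' hc)
    obtain ⟨y, hy, z, hz, rfl⟩ := Submodule.mem_sup.1 (h h3)
    rw [show c + (y + z) = (c + z) + y by abel]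
    exact Submodule.add_mem_sup (Submodule.add_mem _ hc hz.2) hy
  · rintro h a ⟨ha, hbc⟩
    obtain ⟨b, hb, c, hc, rfl⟩ := Submodule.mem_sup.1 hbc
    have h3 : b + c ∈ (C ⊔ A) ⊓ (C ⊔ B) := by
      refine ⟨Submodule.mem_sup_right ha, ?_⟩
      rw [add_comm]
      exact Submodule.add_mem_sup hc hb
    obtain ⟨y, hy, z, hz, hyz⟩ := Submodule.mem_sup.1 (h h3)
    rw [← hyz, add_comm]
    refine Submodule.add_mem_sup hz ⟨?_, hy⟩
    rw [show y = (b + c) - z by rw [← hyz]; abel]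
    exact Submodule.sub_mem _ ha hz.1

/-- `relInf` and `relSup` distribute over each other. -/
def Distrib (R : Submodule k (V ⊗[k] V)) (n : ℕ) (S T : Finset ℕ) : Prop :=
  relInf R n S ⊓ relSup R n T ≤ ⨆ i ∈ T, relInf R n (insert i S)

/-- No position straddles the cut after `l` letters, so both families live in separate tensor
factors and `mul_inf_sup_le` reduces the claim to the two factors. -/
lemma distrib_split {l m : ℕ} {S T S' T' : Finset ℕ} (hS : ∀ i ∈ S, i + 2 ≤ l)
    (hT : ∀ i ∈ T, i + 2 ≤ l) (hS' : ∀ i ∈ S', i + 2 ≤ m) (hT' : ∀ i ∈ T', i + 2 ≤ m)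
    (h : Distrib R l S T) (h' : Distrib R m S' T') :
    Distrib R (l + m) (S ∪ S'.image (l + ·)) (T ∪ T'.image (l + ·)) := by
  have hb (n i : ℕ) (S : Finset ℕ) (hi : i + 2 ≤ n) (hS : ∀ i ∈ S, i + 2 ≤ n) :
      ∀ j ∈ insert i S, j + 2 ≤ n := by
    intro j hj
    rw [Finset.mem_insert] at hj
    rcases hj with rfl | hj
    exacts [hi, hS _ hj]
  rw [Distrib, ← relInf_mul hS hS', relSup_union, ← relSup_mul_Vpow m hT, ← Vpow_mul_relSup l hT']
  refine (mul_inf_sup_le (relInf_le _ _) (relSup_le hT) (relInf_le _ _) (relSup_le hT')).trans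
    (sup_le ?_ ?_)
  · refine (mul_le_mul_left h _).trans ?_
    simp only [Submodule.iSup_mul]
    refine iSup₂_le fun i hi => ?_
    rw [relInf_mul (hb _ _ _ (hT i hi) hS) hS', Finset.insert_union]
    exact le_iSup₂_of_le i (Finset.mem_union_left _ hi) le_rfl
  · refine (mul_le_mul_right h' _).trans ?_
    simp only [Submodule.mul_iSup]
    refine iSup₂_le fun i hi => ?_
    rw [relInf_mul hS (hb _ _ _ (hT' i hi) hS'), Finset.image_insert, Finset.union_insert]
    exact le_iSup₂_of_le (l + i) (Finset.mem_union_right _ (Finset.mem_image_of_mem _ hi)) le_rfl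

/-- Position `j` covers the letters `j` and `j + 1`. If it does not occur, the word can be cut after
`j + 1` letters. -/
lemma exists_split {n j : ℕ} (hj : j + 1 < n) {S : Finset ℕ} (hS : ∀ i ∈ S, i + 2 ≤ n)
    (hjS : j ∉ S) : ∃ S' S'' : Finset ℕ, (∀ i ∈ S', i + 2 ≤ j + 1) ∧
      (∀ i ∈ S'', i + 2 ≤ n - (j + 1)) ∧ S = S' ∪ S''.image (j + 1 + ·) := by
  refine ⟨S.filter (· < j), (S.filter (j < ·)).image (· - (j + 1)), ?_, ?_, ?_⟩
  · simp only [Finset.mem_filter]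
    rintro i ⟨-, h⟩
    omega
  · simp only [Finset.mem_image, Finset.mem_filter]
    rintro _ ⟨i, ⟨h1, h2⟩, rfl⟩
    have := hS i h1
    omega
  · ext i
    simp only [Finset.mem_union, Finset.mem_image, Finset.mem_filter]
    constructor
    · intro hi
      rcases lt_trichotomy i j with h | rfl | h
      · exact .inl ⟨hi, h⟩
      · exact absurd hi hjS
      · exact .inr ⟨_, ⟨i, ⟨hi, h⟩, rfl⟩, by omega⟩
    · rintro (h | ⟨_, ⟨i', ⟨h1, h2⟩, rfl⟩, rfl⟩)
      · exact h.1
      · rwa [show j + 1 + (i' - (j + 1)) = i' by omega]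

lemma disjoint_of_image_union {l : ℕ} {S S' T T' : Finset ℕ}
    (h : Disjoint (S ∪ S'.image (l + ·)) (T ∪ T'.image (l + ·))) :
    Disjoint S T ∧ Disjoint S' T' := by
  rw [Finset.disjoint_union_left, Finset.disjoint_union_right, Finset.disjoint_union_right] at h
  exact ⟨h.1.1, Finset.disjoint_image (add_right_injective l) |>.1 h.2.2⟩

/-- With `n = t + 1 + (j + 1)` the spaces involved are `V^{t+1} R_{j+1}`, `relDeg (t + 2) V^j`, `V^t
R_{j+2}` and `relDeg (t + 1) V^{j+1}`. Since `V^{t+1} R_{j+1} ⊆ V^{t+2} R_j`, the second may be cut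
down to `relDeg (t + 2) R_j`; what is left is exactness of the Koszul complex. -/
lemma LinRes.distrib_final (K : LinRes R) {n t : ℕ} (h : t + 2 ≤ n) :
    relInf R n (Finset.Ico (t + 1) (n - 1)) ⊓ relSup R n (Finset.range (t + 1)) ≤
      relInf R n (insert t (Finset.Ico (t + 1) (n - 1))) ⊔
        relInf R n (Finset.Ico (t + 1) (n - 1)) ⊓ relSup R n (Finset.range t) := by
  obtain ⟨j, rfl⟩ : ∃ j, n = t + 1 + (j + 1) := ⟨n - t - 2, by omega⟩
  have e1 : relInf R (t + 1 + (j + 1)) (Finset.Ico (t + 1) (t + 1 + (j + 1) - 1)) =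
      Vpow k V (t + 1) * Rsub R (j + 1) := (Vpow_mul_Rsub _ _).symm
  have e2 : relInf R (t + 1 + (j + 1)) (insert t (Finset.Ico (t + 1) (t + 1 + (j + 1) - 1))) =
      Vpow k V t * Rsub R (j + 2) := by
    rw [Vpow_mul_Rsub, show t + (j + 2) = t + 1 + (j + 1) by omega]
    congr 1
    ext i
    simp only [Finset.mem_insert, Finset.mem_Ico]
    omega
  have e3 : relSup R (t + 1 + (j + 1)) (Finset.range (t + 1)) =
      relDeg R (t + 2) * Vpow k V j := by
    rw [relDeg_eq_relSup, relSup_mul_Vpow _ (by simp)]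
    congr 1
    omega
  have e4 : relSup R (t + 1 + (j + 1)) (Finset.range t) =
      relDeg R (t + 1) * Vpow k V (j + 1) := by
    rw [relDeg_eq_relSup, relSup_mul_Vpow _ (by simp)]
    congr 1
  rw [e1, e2, e3, e4]
  have h1 : Vpow k V (t + 1) * Rsub R (j + 1) ≤ Vpow k V (t + 2) * Rsub R j := by
    refine (mul_le_mul_right ((Rsub_add_le 1 j).trans_eq' (by rw [add_comm])) _).trans_eq ?_
    rw [Rsub_one, ← mul_assoc, ← pow_add]
  have h2 : Vpow k V (t + 1) * Rsub R (j + 1) ⊓ relDeg R (t + 2) * Vpow k V j ≤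
      Vpow k V (t + 1) * Rsub R (j + 1) ⊓ relDeg R (t + 2) * Rsub R j := by
    refine le_inf inf_le_left ?_
    refine (inf_le_inf_right _ h1).trans ?_
    rw [mul_inf_mul_Vpow le_rfl (relDeg_le R _) (Rsub_le _)]
    exact mul_le_mul_left inf_le_right _
  refine h2.trans ((K.koszul_exact t j).trans (sup_le_sup_left (le_inf ?_ ?_) _))
  · exact mul_le_mul_left (relDeg_le R _) _
  · exact mul_le_mul_right (Rsub_le _) _

lemma relInf_singleton {n i : ℕ} (h : i + 2 ≤ n) : relInf R n {i} = relAt R n i := by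
  have := relAt_le (R := R) h
  simpa [relInf] using this

/-- Given the claim for `T`, adding one position to `T` amounts to distributivity of a single triple
of subspaces. -/
lemma distrib_insert_iff {n i : ℕ} {S T : Finset ℕ} (hi : i + 2 ≤ n)
    (h : Distrib R n S T) : Distrib R n S (insert i T) ↔
    relInf R n S ⊓ (relInf R n {i} ⊔ relSup R n T) ≤
      relInf R n S ⊓ relInf R n {i} ⊔ relInf R n S ⊓ relSup R n T := by
  have e1 : relSup R n (insert i T) = relInf R n {i} ⊔ relSup R n T := by
    rw [relInf_singleton hi, relSup, Finset.iSup_insert, relSup]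
  have e2 : relInf R n S ⊓ relInf R n {i} = relInf R n (insert i S) := by
    rw [← relInf_union, Finset.union_comm]; rfl
  rw [Distrib, e1, Finset.iSup_insert, ← e2]
  constructor
  · intro h'
    refine h'.trans (sup_le_sup_left (iSup₂_le fun j hj => ?_) _)
    rw [relInf_insert]
    exact inf_le_inf_left _ (le_iSup₂_of_le j hj le_rfl)
  · exact fun h' => h'.trans (sup_le_sup_left h _)

/-- For Koszul algebras, the lattice generated by the `V^{⊗ i} ⊗ R ⊗ V^{⊗ j}` is distributive. -/
theorem LinRes.distrib (K : LinRes R) (n : ℕ) (S T : Finset ℕ) (hS : ∀ i ∈ S, i + 2 ≤ n)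
    (hT : ∀ i ∈ T, i + 2 ≤ n) (hd : Disjoint S T) : Distrib R n S T := by
  induction n using Nat.strong_induction_on generalizing S T with
  | _ n ih =>
  -- A position outside `S ∪ T` splits the tensor power into two shorter ones, covered by the
  -- induction on `n`.
  have proper (S T : Finset ℕ) (hS : ∀ i ∈ S, i + 2 ≤ n) (hT : ∀ i ∈ T, i + 2 ≤ n)
      (hd : Disjoint S T) (j : ℕ) (hj : j + 2 ≤ n) (hjS : j ∉ S) (hjT : j ∉ T) :
      Distrib R n S T := by
    obtain ⟨S', S'', h1, h2, rfl⟩ := exists_split (by omega) hS hjS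
    obtain ⟨T', T'', h3, h4, rfl⟩ := exists_split (by omega) hT hjT
    obtain ⟨h5, h6⟩ := disjoint_of_image_union hd
    have := distrib_split h1 h3 h2 h4 (ih (j + 1) (by omega) S' T' h1 h3 h5)
      (ih (n - (j + 1)) (by omega) S'' T'' h2 h4 h6)
    rwa [show j + 1 + (n - (j + 1)) = n by omega] at this
  -- When `S` and `T` exhaust all positions, the elements of `T` are moved to the left one at a
  -- time; the sum of `T` measures the progress.
  induction hs : ∑ i ∈ T, i using Nat.strong_induction_on generalizing S T with
  | _ s ih' =>
  by_cases hall : ∃ j, j + 2 ≤ n ∧ j ∉ S ∧ j ∉ T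
  · obtain ⟨j, hj, h1, h2⟩ := hall
    exact proper S T hS hT hd j hj h1 h2
  push Not at hall
  -- A position `b < a` outside `T` lies in `S`. The claim for `S ∪ {b}`, `T ∪ {a}` is reduced to
  -- the one with `a` and `b` exchanged, whose sum is smaller.
  by_cases hex : ∃ a ∈ T, ∃ b ∉ T, b < a
  · obtain ⟨a, ha, b, hb, hba⟩ := hex
    have han := hT a ha
    have hbS : b ∈ S := by
      by_contra h
      exact hb (hall b (by omega) h)
    have haS : a ∉ S := fun h => Finset.disjoint_left.1 hd h ha
    obtain ⟨T, haT, rfl⟩ : ∃ T', a ∉ T' ∧ T = insert a T' :=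
      ⟨T.erase a, by simp, (Finset.insert_erase ha).symm⟩
    obtain ⟨S, hbS', rfl⟩ : ∃ S', b ∉ S' ∧ S = insert b S' :=
      ⟨S.erase b, by simp, (Finset.insert_erase hbS).symm⟩
    simp only [Finset.disjoint_insert_left, Finset.disjoint_insert_right, Finset.mem_insert,
      forall_eq_or_imp, not_or] at hS hT hd hb haS
    have hD1 := proper (insert b S) T (by simpa using hS) hT.2
      (by simp [hd.2.2, hb.2]) a han (by simp [haS]) haT
    rw [distrib_insert_iff han hD1, modular_distrib_iff]
    have hD2 : Distrib R n (insert a S) (insert b T) := by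
      refine ih' (∑ i ∈ insert b T, i) ?_ _ _ ?_ ?_ ?_ rfl
      · rw [← hs, Finset.sum_insert haT, Finset.sum_insert hb.2]
        omega
      · simpa using ⟨hT.1, hS.2⟩
      · simpa using ⟨hS.1, hT.2⟩
      · simp [hd.2.2, hbS', haT]
        omega
    have hD3 := proper (insert a S) T (by simpa using ⟨hT.1, hS.2⟩) hT.2
      (by simp [hd.2.2, haT]) b hS.1 (by simp [hbS']; omega) hb.2
    rw [distrib_insert_iff hS.1 hD3, modular_distrib_iff] at hD2
    have hD4 := proper S T hS.2 hT.2 hd.2.2 b hS.1 hbS' hb.2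
    have hD5 : Distrib R n S (insert a T) := proper S (insert a T) hS.2 (by simpa using hT)
      (by simp [hd.2.2, haS.2]) b hS.1 hbS' (by simp [hb])
    rw [distrib_insert_iff han hD4, modular_distrib_iff] at hD5
    have e (S : Finset ℕ) (i : ℕ) : relInf R n S ⊓ relInf R n {i} = relInf R n (insert i S) := by
      rw [← relInf_union, Finset.union_comm]; rfl
    rw [e, Finset.insert_comm]
    rw [e] at hD2 hD5
    -- Write `C` for the sum over `T` and `X` for the intersection over `S`. Then `(C + X ∩ b) ∩ (C
    -- + a)` lies in `C + X ∩ a` by `hD5` and in `C + b` trivially, so `hD2` puts it into `C + X ∩ a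
    -- ∩ b`.
    refine le_trans (le_inf (le_trans ?_ hD5) ?_) hD2
    · exact inf_le_inf_right _ (sup_le_sup_left (relInf_anti (Finset.subset_insert _ _)) _)
    · exact inf_le_left.trans (sup_le_sup_left (relInf_anti (by simp)) _)
  · push Not at hex
    -- No exchange is possible any more: `T` is an initial segment and `S` is the complementary
    -- final one. Only here is the Koszul complex used.
    obtain ⟨t, rfl⟩ : ∃ t, T = Finset.range t := by
      refine ⟨T.card, ?_⟩
      have h1 : T ⊆ Finset.range T.card := by
        intro a ha
        have : Finset.range (a + 1) ⊆ T := by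
          intro b hb
          by_contra hbT
          have h1 := hex a ha b hbT
          simp only [Finset.mem_range] at hb
          have h2 : a = b := by omega
          exact hbT (h2 ▸ ha)
        have := Finset.card_le_card this
        simp only [Finset.card_range] at this
        exact Finset.mem_range.2 (by omega)
      exact Finset.eq_of_subset_of_card_le h1 (by simp)
    cases t with
    | zero => simp [Distrib, relSup]
    | succ t =>
      have ht := hT t (by simp)
      have hSe : S = Finset.Ico (t + 1) (n - 1) := by
        ext i
        simp only [Finset.mem_Ico]
        constructor
        · intro hi
          have h1 := hS i hi
          have h2 := Finset.disjoint_left.1 hd hi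
          simp only [Finset.mem_range] at h2
          omega
        · rintro ⟨h1, h2⟩
          by_contra h
          have := hall i (by omega) h
          simp only [Finset.mem_range] at this
          omega
      subst hSe
      have := proper (Finset.Ico (t + 1) (n - 1)) (Finset.range t) hS
        (fun i hi => hT i (by simp only [Finset.mem_range] at hi ⊢; omega))
        (hd.mono_right (by simp)) t ht (by simp) (by simp)
      rw [Finset.range_add_one, distrib_insert_iff ht this]
      have hf := K.distrib_final ht
      rw [Finset.range_add_one] at hf
      have e : relSup R n (insert t (Finset.range t)) =
          relInf R n {t} ⊔ relSup R n (Finset.range t) := by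
        rw [relInf_singleton ht, relSup, Finset.iSup_insert, relSup]
      rw [e] at hf
      rwa [← relInf_union, Finset.union_comm]

end Distributive

/-! ### Ext groups computed from the linear resolution -/

section ExtComputation
lemma exists_comp_eq_of_ker_le {A M N P : Type*} [Semiring A] [AddCommGroup M] [Module A M]
    [AddCommGroup N] [Module A N] [AddCommGroup P] [Module A P] (e : M →ₗ[A] N)
    (he : Function.Surjective e) (f : M →ₗ[A] P) (h : LinearMap.ker e ≤ LinearMap.ker f) :
    ∃ g : N →ₗ[A] P, g ∘ₗ e = f := by
  obtain ⟨s, hs⟩ := he.hasRightInverse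
  have key {x y : M} (hxy : e x = e y) : f x = f y := by
    rw [← sub_eq_zero, ← map_sub]
    exact h (by rw [LinearMap.mem_ker, map_sub, hxy, sub_self])
  refine ⟨⟨⟨fun y => f (s y), fun x y => ?_⟩, fun a x => ?_⟩, LinearMap.ext fun x => key (hs _)⟩
  · rw [← map_add]
    exact key (by rw [map_add, hs, hs, hs])
  · rw [RingHom.id_apply, ← map_smul]
    exact key (by rw [map_smul, hs, hs])

lemma finsupp_lhom_eq_zero {A ι P : Type*} [Ring A] [AddCommGroup P] [Module A P] [IsEmpty ι]
    (f : (ι →₀ A) →ₗ[A] P) : f = 0 :=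
  LinearMap.ext fun x => by rw [Subsingleton.elim x 0, map_zero, map_zero]

open CategoryTheory
variable {k V : Type u} [Field k] [AddCommGroup V] [Module k V] {R : Submodule k (V ⊗[k] V)}

namespace LinRes
variable (K : LinRes R)

/-- The resolution, as a chain complex. -/
def complex : ChainComplex (ModuleCat.{u} (QAlg R)) ℕ :=
  ChainComplex.of (fun n => ModuleCat.of (QAlg R) (K.I n →₀ QAlg R))
    (fun n => ModuleCat.ofHom (K.δ n))
    (fun n => by ext1; exact LinearMap.ext fun x => K.δ_δ n x)

lemma complex_d (n : ℕ) : K.complex.d (n + 1) n = ModuleCat.ofHom (K.δ n) :=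
  ChainComplex.of_d (fun n => ModuleCat.of (QAlg R) (K.I n →₀ QAlg R))
    (fun n => ModuleCat.ofHom (K.δ n)) n

lemma ε_δ (x) : K.ε (K.δ 0 x) = 0 := by
  have : K.δ 0 x ∈ LinearMap.ker K.ε := K.exact_zero ▸ LinearMap.mem_range_self _ x
  exact this

/-- The augmentation of the resolution. -/
def augMap : K.complex.X 0 ⟶ ModuleCat.of (QAlg R) (Triv R) := ModuleCat.ofHom K.ε

lemma d_augMap : K.complex.d 1 0 ≫ K.augMap = 0 := by
  rw [complex_d]
  exact ModuleCat.hom_ext (LinearMap.ext K.ε_δ)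

/-- The beginning of the resolution. -/
def augComplex : ShortComplex (ModuleCat.{u} (QAlg R)) :=
  ShortComplex.mk (K.complex.d 1 0) K.augMap K.d_augMap

lemma augComplex_exact : K.augComplex.Exact := by
  rw [ShortComplex.moduleCat_exact_iff_range_eq_ker]
  change LinearMap.range (K.complex.d 1 0).hom = LinearMap.ker K.ε
  rw [complex_d]
  exact K.exact_zero

lemma exactAt_succ (n : ℕ) : K.complex.ExactAt (n + 1) := by
  rw [HomologicalComplex.exactAt_iff' _ (n + 2) (n + 1) n (by simp) (by simp),
    ShortComplex.moduleCat_exact_iff_range_eq_ker]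
  change LinearMap.range (K.complex.d (n + 2) (n + 1)).hom =
    LinearMap.ker (K.complex.d (n + 1) n).hom
  rw [complex_d, complex_d]
  exact K.exact n

/-- The resolution, as a projective resolution of the trivial module. -/
def projRes : ProjectiveResolution (ModuleCat.of (QAlg R) (Triv R)) where
  complex := K.complex
  projective n := ModuleCat.projective_of_free (Finsupp.basisSingleOne (ι := K.I n) (R := QAlg R))
  π := (ChainComplex.toSingle₀Equiv _ _).symm ⟨K.augMap, K.d_augMap⟩
  quasiIso := ⟨fun n => by
    cases n with
    | zero =>
      rw [ChainComplex.quasiIsoAt₀_iff, ShortComplex.quasiIso_iff_of_zeros']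
      · refine (ShortComplex.exact_and_epi_g_iff_of_iso (S₂ := K.augComplex) ?_).2 ⟨?_, ?_⟩
        · refine ShortComplex.isoMk (Iso.refl _) (Iso.refl _) (Iso.refl _) ?_ ?_
          · simp [augComplex]
            exact (Category.id_comp _).trans (Category.comp_id _).symm
          · simp [augComplex]
            rfl
        · exact K.augComplex_exact
        · exact (ModuleCat.epi_iff_surjective _).2 K.surj
      all_goals rfl
    | succ n =>
      rw [quasiIsoAt_iff_exactAt']
      · exact K.exactAt_succ n
      · apply ChainComplex.exactAt_succ_single_obj⟩

variable {Y : Type u} [AddCommGroup Y] [Module (QAlg R) Y]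

/-- A linear map on a term of the resolution, as a morphism. -/
def toHom (n : ℕ) (f : (K.I n →₀ QAlg R) →ₗ[QAlg R] Y) :
    K.projRes.complex.X n ⟶ ModuleCat.of (QAlg R) Y := ModuleCat.ofHom f

lemma exists_toHom (n : ℕ) (f : K.projRes.complex.X n ⟶ ModuleCat.of (QAlg R) Y) :
    ∃ g, K.toHom n g = f := ⟨ModuleCat.Hom.hom (A := ModuleCat.of (QAlg R) (K.I n →₀ QAlg R)) f, rfl⟩

lemma toHom_injective (n : ℕ) : Function.Injective (K.toHom (Y := Y) n) := fun _ _ h =>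
  congrArg (ModuleCat.Hom.hom (A := ModuleCat.of (QAlg R) (K.I n →₀ QAlg R))) h

lemma d_toHom (n : ℕ) (f : (K.I n →₀ QAlg R) →ₗ[QAlg R] Y) :
    K.projRes.complex.d (n + 1) n ≫ K.toHom n f = K.toHom (n + 1) (f ∘ₗ K.δ n) := by
  change K.complex.d _ _ ≫ _ = _
  rw [complex_d]
  rfl

/-- The extension class of a cocycle. -/
def extClass (n : ℕ) (f : (K.I n →₀ QAlg R) →ₗ[QAlg R] Y) (hf : f ∘ₗ K.δ n = 0) :
    Abelian.Ext.{u} (ModuleCat.of (QAlg R) (Triv R)) (ModuleCat.of (QAlg R) Y) n :=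
  K.projRes.extMk (K.toHom n f) (n + 1) rfl (by rw [d_toHom, hf]; rfl)

lemma extClass_surjective (n : ℕ) (α : Abelian.Ext.{u} (ModuleCat.of (QAlg R) (Triv R))
    (ModuleCat.of (QAlg R) Y) n) : ∃ f hf, K.extClass n f hf = α := by
  obtain ⟨f, hf, rfl⟩ := K.projRes.extMk_surjective α (n + 1) rfl
  obtain ⟨f, rfl⟩ := K.exists_toHom n f
  rw [d_toHom] at hf
  exact ⟨f, K.toHom_injective _ hf, rfl⟩

lemma extClass_add (n : ℕ) (f g : (K.I n →₀ QAlg R) →ₗ[QAlg R] Y) (hf hg hfg) :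
    K.extClass n (f + g) hfg = K.extClass n f hf + K.extClass n g hg :=
  (K.projRes.add_extMk _ _ (n + 1) rfl _ _).symm

lemma extClass_zero (n : ℕ) (h) : K.extClass (Y := Y) n 0 h = 0 :=
  K.projRes.extMk_zero (n + 1) rfl

lemma exists_of_extClass_eq_zero (n : ℕ) (f : (K.I (n + 1) →₀ QAlg R) →ₗ[QAlg R] Y) (hf)
    (h : K.extClass (n + 1) f hf = 0) :
    ∃ g : (K.I n →₀ QAlg R) →ₗ[QAlg R] Y, g ∘ₗ K.δ n = f := by
  obtain ⟨g, hg⟩ := (K.projRes.extMk_eq_zero_iff _ (n + 2) rfl _ n rfl).1 h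
  obtain ⟨g, rfl⟩ := K.exists_toHom n g
  rw [d_toHom] at hg
  exact ⟨g, K.toHom_injective _ hg⟩

lemma exists_of_ext_subsingleton (n : ℕ)
    (h : Subsingleton (Abelian.Ext.{u} (ModuleCat.of (QAlg R) (Triv R))
      (ModuleCat.of (QAlg R) Y) (n + 1)))
    (f : (K.I (n + 1) →₀ QAlg R) →ₗ[QAlg R] Y) (hf : f ∘ₗ K.δ (n + 1) = 0) :
    ∃ g : (K.I n →₀ QAlg R) →ₗ[QAlg R] Y, g ∘ₗ K.δ n = f :=
  K.exists_of_extClass_eq_zero n f hf (h.elim _ _)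

lemma hom_eq_zero_of_ext_subsingleton
    (h : Subsingleton (Abelian.Ext.{u} (ModuleCat.of (QAlg R) (Triv R))
      (ModuleCat.of (QAlg R) Y) 0)) (g : Triv R →ₗ[QAlg R] Y) : g = 0 := by
  have h2 : Abelian.Ext.mk₀ (ModuleCat.ofHom g) = Abelian.Ext.mk₀.{u} (ModuleCat.ofHom 0) :=
    h.elim _ _
  have h3 := (Abelian.Ext.mk₀_bijective _ _).1 h2
  exact congrArg (ModuleCat.Hom.hom (A := ModuleCat.of (QAlg R) (Triv R))) h3

lemma exists_comp_ε (f : (K.I 0 →₀ QAlg R) →ₗ[QAlg R] Y) (hf : f ∘ₗ K.δ 0 = 0) :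
    ∃ g : Triv R →ₗ[QAlg R] Y, g ∘ₗ K.ε = f :=
  have h : LinearMap.ker K.ε ≤ LinearMap.ker f :=
    K.exact_zero.ge.trans (LinearMap.range_le_ker_iff.2 hf)
  by
    obtain ⟨g, hg⟩ := exists_comp_eq_of_ker_le (A := QAlg R) (N := Triv R) (P := Y)
      (M := K.I 0 →₀ QAlg R) K.ε K.surj f h
    exact ⟨g, hg⟩

lemma eq_zero_of_ext_subsingleton
    (h : Subsingleton (Abelian.Ext.{u} (ModuleCat.of (QAlg R) (Triv R))
      (ModuleCat.of (QAlg R) Y) 0))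
    (f : (K.I 0 →₀ QAlg R) →ₗ[QAlg R] Y) (hf : f ∘ₗ K.δ 0 = 0) : f = 0 := by
  obtain ⟨g, rfl⟩ := K.exists_comp_ε f hf
  rw [hom_eq_zero_of_ext_subsingleton h g, LinearMap.zero_comp]

/-- The entries of the differential lie in `A_1`, so the values of a coboundary on basis elements
are killed by the augmentation. This makes classes in Ext visible through the augmentation. -/
lemma aug_comp_δ (n : ℕ) (g : (K.I n →₀ QAlg R) →ₗ[QAlg R] QAlg R) (i : K.I (n + 1)) :
    QAlg.aug R (g (K.δ n (Finsupp.single i 1))) = 0 := by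
  rw [← red_ent, ← Finsupp.sum_single (K.red n _), Finsupp.sum, map_sum, map_sum]
  refine Finset.sum_eq_zero fun j _ => ?_
  rw [← mul_one (K.red n _ j), ← smul_eq_mul, ← Finsupp.smul_single, map_smul, smul_eq_mul,
    map_mul, red, Finsupp.mapRange_apply, aug_mk (K.ent_mem n i j), zero_mul]

lemma triv_comp_δ (n : ℕ) (g : (K.I n →₀ QAlg R) →ₗ[QAlg R] Triv R) (i : K.I (n + 1)) :
    g (K.δ n (Finsupp.single i 1)) = 0 := by
  rw [← red_ent, ← Finsupp.sum_single (K.red n _), Finsupp.sum, map_sum]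
  refine Finset.sum_eq_zero fun j _ => ?_
  rw [← mul_one (K.red n _ j), ← smul_eq_mul, ← Finsupp.smul_single, map_smul]
  have h1 : QAlg.aug R (K.red n (K.ent n i) j) = 0 := aug_mk (K.ent_mem n i j)
  have h2 (t : k) : (QAlg.aug R (K.red n (K.ent n i) j) * t : k) = 0 := by rw [h1, zero_mul]
  exact h2 (g (Finsupp.single j 1))

/-- The differentials of `Hom(P, k)` vanish by minimality, so a basis element of `P_{n+1}` would
give a nonzero class: the cocycle with value `1` on the basis is not a coboundary. -/
lemma isEmpty_of_ext_triv (n : ℕ)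
    (h : Subsingleton (Abelian.Ext.{u} (ModuleCat.of (QAlg R) (Triv R))
      (ModuleCat.of (QAlg R) (Triv R)) (n + 1))) : IsEmpty (K.I (n + 1)) := by
  refine ⟨fun i => ?_⟩
  let f : (K.I (n + 1) →₀ QAlg R) →ₗ[QAlg R] Triv R :=
    Finsupp.linearCombination (QAlg R) (fun _ => (1 : k) : K.I (n + 1) → Triv R)
  obtain ⟨g, hg⟩ := K.exists_of_ext_subsingleton n h f (by
    ext1 j
    ext
    exact K.triv_comp_δ (n + 1) f j)
  have h1 : f (Finsupp.single i 1) = 0 := by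
    rw [← hg]
    exact K.triv_comp_δ n g i
  have h2 : f (Finsupp.single i 1) = (1 : k) :=
    (Finsupp.linearCombination_single ..).trans (one_smul (QAlg R) (show Triv R from (1 : k)))
  exact one_ne_zero (α := k) (h2.symm.trans h1)

end LinRes

lemma IsASRegular.subsingleton_ext_triv {d : ℕ} (h : IsASRegular R d) :
    Subsingleton (Abelian.Ext.{u} (ModuleCat.of (QAlg R) (Triv R))
      (ModuleCat.of (QAlg R) (Triv R)) (d + 1)) := by
  have h1 : projectiveDimension (ModuleCat.of (QAlg R) (Triv R)) ≤ d := by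
    rw [← h.globalDim]
    exact le_iSup projectiveDimension (ModuleCat.of (QAlg R) (Triv R))
  have := (projectiveDimension_le_iff _ d).1 h1
  exact HasProjectiveDimensionLT.subsingleton _ (d + 1) (d + 1) le_rfl _

namespace LinRes
variable (K : LinRes R)

lemma extClass_smul (n : ℕ) (a : k) (f : (K.I n →₀ QAlg R) →ₗ[QAlg R] QAlg R) (hf haf) :
    K.extClass n (a • f) haf = a • K.extClass n f hf := by
  rw [Abelian.Ext.smul_eq_comp_mk₀, extClass, extClass,
    K.projRes.extMk_comp_mk₀ _ (n + 1) rfl]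
  congr 1

/-- Since `P_{d+1} = 0`, every map `P_d → A` is a cocycle, and coboundaries have augmentation zero
on the basis. The coordinate functions of `P_d` therefore stay independent in `Ext^d(k, A)`, which
is a line; it is nonzero, so the basis is not empty. -/
lemma exists_unique_top {d : ℕ} (hd : 1 ≤ d) (h : IsASRegular R d) : Nonempty (Unique (K.I d)) := by
  obtain ⟨n, rfl⟩ : ∃ n, d = n + 1 := ⟨d - 1, by omega⟩
  have hE := K.isEmpty_of_ext_triv (n + 1) h.subsingleton_ext_triv
  have hc (f : (K.I (n + 1) →₀ QAlg R) →ₗ[QAlg R] QAlg R) : f ∘ₗ K.δ (n + 1) = 0 :=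
    finsupp_lhom_eq_zero _
  let φ (f : (K.I (n + 1) →₀ QAlg R) →ₗ[QAlg R] QAlg R) :
      Abelian.Ext.{u} (ModuleCat.of (QAlg R) (Triv R)) (ModuleCat.of (QAlg R) (QAlg R)) (n + 1) :=
    K.extClass (n + 1) f (hc f)
  have hφs : Function.Surjective φ := fun α => by
    obtain ⟨f, hf, rfl⟩ := K.extClass_surjective (n + 1) α
    exact ⟨f, rfl⟩
  have hφa (f g) : φ (f + g) = φ f + φ g := K.extClass_add (n + 1) f g _ _ _
  have hφm (a : k) (f) : φ (a • f) = a • φ f := K.extClass_smul (n + 1) a f _ _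
  have hφ0 (f) (hf : φ f = 0) (i) : QAlg.aug R (f (Finsupp.single i 1)) = 0 := by
    obtain ⟨g, hg⟩ := K.exists_of_extClass_eq_zero n f (hc f) hf
    rw [← hg]
    exact K.aug_comp_δ n g i
  have h1 := h.finrank_ext
  have hne : Nonempty (K.I (n + 1)) := by
    by_contra hne
    rw [not_nonempty_iff] at hne
    have : ∀ f, φ f = 0 := fun f => by
      obtain rfl : f = 0 := finsupp_lhom_eq_zero _
      exact K.extClass_zero (n + 1) _
    have : Subsingleton (Abelian.Ext.{u} (ModuleCat.of (QAlg R) (Triv R))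
        (ModuleCat.of (QAlg R) (QAlg R)) (n + 1)) := ⟨fun x y => by
      obtain ⟨f, rfl⟩ := hφs x
      obtain ⟨g, rfl⟩ := hφs y
      rw [this, this]⟩
    rw [Module.finrank_zero_of_subsingleton] at h1
    omega
  have hsub : Subsingleton (K.I (n + 1)) := by
    refine ⟨fun i j => ?_⟩
    by_contra hij
    let f (i : K.I (n + 1)) : (K.I (n + 1) →₀ QAlg R) →ₗ[QAlg R] QAlg R := Finsupp.lapply i
    obtain ⟨e, he0, he⟩ := finrank_eq_one_iff'.1 h1
    obtain ⟨a, ha⟩ := he (φ (f i))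
    obtain ⟨b, hb⟩ := he (φ (f j))
    -- With `φ (f i) = a e` and `φ (f j) = b e`, this combination is a coboundary with augmentations
    -- `b` at `i` and `-a` at `j`. So `a = 0` and `f i` itself would be a coboundary, although its
    -- augmentation at `i` is `1`.
    have h2 : φ (b • f i + (-a) • f j) = 0 := by
      rw [hφa, hφm, hφm, ← ha, ← hb, smul_smul, smul_smul, ← add_smul]
      simp [mul_comm]
    have h3 := hφ0 _ h2 i
    have h4 := hφ0 _ h2 j
    simp only [f, LinearMap.add_apply, LinearMap.smul_apply, Finsupp.lapply_apply,
      Finsupp.single_eq_same, Finsupp.single_eq_of_ne hij, Finsupp.single_eq_of_ne (Ne.symm hij),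
      smul_zero, add_zero, zero_add, map_smul, map_one, smul_eq_mul, mul_one, neg_eq_zero] at h3 h4
    have h5 : φ (f i) = 0 := by rw [← ha, h4, zero_smul]
    have h6 := hφ0 _ h5 i
    simp [f] at h6
  obtain ⟨i⟩ := hne
  exact ⟨⟨⟨i⟩, fun j => Subsingleton.elim _ _⟩⟩

end LinRes
end ExtComputation

/-! ### Contraction of the first or last letters with functionals -/

section Contraction
variable {k V : Type u} [Field k] [AddCommGroup V] [Module k V]

lemma exists_sum_projT_rTensor {X : Type*} [AddCommGroup X] [Module k X]
    (z : TensorAlgebra k V ⊗[k] X) :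
    ∃ N, ∀ M, N ≤ M → ∑ l ∈ Finset.range M, (projT l).rTensor X z = z := by
  induction z with
  | zero => exact ⟨0, fun M _ => by simp⟩
  | add a b ha hb =>
    obtain ⟨N, hN⟩ := ha
    obtain ⟨N', hN'⟩ := hb
    refine ⟨max N N', fun M hM => ?_⟩
    simp only [map_add, Finset.sum_add_distrib]
    rw [hN M (by omega), hN' M (by omega)]
  | tmul x y =>
    have h : x ∈ ⨆ n, Vpow k V n := by rw [iSup_Vpow]; trivial
    induction h using Submodule.iSup_induction' with
    | zero => exact ⟨0, fun M _ => by simp⟩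
    | add a b ha hb iha ihb =>
      obtain ⟨N, hN⟩ := iha
      obtain ⟨N', hN'⟩ := ihb
      refine ⟨max N N', fun M hM => ?_⟩
      rw [TensorProduct.add_tmul]
      simp only [map_add, Finset.sum_add_distrib]
      rw [hN M (by omega), hN' M (by omega)]
    | mem n x hx =>
      refine ⟨n + 1, fun M hM => ?_⟩
      rw [Finset.sum_eq_single n]
      · rw [LinearMap.rTensor_tmul, projT_of_mem hx]
      · intro m _ hm
        rw [LinearMap.rTensor_tmul, projT_of_mem_ne (Ne.symm hm) hx, TensorProduct.zero_tmul]
      · intro h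
        exact absurd (Finset.mem_range.2 (by omega)) h

lemma projT_mul' {n m : ℕ} {x : TensorAlgebra k V} (y : TensorAlgebra k V) (hx : x ∈ Vpow k V m) :
    projT (m + n) (x * y) = x * projT n y :=
  DirectSum.coe_decompose_mul_add_of_left_mem (Vpow k V) hx

/-- The projection to the part of degree `n`. -/
def projV (n : ℕ) : TensorAlgebra k V →ₗ[k] Vpow k V n := (projT n).codRestrict _ (projT_mem n)

/-- Only one factor has to be homogeneous: the components of the other one are separated by the
degree of the product. -/
lemma tmul_id_injective {X : Type*} [AddCommGroup X] [Module k X] {m : ℕ}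
    {f : X →ₗ[k] TensorAlgebra k V} (hf : Function.Injective f) (hfm : ∀ x, f x ∈ Vpow k V m) :
    Function.Injective (tmul LinearMap.id f) := by
  rw [injective_iff_map_eq_zero]
  intro z hz
  have h1 (l : ℕ) : (projV l).rTensor X z = 0 := by
    apply tmul_injective (Vpow k V l).injective_subtype hf (fun x => x.2) hfm
    rw [map_zero]
    have : tmul (Vpow k V l).subtype f ((projV l).rTensor X z) =
        projT (l + m) (tmul LinearMap.id f z) := by
      clear hz
      induction z with
      | zero => simp
      | add a b ha hb => simp only [map_add, ha, hb]
      | tmul x y =>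
        rw [LinearMap.rTensor_tmul, tmul_tmul, tmul_tmul, LinearMap.id_apply,
          projT_mul _ (hfm y)]
        rfl
    rw [this, hz, map_zero]
  obtain ⟨N, hN⟩ := exists_sum_projT_rTensor z
  rw [← hN N le_rfl]
  refine Finset.sum_eq_zero fun l _ => ?_
  have : projT l = (Vpow k V l).subtype ∘ₗ projV l := rfl
  rw [this, LinearMap.rTensor_comp, LinearMap.comp_apply, h1, map_zero]

lemma tmul_injective_id {X : Type*} [AddCommGroup X] [Module k X] {m : ℕ}
    {f : X →ₗ[k] TensorAlgebra k V} (hf : Function.Injective f) (hfm : ∀ x, f x ∈ Vpow k V m) :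
    Function.Injective (tmul f LinearMap.id) := by
  rw [injective_iff_map_eq_zero]
  intro z hz
  have h1 (l : ℕ) : (projV l).lTensor X z = 0 := by
    apply tmul_injective hf (Vpow k V l).injective_subtype hfm (fun x => x.2)
    rw [map_zero]
    have : tmul f (Vpow k V l).subtype ((projV l).lTensor X z) =
        projT (m + l) (tmul f LinearMap.id z) := by
      clear hz
      induction z with
      | zero => simp
      | add a b ha hb => simp only [map_add, ha, hb]
      | tmul x y =>
        rw [LinearMap.lTensor_tmul, tmul_tmul, tmul_tmul, LinearMap.id_apply,
          projT_mul' _ (hfm x)]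
        rfl
    rw [this, hz, map_zero]
  apply (TensorProduct.comm k _ _).injective
  rw [map_zero]
  obtain ⟨N, hN⟩ := exists_sum_projT_rTensor (TensorProduct.comm k _ _ z)
  rw [← hN N le_rfl]
  refine Finset.sum_eq_zero fun l _ => ?_
  have : projT l = (Vpow k V l).subtype ∘ₗ projV l := rfl
  have h2 (z) : (projT l).rTensor X (TensorProduct.comm k X (TensorAlgebra k V) z) =
      TensorProduct.comm k X (TensorAlgebra k V) ((projT l).lTensor X z) := by
    induction z with
    | zero => simp
    | add a b ha hb => simp only [map_add, ha, hb]
    | tmul x y => simp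
  rw [h2, this, LinearMap.lTensor_comp, LinearMap.comp_apply, h1, map_zero, map_zero]

/-- The values of the chosen inverse outside `V^{⊗ n} · TV` are arbitrary. Contractions are
meaningful only on products with a factor of degree `n`, which is why the lemmas on them assume
membership in a product of subspaces. -/
lemma exists_leftInverse_left (n : ℕ) : ∃ g : TensorAlgebra k V →ₗ[k] Vpow k V n ⊗[k] TensorAlgebra k V,
    g ∘ₗ tmul (Vpow k V n).subtype LinearMap.id = LinearMap.id := by
  have h : Function.Injective (tmul (Vpow k V n).subtype
      (LinearMap.id : TensorAlgebra k V →ₗ[k] TensorAlgebra k V)) :=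
    tmul_injective_id (Submodule.injective_subtype _) fun x => x.2
  have h' := LinearMap.ker_eq_bot_of_injective h
  obtain ⟨g, hg⟩ := LinearMap.exists_leftInverse_of_injective
    (V := ↥(Vpow k V n) ⊗[k] TensorAlgebra k V) (V' := TensorAlgebra k V)
    (tmul (Vpow k V n).subtype LinearMap.id) h'
  exact ⟨g, hg⟩

lemma exists_leftInverse_right (n : ℕ) :
    ∃ g : TensorAlgebra k V →ₗ[k] TensorAlgebra k V ⊗[k] Vpow k V n,
    g ∘ₗ tmul LinearMap.id (Vpow k V n).subtype = LinearMap.id :=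
  LinearMap.exists_leftInverse_of_injective _
    (LinearMap.ker_eq_bot.2 (tmul_id_injective (Submodule.injective_subtype _) fun x => x.2))

/-- `y * x ↦ y ⊗ x` for `y` of degree `n`. -/
def splitL (n : ℕ) : TensorAlgebra k V →ₗ[k] Vpow k V n ⊗[k] TensorAlgebra k V :=
  Classical.choose (exists_leftInverse_left n)

/-- `x * y ↦ x ⊗ y` for `y` of degree `n`. -/
def splitR (n : ℕ) : TensorAlgebra k V →ₗ[k] TensorAlgebra k V ⊗[k] Vpow k V n :=
  Classical.choose (exists_leftInverse_right n)

lemma splitL_mul {n : ℕ} {y : TensorAlgebra k V} (hy : y ∈ Vpow k V n) (x : TensorAlgebra k V) :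
    splitL n (y * x) = ⟨y, hy⟩ ⊗ₜ x :=
  LinearMap.congr_fun (Classical.choose_spec (exists_leftInverse_left (k := k) (V := V) n))
    (⟨y, hy⟩ ⊗ₜ x)

lemma splitR_mul {n : ℕ} {y : TensorAlgebra k V} (hy : y ∈ Vpow k V n) (x : TensorAlgebra k V) :
    splitR n (x * y) = x ⊗ₜ ⟨y, hy⟩ :=
  LinearMap.congr_fun (Classical.choose_spec (exists_leftInverse_right (k := k) (V := V) n))
    (x ⊗ₜ ⟨y, hy⟩)

/-- Contraction of the last `n` letters with a functional. -/
def cR (n : ℕ) : Module.Dual k (TensorAlgebra k V) →ₗ[k] TensorAlgebra k V →ₗ[k] TensorAlgebra k V :=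
  LinearMap.mk₂ k (fun f x => TensorProduct.rid k _
      ((f ∘ₗ (Vpow k V n).subtype).lTensor _ (splitR n x)))
    (fun f g x => by rw [LinearMap.add_comp, LinearMap.lTensor_add, LinearMap.add_apply, map_add])
    (fun a f x => by rw [LinearMap.smul_comp, LinearMap.lTensor_smul, LinearMap.smul_apply, map_smul])
    (fun f x y => by simp only [map_add]) (fun a f x => by simp only [map_smul])

/-- Contraction of the first `n` letters with a functional. -/
def cL (n : ℕ) : Module.Dual k (TensorAlgebra k V) →ₗ[k] TensorAlgebra k V →ₗ[k] TensorAlgebra k V :=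
  LinearMap.mk₂ k (fun f x => TensorProduct.lid k _
      ((f ∘ₗ (Vpow k V n).subtype).rTensor _ (splitL n x)))
    (fun f g x => by rw [LinearMap.add_comp, LinearMap.rTensor_add, LinearMap.add_apply, map_add])
    (fun a f x => by rw [LinearMap.smul_comp, LinearMap.rTensor_smul, LinearMap.smul_apply, map_smul])
    (fun f x y => by simp only [map_add]) (fun a f x => by simp only [map_smul])

/-- The map `y * x ↦ y * g x` for `y` of degree `n`. -/
def lw (n : ℕ) (g : TensorAlgebra k V →ₗ[k] TensorAlgebra k V) :
    TensorAlgebra k V →ₗ[k] TensorAlgebra k V :=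
  tmul (Vpow k V n).subtype g ∘ₗ splitL n

variable {n : ℕ}

lemma cR_mul (f : Module.Dual k (TensorAlgebra k V)) (x : TensorAlgebra k V)
    {y : TensorAlgebra k V} (hy : y ∈ Vpow k V n) : cR n f (x * y) = f y • x := by
  simp [cR, splitR_mul hy]

lemma cL_mul (f : Module.Dual k (TensorAlgebra k V)) {y : TensorAlgebra k V}
    (hy : y ∈ Vpow k V n) (x : TensorAlgebra k V) : cL n f (y * x) = f y • x := by
  simp [cL, splitL_mul hy]

lemma lw_mul (g : TensorAlgebra k V →ₗ[k] TensorAlgebra k V) {y : TensorAlgebra k V}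
    (hy : y ∈ Vpow k V n) (x : TensorAlgebra k V) : lw n g (y * x) = y * g x := by
  simp [lw, splitL_mul hy]

lemma one_mem_Vpow_zero : (1 : TensorAlgebra k V) ∈ Vpow k V 0 := by
  rw [Vpow, pow_zero]
  exact Submodule.one_le.1 le_rfl

lemma cR_zero (f : Module.Dual k (TensorAlgebra k V)) (x : TensorAlgebra k V) :
    cR 0 f x = f 1 • x := by
  rw [← cR_mul f x one_mem_Vpow_zero, mul_one]

lemma cR_self (f : Module.Dual k (TensorAlgebra k V)) {x : TensorAlgebra k V}
    (hx : x ∈ Vpow k V n) : cR n f x = f x • 1 := by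
  rw [← cR_mul f 1 hx, one_mul]

variable {P Q N : Submodule k (TensorAlgebra k V)}

/-- Linear maps that agree on products agree on the product of two subspaces. -/
lemma eqOn_mul {X : Type*} [AddCommGroup X] [Module k X] {f g : TensorAlgebra k V →ₗ[k] X}
    (h : ∀ x ∈ P, ∀ y ∈ Q, f (x * y) = g (x * y)) {z : TensorAlgebra k V} (hz : z ∈ P * Q) :
    f z = g z := by
  induction hz using Submodule.mul_induction_on' with
  | mem_mul_mem x hx y hy => exact h x hx y hy
  | add x _ y _ hx hy => rw [map_add, map_add, hx, hy]

lemma cR_mem (hQ : Q ≤ Vpow k V n) (f : Module.Dual k (TensorAlgebra k V)) {z : TensorAlgebra k V}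
    (hz : z ∈ P * Q) : cR n f z ∈ P := by
  have : P * Q ≤ P.comap (cR n f) := Submodule.mul_le.2 fun x hx y hy => by
    rw [Submodule.mem_comap, cR_mul f x (hQ hy)]
    exact P.smul_mem _ hx
  exact this hz

lemma cR_mul_left (hQ : Q ≤ Vpow k V n) (f : Module.Dual k (TensorAlgebra k V))
    (x : TensorAlgebra k V) {z : TensorAlgebra k V} (hz : z ∈ P * Q) :
    cR n f (x * z) = x * cR n f z :=
  eqOn_mul (f := cR n f ∘ₗ LinearMap.mulLeft k x) (g := LinearMap.mulLeft k x ∘ₗ cR n f)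
    (fun p _ q hq => by
      simp only [LinearMap.comp_apply, LinearMap.mulLeft_apply]
      rw [← mul_assoc, cR_mul _ _ (hQ hq), cR_mul _ _ (hQ hq), mul_smul_comm]) hz

lemma cL_cR {m : ℕ} (hP : P ≤ Vpow k V m) (hQ : Q ≤ Vpow k V n)
    (f g : Module.Dual k (TensorAlgebra k V)) {z : TensorAlgebra k V} (hz : z ∈ P * (N * Q)) :
    cL m g (cR n f z) = cR n f (cL m g z) :=
  eqOn_mul (f := cL m g ∘ₗ cR n f) (g := cR n f ∘ₗ cL m g)
    (fun p hp q hq => by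
      simp only [LinearMap.comp_apply]
      rw [cR_mul_left hQ f p hq, cL_mul _ (hP hp), cL_mul _ (hP hp), map_smul]) hz

lemma cR_congr (hQ : Q ≤ Vpow k V n) {f g : Module.Dual k (TensorAlgebra k V)}
    (h : ∀ y ∈ Q, f y = g y) {z : TensorAlgebra k V} (hz : z ∈ P * Q) : cR n f z = cR n g z :=
  eqOn_mul (fun p _ q hq => by rw [cR_mul _ _ (hQ hq), cR_mul _ _ (hQ hq), h q hq]) hz

lemma Vpow_add (m n : ℕ) : Vpow k V (m + n) = Vpow k V m * Vpow k V n := pow_add ..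

/-- The tensor product of two functionals, the first one on the part of degree `m`. -/
def dualMul (m : ℕ) (f g : Module.Dual k (TensorAlgebra k V)) : Module.Dual k (TensorAlgebra k V) :=
  g ∘ₗ cL m f

lemma dualMul_mul {m : ℕ} (f g : Module.Dual k (TensorAlgebra k V)) {x : TensorAlgebra k V}
    (hx : x ∈ Vpow k V m) (y : TensorAlgebra k V) : dualMul m f g (x * y) = f x * g y := by
  rw [dualMul, LinearMap.comp_apply, cL_mul _ hx, map_smul, smul_eq_mul]

lemma cR_cR {m : ℕ} (hP : P ≤ Vpow k V m) (hQ : Q ≤ Vpow k V n)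
    (f g : Module.Dual k (TensorAlgebra k V)) {z : TensorAlgebra k V} (hz : z ∈ N * (P * Q)) :
    cR m f (cR n g z) = cR (m + n) (dualMul m f g) z :=
  eqOn_mul (f := cR m f ∘ₗ cR n g) (g := cR (m + n) (dualMul m f g))
    (fun x _ y hy => by
      refine eqOn_mul (f := cR m f ∘ₗ cR n g ∘ₗ LinearMap.mulLeft k x)
        (g := cR (m + n) (dualMul m f g) ∘ₗ LinearMap.mulLeft k x) (fun p hp q hq => ?_) hy
      simp only [LinearMap.comp_apply, LinearMap.mulLeft_apply]
      rw [cR_mul _ _ (n := m + n) (by rw [Vpow_add]; exact Submodule.mul_mem_mul (hP hp) (hQ hq)),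
        dualMul_mul _ _ (hP hp), ← mul_assoc, cR_mul _ _ (hQ hq), map_smul, cR_mul _ _ (hP hp),
        smul_smul, mul_comm]) hz

end Contraction

/-! ### Consequences of Artin–Schelter regularity for the spaces `R_n` -/

section Nondegenerate
variable {k V : Type u} [Field k] [AddCommGroup V] [Module k V] {R : Submodule k (V ⊗[k] V)}

/-- `t` spans `R_d`, the higher `R_n` vanish, and no functional on `R_m`, `m < d`, is killed by
contraction with `R_{m+1}`. -/
structure IsFrob (R : Submodule k (V ⊗[k] V)) (d : ℕ) (t : TensorAlgebra k V) : Prop where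
  mem : t ∈ Rsub R d
  ne_zero : t ≠ 0
  exists_smul : ∀ x ∈ Rsub R d, ∃ a : k, x = a • t
  eq_bot : ∀ n, d < n → Rsub R n = ⊥
  nondeg : ∀ m < d, ∀ f : Module.Dual k (TensorAlgebra k V),
    (∀ x ∈ Rsub R (m + 1), cR m f x = 0) → ∀ y ∈ Rsub R m, f y = 0

namespace LinRes
variable (K : LinRes R)

/-- The map `P_n → A` with the values `f (gen j)` on the basis. -/
def dualMap (n : ℕ) (f : Module.Dual k (TensorAlgebra k V)) : (K.I n →₀ QAlg R) →ₗ[QAlg R] QAlg R :=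
  Finsupp.linearCombination (QAlg R) fun j => algebraMap k (QAlg R) (f (K.gen n j))

lemma dualMap_single (n : ℕ) (f : Module.Dual k (TensorAlgebra k V)) (j : K.I n) :
    K.dualMap n f (Finsupp.single j 1) = algebraMap k (QAlg R) (f (K.gen n j)) :=
  (Finsupp.linearCombination_single ..).trans (one_smul ..)

/-- This translates the dual of the resolution into contractions: composing `dualMap` with the
differential amounts to contracting elements of the next `R_n` with `f`. -/
lemma dualMap_red (n : ℕ) (f : Module.Dual k (TensorAlgebra k V))
    (X : K.I n →₀ TensorAlgebra k V) :
    K.dualMap n f (K.red n X) = QAlg.mk R (cR n f (evalT (K.gen n) X)) := by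
  induction X using Finsupp.induction_linear with
  | zero => simp [red]
  | add X Y hX hY => rw [red_add]; simp only [map_add, hX, hY]
  | single j x =>
    rw [evalT, Finsupp.linearCombination_single, smul_eq_mul, cR_mul _ _ (K.gen_mem_Vpow n j),
      red, Finsupp.mapRange_single, map_smul, dualMap]
    refine (Finsupp.linearCombination_single ..).trans ?_
    rw [smul_eq_mul, ← Algebra.commutes, Algebra.smul_def]

/-- If contraction with `f` kills `R_{m+1}`, then `dualMap m f` is a cocycle. As `Ext^m(k, A) = 0`
for `m < d`, it is a coboundary (zero for `m = 0`), so the augmentations of its values vanish; but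
these values are the scalars `f (gen j)`. -/
lemma nondeg (K : LinRes R) {d : ℕ} (h : IsASRegular R d) (m : ℕ) (hm : m < d)
    (f : Module.Dual k (TensorAlgebra k V)) (hf : ∀ x ∈ Rsub R (m + 1), cR m f x = 0)
    (y) (hy : y ∈ Rsub R m) : f y = 0 := by
  have h1 : K.dualMap m f ∘ₗ K.δ m = 0 := by
    refine Finsupp.lhom_ext' fun i => LinearMap.ext_ring ?_
    change K.dualMap m f (K.δ m (Finsupp.single i 1)) = 0
    have h3 : evalT (K.gen m) (K.ent m i) ∈ Rsub R (m + 1) := by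
      rw [← K.span_gen]
      exact Submodule.subset_span ⟨i, rfl⟩
    rw [← red_ent, dualMap_red, hf _ h3, map_zero]
  have h2 (j : K.I m) : f (K.gen m j) = 0 := by
    have h3 : QAlg.aug R (K.dualMap m f (Finsupp.single j 1)) = 0 := by
      cases m with
      | zero =>
        rw [K.eq_zero_of_ext_subsingleton (h.ext_eq_zero 0 (by omega)) _ h1, LinearMap.zero_apply,
          map_zero]
      | succ n =>
        obtain ⟨g, hg⟩ := K.exists_of_ext_subsingleton n (h.ext_eq_zero (n + 1) (by omega)) _ h1
        rw [← hg]
        exact K.aug_comp_δ n g j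
    rwa [dualMap_single, AlgHom.commutes] at h3
  rw [← K.span_gen] at hy
  have : Submodule.span k (Set.range (K.gen m)) ≤ LinearMap.ker f :=
    Submodule.span_le.2 (by rintro _ ⟨j, rfl⟩; exact h2 j)
  exact this hy

lemma exists_isFrob (K : LinRes R) {d : ℕ} (hd : 1 ≤ d) (h : IsASRegular R d) : ∃ t, IsFrob R d t := by
  obtain ⟨u⟩ := K.exists_unique_top hd h
  have h1 : Rsub R (d + 1) = ⊥ := by
    have := K.isEmpty_of_ext_triv d h.subsingleton_ext_triv
    rw [← K.span_gen, Set.range_eq_empty, Submodule.span_empty]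
  have h2 : Submodule.span k {K.gen d u.default} = Rsub R d := by
    rw [← K.span_gen, Set.range_unique]
  refine ⟨K.gen d u.default, h2.le (Submodule.mem_span_singleton_self _),
    (K.linearIndependent_gen d).ne_zero _, fun x hx => ?_, fun n hn => ?_, K.nondeg h⟩
  · rw [← h2] at hx
    obtain ⟨a, rfl⟩ := Submodule.mem_span_singleton.1 hx
    exact ⟨a, rfl⟩
  · obtain ⟨m, rfl⟩ := Nat.exists_eq_add_of_le (show d + 1 ≤ n from hn)
    rw [eq_bot_iff]
    refine (Rsub_add_le _ _).trans ?_
    rw [h1, Submodule.bot_mul]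

end LinRes
end Nondegenerate

/-! ### The perfect pairings of `R_a` with `R_{d-a}` and the contractions `D` -/

section Frobenius
variable {k V : Type u} [Field k] [AddCommGroup V] [Module k V] {R : Submodule k (V ⊗[k] V)}
  {d : ℕ} {t : TensorAlgebra k V}

lemma Rsub_le_mul {a b c : ℕ} (h : a + b = c) : Rsub R c ≤ Rsub R a * Rsub R b :=
  h ▸ Rsub_add_le a b

lemma apply_cL {m n : ℕ} {P Q : Submodule k (TensorAlgebra k V)} (hP : P ≤ Vpow k V m)
    (hQ : Q ≤ Vpow k V n) (f g : Module.Dual k (TensorAlgebra k V)) {z : TensorAlgebra k V}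
    (hz : z ∈ P * Q) : g (cL m f z) = f (cR n g z) :=
  eqOn_mul (f := g ∘ₗ cL m f) (g := f ∘ₗ cR n g) (fun p hp q hq => by
    simp only [LinearMap.comp_apply]
    rw [cL_mul _ (hP hp), cR_mul _ _ (hQ hq), map_smul, map_smul, smul_eq_mul, smul_eq_mul,
      mul_comm]) hz

lemma eq_of_forall_dual {x y : TensorAlgebra k V}
    (h : ∀ f : Module.Dual k (TensorAlgebra k V), f x = f y) : x = y := by
  rw [← sub_eq_zero, ← Module.forall_dual_apply_eq_zero_iff k]
  intro f
  rw [map_sub, h, sub_self]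

/-- A linear projection to a subspace. -/
def projSub (N : Submodule k (TensorAlgebra k V)) : TensorAlgebra k V →ₗ[k] N :=
  Classical.choose (LinearMap.exists_leftInverse_of_injective N.subtype
    (LinearMap.ker_eq_bot_of_injective N.injective_subtype))

lemma projSub_coe (N : Submodule k (TensorAlgebra k V)) (x : N) : projSub N x = x :=
  LinearMap.congr_fun (Classical.choose_spec (LinearMap.exists_leftInverse_of_injective N.subtype
    (LinearMap.ker_eq_bot_of_injective N.injective_subtype))) x

/-- The linear map `y₁ * y₂ ↦ φ y₁ * y₂` for `y₁` of degree `n`. -/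
def lm (n : ℕ) : (TensorAlgebra k V →ₗ[k] TensorAlgebra k V) →ₗ[k]
    TensorAlgebra k V →ₗ[k] TensorAlgebra k V :=
  LinearMap.mk₂ k (fun φ y => tmul (φ ∘ₗ (Vpow k V n).subtype) LinearMap.id (splitL n y))
    (fun f g y => by
      rw [LinearMap.add_comp, tmul, TensorProduct.map_add_left, LinearMap.comp_add,
        LinearMap.add_apply]; rfl)
    (fun a f y => by
      rw [LinearMap.smul_comp, tmul, TensorProduct.map_smul_left, LinearMap.comp_smul,
        LinearMap.smul_apply]; rfl)
    (fun f x y => by simp only [map_add]) (fun a f x => by simp only [map_smul])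

lemma lm_mul {n : ℕ} (φ : TensorAlgebra k V →ₗ[k] TensorAlgebra k V) {y : TensorAlgebra k V}
    (hy : y ∈ Vpow k V n) (x : TensorAlgebra k V) : lm n φ (y * x) = φ y * x := by
  simp [lm, splitL_mul hy]

namespace IsFrob
variable (F : IsFrob R d t)

/-- Induction downwards from `m = d`. By `nondeg` it suffices that the contraction of every `x ∈
R_{m+1}` with `f` vanishes. Tested against a functional `g` on `V`, this is the value of `g ⊗ f` at
`x`, and `g ⊗ f` again contracts `t` to zero. -/
lemma apply_eq_zero (F : IsFrob R d t) {m c : ℕ} (h : m + c = d)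
    (f : Module.Dual k (TensorAlgebra k V)) (hf : cR m f t = 0) (y) (hy : y ∈ Rsub R m) :
    f y = 0 := by
  induction c generalizing m f y with
  | zero =>
    obtain rfl : m = d := h
    rw [cR_self f (Rsub_le _ F.mem), smul_eq_zero_iff_left one_ne_zero] at hf
    obtain ⟨a, rfl⟩ := F.exists_smul y hy
    rw [map_smul, hf, smul_zero]
  | succ c ih =>
    refine F.nondeg m (by omega) f (fun x hx => ?_) y hy
    apply eq_of_forall_dual
    intro g
    rw [map_zero, ← apply_cL (m := 1) (Rsub_le 1) (Rsub_le m) g f (Rsub_le_mul (by omega) hx)]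
    refine ih (m := m + 1) (by omega) (dualMul 1 g f) ?_ x hx
    have ht : t ∈ Rsub R c * (Rsub R 1 * Rsub R m) :=
      (Rsub_le_mul (by omega)).trans (mul_le_mul' le_rfl (Rsub_le_mul rfl)) F.mem
    rw [add_comm m, ← cR_cR (Rsub_le 1) (Rsub_le m) g f ht, hf, map_zero]

lemma t_mem (F : IsFrob R d t) {a b : ℕ} (h : a + b = d) : t ∈ Rsub R a * Rsub R b :=
  Rsub_le_mul h F.mem

/-- The map `f ↦ (id ⊗ f)(t)`. -/
def dualTo (F : IsFrob R d t) {m c : ℕ} (h : m + c = d) :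
    Module.Dual k (Rsub R m) →ₗ[k] Rsub R c :=
  ((cR m).flip t ∘ₗ (projSub (Rsub R m)).dualMap).codRestrict _ fun f =>
    cR_mem (Rsub_le m) _ (F.t_mem (by omega))

lemma dualTo_injective {m c : ℕ} (h : m + c = d) : Function.Injective (F.dualTo h) := by
  rw [injective_iff_map_eq_zero]
  intro f hf
  refine LinearMap.ext fun x => ?_
  have := F.apply_eq_zero h (f ∘ₗ projSub (Rsub R m)) (congrArg Subtype.val hf) x x.2
  rwa [LinearMap.comp_apply, projSub_coe] at this

variable [FiniteDimensional k V]

lemma finrank_le (F : IsFrob R d t) {m c : ℕ} (h : m + c = d) :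
    Module.finrank k (Rsub R m) ≤ Module.finrank k (Rsub R c) := by
  rw [← Subspace.dual_finrank_eq]
  exact LinearMap.finrank_le_finrank_of_injective (F.dualTo_injective h)

/-- The injections `R_m^* → R_c` and `R_c^* → R_m` force equal dimensions. -/
lemma dualTo_surjective {m c : ℕ} (h : m + c = d) : Function.Surjective (F.dualTo h) := by
  refine (LinearMap.injective_iff_surjective_of_finrank_eq_finrank ?_).1 (F.dualTo_injective h)
  rw [Subspace.dual_finrank_eq]
  exact le_antisymm (F.finrank_le h) (F.finrank_le ((add_comm c m).trans h))

lemma exists_eta (F : IsFrob R d t) (b : ℕ) (hb : b ≤ d) :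
    ∃ η : TensorAlgebra k V →ₗ[k] Module.Dual k (TensorAlgebra k V),
      ∀ y ∈ Rsub R b, cR (d - b) (η y) t = y := by
  have h : d - b + b = d := by omega
  obtain ⟨s, hs⟩ := LinearMap.exists_rightInverse_of_surjective (F.dualTo h)
    (LinearMap.range_eq_top.2 (F.dualTo_surjective h))
  refine ⟨(projSub (Rsub R (d - b))).dualMap ∘ₗ s ∘ₗ projSub (Rsub R b), fun y hy => ?_⟩
  have := congrArg Subtype.val (LinearMap.congr_fun hs ⟨y, hy⟩)
  rw [LinearMap.comp_apply, LinearMap.comp_apply, projSub_coe _ ⟨y, hy⟩]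
  exact this

open scoped Classical in
/-- The functional `η_y` on `R_{d-b}` with `(id ⊗ η_y)(t) = y`, for `y ∈ R_b`. -/
def eta (F : IsFrob R d t) (b : ℕ) : TensorAlgebra k V →ₗ[k] Module.Dual k (TensorAlgebra k V) :=
  if h : b ≤ d then Classical.choose (F.exists_eta b h) else 0

lemma cR_eta {b : ℕ} (hb : b ≤ d) {y} (hy : y ∈ Rsub R b) : cR (d - b) (F.eta b y) t = y := by
  rw [eta, dif_pos hb]
  exact Classical.choose_spec (F.exists_eta b hb) y hy

/-- `D b y x` is the contraction `R_a × R_b → R_{a+b-d}` of `x ∈ R_a` and `y ∈ R_b`. -/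
def D (F : IsFrob R d t) (b : ℕ) :
    TensorAlgebra k V →ₗ[k] TensorAlgebra k V →ₗ[k] TensorAlgebra k V :=
  cR (d - b) ∘ₗ F.eta b

lemma D_apply (b : ℕ) (y x : TensorAlgebra k V) : F.D b y x = cR (d - b) (F.eta b y) x := rfl

lemma D_mem {a b c : ℕ} (hb : b ≤ d) (h : a + b = c + d) {x} (y) (hx : x ∈ Rsub R a) :
    F.D b y x ∈ Rsub R c :=
  cR_mem (Rsub_le (d - b)) _ (Rsub_le_mul (by omega) hx)

lemma D_t {b : ℕ} (hb : b ≤ d) {y} (hy : y ∈ Rsub R b) : F.D b y t = y := F.cR_eta hb hy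

lemma D_top (x : TensorAlgebra k V) : F.D d t x = x := by
  have h := F.cR_eta le_rfl F.mem
  rw [D_apply]
  rw [Nat.sub_self, cR_zero] at h ⊢
  have h1 : (F.eta d t) 1 = 1 := by
    by_contra h2
    have : ((F.eta d t) 1 - 1) • t = 0 := by rw [sub_smul, one_smul, h, sub_self]
    rcases smul_eq_zero.1 this with h3 | h3
    · exact h2 (sub_eq_zero.1 h3)
    · exact F.ne_zero h3
  rw [h1, one_smul]

/-- The functional `η_y` is determined only on `R_{d-b}`, and there it is determined by its
contraction with `t`. -/
lemma eta_eq {b : ℕ} (hb : b ≤ d) (f : Module.Dual k (TensorAlgebra k V)) (u)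
    (hu : u ∈ Rsub R (d - b)) : F.eta b (cR (d - b) f t) u = f u := by
  rw [← sub_eq_zero, ← LinearMap.sub_apply]
  refine F.apply_eq_zero (m := d - b) (c := b) (by omega) _ ?_ u hu
  rw [map_sub, LinearMap.sub_apply, F.cR_eta hb, sub_self]
  exact cR_mem (Rsub_le _) _ (F.t_mem (by omega))

lemma D_mul {a b c : ℕ} (hb : b ≤ d) (h : a + b = c + d) (y p) {x} (hx : x ∈ Rsub R a) :
    F.D b y (p * x) = p * F.D b y x :=
  cR_mul_left (Rsub_le (d - b)) _ p (Rsub_le_mul (a := c) (by omega) hx)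

lemma cL_eta {g : ℕ} (hg : g ≤ d) {u} (hu : u ∈ Rsub R (d - g)) :
    cL g ((F.eta g).flip u) t = u := by
  apply eq_of_forall_dual
  intro f
  rw [apply_cL (Rsub_le g) (Rsub_le (d - g)) _ _ (F.t_mem (by omega)), LinearMap.flip_apply,
    F.eta_eq hg f u hu]

/-- Here the contraction with the first factor of `y` is a scalar, so the left side is a left
contraction of `y`. Writing `y` as a right contraction of `t`, the two contractions commute and the
left one turns `t` into `u`. -/
lemma lm_D_self {g h b : ℕ} (hb : b ≤ d) (hgh : g + h = b) {y u} (hy : y ∈ Rsub R b)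
    (hu : u ∈ Rsub R (d - g)) : lm g ((F.D g).flip u) y = F.D b y u := by
  have h1 : lm g ((F.D g).flip u) y = cL g ((F.eta g).flip u) y :=
    eqOn_mul (P := Rsub R g) (Q := Rsub R h) (fun p hp q hq => by
      rw [lm_mul _ (Rsub_le _ hp), cL_mul _ (Rsub_le _ hp), LinearMap.flip_apply,
        LinearMap.flip_apply, D_apply, cR_self _ (Rsub_le _ hu), smul_mul_assoc, one_mul])
      (Rsub_le_mul hgh hy)
  have h2 : t ∈ Rsub R g * (Rsub R h * Rsub R (d - b)) :=
    (Rsub_le_mul (b := d - g) (by omega)).trans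
      (mul_le_mul' le_rfl (Rsub_le_mul (by omega))) F.mem
  rw [h1, D_apply]
  conv_lhs => rw [← F.cR_eta hb hy]
  rw [cL_cR (Rsub_le g) (Rsub_le (d - b)) _ _ h2, F.cL_eta (by omega) hu]

/-- Contracting with the first factor of `y ∈ R_{g+h} ⊆ R_g ⊗ R_h` is contracting with `y`. -/
lemma lm_D {a g h b c : ℕ} (hb : b ≤ d) (hgh : g + h = b) (ha : a + g = c + d) {x y}
    (hx : x ∈ Rsub R a) (hy : y ∈ Rsub R b) : lm g ((F.D g).flip x) y = F.D b y x := by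
  refine eqOn_mul (P := Rsub R c) (Q := Rsub R (d - g)) (f := (lm g).flip y ∘ₗ (F.D g).flip)
    (g := F.D b y) (fun p hp u hu => ?_) (Rsub_le_mul (by omega) hx)
  have h1 : lm g ((F.D g).flip (p * u)) y = p * lm g ((F.D g).flip u) y :=
    eqOn_mul (P := Rsub R g) (Q := Rsub R h) (f := lm g ((F.D g).flip (p * u)))
      (g := LinearMap.mulLeft k p ∘ₗ lm g ((F.D g).flip u)) (fun v hv w hw => by
        simp only [LinearMap.comp_apply, LinearMap.mulLeft_apply]
        rw [lm_mul _ (Rsub_le _ hv), lm_mul _ (Rsub_le _ hv), LinearMap.flip_apply,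
          LinearMap.flip_apply, F.D_mul (c := 0) (by omega) (by omega) _ _ hu, mul_assoc])
      (Rsub_le_mul hgh hy)
  simp only [LinearMap.comp_apply, LinearMap.flip_apply]
  rw [h1, F.lm_D_self hb hgh hy hu, F.D_mul (c := h) hb (by omega) _ _ hu]

/-- Reading `t` in `R_c R_{d-b} R_{d-a}`, contraction with `η_x` gives `x` and a further contraction
with `η_y` gives `D b y x`. Uniqueness of `η` yields a product formula, the source of the
adjointness in `pair_contract`. -/
lemma eta_D {a b c : ℕ} (ha : a ≤ d) (hb : b ≤ d) (h : a + b = c + d) {x} (y) {u}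
    (hx : x ∈ Rsub R a) (hu : u ∈ Rsub R (d - c)) :
    F.eta c (F.D b y x) u = dualMul (d - b) (F.eta b y) (F.eta a x) u := by
  have h2 : t ∈ Rsub R c * (Rsub R (d - b) * Rsub R (d - a)) :=
    (Rsub_le_mul (b := d - c) (by omega)).trans
      (mul_le_mul' le_rfl (Rsub_le_mul (by omega))) F.mem
  have h1 : F.D b y x = cR (d - c) (dualMul (d - b) (F.eta b y) (F.eta a x)) t := by
    rw [show d - c = d - b + (d - a) by omega, ← cR_cR (Rsub_le _) (Rsub_le _) _ _ h2,
      F.cR_eta ha hx, D_apply]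
  rw [h1, F.eta_eq (by omega) _ u hu]

end IsFrob
end Frobenius

/-! ### The generators of `U` as maps between normal forms -/

section Sorting
variable {k V : Type u} [Field k] [AddCommGroup V] [Module k V]

/-- A normal form `r_d^{x₀} r_{a₁} r_d^{x₁} r_{a₂} r_d^{x₂} ⋯` of an element of `Λ`. -/
abbrev NForm : Type := ℤ × List (ℕ × ℤ)

/-- The subspace `R_{a₁} R_{a₂} ⋯` of `TV`. -/
def prodSub (R : Submodule k (V ⊗[k] V)) : List (ℕ × ℤ) → Submodule k (TensorAlgebra k V)
  | [] => 1
  | (a, _) :: L => Rsub R a * prodSub R L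

variable {R : Submodule k (V ⊗[k] V)} {d : ℕ} {t : TensorAlgebra k V}

@[simp] lemma prodSub_nil : prodSub R [] = 1 := rfl

@[simp] lemma prodSub_cons (a : ℕ) (x : ℤ) (L : List (ℕ × ℤ)) :
    prodSub R ((a, x) :: L) = Rsub R a * prodSub R L := rfl

lemma prodSub_append (L L' : List (ℕ × ℤ)) :
    prodSub R (L ++ L') = prodSub R L * prodSub R L' := by
  induction L with
  | nil => simp
  | cons p L ih =>
    obtain ⟨a, x⟩ := p
    rw [List.cons_append, prodSub_cons, ih, prodSub_cons, mul_assoc]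

lemma mul_mem_of_mem_mul {P Q N : Submodule k (TensorAlgebra k V)} {x y : TensorAlgebra k V}
    (hx : x ∈ P * Q) (hy : y ∈ N) : x * y ∈ P * (Q * N) := by
  rw [← mul_assoc]
  exact Submodule.mul_mem_mul hx hy

/-- The maps given by the generators `φ_{a,b}`, on normal forms. -/
inductive UpMap (R : Submodule k (V ⊗[k] V)) (d : ℕ) (t : TensorAlgebra k V) :
    NForm → NForm → (TensorAlgebra k V →ₗ[k] TensorAlgebra k V) → Prop
  | merge {x y : ℤ} {L : List (ℕ × ℤ)} {a b c : ℕ} {f} (ha : 1 ≤ a) (hb : 1 ≤ b) (h : a + b = c)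
      (hc : c < d) (hf : ∀ z ∈ prodSub R ((c, y) :: L), f z = z) :
      UpMap R d t (x, (c, y) :: L) (x, (a, 0) :: (b, y) :: L) f
  -- For `a + b = d` the source letter `r_d` disappears into the power of `r_d`: `r_d^x r_d r_d^y`
  -- accounts for `z = x + y + 1`, and the inclusion becomes multiplication by `t`.
  | insert {x y z : ℤ} {L : List (ℕ × ℤ)} {a b : ℕ} {f} (ha : 1 ≤ a) (hb : 1 ≤ b) (h : a + b = d)
      (hz : z = x + y + 1) (hf : ∀ w ∈ prodSub R L, f w = t * w) :
      UpMap R d t (z, L) (x, (a, 0) :: (b, y) :: L) f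
  | whisker {z x x' : ℤ} {L L' : List (ℕ × ℤ)} {a : ℕ} {f g} (ha : 1 ≤ a) (had : a < d)
      (hU : UpMap R d t (x, L) (x', L') f)
      (hg : ∀ p ∈ Rsub R a, ∀ w ∈ prodSub R L, g (p * w) = p * f w) :
      UpMap R d t (z, (a, x) :: L) (z, (a, x') :: L') g

/-- The maps given by the generators `θ_{a,b}`, on normal forms. -/
inductive DownMap [FiniteDimensional k V] (F : IsFrob R d t) :
    NForm → NForm → (TensorAlgebra k V →ₗ[k] TensorAlgebra k V) → Prop
  | merge {x y g : ℤ} {L : List (ℕ × ℤ)} {a b c : ℕ} {f} (had : a < d) (hbd : b < d) (hc : 1 ≤ c)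
      (h : a + b = c + d) (hg : g = -1)
      (hf : ∀ p ∈ Rsub R a, ∀ q ∈ Rsub R b, ∀ w ∈ prodSub R L, f (p * (q * w)) = F.D b q p * w) :
      DownMap F (x, (a, g) :: (b, y) :: L) (x, (c, y) :: L) f
  -- For `a + b = d` the contraction is a scalar in `R_0 = k`. Both letters and the `r_d⁻¹` between
  -- them go away, so the outer powers of `r_d` add up.
  | delete {x y g z : ℤ} {L : List (ℕ × ℤ)} {a b : ℕ} {f} (had : a < d) (hbd : b < d)
      (h : a + b = d) (hg : g = -1) (hz : z = x + y)
      (hf : ∀ p ∈ Rsub R a, ∀ q ∈ Rsub R b, ∀ w ∈ prodSub R L, f (p * (q * w)) = F.D b q p * w) :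
      DownMap F (x, (a, g) :: (b, y) :: L) (z, L) f
  | whisker {z x x' : ℤ} {L L' : List (ℕ × ℤ)} {a : ℕ} {f g} (ha : 1 ≤ a) (had : a < d)
      (hU : DownMap F (x, L) (x', L') f)
      (hg : ∀ p ∈ Rsub R a, ∀ w ∈ prodSub R L, g (p * w) = p * f w) :
      DownMap F (z, (a, x) :: L) (z, (a, x') :: L') g

lemma apply_mem_of_mul {F : TensorAlgebra k V →ₗ[k] TensorAlgebra k V}
    {P Q N : Submodule k (TensorAlgebra k V)} (h : ∀ p ∈ P, ∀ w ∈ Q, F (p * w) ∈ N) {z}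
    (hz : z ∈ P * Q) : F z ∈ N := by
  have : P * Q ≤ N.comap F := Submodule.mul_le.2 h
  exact this hz

lemma apply_mem_of_mul_mul {F : TensorAlgebra k V →ₗ[k] TensorAlgebra k V}
    {P Q N N' : Submodule k (TensorAlgebra k V)}
    (h : ∀ p ∈ P, ∀ q ∈ Q, ∀ w ∈ N, F (p * (q * w)) ∈ N') {z} (hz : z ∈ P * (Q * N)) :
    F z ∈ N' :=
  apply_mem_of_mul (fun p hp _ hz =>
    apply_mem_of_mul (F := F ∘ₗ LinearMap.mulLeft k p) (fun q hq w hw => h p hp q hq w hw) hz) hz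

lemma eqOn_mul_mul {X : Type*} [AddCommGroup X] [Module k X] {f g : TensorAlgebra k V →ₗ[k] X}
    {P Q N : Submodule k (TensorAlgebra k V)}
    (h : ∀ x ∈ P, ∀ y ∈ Q, ∀ w ∈ N, f (x * (y * w)) = g (x * (y * w))) {z : TensorAlgebra k V}
    (hz : z ∈ P * (Q * N)) : f z = g z :=
  eqOn_mul (fun p hp _ hz => eqOn_mul (f := f ∘ₗ LinearMap.mulLeft k p)
    (g := g ∘ₗ LinearMap.mulLeft k p) (fun q hq w hw => h p hp q hq w hw) hz) hz

namespace UpMap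
variable {s s' : NForm} {f g : TensorAlgebra k V →ₗ[k] TensorAlgebra k V}

lemma mem (ht : t ∈ Rsub R d) (h : UpMap R d t s s' f) {z} (hz : z ∈ prodSub R s.2) :
    f z ∈ prodSub R s'.2 := by
  induction h generalizing z with
  | merge ha hb h hc hf =>
    rw [hf z hz]
    simp only [prodSub_cons, ← mul_assoc] at hz ⊢
    exact mul_le_mul' (Rsub_le_mul h) le_rfl hz
  | insert ha hb h hz' hf =>
    rw [hf z hz]
    exact mul_mem_of_mem_mul (Rsub_le_mul h ht) hz
  | whisker ha had hU hg ih =>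
    refine apply_mem_of_mul (fun p hp w hw => ?_) hz
    rw [hg p hp w hw]
    exact Submodule.mul_mem_mul hp (ih hw)

lemma shift (h : UpMap R d t s s' f) (n : ℤ) :
    UpMap R d t (s.1 + n, s.2) (s'.1 + n, s'.2) f := by
  cases h with
  | merge ha hb h hc hf => exact .merge ha hb h hc hf
  | insert ha hb h hz hf => exact .insert ha hb h (by simp only; omega) hf
  | whisker ha had hU hg => exact .whisker ha had hU hg

lemma exists_whisker (z : ℤ) {x x' : ℤ} {L L' : List (ℕ × ℤ)} {a : ℕ} (ha : 1 ≤ a) (had : a < d)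
    (hU : UpMap R d t (x, L) (x', L') f) : ∃ g, UpMap R d t (z, (a, x) :: L) (z, (a, x') :: L') g ∧
      ∀ p ∈ Rsub R a, ∀ w ∈ prodSub R L, g (p * w) = p * f w := by
  have h : ∀ p ∈ Rsub R a, ∀ w ∈ prodSub R L, lw a f (p * w) = p * f w :=
    fun p hp w _ => lw_mul f (Rsub_le _ hp) w
  exact ⟨lw a f, .whisker ha had hU h, h⟩

end UpMap

variable [FiniteDimensional k V]

/-- `p * (q * w) ↦ D(p, q) * w`, for `p` and `q` of degree `a` and `b`. -/
def IsFrob.contract (F : IsFrob R d t) (a b : ℕ) : TensorAlgebra k V →ₗ[k] TensorAlgebra k V :=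
  TensorProduct.lift (lm b ∘ₗ (F.D b).flip ∘ₗ (Vpow k V a).subtype) ∘ₗ splitL a

lemma IsFrob.contract_mul (F : IsFrob R d t) {a b : ℕ} {p q} (hp : p ∈ Rsub R a)
    (hq : q ∈ Rsub R b) (w : TensorAlgebra k V) : F.contract a b (p * (q * w)) = F.D b q p * w := by
  rw [contract, LinearMap.comp_apply, splitL_mul (Rsub_le _ hp), TensorProduct.lift.tmul,
    LinearMap.comp_apply, LinearMap.comp_apply, lm_mul _ (Rsub_le _ hq)]
  rfl

namespace DownMap
variable {F : IsFrob R d t} {s s' : NForm} {f g : TensorAlgebra k V →ₗ[k] TensorAlgebra k V}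

lemma mem (h : DownMap F s s' f) {z} (hz : z ∈ prodSub R s.2) : f z ∈ prodSub R s'.2 := by
  induction h generalizing z with
  | merge had hbd hc h hg hf =>
    refine apply_mem_of_mul_mul (fun p hp q hq w hw => ?_) hz
    rw [hf p hp q hq w hw]
    exact Submodule.mul_mem_mul (F.D_mem hbd.le h q hp) hw
  | @delete x y g z L a b f had hbd h hg hz' hf =>
    refine apply_mem_of_mul_mul (fun p hp q hq w hw => ?_) hz
    rw [hf p hp q hq w hw]
    have := Submodule.mul_mem_mul (F.D_mem (c := 0) hbd.le (by omega) q hp) hw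
    rwa [Rsub_zero, one_mul] at this
  | whisker ha had hU hg ih =>
    refine apply_mem_of_mul (fun p hp w hw => ?_) hz
    rw [hg p hp w hw]
    exact Submodule.mul_mem_mul hp (ih hw)

lemma shift (h : DownMap F s s' f) (n : ℤ) :
    DownMap F (s.1 + n, s.2) (s'.1 + n, s'.2) f := by
  cases h with
  | merge had hbd hc h hg hf => exact .merge had hbd hc h hg hf
  | delete had hbd h hg hz hf => exact .delete had hbd h hg (by simp only; omega) hf
  | whisker ha had hU hg => exact .whisker ha had hU hg

lemma exists_whisker (z : ℤ) {x x' : ℤ} {L L' : List (ℕ × ℤ)} {a : ℕ} (ha : 1 ≤ a) (had : a < d)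
    (hU : DownMap F (x, L) (x', L') f) : ∃ g, DownMap F (z, (a, x) :: L) (z, (a, x') :: L') g ∧
      ∀ p ∈ Rsub R a, ∀ w ∈ prodSub R L, g (p * w) = p * f w := by
  have h : ∀ p ∈ Rsub R a, ∀ w ∈ prodSub R L, lw a f (p * w) = p * f w :=
    fun p hp w _ => lw_mul f (Rsub_le _ hp) w
  exact ⟨lw a f, .whisker ha had hU h, h⟩

end DownMap

/-- At most one of the maps `UpMap`. -/
def UpMapOpt (R : Submodule k (V ⊗[k] V)) (d : ℕ) (t : TensorAlgebra k V) (s s' : NForm)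
    (f : TensorAlgebra k V →ₗ[k] TensorAlgebra k V) : Prop :=
  (s = s' ∧ ∀ z ∈ prodSub R s.2, f z = z) ∨ UpMap R d t s s' f

/-- At most one of the maps `DownMap`. -/
def DownMapOpt (F : IsFrob R d t) (s s' : NForm)
    (f : TensorAlgebra k V →ₗ[k] TensorAlgebra k V) : Prop :=
  (s = s' ∧ ∀ z ∈ prodSub R s.2, f z = z) ∨ DownMap F s s' f

namespace IsFrob
variable {F : IsFrob R d t}

/-- The composition of a map of the first kind with a map of the second kind is also a composition
in the other order. -/
def Exchange (F : IsFrob R d t) (s s'' : NForm) (h : TensorAlgebra k V →ₗ[k] TensorAlgebra k V) :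
    Prop :=
  ∃ s₁ f' g', DownMapOpt F s s₁ g' ∧ UpMapOpt R d t s₁ s'' f' ∧ ∀ z ∈ prodSub R s.2, h z = f' (g' z)

end IsFrob

end Sorting

/-! ### Exchanging a map `φ` with a subsequent map `θ` -/

section Exchange
variable {k V : Type u} [Field k] [AddCommGroup V] [Module k V] [FiniteDimensional k V]
  {R : Submodule k (V ⊗[k] V)} {d : ℕ} {t : TensorAlgebra k V}

namespace IsFrob
variable {F : IsFrob R d t}

lemma exchange_of_down {s s'' : NForm} {h : TensorAlgebra k V →ₗ[k] TensorAlgebra k V}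
    (hD : DownMap F s s'' h) : F.Exchange s s'' h :=
  ⟨s'', LinearMap.id, h, .inr hD, .inl ⟨rfl, fun _ _ => rfl⟩, fun _ _ => rfl⟩

lemma exchange_of_up {s s'' : NForm} {h : TensorAlgebra k V →ₗ[k] TensorAlgebra k V}
    (hU : UpMap R d t s s'' h) : F.Exchange s s'' h :=
  ⟨s, h, LinearMap.id, .inl ⟨rfl, fun _ _ => rfl⟩, .inr hU, fun _ _ => rfl⟩

lemma exchange_of_id {s s'' : NForm} {h : TensorAlgebra k V →ₗ[k] TensorAlgebra k V}
    (hs : s = s'') (hh : ∀ z ∈ prodSub R s.2, h z = z) : F.Exchange s s'' h :=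
  ⟨s, LinearMap.id, LinearMap.id, .inl ⟨rfl, fun _ _ => rfl⟩, .inl ⟨hs, fun _ _ => rfl⟩, hh⟩

variable {a b c e : ℕ} {x y : ℤ} {L : List (ℕ × ℤ)} {g g₀ : TensorAlgebra k V →ₗ[k] TensorAlgebra k V}

/-- Contraction only touches the last factor of an element of `R_a R_b`, so it commutes with
regrouping on the left. -/
lemma apply_mul_left (hg : ∀ p ∈ Rsub R a, ∀ w ∈ prodSub R ((b, x) :: (c, y) :: L),
      g (p * w) = p * g₀ w)
    (hg₀ : ∀ p ∈ Rsub R b, ∀ q ∈ Rsub R c, ∀ w ∈ prodSub R L, g₀ (p * (q * w)) = F.D c q p * w)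
    (hc : c ≤ d) (h : b + c = e + d) {p} (hp : p ∈ Rsub R a * Rsub R b) {q} (hq : q ∈ Rsub R c)
    {w} (hw : w ∈ prodSub R L) : g (p * (q * w)) = F.D c q p * w :=
  eqOn_mul (f := g ∘ₗ LinearMap.mulRight k (q * w)) (g := LinearMap.mulRight k w ∘ₗ F.D c q)
    (fun p₁ hp₁ p₂ hp₂ => by
      simp only [LinearMap.comp_apply, LinearMap.mulRight_apply]
      rw [mul_assoc, hg p₁ hp₁ _ (Submodule.mul_mem_mul hp₂ (Submodule.mul_mem_mul hq hw)),
        hg₀ p₂ hp₂ q hq w hw, F.D_mul hc h _ _ hp₂, mul_assoc]) hp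

/-- By `lm_D`, contracting with the first factor of `q ∈ R_{b₁+b₂}` is contracting with all of `q`.
-/
lemma apply_mul_right {b₁ b₂ : ℕ} (hg : ∀ p ∈ Rsub R a, ∀ q ∈ Rsub R b₁,
      ∀ w ∈ prodSub R ((b₂, y) :: L), g (p * (q * w)) = F.D b₁ q p * w)
    (hb : b ≤ d) (hbb : b₁ + b₂ = b) (h : a + b₁ = c + d) {p} (hp : p ∈ Rsub R a) {q}
    (hq : q ∈ Rsub R b) {w} (hw : w ∈ prodSub R L) : g (p * (q * w)) = F.D b q p * w := by
  rw [← F.lm_D hb hbb h hp hq]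
  refine eqOn_mul (f := g ∘ₗ LinearMap.mulLeft k p ∘ₗ LinearMap.mulRight k w)
    (g := LinearMap.mulRight k w ∘ₗ lm b₁ ((F.D b₁).flip p))
    (fun q₁ hq₁ q₂ hq₂ => ?_) (Rsub_le_mul hbb hq)
  simp only [LinearMap.comp_apply, LinearMap.mulRight_apply, LinearMap.mulLeft_apply]
  rw [mul_assoc, hg p hp q₁ hq₁ _ (Submodule.mul_mem_mul hq₂ hw), lm_mul _ (Rsub_le _ hq₁),
    LinearMap.flip_apply, mul_assoc]

lemma contract_spec (L : List (ℕ × ℤ)) : ∀ p ∈ Rsub R a, ∀ q ∈ Rsub R b, ∀ w ∈ prodSub R L,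
    F.contract a b (p * (q * w)) = F.D b q p * w := fun _ hp _ hq w _ => F.contract_mul hp hq w

lemma eq_mulLeft_t (ht : t ∈ Rsub R a * Rsub R b) {w₀ : ℤ} {L : List (ℕ × ℤ)}
    {g₁ : TensorAlgebra k V →ₗ[k] TensorAlgebra k V}
    (hg : ∀ p ∈ Rsub R a, ∀ w ∈ prodSub R ((b, w₀) :: L), g (p * w) = p * g₀ w)
    (hg₀ : ∀ p ∈ Rsub R b, ∀ w ∈ prodSub R L, g₀ (p * w) = p * g₁ w) {z}
    (hz : z ∈ prodSub R L) : g (t * z) = t * g₁ z :=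
  eqOn_mul (f := g ∘ₗ LinearMap.mulRight k z) (g := LinearMap.mulRight k (g₁ z))
    (fun p hp q hq => by
      simp only [LinearMap.comp_apply, LinearMap.mulRight_apply]
      rw [mul_assoc, hg p hp _ (Submodule.mul_mem_mul hq hz), hg₀ q hq z hz, mul_assoc]) ht

/-- The new gap is `0`, so the subsequent contraction cannot involve both halves of the split
letter. If it uses the second half and the next letter, the whole letter may be contracted first and
then split; if that second half disappears, a single contraction remains; further to the right the
two maps are independent. -/
lemma exchange_merge {x y : ℤ} {L : List (ℕ × ℤ)} {a b c : ℕ} {f g} {s'' : NForm} (ha : 1 ≤ a)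
    (hb : 1 ≤ b) (h : a + b = c) (hc : c < d) (hf : ∀ z ∈ prodSub R ((c, y) :: L), f z = z)
    (hD : DownMap F (x, (a, 0) :: (b, y) :: L) s'' g) :
    F.Exchange (x, (c, y) :: L) s'' (g ∘ₗ f) := by
  cases hD with
  | merge _ _ _ _ hg _ => omega
  | delete _ _ _ hg _ _ => omega
  | @whisker _ _ _ _ _ _ g₀ _ _ had hU hg =>
    cases hU with
    | @merge _ y' _ L' _ b' e _ had' hbd he h' hgap hg₀ =>
      subst hgap
      refine ⟨(x, (a + e, y') :: L'), LinearMap.id, F.contract c b',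
        .inr (.merge hc hbd (by omega) (by omega) rfl (contract_spec _)),
        .inr (.merge ha he rfl (by omega) fun _ _ => rfl), fun z hz => ?_⟩
      rw [LinearMap.id_apply, LinearMap.comp_apply, hf z hz]
      refine eqOn_mul_mul (fun p hp q hq w hw => ?_) hz
      rw [F.contract_mul hp hq,
        apply_mul_left hg hg₀ hbd.le h' (Rsub_le_mul h hp) hq hw]
    | @delete _ y' _ _ L' _ b' _ had' hbd h' hgap hz' hg₀ =>
      subst hgap
      obtain rfl := (zero_add y').symm.trans hz'.symm
      refine exchange_of_down (.merge hc hbd ha (by omega) rfl fun p hp q hq w hw => ?_)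
      rw [LinearMap.comp_apply, hf _ (Submodule.mul_mem_mul hp (Submodule.mul_mem_mul hq hw)),
        apply_mul_left (e := 0) hg hg₀ hbd.le (by omega) (Rsub_le_mul h hp) hq hw]
    | @whisker _ _ y'' _ L'' _ g₁ _ hb' hbd hU' hg₁ =>
      obtain ⟨g', hg', hgs⟩ := hU'.exists_whisker x (a := c) (by omega) hc
      refine ⟨_, LinearMap.id, g', .inr hg', .inr (.merge ha hb h hc fun _ _ => rfl), fun z hz => ?_⟩
      rw [LinearMap.id_apply, LinearMap.comp_apply, hf z hz]
      refine eqOn_mul (fun p hp w hw => ?_) hz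
      rw [hgs p hp w hw]
      refine eqOn_mul (f := g ∘ₗ LinearMap.mulRight k w) (g := LinearMap.mulRight k (g₁ w))
        (fun p₁ hp₁ p₂ hp₂ => ?_) (Rsub_le_mul h hp)
      simp only [LinearMap.comp_apply, LinearMap.mulRight_apply]
      rw [mul_assoc, hg p₁ hp₁ _ (Submodule.mul_mem_mul hp₂ hw), hg₁ p₂ hp₂ w hw, mul_assoc]

/-- If the second factor of the inserted `t` is contracted with the next letter `q`, then `D_t`
returns `q`. The composite only splits `q`, or is the identity if the contraction was a scalar. -/
lemma exchange_insert {x y z : ℤ} {L : List (ℕ × ℤ)} {a b : ℕ} {f g} {s'' : NForm} (ha : 1 ≤ a)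
    (hb : 1 ≤ b) (h : a + b = d) (hz : z = x + y + 1) (hf : ∀ w ∈ prodSub R L, f w = t * w)
    (hD : DownMap F (x, (a, 0) :: (b, y) :: L) s'' g) :
    F.Exchange (z, L) s'' (g ∘ₗ f) := by
  cases hD with
  | merge _ _ _ _ hg _ => omega
  | delete _ _ _ hg _ _ => omega
  | @whisker _ _ _ _ _ _ g₀ _ _ had hU hg =>
    cases hU with
    | @merge _ y' _ L' _ b' e _ had' hbd he h' hgap hg₀ =>
      subst hgap
      obtain rfl : x = z := by omega
      refine exchange_of_up (.merge ha he (by omega) hbd fun w hw => ?_)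
      rw [LinearMap.comp_apply, hf w hw]
      refine eqOn_mul (f := g ∘ₗ LinearMap.mulLeft k t) (g := LinearMap.id) (fun q hq w hw => ?_) hw
      simp only [LinearMap.comp_apply, LinearMap.mulLeft_apply, LinearMap.id_apply]
      rw [apply_mul_left hg hg₀ hbd.le h' (F.t_mem h) hq hw, F.D_t hbd.le hq]
    | @delete _ y' _ _ L' _ b' _ had' hbd h' hgap hz' hg₀ =>
      subst hgap
      obtain rfl : b' = a := by omega
      refine exchange_of_id (by simp [hz', hz]) fun w hw => ?_
      rw [LinearMap.comp_apply, hf w hw]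
      refine eqOn_mul (f := g ∘ₗ LinearMap.mulLeft k t) (g := LinearMap.id) (fun q hq w hw => ?_) hw
      simp only [LinearMap.comp_apply, LinearMap.mulLeft_apply, LinearMap.id_apply]
      rw [apply_mul_left (e := 0) hg hg₀ hbd.le (by omega) (F.t_mem h) hq hw, F.D_t hbd.le hq]
    | @whisker _ _ y'' _ L'' _ g₁ _ hb' hbd hU' hg₁ =>
      have h1 := hU'.shift (x + 1)
      simp only at h1
      rw [show y + (x + 1) = z by omega] at h1
      refine ⟨_, LinearMap.mulLeft k t, g₁, .inr h1,
        .inr (.insert ha hb h (by ring) fun _ _ => rfl), fun w hw => ?_⟩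
      rw [LinearMap.comp_apply, hf w hw, LinearMap.mulLeft_apply]
      exact eq_mulLeft_t (F.t_mem h) hg hg₁ hw

/-- The remaining overlaps have the new pair to the right of the contracted letter. If a letter is
split, `lm_D` merges both steps into one contraction; if `t` is inserted, `D_top` says that
contraction with `t` is the identity. Maps at distant places commute. -/
theorem exchange {s s' s'' : NForm} {f g : TensorAlgebra k V →ₗ[k] TensorAlgebra k V}
    (hU : UpMap R d t s s' f) (hD : DownMap F s' s'' g) : F.Exchange s s'' (g ∘ₗ f) := by
  induction hU generalizing s'' g with
  | merge ha hb h hc hf => exact exchange_merge ha hb h hc hf hD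
  | insert ha hb h hz hf => exact exchange_insert ha hb h hz hf hD
  | @whisker z x x' L L' a f₀ f ha had hU hf ih =>
    cases hD with
    | @merge _ y _ L₁ _ b c _ _ hbd hc h hgap hg =>
      cases hU with
      | @merge _ y₂ L₂ b₁ b₂ b' _ hb₁ hb₂ hb hbd' hf₀ =>
        subst hgap
        refine ⟨(z, (c + b₂, y₂) :: L₂), LinearMap.id, F.contract a b',
          .inr (.merge had hbd' (by omega) (by omega) rfl (contract_spec _)),
          .inr (.merge hc hb₂ rfl (by omega) fun _ _ => rfl), fun w hw => ?_⟩
        rw [LinearMap.id_apply, LinearMap.comp_apply]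
        refine eqOn_mul_mul (f := g ∘ₗ f) (fun p hp q hq w hw => ?_) hw
        have h1 := Submodule.mul_mem_mul hq hw
        rw [LinearMap.comp_apply, F.contract_mul hp hq, hf p hp _ h1, hf₀ _ h1,
          apply_mul_right hg hbd'.le hb h hp hq hw]
      | @insert _ y₂ _ L₂ b₁ b₂ _ hb₁ hb₂ hb hz hf₀ =>
        obtain rfl : x = y₂ := by omega
        refine exchange_of_up (.merge hc hb₂ (by omega) had fun w hw => ?_)
        rw [LinearMap.comp_apply]
        refine eqOn_mul (f := g ∘ₗ f) (g := LinearMap.id) (fun p hp w hw => ?_) hw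
        rw [LinearMap.comp_apply, hf p hp _ hw, hf₀ _ hw,
          apply_mul_right hg le_rfl hb h hp F.mem hw, F.D_top]
        rfl
      | @whisker _ y₀ _ L₀ _ _ f₁ _ hb hbd' hU₁ hf₀ =>
        subst hgap
        obtain ⟨f', hf', hfs⟩ := hU₁.exists_whisker z (a := c) hc (by omega)
        refine ⟨_, f', F.contract a b, .inr (.merge had hbd hc h rfl (contract_spec _)), .inr hf',
          fun w hw => ?_⟩
        refine eqOn_mul_mul (f := g ∘ₗ f) (g := f' ∘ₗ F.contract a b)
          (fun p hp q hq w hw => ?_) hw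
        rw [LinearMap.comp_apply, LinearMap.comp_apply, F.contract_mul hp hq,
          hf p hp _ (Submodule.mul_mem_mul hq hw), hf₀ q hq w hw, hg p hp q hq _ (hU₁.mem F.mem hw),
          hfs _ (F.D_mem hbd.le h _ hp) w hw]
    | @delete _ y _ z' L₁ _ b _ _ hbd h hgap hz' hg =>
      cases hU with
      | @merge _ y₂ L₂ b₁ b₂ b' _ hb₁ hb₂ hb hbd' hf₀ =>
        subst hgap
        obtain rfl : z = z' := by omega
        refine exchange_of_down (.merge had hbd' hb₂ (by omega) rfl fun p hp q hq w hw => ?_)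
        have h1 := Submodule.mul_mem_mul hq hw
        rw [LinearMap.comp_apply, hf p hp _ h1, hf₀ _ h1,
          apply_mul_right (c := 0) hg hbd'.le hb (by omega) hp hq hw]
      | @insert _ y₂ _ L₂ b₁ b₂ _ hb₁ hb₂ hb hz hf₀ =>
        obtain rfl : x = y₂ := by omega
        obtain rfl : a = b₂ := by omega
        refine exchange_of_id (by simp [hz']) fun w hw => ?_
        rw [LinearMap.comp_apply]
        refine eqOn_mul (f := g ∘ₗ f) (g := LinearMap.id) (fun p hp w hw => ?_) hw
        rw [LinearMap.comp_apply, hf p hp _ hw, hf₀ _ hw,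
          apply_mul_right (c := 0) hg le_rfl hb (by omega) hp F.mem hw, F.D_top]
        rfl
      | @whisker _ y₀ _ L₀ _ _ f₁ _ hb hbd' hU₁ hf₀ =>
        subst hgap
        have h1 := hU₁.shift z
        simp only at h1
        rw [show y + z = z' by omega] at h1
        refine ⟨_, f₁, F.contract a b, .inr (.delete had hbd h rfl (add_comm y₀ z) (contract_spec _)),
          .inr h1, fun w hw => ?_⟩
        refine eqOn_mul_mul (f := g ∘ₗ f) (g := f₁ ∘ₗ F.contract a b)
          (fun p hp q hq w hw => ?_) hw
        -- The contraction of the two deleted letters is a scalar, hence commutes with the map on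
        -- the remaining letters.
        have h2 := F.D_mem (c := 0) hbd.le (by omega) q hp
        rw [Rsub_zero, Submodule.mem_one] at h2
        obtain ⟨r, hr⟩ := h2
        rw [LinearMap.comp_apply, LinearMap.comp_apply, F.contract_mul hp hq,
          hf p hp _ (Submodule.mul_mem_mul hq hw), hf₀ q hq w hw, hg p hp q hq _ (hU₁.mem F.mem hw),
          ← hr, ← Algebra.smul_def, ← Algebra.smul_def, map_smul]
    | @whisker _ _ x'' _ L'' _ g₀ _ _ _ hD hg =>
      obtain ⟨s₁, f', g', hg', hf', he⟩ := ih hD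
      have h1 : ∃ g₁, DownMapOpt F (z, (a, x) :: L) (z, (a, s₁.1) :: s₁.2) g₁ ∧
          ∀ p ∈ Rsub R a, ∀ w ∈ prodSub R L, g₁ (p * w) = p * g' w := by
        rcases hg' with ⟨rfl, h⟩ | h
        · exact ⟨LinearMap.id, .inl ⟨rfl, fun _ _ => rfl⟩, fun p hp w hw => by
            rw [h w hw]; rfl⟩
        · obtain ⟨g₁, h2, h3⟩ := h.exists_whisker z ha had
          exact ⟨g₁, .inr h2, h3⟩
      have h2 : ∃ f₁, UpMapOpt R d t (z, (a, s₁.1) :: s₁.2) (z, (a, x'') :: L'') f₁ ∧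
          ∀ p ∈ Rsub R a, ∀ w ∈ prodSub R s₁.2, f₁ (p * w) = p * f' w := by
        rcases hf' with ⟨rfl, h⟩ | h
        · exact ⟨LinearMap.id, .inl ⟨rfl, fun _ _ => rfl⟩, fun p hp w hw => by
            rw [h w hw]; rfl⟩
        · obtain ⟨g₁, h2, h3⟩ := h.exists_whisker z ha had
          exact ⟨g₁, .inr h2, h3⟩
      obtain ⟨g₁, hg₁, hg₁'⟩ := h1
      obtain ⟨f₁, hf₁, hf₁'⟩ := h2
      refine ⟨_, f₁, g₁, hg₁, hf₁, fun w hw => ?_⟩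
      refine eqOn_mul (f := g ∘ₗ f) (g := f₁ ∘ₗ g₁) (fun p hp w hw => ?_) hw
      have h3 : g' w ∈ prodSub R s₁.2 := by
        rcases hg' with ⟨rfl, h⟩ | h
        · rw [h w hw]; exact hw
        · exact h.mem hw
      rw [LinearMap.comp_apply, LinearMap.comp_apply, hf p hp w hw, hg₁' p hp w hw,
        hf₁' p hp _ h3, ← he w hw, hg p hp _ (hU.mem F.mem hw)]
      rfl

end IsFrob
end Exchange

/-! ### Composites of maps `θ` followed by maps `φ` -/

section SortedMaps
variable {k V : Type u} [Field k] [AddCommGroup V] [Module k V]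
  {R : Submodule k (V ⊗[k] V)} {d : ℕ} {t : TensorAlgebra k V}

/-- Compositions of maps `UpMap`. -/
inductive UpMaps (R : Submodule k (V ⊗[k] V)) (d : ℕ) (t : TensorAlgebra k V) :
    NForm → NForm → (TensorAlgebra k V →ₗ[k] TensorAlgebra k V) → Prop
  | refl {s : NForm} {f} (hf : ∀ z ∈ prodSub R s.2, f z = z) : UpMaps R d t s s f
  | tail {s s' s'' : NForm} {f g h} (hf : UpMaps R d t s s' f) (hg : UpMap R d t s' s'' g)
      (hh : ∀ z ∈ prodSub R s.2, h z = g (f z)) : UpMaps R d t s s'' h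

namespace UpMap
variable {s s' : NForm} {f g : TensorAlgebra k V →ₗ[k] TensorAlgebra k V}

lemma length_lt (h : UpMap R d t s s' f) : s.2.length < s'.2.length := by
  induction h with
  | merge => simp
  | insert => simp
  | whisker _ _ _ _ ih => simpa using ih

end UpMap

namespace UpMaps
variable {s s' s'' : NForm} {f g h : TensorAlgebra k V →ₗ[k] TensorAlgebra k V}

lemma mem (ht : t ∈ Rsub R d) (h : UpMaps R d t s s' f) {z} (hz : z ∈ prodSub R s.2) :
    f z ∈ prodSub R s'.2 := by
  induction h with
  | refl hf => rwa [hf z hz]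
  | tail hf hg hh ih =>
    rw [hh z hz]
    exact hg.mem ht ih

lemma length_le (h : UpMaps R d t s s' f) : s.2.length ≤ s'.2.length := by
  induction h with
  | refl hf => rfl
  | tail hf hg hh ih => exact ih.trans hg.length_lt.le

lemma congr (h : UpMaps R d t s s' f) (hfg : ∀ z ∈ prodSub R s.2, g z = f z) :
    UpMaps R d t s s' g := by
  cases h with
  | refl hf => exact .refl fun z hz => (hfg z hz).trans (hf z hz)
  | tail hf hg hh => exact .tail hf hg fun z hz => (hfg z hz).trans (hh z hz)

lemma shift (h : UpMaps R d t s s' f) (n : ℤ) :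
    UpMaps R d t (s.1 + n, s.2) (s'.1 + n, s'.2) f := by
  induction h with
  | refl hf => exact .refl hf
  | tail hf hg hh ih => exact .tail ih (hg.shift n) hh

lemma exists_whisker (ht : t ∈ Rsub R d) (z : ℤ) {a : ℕ} (ha : 1 ≤ a) (had : a < d)
    (h : UpMaps R d t s s' f) : ∃ g, UpMaps R d t (z, (a, s.1) :: s.2) (z, (a, s'.1) :: s'.2) g ∧
      ∀ p ∈ Rsub R a, ∀ w ∈ prodSub R s.2, g (p * w) = p * f w := by
  induction h with
  | refl hf =>
    exact ⟨LinearMap.id, .refl fun _ _ => rfl, fun p _ w hw => by rw [hf w hw]; rfl⟩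
  | @tail s' s'' f g h hf hg hh ih =>
    obtain ⟨f', h1, h2⟩ := ih
    obtain ⟨g', h3, h4⟩ := UpMap.exists_whisker z ha had hg
    refine ⟨g' ∘ₗ f', .tail h1 h3 fun _ _ => rfl, fun p hp w hw => ?_⟩
    rw [LinearMap.comp_apply, h2 p hp w hw, h4 p hp _ (hf.mem ht hw), hh w hw]

lemma trans (ht : t ∈ Rsub R d) (hf : UpMaps R d t s s' f) (hg : UpMaps R d t s' s'' g)
    (hh : ∀ z ∈ prodSub R s.2, h z = g (f z)) : UpMaps R d t s s'' h := by
  induction hg generalizing h with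
  | refl hg => exact hf.congr fun z hz => (hh z hz).trans (hg _ (hf.mem ht hz))
  | tail h1 h2 h3 ih =>
    exact .tail (ih (h := _ ∘ₗ f) fun _ _ => rfl) h2 fun z hz =>
      (hh z hz).trans (h3 _ (hf.mem ht hz))

end UpMaps

variable [FiniteDimensional k V]

/-- Compositions of maps `DownMap`. -/
inductive DownMaps (F : IsFrob R d t) :
    NForm → NForm → (TensorAlgebra k V →ₗ[k] TensorAlgebra k V) → Prop
  | refl {s : NForm} {f} (hf : ∀ z ∈ prodSub R s.2, f z = z) : DownMaps F s s f
  | head {s s' s'' : NForm} {f g h} (hf : DownMap F s s' f) (hg : DownMaps F s' s'' g)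
      (hh : ∀ z ∈ prodSub R s.2, h z = g (f z)) : DownMaps F s s'' h

variable {F : IsFrob R d t} {s s' s'' : NForm} {f g h : TensorAlgebra k V →ₗ[k] TensorAlgebra k V}

lemma DownMap.length_lt (h : DownMap F s s' f) : s'.2.length < s.2.length := by
  induction h with
  | merge => simp
  | delete => simp
  | whisker _ _ _ _ ih => simpa using ih

namespace DownMaps

lemma mem (h : DownMaps F s s' f) {z} (hz : z ∈ prodSub R s.2) : f z ∈ prodSub R s'.2 := by
  induction h generalizing z with
  | refl hf => rwa [hf z hz]
  | head hf hg hh ih =>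
    rw [hh z hz]
    exact ih (hf.mem hz)

lemma length_le (h : DownMaps F s s' f) : s'.2.length ≤ s.2.length := by
  induction h with
  | refl hf => rfl
  | head hf hg hh ih => exact ih.trans hf.length_lt.le

lemma congr (h : DownMaps F s s' f) (hfg : ∀ z ∈ prodSub R s.2, g z = f z) :
    DownMaps F s s' g := by
  cases h with
  | refl hf => exact .refl fun z hz => (hfg z hz).trans (hf z hz)
  | head hf hg hh => exact .head hf hg fun z hz => (hfg z hz).trans (hh z hz)

lemma shift (h : DownMaps F s s' f) (n : ℤ) :
    DownMaps F (s.1 + n, s.2) (s'.1 + n, s'.2) f := by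
  induction h with
  | refl hf => exact .refl hf
  | head hf hg hh ih => exact .head (hf.shift n) ih hh

lemma exists_whisker (z : ℤ) {a : ℕ} (ha : 1 ≤ a) (had : a < d)
    (h : DownMaps F s s' f) : ∃ g, DownMaps F (z, (a, s.1) :: s.2) (z, (a, s'.1) :: s'.2) g ∧
      ∀ p ∈ Rsub R a, ∀ w ∈ prodSub R s.2, g (p * w) = p * f w := by
  induction h with
  | refl hf =>
    exact ⟨LinearMap.id, .refl fun _ _ => rfl, fun p _ w hw => by rw [hf w hw]; rfl⟩
  | @head s s' s'' f g h hf hg hh ih =>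
    obtain ⟨g', h1, h2⟩ := ih
    obtain ⟨f', h3, h4⟩ := DownMap.exists_whisker z ha had hf
    refine ⟨g' ∘ₗ f', .head h3 h1 fun _ _ => rfl, fun p hp w hw => ?_⟩
    rw [LinearMap.comp_apply, h4 p hp w hw, h2 p hp _ (hf.mem hw), hh w hw]

lemma trans (hf : DownMaps F s s' f) (hg : DownMaps F s' s'' g)
    (hh : ∀ z ∈ prodSub R s.2, h z = g (f z)) : DownMaps F s s'' h := by
  induction hf generalizing h with
  | refl hf => exact hg.congr fun z hz => (hh z hz).trans (congrArg g (hf z hz))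
  | head h1 h2 h3 ih =>
    exact .head h1 (ih hg (h := g ∘ₗ _) fun _ _ => rfl) fun z hz =>
      (hh z hz).trans (congrArg g (h3 z hz))

end DownMaps

lemma DownMapOpt.mem (h : DownMapOpt F s s' f) {z} (hz : z ∈ prodSub R s.2) :
    f z ∈ prodSub R s'.2 := by
  rcases h with ⟨rfl, h⟩ | h
  · rwa [h z hz]
  · exact h.mem hz

lemma DownMapOpt.downMaps (h : DownMapOpt F s s' f) : DownMaps F s s' f := by
  rcases h with ⟨rfl, h⟩ | h
  · exact .refl h
  · exact .head h (.refl (f := LinearMap.id) fun _ _ => rfl) fun _ _ => rfl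

lemma UpMapOpt.upMaps_trans (ht : t ∈ Rsub R d) (hf : UpMaps R d t s s' f)
    (hg : UpMapOpt R d t s' s'' g) (hh : ∀ z ∈ prodSub R s.2, h z = g (f z)) :
    UpMaps R d t s s'' h := by
  rcases hg with ⟨rfl, hg⟩ | hg
  · exact hf.congr fun z hz => (hh z hz).trans (hg _ (hf.mem ht hz))
  · exact .tail hf hg hh

lemma UpMaps.exchange_opt (hU : UpMaps R d t s s' f) (hD : DownMapOpt F s' s'' g) :
    ∃ s₁ f' g', DownMapOpt F s s₁ g' ∧ UpMaps R d t s₁ s'' f' ∧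
      ∀ z ∈ prodSub R s.2, g (f z) = f' (g' z) := by
  induction hU generalizing s'' g with
  | refl hf =>
    exact ⟨_, LinearMap.id, g, hD, .refl fun _ _ => rfl, fun z hz => congrArg g (hf z hz)⟩
  | @tail s' s₂ f f₁ f₂ hU hU₁ hf₂ ih =>
    rcases hD with ⟨rfl, hD⟩ | hD
    · refine ⟨_, f₂, LinearMap.id, .inl ⟨rfl, fun _ _ => rfl⟩, .tail hU hU₁ hf₂, fun z hz => ?_⟩
      rw [hD _ (hf₂ z hz ▸ hU₁.mem F.mem (hU.mem F.mem hz))]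
      rfl
    · obtain ⟨s₁, f', g', hD', hU', he⟩ := IsFrob.exchange hU₁ hD
      obtain ⟨s₀, f'', g'', hD'', hU'', he'⟩ := ih hD'
      refine ⟨s₀, f' ∘ₗ f'', g'', hD'', hU'.upMaps_trans F.mem hU'' fun _ _ => rfl, fun z hz => ?_⟩
      rw [hf₂ z hz, LinearMap.comp_apply, ← he' z hz, ← he _ (hU.mem F.mem hz)]
      rfl

lemma UpMaps.exchange (hU : UpMaps R d t s s' f) (hD : DownMaps F s' s'' g) :
    ∃ s₁ f' g', DownMaps F s s₁ g' ∧ UpMaps R d t s₁ s'' f' ∧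
      ∀ z ∈ prodSub R s.2, g (f z) = f' (g' z) := by
  induction hD generalizing s f with
  | refl hg =>
    exact ⟨_, f, LinearMap.id, .refl fun _ _ => rfl, hU, fun z hz => hg _ (hU.mem F.mem hz)⟩
  | head hD₁ hD hg ih =>
    obtain ⟨s₁, f', g', hD', hU', he⟩ := hU.exchange_opt (.inr hD₁)
    obtain ⟨s₂, f'', g'', hD'', hU'', he'⟩ := ih hU'
    refine ⟨s₂, f'', g'' ∘ₗ g', hD'.downMaps.trans hD'' fun _ _ => rfl, hU'', fun z hz => ?_⟩
    rw [hg _ (hU.mem F.mem hz), he z hz, he' _ (hD'.mem hz)]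
    rfl

/-- Compositions of maps `DownMap`, followed by compositions of maps `UpMap`. -/
def SortedMap (F : IsFrob R d t) (s s' : NForm)
    (h : TensorAlgebra k V →ₗ[k] TensorAlgebra k V) : Prop :=
  ∃ s₁ f g, DownMaps F s s₁ g ∧ UpMaps R d t s₁ s' f ∧ ∀ z ∈ prodSub R s.2, h z = f (g z)

namespace SortedMap

lemma refl (hf : ∀ z ∈ prodSub R s.2, f z = z) : SortedMap F s s f :=
  ⟨s, LinearMap.id, f, .refl hf, .refl fun _ _ => rfl, fun _ _ => rfl⟩

lemma of_up (hf : UpMap R d t s s' f) : SortedMap F s s' f :=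
  ⟨s, f, LinearMap.id, .refl fun _ _ => rfl,
    .tail (.refl (f := LinearMap.id) fun _ _ => rfl) hf fun _ _ => rfl, fun _ _ => rfl⟩

lemma of_down (hf : DownMap F s s' f) : SortedMap F s s' f :=
  ⟨s', LinearMap.id, f, .head hf (.refl (f := LinearMap.id) fun _ _ => rfl) fun _ _ => rfl,
    .refl fun _ _ => rfl, fun _ _ => rfl⟩

lemma comp (hf : SortedMap F s s' f) (hg : SortedMap F s' s'' g) :
    SortedMap F s s'' (g ∘ₗ f) := by
  obtain ⟨s₁, f₁, f₂, h1, h2, h3⟩ := hf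
  obtain ⟨s₂, g₁, g₂, h4, h5, h6⟩ := hg
  obtain ⟨s₃, e₁, e₂, h7, h8, h9⟩ := h2.exchange h4
  refine ⟨s₃, g₁ ∘ₗ e₁, e₂ ∘ₗ f₂, h1.trans h7 fun _ _ => rfl, h8.trans F.mem h5 fun _ _ => rfl,
    fun z hz => ?_⟩
  have h10 : f₁ (f₂ z) ∈ prodSub R s'.2 := h2.mem F.mem (h1.mem hz)
  rw [LinearMap.comp_apply, h3 z hz, h6 _ h10, h9 _ (h1.mem hz)]
  rfl

lemma shift (hf : SortedMap F s s' f) (n : ℤ) :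
    SortedMap F (s.1 + n, s.2) (s'.1 + n, s'.2) f := by
  obtain ⟨s₁, f₁, f₂, h1, h2, h3⟩ := hf
  exact ⟨_, f₁, f₂, h1.shift n, h2.shift n, h3⟩

lemma exists_whisker (z : ℤ) {a : ℕ} (ha : 1 ≤ a) (had : a < d)
    (h : SortedMap F s s' f) : ∃ g, SortedMap F (z, (a, s.1) :: s.2) (z, (a, s'.1) :: s'.2) g ∧
      ∀ p ∈ Rsub R a, ∀ w ∈ prodSub R s.2, g (p * w) = p * f w := by
  obtain ⟨s₁, f₁, f₂, h1, h2, h3⟩ := h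
  obtain ⟨g₁, h4, h5⟩ := h2.exists_whisker F.mem z ha had
  obtain ⟨g₂, h6, h7⟩ := h1.exists_whisker z ha had
  refine ⟨g₁ ∘ₗ g₂, ⟨_, g₁, g₂, h6, h4, fun _ _ => rfl⟩, fun p hp w hw => ?_⟩
  rw [LinearMap.comp_apply, h7 p hp w hw, h5 p hp _ (h1.mem hw), h3 w hw]

/-- Contractions shorten the list and inclusions lengthen it. A sorted map to a longer list
therefore ends with an inclusion, and its image lies in the image of that single generator. -/
lemma exists_up (h : SortedMap F s s' f) (hl : s.2.length < s'.2.length) :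
    ∃ s₁ g, UpMap R d t s₁ s' g ∧ ∀ z ∈ prodSub R s.2, ∃ y ∈ prodSub R s₁.2, f z = g y := by
  obtain ⟨s₁, f₁, f₂, h1, h2, h3⟩ := h
  cases h2 with
  | refl hf => exact absurd h1.length_le (by omega)
  | @tail s₂ _ e g _ h4 h5 h6 =>
    exact ⟨s₂, g, h5, fun z hz => ⟨e (f₂ z), h4.mem F.mem (h1.mem hz),
      (h3 z hz).trans (h6 _ (h1.mem hz))⟩⟩

/-- A sorted map to a shorter list starts with a contraction, and its kernel contains the kernel of
that single generator. -/
lemma exists_down (h : SortedMap F s s' f) (hl : s'.2.length < s.2.length) :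
    ∃ s₁ g, DownMap F s s₁ g ∧ ∀ z ∈ prodSub R s.2, g z = 0 → f z = 0 := by
  obtain ⟨s₁, f₁, f₂, h1, h2, h3⟩ := h
  cases h1 with
  | refl hf => exact absurd h2.length_le (by omega)
  | @head _ s₂ _ e g _ h4 h5 h6 =>
    exact ⟨s₂, e, h4, fun z hz h0 => by rw [h3 z hz, h6 z hz, h0, map_zero, map_zero]⟩

end SortedMap
end SortedMaps

/-! ### The image subspaces `imT` in terms of positions -/

section ListSubspaces
variable {k V : Type u} [Field k] [AddCommGroup V] [Module k V]

/-- The degree of a list of letters. -/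
def listDeg : List (ℕ × ℤ) → ℕ
  | [] => 0
  | (a, _) :: L => a + listDeg L

/-- The positions of the relations inside the letters of the list. -/
def glue : List (ℕ × ℤ) → Finset ℕ
  | [] => ∅
  | (a, _) :: L => Finset.range (a - 1) ∪ (glue L).image (a + ·)

/-- The positions of the relations between two letters with gap zero. -/
def cuts : List (ℕ × ℤ) → Finset ℕ
  | [] => ∅
  | (a, x) :: L => (if x = 0 ∧ L ≠ [] then {a - 1} else ∅) ∪ (cuts L).image (a + ·)

/-- All letters are positive. -/
def PosList (L : List (ℕ × ℤ)) : Prop := ∀ p ∈ L, 1 ≤ p.1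

variable (R : Submodule k (V ⊗[k] V))

/-- `R_{a+b} R_{a₂} ⋯` for a list `(b, a₂, …)` if the gap `x` between `a` and `b` is zero. -/
def headIm (a : ℕ) (x : ℤ) : List (ℕ × ℤ) → Submodule k (TensorAlgebra k V)
  | [] => ⊥
  | (b, _) :: L => if x = 0 then Rsub R (a + b) * prodSub R L else ⊥

/-- The sum of the images of the maps `UpMap` into `prodSub`. -/
def imT : List (ℕ × ℤ) → Submodule k (TensorAlgebra k V)
  | [] => ⊥
  | (a, x) :: L => headIm R a x L ⊔ Rsub R a * imT L

variable {R} {a b : ℕ} {x y : ℤ} {L A B : List (ℕ × ℤ)}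

@[simp] lemma imT_nil : imT R [] = ⊥ := rfl

lemma imT_cons : imT R ((a, x) :: L) = headIm R a x L ⊔ Rsub R a * imT R L := rfl

@[simp] lemma imT_singleton : imT R [(a, x)] = ⊥ := by simp [imT_cons, headIm]

lemma prodSub_le (L : List (ℕ × ℤ)) : prodSub R L ≤ Vpow k V (listDeg L) := by
  induction L with
  | nil => rw [prodSub_nil, listDeg, Vpow, pow_zero]
  | cons p L ih =>
    obtain ⟨a, x⟩ := p
    rw [prodSub_cons, listDeg, Vpow_add]
    exact mul_le_mul' (Rsub_le a) ih

lemma headIm_le : headIm R a x L ≤ Rsub R a * prodSub R L := by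
  cases L with
  | nil => exact bot_le
  | cons p L =>
    obtain ⟨b, y⟩ := p
    rw [headIm]
    split_ifs
    · rw [prodSub_cons, ← mul_assoc]
      exact mul_le_mul' (Rsub_add_le a b) le_rfl
    · exact bot_le

lemma imT_le (L : List (ℕ × ℤ)) : imT R L ≤ prodSub R L := by
  induction L with
  | nil => exact bot_le
  | cons p L ih =>
    obtain ⟨a, x⟩ := p
    exact sup_le headIm_le (mul_le_mul' le_rfl ih)

lemma PosList.of_cons {p : ℕ × ℤ} (h : PosList (p :: L)) : 1 ≤ p.1 ∧ PosList L :=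
  ⟨h p (by simp), fun q hq => h q (by simp [hq])⟩

lemma glue_lt (h : PosList L) {i : ℕ} (hi : i ∈ glue L) : i + 2 ≤ listDeg L := by
  induction L generalizing i with
  | nil => simp [glue] at hi
  | cons p L ih =>
    obtain ⟨a, x⟩ := p
    simp only [glue, Finset.mem_union, Finset.mem_range, Finset.mem_image] at hi
    rw [listDeg]
    rcases hi with hi | ⟨j, hj, rfl⟩
    · omega
    · have := ih h.of_cons.2 hj
      omega

lemma one_le_listDeg (h : PosList L) (hL : L ≠ []) : 1 ≤ listDeg L := by
  cases L with
  | nil => exact absurd rfl hL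
  | cons p L =>
    have := h.of_cons.1
    obtain ⟨a, x⟩ := p
    rw [listDeg]
    exact this.trans (by simp)

lemma mem_cuts_cons {i : ℕ} : i ∈ cuts ((a, x) :: L) ↔
    ((x = 0 ∧ L ≠ []) ∧ i = a - 1) ∨ ∃ j ∈ cuts L, a + j = i := by
  rw [cuts, Finset.mem_union, Finset.mem_image]
  split_ifs with h <;> simp [h]

lemma cuts_lt (h : PosList L) {i : ℕ} (hi : i ∈ cuts L) : i + 2 ≤ listDeg L := by
  induction L generalizing i with
  | nil => simp [cuts] at hi
  | cons p L ih =>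
    obtain ⟨a, x⟩ := p
    have h1 : 1 ≤ a := h.of_cons.1
    rw [listDeg]
    rcases mem_cuts_cons.1 hi with ⟨⟨_, hL⟩, rfl⟩ | ⟨j, hj, rfl⟩
    · have := one_le_listDeg h.of_cons.2 hL
      omega
    · have := ih h.of_cons.2 hj
      omega

lemma disjoint_glue_cuts (h : PosList L) : Disjoint (glue L) (cuts L) := by
  rw [Finset.disjoint_left]
  intro i hi hi'
  induction L generalizing i with
  | nil => simp [cuts] at hi'
  | cons p L ih =>
    obtain ⟨a, x⟩ := p
    have h1 : 1 ≤ a := h.of_cons.1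
    simp only [glue, Finset.mem_union, Finset.mem_range, Finset.mem_image] at hi
    rcases mem_cuts_cons.1 hi' with ⟨_, rfl⟩ | ⟨j, hj, rfl⟩
    · rcases hi with hi | ⟨j, hj, h2⟩ <;> omega
    · rcases hi with hi | ⟨j', hj', h2⟩
      · omega
      · obtain rfl : j' = j := by omega
        exact ih h.of_cons.2 hj' hj

lemma Rsub_mul_relInf {n : ℕ} {S : Finset ℕ} (hS : ∀ i ∈ S, i + 2 ≤ n) :
    Rsub R a * relInf R n S = relInf R (a + n) (Finset.range (a - 1) ∪ S.image (a + ·)) := by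
  rw [Rsub_eq_relInf]
  exact relInf_mul (fun i hi => by rw [Finset.mem_range] at hi; omega) hS

lemma prodSub_eq (h : PosList L) : prodSub R L = relInf R (listDeg L) (glue L) := by
  induction L with
  | nil => rw [glue, listDeg, relInf_empty, prodSub_nil, Vpow, pow_zero]
  | cons p L ih =>
    obtain ⟨a, x⟩ := p
    rw [prodSub_cons, ih h.of_cons.2, Rsub_mul_relInf fun i hi => glue_lt h.of_cons.2 hi]
    rfl

lemma image_add_insert (a i : ℕ) (S : Finset ℕ) :
    (insert i S).image (a + ·) = insert (a + i) (S.image (a + ·)) := Finset.image_insert ..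

lemma union_insert_comm (i : ℕ) (S S' : Finset ℕ) : S ∪ insert i S' = insert i (S ∪ S') :=
  Finset.union_insert ..

/-- Merging two neighbouring letters adds exactly the position that straddles them: `a - 1` counted
from the start of the first letter. -/
lemma glue_merge (ha : 1 ≤ a) (hb : 1 ≤ b) (A B : List (ℕ × ℤ)) :
    glue (A ++ (a + b, y) :: B) =
      insert (listDeg A + a - 1) (glue (A ++ (a, x) :: (b, y) :: B)) := by
  induction A with
  | nil =>
    ext i
    simp only [List.nil_append, glue, listDeg, Finset.mem_union, Finset.mem_range,
      Finset.mem_image, Finset.mem_insert]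
    constructor
    · rintro (h | ⟨j, hj, rfl⟩)
      · rcases lt_trichotomy i (a - 1) with h1 | h1 | h1
        · exact .inr (.inl h1)
        · exact .inl (by omega)
        · exact .inr (.inr ⟨i - a, .inl (by omega), by omega⟩)
      · exact .inr (.inr ⟨b + j, .inr ⟨j, hj, rfl⟩, by omega⟩)
    · rintro (h | h | ⟨j, h | ⟨l, hl, rfl⟩, rfl⟩)
      · exact .inl (by omega)
      · exact .inl (by omega)
      · exact .inl (by omega)
      · exact .inr ⟨l, hl, by omega⟩
  | cons p A ih =>
    obtain ⟨e, h⟩ := p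
    rw [List.cons_append, glue, ih, image_add_insert, union_insert_comm, List.cons_append, glue,
      listDeg]
    congr 1
    omega

/-- A nonzero gap is not a cut, so merging the letters across it changes no cut. -/
lemma cuts_merge (hb : 1 ≤ b) (hx : x ≠ 0) (A B : List (ℕ × ℤ)) :
    cuts (A ++ (a, x) :: (b, y) :: B) = cuts (A ++ (a + b, y) :: B) := by
  induction A with
  | nil =>
    ext i
    simp only [List.nil_append, mem_cuts_cons, hx, false_and, false_or]
    constructor
    · rintro ⟨j, ⟨h, rfl⟩ | ⟨l, hl, rfl⟩, rfl⟩
      · exact .inl ⟨h, by omega⟩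
      · exact .inr ⟨l, hl, by omega⟩
    · rintro (⟨h, rfl⟩ | ⟨l, hl, rfl⟩)
      · exact ⟨b - 1, .inl ⟨h, rfl⟩, by omega⟩
      · exact ⟨b + l, .inr ⟨l, hl, rfl⟩, by omega⟩
  | cons p A ih =>
    obtain ⟨e, h⟩ := p
    simp only [List.cons_append, cuts, ih]
    simp

lemma listDeg_merge (A B : List (ℕ × ℤ)) :
    listDeg (A ++ (a, x) :: (b, y) :: B) = listDeg (A ++ (a + b, y) :: B) := by
  induction A with
  | nil => simp [listDeg, add_assoc]
  | cons p A ih =>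
    obtain ⟨e, h⟩ := p
    simp [listDeg, ih]

lemma Rsub_mul_iSup {n : ℕ} {C S : Finset ℕ} (hC : ∀ i ∈ C, i + 2 ≤ n) (hS : ∀ i ∈ S, i + 2 ≤ n) :
    Rsub R a * ⨆ i ∈ C, relInf R n (insert i S) = ⨆ i ∈ C.image (a + ·),
      relInf R (a + n) (insert i (Finset.range (a - 1) ∪ S.image (a + ·))) := by
  simp only [Submodule.mul_iSup, Finset.mem_image]
  have h (i) (hi : i ∈ C) : Rsub R a * relInf R n (insert i S) =
      relInf R (a + n) (insert (a + i) (Finset.range (a - 1) ∪ S.image (a + ·))) := by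
    rw [Rsub_mul_relInf, image_add_insert, union_insert_comm]
    intro j hj
    rcases Finset.mem_insert.1 hj with rfl | hj
    · exact hC _ hi
    · exact hS j hj
  apply le_antisymm
  · refine iSup₂_le fun i hi => ?_
    rw [h i hi]
    exact le_iSup₂_of_le (a + i) ⟨i, hi, rfl⟩ le_rfl
  · refine iSup₂_le ?_
    rintro _ ⟨i, hi, rfl⟩
    rw [← h i hi]
    exact le_iSup₂_of_le i hi le_rfl

/-- Each available inclusion imposes one extra relation at a cut, in addition to those inside the
letters. In this form distributivity applies. -/
lemma imT_eq (h : PosList L) :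
    imT R L = ⨆ i ∈ cuts L, relInf R (listDeg L) (insert i (glue L)) := by
  induction L with
  | nil => simp [cuts]
  | cons p L ih =>
    obtain ⟨a, x⟩ := p
    have ha : 1 ≤ a := h.of_cons.1
    have hL := h.of_cons.2
    rw [imT_cons, ih hL, Rsub_mul_iSup (fun i hi => cuts_lt hL hi) fun i hi => glue_lt hL hi, cuts]
    simp only [Finset.mem_union, iSup_or, iSup_sup_eq]
    congr 1
    cases L with
    | nil => simp [headIm]
    | cons p L =>
      obtain ⟨b, y⟩ := p
      have hb : 1 ≤ b := hL.of_cons.1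
      rw [headIm]
      split_ifs with h1 h2 h2
      · have h3 := glue_merge (x := x) (y := y) ha hb [] L
        simp only [List.nil_append, listDeg, zero_add] at h3
        have h4 : Rsub R (a + b) * prodSub R L = prodSub R ((a + b, y) :: L) := rfl
        rw [h4, prodSub_eq, h3]
        · simp [listDeg, add_assoc]
        · intro p hp
          rcases List.mem_cons.1 hp with rfl | hp
          · exact Nat.le_add_right_of_le ha
          · exact hL.of_cons.2 p hp
      · exact absurd ⟨h1, by simp⟩ h2
      · exact absurd h2.1 h1
      · simp

/-- The distributivity behind the exact sequences. -/
theorem LinRes.merge_inf_imT (K : LinRes R) (ha : 1 ≤ a) (hb : 1 ≤ b) (hA : PosList A)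
    (hB : PosList B) (hx : x ≠ 0) : prodSub R (A ++ (a + b, y) :: B) ⊓
      imT R (A ++ (a, x) :: (b, y) :: B) ≤ imT R (A ++ (a + b, y) :: B) := by
  have h1 : PosList (A ++ (a + b, y) :: B) := by
    intro p hp
    simp only [List.mem_append, List.mem_cons] at hp
    rcases hp with hp | rfl | hp
    · exact hA p hp
    · exact Nat.le_add_right_of_le ha
    · exact hB p hp
  have h2 : PosList (A ++ (a, x) :: (b, y) :: B) := by
    intro p hp
    simp only [List.mem_append, List.mem_cons] at hp
    rcases hp with hp | rfl | rfl | hp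
    · exact hA p hp
    · exact ha
    · exact hb
    · exact hB p hp
  rw [prodSub_eq h1, imT_eq h1, imT_eq h2, cuts_merge hb hx, listDeg_merge]
  -- Of each summand of `imT` only the relation at its cut is kept. The merged word supplies all
  -- positions in its letters, which are disjoint from the cuts, and distributivity does the rest.
  refine le_trans (inf_le_inf_left _ (iSup₂_mono fun i hi => ?_))
    (K.distrib _ _ _ (fun i hi => glue_lt h1 hi) (fun i hi => cuts_lt h1 hi)
      (disjoint_glue_cuts h1))
  rw [relInf_insert]
  exact inf_le_right

lemma headIm_append (e : ℕ) (h : ℤ) (p : ℕ × ℤ) (L : List (ℕ × ℤ)) :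
    headIm R e h (A ++ p :: L) = headIm R e h (A ++ [p]) * prodSub R L := by
  cases A with
  | nil =>
    simp only [List.nil_append, headIm]
    split_ifs <;> simp
  | cons q A =>
    simp only [List.cons_append, headIm]
    split_ifs
    · rw [show A ++ p :: L = (A ++ [p]) ++ L by simp, prodSub_append (A ++ [p]) L, mul_assoc]
    · simp

/-- The summands are sorted by place: left of the letter `a`, right of it, and at the junction
following it. -/
lemma imT_append (A L : List (ℕ × ℤ)) : imT R (A ++ (a, x) :: L) =
    imT R (A ++ [(a, x)]) * prodSub R L ⊔ prodSub R (A ++ [(a, x)]) * imT R L ⊔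
      prodSub R A * headIm R a x L := by
  induction A with
  | nil => simp [imT_cons, headIm, sup_comm]
  | cons q A ih =>
    obtain ⟨e, h⟩ := q
    simp only [List.cons_append, imT_cons, prodSub_cons]
    rw [ih, headIm_append, Submodule.sup_mul, Submodule.mul_sup, Submodule.mul_sup]
    simp only [mul_assoc, sup_assoc]

lemma imT_append_last (A : List (ℕ × ℤ)) (x' : ℤ) :
    imT R (A ++ [(a, x)]) = imT R (A ++ [(a, x')]) := by
  induction A with
  | nil => simp
  | cons q A ih =>
    obtain ⟨e, h⟩ := q
    simp only [List.cons_append, imT_cons, ih]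
    congr 1
    cases A with
    | nil => simp [headIm]
    | cons q A =>
      simp only [List.cons_append, headIm, prodSub_append]
      simp

end ListSubspaces

/-! ### The dual list and its perfect pairing -/

section Pairing
variable {k V : Type u} [Field k] [AddCommGroup V] [Module k V] [FiniteDimensional k V]
  {R : Submodule k (V ⊗[k] V)} {d : ℕ} {t : TensorAlgebra k V}

/-- The letters of the dual of the product of a list; `g` is the gap after the last letter. -/
def dualList (d : ℕ) (g : ℤ) : List (ℕ × ℤ) → List (ℕ × ℤ)
  | [] => []
  -- The shift by one sends the gap `-1`, where contractions take place, to the gap `0`, where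
  -- inclusions do.
  | (a, x) :: L => dualList d (x + 1) L ++ [(d - a, g)]

/-- The pairing between `prodSub R L` and `prodSub R (dualList d g L)`. -/
def IsFrob.pair (F : IsFrob R d t) : List (ℕ × ℤ) →
    TensorAlgebra k V →ₗ[k] Module.Dual k (TensorAlgebra k V)
  | [] => (LinearMap.mul k k).compl₁₂ (TensorAlgebra.algebraMapInv (M := V)).toLinearMap
      (TensorAlgebra.algebraMapInv (M := V)).toLinearMap
  -- The first letter of `z` is paired with the last letter of `w`; the remaining letters are nested
  -- inside.
  | (a, _) :: L => TensorProduct.lift (LinearMap.mk₂ k (fun (p : Vpow k V a) z =>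
      pair F L z ∘ₗ F.D a p)
      (fun p p' z => by rw [Submodule.coe_add, map_add, LinearMap.comp_add])
      (fun r p z => by rw [Submodule.coe_smul, map_smul, LinearMap.comp_smul])
      (fun p z z' => by rw [map_add, LinearMap.add_comp])
      (fun r p z => by rw [map_smul, LinearMap.smul_comp])) ∘ₗ splitL a

namespace IsFrob
variable (F : IsFrob R d t) {a b c : ℕ} {x y g : ℤ} {L A B : List (ℕ × ℤ)}

lemma pair_nil (r s : k) : F.pair [] (algebraMap k _ r) (algebraMap k _ s) = r * s := by
  simp [pair]

lemma pair_cons {p} (hp : p ∈ Rsub R a) (z w : TensorAlgebra k V) :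
    F.pair ((a, x) :: L) (p * z) w = F.pair L z (F.D a p w) := by
  rw [pair, LinearMap.comp_apply, splitL_mul (Rsub_le _ hp)]
  rfl

lemma pair_cons_mul {p} (hp : p ∈ Rsub R a) {q} (hq : q ∈ Rsub R (d - a))
    (z w : TensorAlgebra k V) :
    F.pair ((a, x) :: L) (p * z) (w * q) = F.eta a p q * F.pair L z w := by
  rw [F.pair_cons hp, D_apply, cR_mul _ _ (Rsub_le _ hq), map_smul, smul_eq_mul]

/-- Dual bases of two spaces in perfect duality. -/
lemma exists_dualBasis_of_perfect (β : TensorAlgebra k V →ₗ[k] Module.Dual k (TensorAlgebra k V))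
    {P Q : Submodule k (TensorAlgebra k V)} [Module.Finite k Q]
    (hl : ∀ z ∈ P, (∀ w ∈ Q, β z w = 0) → z = 0)
    (hr : ∀ ψ : Module.Dual k (TensorAlgebra k V), ∃ z ∈ P, ∀ w ∈ Q, β z w = ψ w) :
    ∃ (n : ℕ) (p q : Fin n → TensorAlgebra k V), (∀ i, p i ∈ P) ∧ (∀ i, q i ∈ Q) ∧
      (∀ i j, β (p i) (q j) = if i = j then 1 else 0) ∧
      P ≤ Submodule.span k (Set.range p) ∧ Q ≤ Submodule.span k (Set.range q) := by
  classical
  let e := Module.finBasis k Q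
  have he {u} (hu : u ∈ Q) : u = ∑ i, e.coord i (projSub Q u) • (e i : TensorAlgebra k V) := by
    have := congrArg Subtype.val (e.sum_repr (projSub Q u))
    rw [projSub_coe _ ⟨u, hu⟩] at this
    simp only [AddSubmonoidClass.coe_finsetSum, Submodule.coe_smul] at this
    conv_lhs => rw [← this]
    rw [projSub_coe _ ⟨u, hu⟩]
    rfl
  choose p hp hpe using fun i => hr (e.coord i ∘ₗ projSub Q)
  have hpq (i j) : β (p i) (e j) = if i = j then 1 else 0 := by
    rw [hpe i _ (e j).2, LinearMap.comp_apply, projSub_coe, Module.Basis.coord_apply,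
      Module.Basis.repr_self, Finsupp.single_apply]
    simp [eq_comm]
  refine ⟨_, p, fun i => e i, hp, fun i => (e i).2, hpq, fun v hv => ?_, fun v hv => ?_⟩
  · have h1 : v - ∑ i, β v (e i) • p i = 0 := by
      refine hl _ (P.sub_mem hv (Submodule.sum_mem _ fun i _ => P.smul_mem _ (hp i)))
        fun w hw => ?_
      rw [he hw]
      simp only [map_sub, map_sum, map_smul, LinearMap.sub_apply, LinearMap.sum_apply,
        LinearMap.smul_apply, hpq]
      simp
    rw [sub_eq_zero.1 h1]
    exact Submodule.sum_mem _ fun i _ => Submodule.smul_mem _ _ (Submodule.subset_span ⟨i, rfl⟩)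
  · rw [he hv]
    exact Submodule.sum_mem _ fun i _ => Submodule.smul_mem _ _ (Submodule.subset_span ⟨i, rfl⟩)

/-- Dual bases of `R_a` and `R_{d-a}`. -/
lemma exists_dualBasis (F : IsFrob R d t) (ha : a ≤ d) :
    ∃ (n : ℕ) (p q : Fin n → TensorAlgebra k V), (∀ i, p i ∈ Rsub R a) ∧ (∀ i, q i ∈ Rsub R (d - a)) ∧
      (∀ i j, F.eta a (p i) (q j) = if i = j then 1 else 0) ∧
      Rsub R a ≤ Submodule.span k (Set.range p) ∧
      Rsub R (d - a) ≤ Submodule.span k (Set.range q) := by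
  refine exists_dualBasis_of_perfect (F.eta a) (fun z hz h => ?_) fun ψ =>
    ⟨cR (d - a) ψ t, cR_mem (Rsub_le _) _ (F.t_mem (by omega)), fun w hw => F.eta_eq ha ψ w hw⟩
  rw [← F.cR_eta ha hz, cR_congr (g := 0) (Rsub_le (d - a)) (fun y hy => h y hy)
    (F.t_mem (a := a) (by omega)), map_zero, LinearMap.zero_apply]

/-- Elements of `N P` as combinations of a spanning family of `N`. -/
lemma exists_sum_of_mem_mul {n : ℕ} {p : Fin n → TensorAlgebra k V}
    {N P : Submodule k (TensorAlgebra k V)} (hN : N ≤ Submodule.span k (Set.range p)) {z}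
    (hz : z ∈ N * P) : ∃ w : Fin n → TensorAlgebra k V, (∀ i, w i ∈ P) ∧ z = ∑ i, p i * w i := by
  have hz' := mul_le_mul' hN (le_refl P) hz
  clear hz
  induction hz' using Submodule.mul_induction_on' with
  | mem_mul_mem x hx y hy =>
    obtain ⟨c, rfl⟩ := (Submodule.mem_span_range_iff_exists_fun k).1 hx
    refine ⟨fun i => c i • y, fun i => P.smul_mem _ hy, ?_⟩
    rw [Finset.sum_mul]
    exact Finset.sum_congr rfl fun i _ => by rw [smul_mul_assoc, mul_smul_comm]
  | add x hx y hy h1 h2 =>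
    obtain ⟨w, hw, rfl⟩ := h1
    obtain ⟨w', hw', rfl⟩ := h2
    refine ⟨fun i => w i + w' i, fun i => P.add_mem (hw i) (hw' i), ?_⟩
    simp only [mul_add, Finset.sum_add_distrib]

/-- Elements of `P N` as combinations of a spanning family of `N`. -/
lemma exists_sum_of_mem_mul' {n : ℕ} {p : Fin n → TensorAlgebra k V}
    {N P : Submodule k (TensorAlgebra k V)} (hN : N ≤ Submodule.span k (Set.range p)) {z}
    (hz : z ∈ P * N) : ∃ w : Fin n → TensorAlgebra k V, (∀ i, w i ∈ P) ∧ z = ∑ i, w i * p i := by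
  have hz' := mul_le_mul' (le_refl P) hN hz
  clear hz
  induction hz' using Submodule.mul_induction_on' with
  | mem_mul_mem x hx y hy =>
    obtain ⟨c, rfl⟩ := (Submodule.mem_span_range_iff_exists_fun k).1 hy
    refine ⟨fun i => c i • x, fun i => P.smul_mem _ hx, ?_⟩
    rw [Finset.mul_sum]
    exact Finset.sum_congr rfl fun i _ => by rw [smul_mul_assoc, mul_smul_comm]
  | add x hx y hy h1 h2 =>
    obtain ⟨w, hw, rfl⟩ := h1
    obtain ⟨w', hw', rfl⟩ := h2
    refine ⟨fun i => w i + w' i, fun i => P.add_mem (hw i) (hw' i), ?_⟩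
    simp only [add_mul, Finset.sum_add_distrib]

lemma dualList_append (g : ℤ) (A B : List (ℕ × ℤ)) : dualList d g (A ++ (a, x) :: B) =
    dualList d (x + 1) B ++ dualList d g (A ++ [(a, x)]) := by
  induction A generalizing g with
  | nil => simp [dualList]
  | cons p A ih =>
    obtain ⟨e, h⟩ := p
    simp only [List.cons_append, dualList, ih, List.append_assoc]

lemma dualList_append_last (g : ℤ) (A : List (ℕ × ℤ)) (x' : ℤ) :
    dualList d g (A ++ [(a, x)]) = dualList d g (A ++ [(a, x')]) := by
  induction A generalizing g with
  | nil => simp [dualList]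
  | cons p A ih =>
    obtain ⟨e, h⟩ := p
    simp only [List.cons_append, dualList, ih]

/-- The letters are at most `d`. -/
def LeList (d : ℕ) (L : List (ℕ × ℤ)) : Prop := ∀ p ∈ L, p.1 ≤ d

lemma LeList.of_cons {p : ℕ × ℤ} (h : LeList d (p :: L)) : p.1 ≤ d ∧ LeList d L :=
  ⟨h p (by simp), fun q hq => h q (by simp [hq])⟩

/-- With dual bases of `R_a` and `R_{d-a}`, testing on `u * q j` isolates the coefficient of `p j`,
to which the induction hypothesis applies. The same bases give surjectivity in `pair_right`. -/
lemma pair_left (hL : LeList d L) {z} (hz : z ∈ prodSub R L)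
    (h : ∀ w ∈ prodSub R (dualList d g L), F.pair L z w = 0) : z = 0 := by
  induction L generalizing g z with
  | nil =>
    obtain ⟨r, rfl⟩ := Submodule.mem_one.1 hz
    have := h 1 (Submodule.mem_one.2 ⟨1, map_one _⟩)
    rw [← map_one (algebraMap k (TensorAlgebra k V)), pair_nil, mul_one] at this
    rw [this, map_zero]
  | cons p L ih =>
    obtain ⟨a, x⟩ := p
    have ha : a ≤ d := hL.of_cons.1
    obtain ⟨n, p, q, hp, hq, hpq, hsp, -⟩ := F.exists_dualBasis ha
    obtain ⟨w, hw, rfl⟩ := exists_sum_of_mem_mul hsp hz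
    refine Finset.sum_eq_zero fun j _ => ?_
    rw [ih hL.of_cons.2 (hw j) (g := x + 1) fun u hu => ?_, mul_zero]
    have h1 := h (u * q j) (by
      rw [dualList, prodSub_append, prodSub_cons, prodSub_nil, mul_one]
      exact Submodule.mul_mem_mul hu (hq j))
    rw [map_sum, LinearMap.sum_apply] at h1
    simpa [F.pair_cons_mul (hp _) (hq j), hpq] using h1

lemma pair_right (hL : LeList d L) (ψ : Module.Dual k (TensorAlgebra k V)) :
    ∃ z ∈ prodSub R L, ∀ w ∈ prodSub R (dualList d g L), F.pair L z w = ψ w := by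
  induction L generalizing g ψ with
  | nil =>
    refine ⟨algebraMap k _ (ψ 1), Submodule.mem_one.2 ⟨_, rfl⟩, fun w hw => ?_⟩
    obtain ⟨r, rfl⟩ := Submodule.mem_one.1 hw
    rw [pair_nil, Algebra.algebraMap_eq_smul_one, map_smul, smul_eq_mul, mul_comm]
  | cons p L ih =>
    obtain ⟨a, x⟩ := p
    have ha : a ≤ d := hL.of_cons.1
    obtain ⟨n, p, q, hp, hq, hpq, -, hsq⟩ := F.exists_dualBasis ha
    choose z hz hzw using fun j => ih hL.of_cons.2 (g := x + 1) (ψ ∘ₗ LinearMap.mulRight k (q j))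
    refine ⟨∑ j, p j * z j, Submodule.sum_mem _ fun j _ => Submodule.mul_mem_mul (hp j) (hz j),
      fun w hw => ?_⟩
    rw [dualList, prodSub_append, prodSub_cons, prodSub_nil, mul_one] at hw
    refine eqOn_mul (f := F.pair ((a, x) :: L) (∑ j, p j * z j)) (g := ψ) (fun u hu v hv => ?_) hw
    obtain ⟨c, rfl⟩ := (Submodule.mem_span_range_iff_exists_fun k).1 (hsq hv)
    simp only [Finset.mul_sum, map_sum, mul_smul_comm, map_smul, LinearMap.sum_apply]
    refine Finset.sum_congr rfl fun j _ => ?_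
    simp [F.pair_cons_mul (hp _) (hq j), hpq, hzw j u hu]

instance (L : List (ℕ × ℤ)) : Module.Finite k (prodSub R L) := by
  have h : (Vpow k V (listDeg L)).FG := Submodule.FG.pow (Module.Finite.iff_fg.1 inferInstance) _
  have : Module.Finite k (Vpow k V (listDeg L)) := Module.Finite.of_fg h
  exact Submodule.finiteDimensional_of_le (prodSub_le L)

/-- Dual bases of the spaces attached to a list and its dual. -/
lemma exists_dualBasis_list (hL : LeList d L) (g : ℤ) :
    ∃ (n : ℕ) (p q : Fin n → TensorAlgebra k V), (∀ i, p i ∈ prodSub R L) ∧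
      (∀ i, q i ∈ prodSub R (dualList d g L)) ∧
      (∀ i j, F.pair L (p i) (q j) = if i = j then 1 else 0) ∧
      prodSub R L ≤ Submodule.span k (Set.range p) ∧
      prodSub R (dualList d g L) ≤ Submodule.span k (Set.range q) :=
  exists_dualBasis_of_perfect (F.pair L) (fun _ hz h => F.pair_left hL hz h)
    fun ψ => F.pair_right hL ψ

/-- The elements of `prodSub R L` that pair to zero with the images of the maps `UpMap`. -/
def annT (F : IsFrob R d t) (L : List (ℕ × ℤ)) : Submodule k (TensorAlgebra k V) :=
  prodSub R L ⊓ ⨅ u ∈ imT R (dualList d 1 L), LinearMap.ker ((F.pair L).flip u)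

lemma imT_dualList (L : List (ℕ × ℤ)) (g g' : ℤ) :
    imT R (dualList d g L) = imT R (dualList d g' L) := by
  cases L with
  | nil => rfl
  | cons p L => exact imT_append_last _ _

lemma mem_annT (g : ℤ) {z} : z ∈ F.annT L ↔
    z ∈ prodSub R L ∧ ∀ u ∈ imT R (dualList d g L), F.pair L z u = 0 := by
  rw [annT, imT_dualList L 1 g]
  simp

lemma annT_le : F.annT L ≤ prodSub R L := inf_le_left

lemma pair_gap (A : List (ℕ × ℤ)) (x x' : ℤ) :
    F.pair (A ++ (a, x) :: B) = F.pair (A ++ (a, x') :: B) := by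
  induction A with
  | nil => rfl
  | cons p A ih =>
    obtain ⟨e, h⟩ := p
    simp only [List.cons_append, pair, ih]

lemma annT_last (A : List (ℕ × ℤ)) (x x' : ℤ) :
    F.annT (A ++ [(a, x)]) = F.annT (A ++ [(a, x')]) := by
  rw [annT, annT, F.pair_gap A x x', dualList_append_last 1 A x']
  simp [prodSub_append]

end IsFrob
end Pairing

/-! ### Annihilators of images and kernels of contractions -/

section Annihilators
variable {k V : Type u} [Field k] [AddCommGroup V] [Module k V] [FiniteDimensional k V]
  {R : Submodule k (V ⊗[k] V)} {d : ℕ} {t : TensorAlgebra k V}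

namespace IsFrob
variable (F : IsFrob R d t) {a b c : ℕ} {x y g : ℤ} {L A B : List (ℕ × ℤ)}

/-- The pairing is nested, so the dual of the first factor stands last. With this order the pairing
is multiplicative. -/
lemma pair_append_mul (g : ℤ) {p} (hp : p ∈ prodSub R A) {q} (hq : q ∈ prodSub R (dualList d g A))
    (z w : TensorAlgebra k V) : F.pair (A ++ B) (p * z) (w * q) = F.pair A p q * F.pair B z w := by
  induction A generalizing g p q with
  | nil =>
    obtain ⟨r, rfl⟩ := Submodule.mem_one.1 hp
    obtain ⟨s, rfl⟩ := Submodule.mem_one.1 hq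
    rw [pair_nil, ← Algebra.smul_def, ← Algebra.commutes, ← Algebra.smul_def]
    simp only [List.nil_append, map_smul, LinearMap.smul_apply, smul_eq_mul]
    ring
  | cons e A ih =>
    obtain ⟨a, x⟩ := e
    rw [dualList, prodSub_append, prodSub_cons, prodSub_nil, mul_one] at hq
    refine eqOn_mul (f := F.pair ((a, x) :: A ++ B) (p * z) ∘ₗ LinearMap.mulLeft k w)
      (g := (F.pair B z w) • F.pair ((a, x) :: A) p) (fun q₁ hq₁ q₂ hq₂ => ?_) hq |>.trans
        (mul_comm _ _)
    refine eqOn_mul (f := (F.pair ((a, x) :: A ++ B)).flip (w * (q₁ * q₂)) ∘ₗ LinearMap.mulRight k z)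
      (g := (F.pair B z w) • (F.pair ((a, x) :: A)).flip (q₁ * q₂)) (fun p₁ hp₁ p₂ hp₂ => ?_) hp
    simp only [LinearMap.comp_apply, LinearMap.mulRight_apply, LinearMap.flip_apply,
      LinearMap.smul_apply, smul_eq_mul]
    rw [← mul_assoc w, mul_assoc p₁, List.cons_append, F.pair_cons_mul hp₁ hq₂,
      F.pair_cons_mul hp₁ hq₂, ih (x + 1) hp₂ hq₁]
    ring

/-- At the junction the dual list could merge `d - b` and `d - a`. This requires the gap `x + 1 =
0`, and the result vanishes for `a + b < d` because its degree exceeds `d`. -/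
lemma imT_dualList_append (F : IsFrob R d t) (h : x ≠ -1 ∨ a + b < d) (hb : b ≤ d) (A B : List (ℕ × ℤ)) :
    imT R (dualList d g (A ++ (a, x) :: (b, y) :: B)) =
      imT R (dualList d (x + 1) ((b, y) :: B)) * prodSub R (dualList d g (A ++ [(a, x)])) ⊔
      prodSub R (dualList d (x + 1) ((b, y) :: B)) * imT R (dualList d g (A ++ [(a, x)])) := by
  rw [dualList_append, dualList, List.append_assoc, List.singleton_append, imT_append]
  refine sup_eq_left.2 (le_of_eq_of_le ?_ bot_le)
  have h1 : headIm R (d - b) (x + 1) (dualList d g (A ++ [(a, x)])) = ⊥ := by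
    have h2 : dualList d g (A ++ [(a, x)]) =
        (d - a, (dualList d g (A ++ [(a, x)])).head?.elim 0 Prod.snd) ::
          (dualList d g (A ++ [(a, x)])).tail := by
      clear h
      induction A generalizing g with
      | nil => simp [dualList]
      | cons e A ih =>
        obtain ⟨e, h⟩ := e
        simp only [List.cons_append, dualList]
        rw [ih]
        simp
    rw [h2, headIm]
    split_ifs with h3
    · rw [F.eq_bot _ (by omega), Submodule.bot_mul]
    · rfl
  rw [h1, Submodule.mul_bot]

/-- Annihilators multiply when no map `DownMap` mixes the factors. -/
lemma annT_append (hA : LeList d (A ++ [(a, x)])) (hB : LeList d ((b, y) :: B))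
    (h : x ≠ -1 ∨ a + b < d) : F.annT (A ++ (a, x) :: (b, y) :: B) =
      F.annT (A ++ [(a, x)]) * F.annT ((b, y) :: B) := by
  have hL : A ++ (a, x) :: (b, y) :: B = (A ++ [(a, x)]) ++ (b, y) :: B := by simp
  have hI := F.imT_dualList_append (g := 1) (y := y) h hB.of_cons.1 A B
  rw [hL] at hI ⊢
  generalize A ++ [(a, x)] = L₁ at *
  generalize (b, y) :: B = L₂ at *
  obtain ⟨n, p, q, hp, hq, hpq, hps, hqs⟩ := F.exists_dualBasis_list hA 1
  obtain ⟨n', p', q', hp', hq', hpq', hps', hqs'⟩ := F.exists_dualBasis_list hB (x + 1)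
  apply le_antisymm
  · intro z hz
    rw [F.mem_annT 1, hI, prodSub_append] at hz
    obtain ⟨hz, hz'⟩ := hz
    have h1 : z ∈ prodSub R L₁ * F.annT L₂ := by
      obtain ⟨w, hw, rfl⟩ := exists_sum_of_mem_mul hps hz
      refine Submodule.sum_mem _ fun i _ => Submodule.mul_mem_mul (hp i) ?_
      refine (F.mem_annT (x + 1)).2 ⟨hw i, fun u hu => ?_⟩
      have h2 := hz' (u * q i) (Submodule.mem_sup_left (Submodule.mul_mem_mul hu (hq i)))
      rw [map_sum, LinearMap.sum_apply] at h2
      simpa [F.pair_append_mul 1 (hp _) (hq i), hpq] using h2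
    have h2 : z ∈ F.annT L₁ * prodSub R L₂ := by
      obtain ⟨w, hw, rfl⟩ := exists_sum_of_mem_mul' hps' hz
      refine Submodule.sum_mem _ fun i _ => Submodule.mul_mem_mul ?_ (hp' i)
      refine (F.mem_annT 1).2 ⟨hw i, fun u hu => ?_⟩
      have h2 := hz' (q' i * u) (Submodule.mem_sup_right (Submodule.mul_mem_mul (hq' i) hu))
      rw [map_sum, LinearMap.sum_apply] at h2
      simpa [F.pair_append_mul 1 (hw _) (imT_le _ hu), hpq'] using h2
    -- The two memberships `z ∈ P₁ N₂` and `z ∈ N₁ P₂`, with `Nᵢ` the annihilator in `Pᵢ`, give `z ∈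
    -- N₁ N₂`.
    have h3 := mul_inf_mul_Vpow (prodSub_le (R := R) L₁) (F.annT_le.trans (prodSub_le L₁))
      ((F.annT_le (L := L₂)).trans (prodSub_le L₂))
    have h4 : z ∈ F.annT L₁ * Vpow k V (listDeg L₂) := mul_le_mul' le_rfl (prodSub_le L₂) h2
    have h5 := h3.le ⟨h1, h4⟩
    rwa [inf_eq_right.2 F.annT_le] at h5
  · refine Submodule.mul_le.2 fun z hz w hw => ?_
    rw [F.mem_annT 1] at hz
    rw [F.mem_annT (x + 1)] at hw
    rw [F.mem_annT 1, hI, prodSub_append]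
    refine ⟨Submodule.mul_mem_mul hz.1 hw.1, fun u hu => ?_⟩
    have h1 : imT R (dualList d (x + 1) L₂) * prodSub R (dualList d 1 L₁) ⊔
        prodSub R (dualList d (x + 1) L₂) * imT R (dualList d 1 L₁) ≤
        LinearMap.ker (F.pair (L₁ ++ L₂) (z * w)) := by
      refine sup_le (Submodule.mul_le.2 fun u hu v hv => ?_) (Submodule.mul_le.2 fun u hu v hv => ?_)
      · rw [LinearMap.mem_ker, F.pair_append_mul 1 hz.1 hv, hw.2 u hu, mul_zero]
      · rw [LinearMap.mem_ker, F.pair_append_mul 1 hz.1 (imT_le _ hv), hz.2 v hv, zero_mul]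
    exact h1 hu

/-- Contraction is adjoint to the inclusion of `R_{d-c}` into `R_{d-b} R_{d-a}`. -/
lemma pair_contract (ha : a ≤ d) (hb : b ≤ d) (h : a + b = c + d) {f : TensorAlgebra k V →ₗ[k] TensorAlgebra k V}
    (hf : ∀ p ∈ Rsub R a, ∀ q ∈ Rsub R b, ∀ w ∈ prodSub R B, f (p * (q * w)) = F.D b q p * w)
    {z} (hz : z ∈ prodSub R ((a, x) :: (b, y) :: B)) (w' : TensorAlgebra k V) {r}
    (hr : r ∈ Rsub R (d - c)) : F.pair ((c, y) :: B) (f z) (w' * r) =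
      F.pair ((a, x) :: (b, y) :: B) z (w' * r) := by
  refine eqOn_mul_mul (f := (F.pair ((c, y) :: B)).flip (w' * r) ∘ₗ f)
    (g := (F.pair ((a, x) :: (b, y) :: B)).flip (w' * r)) (fun p hp q hq w hw => ?_) hz
  simp only [LinearMap.comp_apply, LinearMap.flip_apply]
  have hr' : r ∈ Rsub R (d - b) * Rsub R (d - a) := Rsub_le_mul (by omega) hr
  have h1 : F.D a p (w' * r) = w' * F.D a p r := cR_mul_left (Rsub_le _) _ _ hr'
  rw [hf p hp q hq w hw, F.pair_cons_mul (F.D_mem hb h q hp) hr, F.pair_cons hp, h1,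
    F.pair_cons_mul hq (show F.D a p r ∈ _ from cR_mem (Rsub_le _) _ hr'),
    F.eta_D ha hb h q hp hr, dualMul,
    LinearMap.comp_apply, apply_cL (Rsub_le _) (Rsub_le _) _ _ hr']
  rfl

lemma imT_dualList_cons_cons : imT R (dualList d g ((a, x) :: (b, y) :: B)) =
    imT R (dualList d (x + 1) ((b, y) :: B)) * Rsub R (d - a) ⊔
      if x = -1 then prodSub R (dualList d (y + 1) B) * Rsub R (d - b + (d - a)) else ⊥ := by
  simp only [dualList, List.append_assoc, List.singleton_append]
  rw [imT_append]
  simp only [imT_singleton, Submodule.mul_bot, sup_bot_eq, prodSub_cons, prodSub_nil, mul_one,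
    headIm]
  congr 1
  by_cases hx : x = -1
  · rw [if_pos hx, if_pos (by omega)]
  · rw [if_neg hx, if_neg (by omega), Submodule.mul_bot]

/-- The letters are less than `d` and positive. -/
def LtList (d : ℕ) (L : List (ℕ × ℤ)) : Prop := ∀ p ∈ L, 1 ≤ p.1 ∧ p.1 < d

lemma LtList.le (h : LtList d L) : LeList d L := fun p hp => (h p hp).2.le

lemma LtList.of_cons {p : ℕ × ℤ} (h : LtList d (p :: L)) : (1 ≤ p.1 ∧ p.1 < d) ∧ LtList d L :=
  ⟨h p (by simp), fun q hq => h q (by simp [hq])⟩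

/-- The elements killed by all maps `DownMap`. -/
lemma mem_annT_iff (hL : LtList d L) (x : ℤ) {z} (hz : z ∈ prodSub R L) :
    z ∈ F.annT L ↔ ∀ s' h, DownMap F (x, L) s' h → h z = 0 := by
  induction L generalizing x z with
  | nil =>
    refine iff_of_true ((F.mem_annT 1).2 ⟨hz, fun u hu => ?_⟩) fun s' h hD => ?_
    · simp only [dualList, imT_nil, Submodule.mem_bot] at hu
      rw [hu, map_zero]
    · cases hD
  | cons e L ih =>
    obtain ⟨a, x₀⟩ := e
    obtain ⟨⟨ha, had⟩, hL⟩ := hL.of_cons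
    obtain ⟨n, p, q, hp, hq, hpq, hsp, hsq⟩ := F.exists_dualBasis had.le
    obtain ⟨w, hw, rfl⟩ := exists_sum_of_mem_mul hsp hz
    -- Relations of the dual list that leave its last letter `d - a` alone constrain each
    -- coefficient `w i` separately.
    have hwh : (∀ u ∈ imT R (dualList d (x₀ + 1) L) * Rsub R (d - a),
        F.pair ((a, x₀) :: L) (∑ i, p i * w i) u = 0) ↔ ∀ i, w i ∈ F.annT L := by
      constructor
      · intro h i
        refine (F.mem_annT (x₀ + 1)).2 ⟨hw i, fun u hu => ?_⟩
        have h1 := h (u * q i) (Submodule.mul_mem_mul hu (hq i))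
        rw [map_sum, LinearMap.sum_apply] at h1
        simpa [F.pair_cons_mul (hp _) (hq i), hpq] using h1
      · intro h u hu
        refine eqOn_mul (g := 0) (fun u hu v hv => ?_) hu
        rw [map_sum, LinearMap.sum_apply]
        refine Finset.sum_eq_zero fun i _ => ?_
        rw [F.pair_cons_mul (hp _) hv, ((F.mem_annT (x₀ + 1)).1 (h i)).2 u hu, mul_zero]
    -- The same for contractions behind the first letter: left contraction with `η(·)(q i)` extracts
    -- the coefficient `w i`.
    have hwd : (∀ s' h, DownMap F (x₀, L) s' h →
        ∀ g : TensorAlgebra k V →ₗ[k] TensorAlgebra k V, (∀ p ∈ Rsub R a, ∀ w ∈ prodSub R L,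
        g (p * w) = p * h w) → g (∑ i, p i * w i) = 0) ↔ ∀ i, w i ∈ F.annT L := by
      simp only [fun i => ih hL x₀ (hw i)]
      constructor
      · intro h i s' f hf
        obtain ⟨g, -, hg⟩ := hf.exists_whisker x ha had
        have h1 := congrArg (cL a ((F.eta a).flip (q i))) (h s' f hf g hg)
        rw [map_sum, map_sum, map_zero] at h1
        simpa [hg _ (hp _) _ (hw _), cL_mul _ (Rsub_le _ (hp _)), hpq] using h1
      · intro h s' f hf g hg
        rw [map_sum]
        refine Finset.sum_eq_zero fun i _ => ?_
        rw [hg _ (hp i) _ (hw i), h i s' f hf, mul_zero]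
    cases L with
    | nil =>
      refine iff_of_true ((F.mem_annT 1).2 ⟨hz, fun u hu => ?_⟩) fun s' h hD => ?_
      · simp only [dualList, List.nil_append, imT_singleton, Submodule.mem_bot] at hu
        rw [hu, map_zero]
      · cases hD with
        | whisker _ _ hU _ => cases hU
    | cons e B =>
      obtain ⟨b, y⟩ := e
      have hbd : b < d := hL.of_cons.1.2
      rw [F.mem_annT 1, imT_dualList_cons_cons, and_iff_right hz]
      have hsup (N N' : Submodule k (TensorAlgebra k V)) (ψ : Module.Dual k (TensorAlgebra k V)) :
          (∀ u ∈ N ⊔ N', ψ u = 0) ↔ (∀ u ∈ N, ψ u = 0) ∧ ∀ u ∈ N', ψ u = 0 := by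
        simp only [← LinearMap.mem_ker]
        exact sup_le_iff (a := N) (b := N') (c := LinearMap.ker ψ)
      rw [hsup, hwh, ← hwd]
      -- A contraction of the first two letters is adjoint to the inclusion of `R_{d-c}` into
      -- `R_{d-b} R_{d-a}`. As the pairing is perfect, vanishing can be tested after pairing.
      have hhead (c : ℕ) (hc : a + b = c + d) (f : TensorAlgebra k V →ₗ[k] TensorAlgebra k V)
          (hf : ∀ p ∈ Rsub R a, ∀ q ∈ Rsub R b, ∀ w ∈ prodSub R B, f (p * (q * w)) = F.D b q p * w) :
          f (∑ i, p i * w i) = 0 ↔ ∀ u ∈ prodSub R (dualList d (y + 1) B) *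
            Rsub R (d - b + (d - a)), F.pair ((a, x₀) :: (b, y) :: B) (∑ i, p i * w i) u = 0 := by
        rw [show d - b + (d - a) = d - c by omega]
        constructor
        · intro h u hu
          refine eqOn_mul (g := 0) (fun u hu v hv => ?_) hu
          rw [← F.pair_contract had.le hbd.le hc hf hz u hv, h, map_zero]
        · intro h
          refine F.pair_left (L := (c, y) :: B) (g := 1) ?_ ?_ fun u hu => ?_
          · intro e he
            rcases List.mem_cons.1 he with rfl | he
            · exact (show c ≤ d by omega)
            · exact (hL.of_cons.2 e he).2.le
          · exact apply_mem_of_mul_mul (fun p hp q hq w hw => by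
              rw [hf p hp q hq w hw]
              exact Submodule.mul_mem_mul (F.D_mem hbd.le hc q hp) hw) hz
          · rw [dualList, prodSub_append, prodSub_cons, prodSub_nil, mul_one] at hu
            refine eqOn_mul (f := F.pair ((c, y) :: B) (f (∑ i, p i * w i))) (g := 0)
              (fun u hu v hv => ?_) hu
            rw [F.pair_contract had.le hbd.le hc hf hz u hv]
            exact h _ (Submodule.mul_mem_mul hu hv)
      constructor
      · rintro ⟨h1, h2⟩ s' f hD
        cases hD with
        | merge _ _ _ h hx hf =>
          rw [if_pos hx] at h2
          exact (hhead _ h f hf).2 h2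
        | delete _ _ h hx hz hf =>
          rw [if_pos hx] at h2
          exact (hhead 0 (by omega) f hf).2 h2
        | whisker _ _ hU hg => exact h1 _ _ hU _ hg
      · intro h
        constructor
        · intro s' f hf g hg
          exact h _ _ (.whisker ha had hf hg)
        · split_ifs with hx
          -- For `a + b < d` there is no contraction, and correspondingly the merged dual letter has
          -- degree above `d` and vanishes.
          · rcases lt_trichotomy (a + b) d with h1 | h1 | h1
            · rw [F.eq_bot _ (by omega), Submodule.mul_bot]
              intro u hu
              rw [(Submodule.mem_bot k).1 hu, map_zero]
            · exact (hhead 0 (by omega) _ (contract_spec B)).1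
                (h _ _ (.delete had hbd h1 hx rfl (contract_spec B)))
            · obtain ⟨c, hc⟩ := Nat.exists_eq_add_of_le h1.le
              exact (hhead c (by omega) _ (contract_spec B)).1
                (h _ _ (.merge (c := c) had hbd (by omega) (by omega) hx (contract_spec B)))
          · intro u hu
            rw [(Submodule.mem_bot k).1 hu, map_zero]

end IsFrob
end Annihilators

/-! ### Behaviour of `imT` and `annT` under merging and contraction -/

section Standard
variable {k V : Type u} [Field k] [AddCommGroup V] [Module k V]
  {R : Submodule k (V ⊗[k] V)} {d : ℕ} {t : TensorAlgebra k V}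
  {a b c : ℕ} {x y g : ℤ} {L A B : List (ℕ × ℤ)}

/-- The cuts agree, and a summand for the merged word only satisfies one relation more, the one
across the merged letters. -/
lemma imT_merge_le (ha : 1 ≤ a) (hb : 1 ≤ b) (hA : PosList A) (hB : PosList B) (hx : x ≠ 0) :
    imT R (A ++ (a + b, y) :: B) ≤ imT R (A ++ (a, x) :: (b, y) :: B) := by
  have h1 : PosList (A ++ (a + b, y) :: B) := by
    intro p hp
    simp only [List.mem_append, List.mem_cons] at hp
    rcases hp with hp | rfl | hp
    exacts [hA p hp, Nat.le_add_right_of_le ha, hB p hp]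
  have h2 : PosList (A ++ (a, x) :: (b, y) :: B) := by
    intro p hp
    simp only [List.mem_append, List.mem_cons] at hp
    rcases hp with hp | rfl | rfl | hp
    exacts [hA p hp, ha, hb, hB p hp]
  rw [imT_eq h1, imT_eq h2, cuts_merge hb hx, listDeg_merge]
  refine iSup₂_mono fun i hi => ?_
  rw [relInf_insert, relInf_insert, glue_merge (x := x) ha hb, relInf_insert]
  exact le_inf (inf_le_left.trans inf_le_left) inf_le_right

/-- Closing a gap makes one new inclusion available, that of the merged word; nothing else changes.
This extra summand produces the third term in the exact sequences. -/
lemma imT_gap_zero (hx : x ≠ 0) : imT R (A ++ (a, 0) :: (b, y) :: B) =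
    imT R (A ++ (a, x) :: (b, y) :: B) ⊔ prodSub R (A ++ (a + b, y) :: B) := by
  rw [imT_append (x := 0), imT_append (x := x), imT_append_last (x := x) A 0]
  simp only [headIm, if_neg hx, if_true, Submodule.mul_bot, sup_bot_eq, prodSub_append,
    prodSub_cons]

lemma exists_dualList_append_singleton (d : ℕ) (g : ℤ) (A : List (ℕ × ℤ)) :
    ∃ g', ∀ a x, dualList d g (A ++ [(a, x)]) = (d - a, g') :: dualList d g A := by
  induction A generalizing g with
  | nil => exact ⟨g, fun a x => rfl⟩
  | cons p A ih =>
    obtain ⟨e, h⟩ := p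
    obtain ⟨g', hg'⟩ := ih (h + 1)
    exact ⟨g', fun a x => by simp only [List.cons_append, dualList, hg']⟩

/-- Extension of a functional by zero. -/
lemma exists_dual_extend {X : Type*} [AddCommGroup X] [Module k X] (P Q : Submodule k X)
    (ψ : Module.Dual k X) (h : P ⊓ Q ≤ LinearMap.ker ψ) :
    ∃ φ : Module.Dual k X, (∀ z ∈ P, φ z = ψ z) ∧ ∀ z ∈ Q, φ z = 0 := by
  have h1 : ψ ∘ₗ P.subtype ∈ LinearMap.range (Q.mkQ ∘ₗ P.subtype).dualMap := by
    rw [LinearMap.range_dualMap_eq_dualAnnihilator_ker, Submodule.mem_dualAnnihilator]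
    intro z hz
    rw [LinearMap.mem_ker, LinearMap.comp_apply, Submodule.mkQ_apply,
      Submodule.Quotient.mk_eq_zero] at hz
    exact h ⟨z.2, hz⟩
  obtain ⟨φ, hφ⟩ := h1
  refine ⟨φ ∘ₗ Q.mkQ, fun z hz => ?_, fun z hz => ?_⟩
  · exact LinearMap.congr_fun hφ ⟨z, hz⟩
  · rw [LinearMap.comp_apply, Submodule.mkQ_apply, (Submodule.Quotient.mk_eq_zero Q).2 hz,
      map_zero]

variable [FiniteDimensional k V]

namespace IsFrob
variable (F : IsFrob R d t)

lemma LtList.posList_dualList (h : LtList d L) : PosList (dualList d g L) := by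
  induction L generalizing g with
  | nil => intro p hp; cases hp
  | cons p L ih =>
    obtain ⟨a, x⟩ := p
    intro q hq
    rw [dualList, List.mem_append, List.mem_singleton] at hq
    rcases hq with hq | rfl
    · exact ih h.of_cons.2 q hq
    · have := h.of_cons.1
      simp only at this ⊢
      omega

lemma pair_contract_append (ha : a ≤ d) (hb : b ≤ d) (h : a + b = c + d)
    {f : TensorAlgebra k V →ₗ[k] TensorAlgebra k V}
    (hf : ∀ p ∈ prodSub R A, ∀ z ∈ Rsub R a * (Rsub R b * prodSub R B),
      f (p * z) = p * F.contract a b z) {z}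
    (hz : z ∈ prodSub R (A ++ (a, x) :: (b, y) :: B)) {u}
    (hu : u ∈ prodSub R (dualList d g (A ++ (c, y) :: B))) :
    F.pair (A ++ (c, y) :: B) (f z) u = F.pair (A ++ (a, x) :: (b, y) :: B) z u := by
  obtain ⟨g', hg'⟩ := exists_dualList_append_singleton d g A
  rw [dualList_append, prodSub_append, hg', prodSub_cons, ← mul_assoc] at hu
  rw [prodSub_append] at hz
  refine eqOn_mul (f := F.pair (A ++ (c, y) :: B) (f z))
    (g := F.pair (A ++ (a, x) :: (b, y) :: B) z) (fun u hu v hv => ?_) hu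
  refine eqOn_mul (f := (F.pair (A ++ (c, y) :: B)).flip (u * v) ∘ₗ f)
    (g := (F.pair (A ++ (a, x) :: (b, y) :: B)).flip (u * v)) (fun p hp z hz => ?_) hz
  simp only [LinearMap.comp_apply, LinearMap.flip_apply]
  rw [hf p hp z hz, F.pair_append_mul g hp hv, F.pair_append_mul g hp hv]
  congr 1
  refine eqOn_mul (f := F.pair ((c, y) :: B) (F.contract a b z))
    (g := F.pair ((a, x) :: (b, y) :: B) z) (fun w hw r hr => ?_) hu
  exact F.pair_contract ha hb h (F.contract_spec B) hz w hr

lemma prodSub_dualList_merge_le (ha : a ≤ d) (hb : b ≤ d) (h : a + b = c + d) :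
    prodSub R (dualList d g (A ++ (c, y) :: B)) ≤
      prodSub R (dualList d g (A ++ (a, x) :: (b, y) :: B)) := by
  obtain ⟨g', hg'⟩ := exists_dualList_append_singleton d g A
  rw [dualList_append (a := a), dualList_append (a := c), hg', hg', dualList]
  simp only [prodSub_append, prodSub_cons, prodSub_nil, mul_one, mul_assoc]
  rw [← mul_assoc (Rsub R (d - b))]
  exact mul_le_mul' le_rfl (mul_le_mul' (Rsub_le_mul (by omega)) le_rfl)

/-- The contraction of two letters maps the annihilator for a generic gap onto the annihilator
for the merged list, and its kernel is the annihilator for the gap `-1`. -/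
theorem annT_contract (K : LinRes R) (hA : LtList d A) (hB : LtList d B) (had : a < d) (hbd : b < d)
    (h : a + b = c + d) (hx : x ≠ -1) {f : TensorAlgebra k V →ₗ[k] TensorAlgebra k V}
    (hf : ∀ p ∈ prodSub R A, ∀ z ∈ Rsub R a * (Rsub R b * prodSub R B),
      f (p * z) = p * F.contract a b z) :
    (F.annT (A ++ (a, x) :: (b, y) :: B)).map f = F.annT (A ++ (c, y) :: B) ∧
      F.annT (A ++ (a, x) :: (b, y) :: B) ⊓ LinearMap.ker f =
        F.annT (A ++ (a, -1) :: (b, y) :: B) := by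
  have hle1 : LeList d (A ++ (a, x) :: (b, y) :: B) := by
    intro p hp
    simp only [List.mem_append, List.mem_cons] at hp
    rcases hp with hp | rfl | rfl | hp
    exacts [hA.le p hp, had.le, hbd.le, hB.le p hp]
  have hle2 : LeList d (A ++ (c, y) :: B) := by
    intro p hp
    simp only [List.mem_append, List.mem_cons] at hp
    rcases hp with hp | rfl | hp
    exacts [hA.le p hp, show c ≤ d by omega, hB.le p hp]
  have hgap : F.pair (A ++ (a, x) :: (b, y) :: B) = F.pair (A ++ (a, -1) :: (b, y) :: B) :=
    F.pair_gap A x (-1)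
  have hprod : prodSub R (A ++ (a, x) :: (b, y) :: B) = prodSub R (A ++ (a, -1) :: (b, y) :: B) := by
    simp [prodSub_append]
  have hmem {z} (hz : z ∈ prodSub R (A ++ (a, x) :: (b, y) :: B)) :
      f z ∈ prodSub R (A ++ (c, y) :: B) := by
    rw [prodSub_append] at hz ⊢
    refine apply_mem_of_mul (fun p hp z hz => ?_) hz
    rw [hf p hp z hz]
    refine Submodule.mul_mem_mul hp (apply_mem_of_mul_mul (fun p hp q hq w hw => ?_) hz)
    rw [F.contract_mul hp hq]
    exact Submodule.mul_mem_mul (F.D_mem hbd.le h q hp) hw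
  have hpair {z} (hz : z ∈ prodSub R (A ++ (a, x) :: (b, y) :: B)) {u}
    (hu : u ∈ prodSub R (dualList d 1 (A ++ (c, y) :: B))) :=
    F.pair_contract_append had.le hbd.le h hf hz hu
  obtain ⟨g', hg'⟩ := exists_dualList_append_singleton d 1 A
  have hN (x : ℤ) : dualList d 1 (A ++ (a, x) :: (b, y) :: B) =
      dualList d (y + 1) B ++ (d - b, x + 1) :: (d - a, g') :: dualList d 1 A := by
    rw [dualList_append, hg', dualList, List.append_assoc, List.singleton_append]
  have hN2 : dualList d 1 (A ++ (c, y) :: B) =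
      dualList d (y + 1) B ++ (d - b + (d - a), g') :: dualList d 1 A := by
    rw [dualList_append, hg', show d - b + (d - a) = d - c by omega]
  have hle : prodSub R (dualList d 1 (A ++ (c, y) :: B)) ≤
      prodSub R (dualList d 1 (A ++ (a, x) :: (b, y) :: B)) :=
    prodSub_dualList_merge_le had.le hbd.le h
  have hx1 : x + 1 ≠ 0 := by omega
  have hpA : PosList (dualList d 1 A) := hA.posList_dualList
  have hpB : PosList (dualList d (y + 1) B) := hB.posList_dualList
  refine ⟨le_antisymm ?_ fun v hv => ?_, ?_⟩
  · rintro _ ⟨z, hz, rfl⟩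
    obtain ⟨hz, hz'⟩ := (F.mem_annT 1).1 hz
    refine (F.mem_annT 1).2 ⟨hmem hz, fun u hu => ?_⟩
    rw [hpair hz (imT_le _ hu)]
    refine hz' u ?_
    rw [hN]
    rw [hN2] at hu
    exact imT_merge_le (by omega) (by omega) hpB hpA hx1 hu
  · obtain ⟨hv, hv'⟩ := (F.mem_annT 1).1 hv
    -- A preimage of `v` is a `z` whose functional is that of `v` on the merged subspace and zero on
    -- `imT` of the longer list. The two prescriptions agree on the intersection by `merge_inf_imT`,
    -- which is where Koszulness is used.
    obtain ⟨ψ, h1, h2⟩ := exists_dual_extend (prodSub R (dualList d 1 (A ++ (c, y) :: B)))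
      (imT R (dualList d 1 (A ++ (a, x) :: (b, y) :: B))) (F.pair (A ++ (c, y) :: B) v)
      (fun u hu => hv' u (by
        rw [hN, hN2] at *
        exact K.merge_inf_imT (by omega) (by omega) hpB hpA hx1 hu))
    obtain ⟨z, hz, hz'⟩ := F.pair_right hle1 (g := 1) ψ
    refine ⟨z, (F.mem_annT 1).2 ⟨hz, fun u hu => ?_⟩, ?_⟩
    · rw [hz' u (imT_le _ hu), h2 u hu]
    · rw [← sub_eq_zero]
      refine F.pair_left hle2 (g := 1) (Submodule.sub_mem _ (hmem hz) hv) fun u hu => ?_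
      rw [map_sub, LinearMap.sub_apply, hpair hz hu, hz' u (hle hu), h1 u hu, sub_self]
  · ext z
    rw [Submodule.mem_inf, LinearMap.mem_ker, F.mem_annT 1, F.mem_annT 1, ← hprod, ← hgap, and_assoc]
    refine and_congr_right fun hz => ?_
    -- The gap `-1` is dual to the gap `0`: compared with a generic gap there is one more condition
    -- on `z`, which by adjointness says that `f` kills `z`.
    have h1 : imT R (dualList d 1 (A ++ (a, -1) :: (b, y) :: B)) =
        imT R (dualList d 1 (A ++ (a, x) :: (b, y) :: B)) ⊔
          prodSub R (dualList d 1 (A ++ (c, y) :: B)) := by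
      rw [hN, hN, hN2, ← imT_gap_zero hx1]
      rfl
    have h2 : f z = 0 ↔ ∀ u ∈ prodSub R (dualList d 1 (A ++ (c, y) :: B)),
        F.pair (A ++ (a, x) :: (b, y) :: B) z u = 0 := by
      constructor
      · intro h u hu
        rw [← hpair hz hu, h, map_zero, LinearMap.zero_apply]
      · intro h
        exact F.pair_left hle2 (hmem hz) fun u hu => (hpair hz hu).trans (h u hu)
    rw [h1, h2]
    exact (sup_le_iff (a := imT R (dualList d 1 (A ++ (a, x) :: (b, y) :: B)))
      (b := prodSub R (dualList d 1 (A ++ (c, y) :: B)))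
      (c := LinearMap.ker (F.pair (A ++ (a, x) :: (b, y) :: B) z))).symm

lemma annT_singleton (F : IsFrob R d t) : F.annT [(a, x)] = Rsub R a := by
  ext z
  rw [F.mem_annT 1]
  simp only [dualList, List.nil_append, imT_singleton, Submodule.mem_bot, forall_eq, map_zero,
    and_true, prodSub_cons, prodSub_nil, mul_one]

/-- A contraction with `a + b = d` leaves a letter of degree `0`. Since the neighbouring letters are
smaller than `d`, no further contraction can involve it, so the annihilators of both sides multiply.
-/
lemma annT_zero (hA : LtList d A) (hB : LtList d B) :
    F.annT (A ++ (0, y) :: B) = F.annT A * F.annT B := by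
  have h1 : F.annT ((0, y) :: B) = F.annT B := by
    rcases B with - | ⟨⟨b, y'⟩, B⟩
    · rw [annT_singleton, Rsub_zero]
      ext z
      rw [F.mem_annT 1]
      simp [dualList]
    · have := F.annT_append (A := []) (a := 0) (x := y) (b := b) (y := y') (B := B)
        (by intro p hp; simp only [List.nil_append, List.mem_singleton] at hp; simp [hp]) hB.le
        (Or.inr (by have := hB.of_cons.1.2; simpa using this))
      rw [List.nil_append, List.nil_append, annT_singleton, Rsub_zero, one_mul] at this
      exact this
  rcases List.eq_nil_or_concat A with rfl | ⟨A, ⟨a, x⟩, rfl⟩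
  · rw [List.nil_append, h1]
    have : F.annT [] = 1 := by
      ext z
      rw [F.mem_annT 1]
      simp [dualList]
    rw [this, one_mul]
  · rw [List.concat_eq_append, List.append_assoc, List.singleton_append, F.annT_append, h1]
    · simpa using hA.le
    · intro p hp
      rcases List.mem_cons.1 hp with rfl | hp
      exacts [Nat.zero_le d, hB.le p hp]
    · exact Or.inr (by have := hA (a, x) (by simp); simpa using this.2)

end IsFrob
end Standard

/-! ### Words, normal forms and the order on `Λ` -/

section Words
variable {d : ℕ}

/-- Multiplication of a normal form by a letter. -/
def nfCons : Letter d → NForm → NForm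
  | .r a _, s => if a = d then (s.1 + 1, s.2) else (0, (a, s.1) :: s.2)
  | .rdInv, s => (s.1 - 1, s.2)

/-- The normal form of a word. -/
def nf (w : Word d) : NForm := w.foldr nfCons (0, [])

@[simp] lemma nf_nil : nf ([] : Word d) = (0, []) := rfl

@[simp] lemma nf_cons (l : Letter d) (w : Word d) : nf (l :: w) = nfCons l (nf w) := rfl

lemma nfCons_r {a : ℕ} (h : 1 ≤ a ∧ a ≤ d) (had : a < d) (s : NForm) :
    nfCons (.r a h) s = (0, (a, s.1) :: s.2) := if_neg had.ne

lemma nfCons_rd (h : 1 ≤ d ∧ d ≤ d) (s : NForm) : nfCons (.r d h) s = (s.1 + 1, s.2) := if_pos rfl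

lemma nfCons_rdInv (s : NForm) : nfCons (.rdInv : Letter d) s = (s.1 - 1, s.2) := rfl

/-- The product of a list of letters and a normal form. -/
def nfAct : List (ℕ × ℤ) → NForm → NForm
  | [], s => s
  | (a, x) :: L, s => (0, (a, x + (nfAct L s).1) :: (nfAct L s).2)

/-- The product of normal forms. -/
def nfMul (s s' : NForm) : NForm := (s.1 + (nfAct s.2 s').1, (nfAct s.2 s').2)

lemma nfMul_nil (x : ℤ) (s : NForm) : nfMul (x, []) s = (x + s.1, s.2) := rfl

lemma nfMul_append (x : ℤ) (A : List (ℕ × ℤ)) (a : ℕ) (g : ℤ) (s : NForm) :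
    nfMul (x, A ++ [(a, g)]) s = (x, A ++ (a, g + s.1) :: s.2) := by
  have h : nfAct (A ++ [(a, g)]) s = (0, A ++ (a, g + s.1) :: s.2) := by
    induction A with
    | nil => rfl
    | cons p A ih =>
      obtain ⟨e, h⟩ := p
      simp [nfAct, ih]
  simp [nfMul, h]

lemma nf_append (u v : Word d) : nf (u ++ v) = nfMul (nf u) (nf v) := by
  induction u with
  | nil => simp [nfMul_nil]
  | cons l u ih =>
    rw [List.cons_append, nf_cons, nf_cons, ih]
    cases l with
    | r a h =>
      simp only [nfCons]
      split_ifs with had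
      · simp only [nfMul, Prod.mk.injEq, and_true]
        omega
      · simp [nfMul, nfAct]
    | rdInv =>
      simp only [nfCons, nfMul, Prod.mk.injEq, and_true]
      omega

lemma nf_lt (w : Word d) : IsFrob.LtList d (nf w).2 := by
  induction w with
  | nil => intro p hp; cases hp
  | cons l w ih =>
    rw [nf_cons]
    cases l with
    | r a h =>
      simp only [nfCons]
      split_ifs with had
      · exact ih
      · intro p hp
        rcases List.mem_cons.1 hp with rfl | hp
        · exact ⟨h.1, lt_of_le_of_ne h.2 had⟩
        · exact ih p hp
    | rdInv => exact ih

/-- The action of a letter on normal forms. -/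
def nfEnd (l : Letter d) : Function.End NForm := nfCons l

/-- The action of `Λ` on normal forms. -/
def nfHom (d : ℕ) : Lambda d →* Function.End NForm :=
  PresentedMonoid.lift (rels := LambdaRel d) (nfEnd : Letter d → Function.End NForm) (by
    rintro _ _ (h | h)
    · rw [map_mul, FreeMonoid.lift_eval_of, FreeMonoid.lift_eval_of, map_one]
      funext s
      change nfCons (.r d h) (nfCons .rdInv s) = s
      rw [nfCons_rd, nfCons_rdInv, sub_add_cancel]
    · rw [map_mul, FreeMonoid.lift_eval_of, FreeMonoid.lift_eval_of, map_one]
      funext s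
      change nfCons (.rdInv : Letter d) (nfCons (.r d h) s) = s
      rw [nfCons_rd, nfCons_rdInv, add_sub_cancel_right])

lemma cls_append (u v : Word d) : cls (u ++ v) = cls u * cls v := rfl

lemma cls_cons (l : Letter d) (w : Word d) : cls (l :: w) = cls [l] * cls w := rfl

lemma nfHom_cls (w : Word d) : nfHom d (cls w) (0, []) = nf w := by
  induction w with
  | nil => rfl
  | cons l w ih =>
    rw [cls_cons, map_mul, nf_cons, ← ih]
    rfl

/-- The monoid `Λ` acts on normal forms, and a word acts on the empty form to give its own normal
form. -/
lemma nf_eq_of_cls {u v : Word d} (h : cls u = cls v) : nf u = nf v := by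
  rw [← nfHom_cls, h, nfHom_cls]

/-- The number of letters other than `r_d` and its inverse. -/
def lenHom (d : ℕ) : Lambda d →* Multiplicative ℕ :=
  PresentedMonoid.lift (rels := LambdaRel d) (fun l : Letter d => match l with
    | .r a _ => Multiplicative.ofAdd (if a = d then 0 else 1)
    | .rdInv => 1) (by
    rintro _ _ (h | h)
    · simp
    · simp)

lemma lenHom_cls (w : Word d) : lenHom d (cls w) = Multiplicative.ofAdd (nf w).2.length := by
  induction w with
  | nil => rfl
  | cons l w ih =>
    rw [cls_cons, map_mul, nf_cons, ih]
    cases l with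
    | r a h =>
      change Multiplicative.ofAdd (if a = d then 0 else 1) * _ = _
      rw [nfCons]
      split_ifs
      · simp
      · rw [← ofAdd_add]
        simp [add_comm]
    | rdInv =>
      change 1 * _ = _
      rw [one_mul]
      rfl

lemma lenHom_rr (a : ℕ) : lenHom d (rr d a) = Multiplicative.ofAdd (if 1 ≤ a ∧ a < d then 1 else 0) := by
  rw [rr]
  split_ifs with h1 h2 h2
  · rw [lenHom_cls, nf_cons, nfCons_r _ h2.2]
    rfl
  · rw [lenHom_cls, nf_cons, nfCons, if_pos (by omega)]
    rfl
  · omega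
  · rw [map_one]
    rfl

/-- In either kind of inequality the larger side has two letters smaller than `d`, while the smaller
side has at most one in their place: none if the index of that letter is `0` or `d`. -/
lemma lenHom_step {x y : Lambda d} (h : LambdaStep d x y) :
    Multiplicative.toAdd (lenHom d x) < Multiplicative.toAdd (lenHom d y) := by
  cases h with
  | up u v a b ha hb h =>
    simp only [map_mul, lenHom_rr, toAdd_mul, toAdd_ofAdd]
    rw [if_pos (show 1 ≤ a ∧ a < d by omega), if_pos (show 1 ≤ b ∧ b < d by omega)]
    split_ifs <;> omega
  | down u v a b ha hb h =>
    have h1 : lenHom d (cls [.rdInv]) = 1 := rfl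
    simp only [map_mul, lenHom_rr, h1, mul_one, toAdd_mul, toAdd_ofAdd]
    rw [if_pos (show 1 ≤ a ∧ a < d by omega), if_pos (show 1 ≤ b ∧ b < d by omega)]
    split_ifs <;> omega

lemma length_lt_of_lt {u v : Word d} (h : (cls u).LT (cls v)) :
    (nf u).2.length < (nf v).2.length := by
  have h1 : ∀ {x y : Lambda d}, x.LT y →
      Multiplicative.toAdd (lenHom d x) < Multiplicative.toAdd (lenHom d y) := by
    intro x y h
    induction h with
    | single h => exact lenHom_step h
    | tail _ h ih => exact ih.trans (lenHom_step h)
  simpa [lenHom_cls] using h1 h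

lemma Lambda.LT.mul_left (u : Lambda d) {x y : Lambda d} (h : x.LT y) : (u * x).LT (u * y) := by
  refine Relation.TransGen.lift (r := LambdaStep d) (p := LambdaStep d) (u * ·) (fun x y h => ?_) _ _ h
  cases h with
  | up u' v a b ha hb h =>
    simpa only [mul_assoc] using LambdaStep.up (u * u') v a b ha hb h
  | down u' v a b ha hb h =>
    simpa only [mul_assoc] using LambdaStep.down (u * u') v a b ha hb h

/-- Words that are linked by cancellations. -/
inductive WordEquiv (d : ℕ) : Word d → Word d → Prop
  | refl (w : Word d) : WordEquiv d w w
  | symm {u v : Word d} : WordEquiv d u v → WordEquiv d v u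
  | trans {u v w : Word d} : WordEquiv d u v → WordEquiv d v w → WordEquiv d u w
  | cons (l : Letter d) {u v : Word d} : WordEquiv d u v → WordEquiv d (l :: u) (l :: v)
  | mulInv (h : 1 ≤ d ∧ d ≤ d) (w : Word d) : WordEquiv d (.r d h :: .rdInv :: w) w
  | invMul (h : 1 ≤ d ∧ d ≤ d) (w : Word d) : WordEquiv d (.rdInv :: .r d h :: w) w

lemma WordEquiv.cls_eq {u v : Word d} (h : WordEquiv d u v) : cls u = cls v := by
  induction h with
  | refl => rfl
  | symm _ ih => exact ih.symm
  | trans _ _ ih ih' => exact ih.trans ih'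
  | cons l _ ih => rw [cls_cons, ih, ← cls_cons]
  | mulInv h w =>
    have h1 : cls [.r d h, .rdInv] = 1 := (Con.eq _).2 (.of _ _ (.mul_inv h))
    rw [show Letter.r d h :: .rdInv :: w = [.r d h, .rdInv] ++ w from rfl, cls_append, h1, one_mul]
  | invMul h w =>
    have h1 : cls [.rdInv, .r d h] = 1 := (Con.eq _).2 (.of _ _ (.inv_mul h))
    rw [show Letter.rdInv :: .r d h :: w = [.rdInv, .r d h] ++ w from rfl, cls_append, h1, one_mul]

/-- The letter `r_a`, as a word. -/
def ltr (d a : ℕ) : Word d := if h : 1 ≤ a ∧ a ≤ d then [.r a h] else []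

lemma ltr_eq {a : ℕ} (h : 1 ≤ a ∧ a ≤ d) : ltr d a = [.r a h] := dif_pos h

lemma cls_ltr (a : ℕ) : cls (ltr d a) = rr d a := by
  rw [ltr, rr]
  split_ifs <;> rfl

variable (hd : 1 ≤ d)

/-- The word `r_{a₁} r_d^{x₁} r_{a₂} r_d^{x₂} ⋯`. -/
def listWord (hd : 1 ≤ d) : List (ℕ × ℤ) → Word d
  | [] => []
  | (a, x) :: L => ltr d a ++ (rdPow ⟨hd, le_rfl⟩ x ++ listWord hd L)

/-- The word of a normal form. -/
def nfWord (hd : 1 ≤ d) (s : NForm) : Word d := rdPow ⟨hd, le_rfl⟩ s.1 ++ listWord hd s.2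

lemma nfWord_cons (x : ℤ) (a : ℕ) (y : ℤ) (L : List (ℕ × ℤ)) : nfWord hd (x, (a, y) :: L) =
    rdPow ⟨hd, le_rfl⟩ x ++ (ltr d a ++ nfWord hd (y, L)) := rfl

lemma nf_rdPow_append (x : ℤ) (w : Word d) :
    nf (rdPow ⟨hd, le_rfl⟩ x ++ w) = (x + (nf w).1, (nf w).2) := by
  have h1 (n : ℕ) (w : Word d) : nf (List.replicate n (.r d ⟨hd, le_rfl⟩) ++ w) =
      (n + (nf w).1, (nf w).2) := by
    induction n with
    | zero => simp
    | succ n ih =>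
      rw [List.replicate_succ, List.cons_append, nf_cons, ih, nfCons_rd, Prod.mk.injEq]
      refine ⟨?_, rfl⟩
      push_cast
      ring
  have h2 (n : ℕ) (w : Word d) : nf (List.replicate n .rdInv ++ w) =
      (-(n : ℤ) + (nf w).1, (nf w).2) := by
    induction n with
    | zero => simp
    | succ n ih =>
      rw [List.replicate_succ, List.cons_append, nf_cons, ih, nfCons_rdInv, Prod.mk.injEq]
      refine ⟨?_, rfl⟩
      push_cast
      ring
  cases x with
  | ofNat n => exact h1 n w
  | negSucc n => exact h2 (n + 1) w

lemma nf_listWord {L : List (ℕ × ℤ)} (hL : IsFrob.LtList d L) (x : ℤ) :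
    nf (nfWord hd (x, L)) = (x, L) := by
  induction L generalizing x with
  | nil => rw [nfWord, listWord, nf_rdPow_append hd, nf_nil, add_zero]
  | cons p L ih =>
    obtain ⟨a, y⟩ := p
    have ha := hL.of_cons.1
    rw [nfWord_cons, nf_rdPow_append hd, ltr_eq ⟨ha.1, ha.2.le⟩, List.singleton_append, nf_cons,
      ih hL.of_cons.2, nfCons_r _ ha.2]
    simp

lemma nf_nfWord {s : NForm} (hL : IsFrob.LtList d s.2) : nf (nfWord hd s) = s := nf_listWord hd hL s.1

lemma wordEquiv_rd_rdPow (x : ℤ) (w : Word d) :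
    WordEquiv d (.r d ⟨hd, le_rfl⟩ :: (rdPow ⟨hd, le_rfl⟩ x ++ w)) (rdPow ⟨hd, le_rfl⟩ (x + 1) ++ w) := by
  rcases x with n | _ | n
  · exact .refl _
  · exact .mulInv _ _
  · exact .mulInv _ _

lemma wordEquiv_rdInv_rdPow (x : ℤ) (w : Word d) :
    WordEquiv d (.rdInv :: (rdPow ⟨hd, le_rfl⟩ x ++ w)) (rdPow ⟨hd, le_rfl⟩ (x - 1) ++ w) := by
  rcases x with (_ | n) | n
  · exact .refl _
  · have h : Int.ofNat (n + 1) - 1 = Int.ofNat n := by simp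
    rw [h]
    exact .invMul _ _
  · exact .refl _

lemma wordEquiv_nfWord (w : Word d) : WordEquiv d w (nfWord hd (nf w)) := by
  induction w with
  | nil => exact .refl _
  | cons l w ih =>
    refine (ih.cons l).trans ?_
    rw [nf_cons]
    cases l with
    | r a h =>
      by_cases had : a = d
      · subst had
        rw [nfCons_rd]
        exact wordEquiv_rd_rdPow hd _ _
      · rw [nfCons_r _ (by omega), nfWord_cons, ltr_eq h]
        exact .refl _
    | rdInv => exact wordEquiv_rdInv_rdPow hd _ _

lemma wordEquiv_of_nf (hd : 1 ≤ d) {u v : Word d} (h : nf u = nf v) : WordEquiv d u v := by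
  have h1 := wordEquiv_nfWord hd u
  rw [h] at h1
  exact h1.trans (wordEquiv_nfWord hd v).symm

lemma cls_eq_of_nf (hd : 1 ≤ d) {u v : Word d} (h : nf u = nf v) : cls u = cls v :=
  (wordEquiv_of_nf hd h).cls_eq

variable {k V : Type u} [Field k] [AddCommGroup V] [Module k V]
  {R : Submodule k (V ⊗[k] V)} {t : TensorAlgebra k V} {s s' : NForm}
  {f : TensorAlgebra k V →ₗ[k] TensorAlgebra k V}

lemma UpMap.ltList (h : UpMap R d t s s' f) (hL : IsFrob.LtList d s'.2) : IsFrob.LtList d s.2 := by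
  induction h with
  | merge ha hb h hc hf =>
    intro p hp
    rcases List.mem_cons.1 hp with rfl | hp
    · exact ⟨by simp only; omega, hc⟩
    · exact hL p (by simp [hp])
  | insert ha hb h hz hf => exact fun p hp => hL p (by simp [hp])
  | whisker ha had hU hg ih =>
    intro p hp
    rcases List.mem_cons.1 hp with rfl | hp
    · exact ⟨ha, had⟩
    · exact ih hL.of_cons.2 p hp

lemma UpMap.lt (h : UpMap R d t s s' f) (hL : IsFrob.LtList d s'.2) :
    (cls (nfWord hd s)).LT (cls (nfWord hd s')) := by
  induction h with
  | @merge x y L a b c f ha hb h hc hf =>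
    subst h
    refine .single ?_
    simp only [nfWord_cons, cls_append, cls_ltr]
    convert LambdaStep.up (d := d) (cls (rdPow ⟨hd, le_rfl⟩ x)) (cls (nfWord hd (y, L))) a b ha hb hc.le
      using 1
    · simp only [mul_assoc]
    · simp only [mul_assoc, show cls (rdPow (d := d) ⟨hd, le_rfl⟩ 0) = 1 from rfl, one_mul]
  | @insert x y z L a b f ha hb h hz hf =>
    refine .single ?_
    -- The inequality needs the letter `r_d` in a specific place, but in the normal form it is
    -- absorbed into the power `z = x + y + 1`.
    have h1 : cls (nfWord hd (z, L)) =
        cls (rdPow ⟨hd, le_rfl⟩ x ++ (.r d ⟨hd, le_rfl⟩ :: nfWord hd (y, L))) := by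
      have hL' : IsFrob.LtList d L := fun p hp => hL p (by simp [hp])
      refine cls_eq_of_nf hd ?_
      rw [nf_rdPow_append hd, nf_cons, nfCons_rd, nf_nfWord hd hL', nf_nfWord hd hL', hz]
      simp [add_assoc]
    rw [h1, cls_append, cls_cons]
    simp only [nfWord_cons, cls_append, cls_ltr]
    convert LambdaStep.up (d := d) (cls (rdPow ⟨hd, le_rfl⟩ x)) (cls (nfWord hd (y, L))) a b ha hb h.le
      using 1
    · rw [h, rr, dif_pos ⟨hd, le_rfl⟩, mul_assoc]
    · simp only [mul_assoc, show cls (rdPow (d := d) ⟨hd, le_rfl⟩ 0) = 1 from rfl, one_mul]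
  | whisker ha had hU hg ih =>
    simp only [nfWord_cons, cls_append]
    exact ((ih hL.of_cons.2).mul_left _).mul_left _

variable [FiniteDimensional k V] {F : IsFrob R d t}

lemma DownMap.lt (h : DownMap F s s' f) (hL : IsFrob.LtList d s.2) :
    (cls (nfWord hd s')).LT (cls (nfWord hd s)) := by
  induction h with
  | @merge x y g L a b c f had hbd hc h hg hf =>
    subst hg
    refine .single ?_
    simp only [nfWord_cons, cls_append, cls_ltr]
    convert LambdaStep.down (d := d) (cls (rdPow ⟨hd, le_rfl⟩ x)) (cls (nfWord hd (y, L))) a b had hbd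
      (by omega) using 1
    · rw [show a + b - d = c by omega]
      simp only [mul_assoc]
    · simp only [mul_assoc, show rdPow (d := d) ⟨hd, le_rfl⟩ (-1) = [.rdInv] from rfl]
  | @delete x y g z L a b f had hbd h hg hz hf =>
    subst hg
    refine .single ?_
    have h1 : cls (nfWord hd (z, L)) = cls (rdPow ⟨hd, le_rfl⟩ x ++ nfWord hd (y, L)) := by
      have hL' : IsFrob.LtList d L := fun p hp => hL p (by simp [hp])
      refine cls_eq_of_nf hd ?_
      rw [nf_rdPow_append hd, nf_nfWord hd hL', nf_nfWord hd hL', hz]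
    rw [h1]
    simp only [nfWord_cons, cls_append, cls_ltr]
    convert LambdaStep.down (d := d) (cls (rdPow ⟨hd, le_rfl⟩ x)) (cls (nfWord hd (y, L))) a b had hbd
      (by omega) using 1
    · rw [show a + b - d = 0 by omega, rr, dif_neg (by omega), mul_one]
    · simp only [mul_assoc, show rdPow (d := d) ⟨hd, le_rfl⟩ (-1) = [.rdInv] from rfl]
  | whisker ha had hU hg ih =>
    simp only [nfWord_cons, cls_append]
    exact ((ih hL.of_cons.2).mul_left _).mul_left _

end Words

/-! ### Embedding of the comodules `M(w)` in the tensor algebra -/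

section Realization
variable {k V : Type u} [Field k] [AddCommGroup V] [Module k V] [FiniteDimensional k V]
  {R : Submodule k (V ⊗[k] V)} {d : ℕ} {t : TensorAlgebra k V}
  {H : Type u} [Ring H] [HopfAlgebra k H]

lemma IsFrob.exists_tau (F : IsFrob R d t) : ∃ f : Module.Dual k (TensorAlgebra k V), f t = 1 :=
  Module.Projective.exists_dual_eq_one k F.ne_zero

/-- A functional with value `1` on the generator of `R_d`. -/
def IsFrob.tau (F : IsFrob R d t) : Module.Dual k (TensorAlgebra k V) :=
  Classical.choose F.exists_tau

lemma IsFrob.tau_t (F : IsFrob R d t) : F.tau t = 1 := Classical.choose_spec F.exists_tau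

lemma IsFrob.eq_tau_smul (F : IsFrob R d t) {x} (hx : x ∈ Rsub R d) : x = F.tau x • t := by
  obtain ⟨a, rfl⟩ := F.exists_smul x hx
  rw [map_smul, F.tau_t, smul_eq_mul, mul_one]

namespace Coaction
variable (c : Coaction R H) (F : IsFrob R d t)

/-- The action of the elements of `M(l)` on `TV`, where `R_d` and its dual act by scalars. -/
def act (F : IsFrob R d t) : (l : Letter d) → c.L l →ₗ[k] TensorAlgebra k V →ₗ[k] TensorAlgebra k V
  | .r a _ => if a = d then LinearMap.lsmul k _ ∘ₗ F.tau ∘ₗ (Rsub R a).subtype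
      else LinearMap.mul k _ ∘ₗ (Rsub R a).subtype
  | .rdInv => LinearMap.lsmul k _ ∘ₗ Module.Dual.eval k (Rsub R d) ⟨t, F.mem⟩

lemma act_r {a : ℕ} (h : 1 ≤ a ∧ a ≤ d) (had : a < d) (x : Rsub R a) (z : TensorAlgebra k V) :
    c.act F (.r a h) x z = x * z := by
  rw [act, if_neg had.ne]
  rfl

lemma act_rd (h : 1 ≤ d ∧ d ≤ d) (x : Rsub R d) (z : TensorAlgebra k V) :
    c.act F (.r d h) x z = F.tau x • z := by
  rw [act, if_pos rfl]
  rfl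

lemma act_rdInv (ξ : Module.Dual k (Rsub R d)) (z : TensorAlgebra k V) :
    c.act F .rdInv ξ z = ξ ⟨t, F.mem⟩ • z := rfl

lemma act_mul (l : Letter d) (x : c.L l) (z w : TensorAlgebra k V) :
    c.act F l x (z * w) = c.act F l x z * w := by
  cases l with
  | r a h =>
    by_cases had : a = d
    · subst had
      rw [act_rd, act_rd, smul_mul_assoc]
    · rw [act_r _ _ _ (by omega), act_r _ _ _ (by omega), mul_assoc]
  | rdInv => rw [act_rdInv, act_rdInv, smul_mul_assoc]

/-- The linear map `M(w) → TV` that forgets the powers of `r_d`. -/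
def toT (F : IsFrob R d t) : (w : Word d) → c.M w →ₗ[k] TensorAlgebra k V
  | [] => Algebra.linearMap k (TensorAlgebra k V)
  | l :: w => TensorProduct.lift ((c.act F l).compl₂ (toT F w))

lemma toT_nil (r : k) : c.toT F [] r = algebraMap k _ r := rfl

lemma toT_cons (l : Letter d) (w : Word d) (x : c.L l) (z : c.M w) :
    c.toT F (l :: w) (x ⊗ₜ[k] z) = c.act F l x (c.toT F w z) := rfl

lemma exists_rd_tmul (F : IsFrob R d t) {X : Type u} [AddCommGroup X] [Module k X]
    (z : Rsub R d ⊗[k] X) : ∃ y, z = (⟨t, F.mem⟩ : Rsub R d) ⊗ₜ[k] y := by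
  induction z with
  | zero => exact ⟨0, by simp⟩
  | add a b ha hb =>
    obtain ⟨y, rfl⟩ := ha
    obtain ⟨y', rfl⟩ := hb
    exact ⟨y + y', by rw [TensorProduct.tmul_add]⟩
  | tmul x y =>
    refine ⟨F.tau x • y, ?_⟩
    rw [← TensorProduct.smul_tmul]
    congr 1
    exact Subtype.ext (F.eq_tau_smul x.2)

lemma exists_dual_tmul (F : IsFrob R d t) {X : Type u} [AddCommGroup X] [Module k X]
    (z : Module.Dual k (Rsub R d) ⊗[k] X) : ∃ y, z = (F.tau ∘ₗ (Rsub R d).subtype) ⊗ₜ[k] y := by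
  induction z with
  | zero => exact ⟨0, by simp⟩
  | add a b ha hb =>
    obtain ⟨y, rfl⟩ := ha
    obtain ⟨y', rfl⟩ := hb
    exact ⟨y + y', by rw [TensorProduct.tmul_add]⟩
  | tmul ξ y =>
    refine ⟨ξ ⟨t, F.mem⟩ • y, ?_⟩
    rw [← TensorProduct.smul_tmul]
    congr 1
    refine LinearMap.ext fun x => ?_
    have h : x = F.tau x • (⟨t, F.mem⟩ : Rsub R d) := Subtype.ext (F.eq_tau_smul x.2)
    rw [congrArg ξ h, map_smul, smul_eq_mul, LinearMap.smul_apply, smul_eq_mul, mul_comm]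
    rfl

lemma toT_rd (h : 1 ≤ d ∧ d ≤ d) (w : Word d) (z : c.M w) :
    c.toT F (.r d h :: w) ((⟨t, F.mem⟩ : Rsub R d) ⊗ₜ[k] z) = c.toT F w z := by
  rw [toT_cons, act_rd]
  simp [F.tau_t]

lemma toT_rdInv (w : Word d) (z : c.M w) :
    c.toT F (.rdInv :: w) ((F.tau ∘ₗ (Rsub R d).subtype) ⊗ₜ[k] z) = c.toT F w z := by
  rw [toT_cons, act_rdInv]
  simp [F.tau_t]

lemma toT_r {a : ℕ} (h : 1 ≤ a ∧ a ≤ d) (had : a < d) (w : Word d) :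
    c.toT F (.r a h :: w) = tmul (Rsub R a).subtype (c.toT F w) := by
  refine TensorProduct.ext' fun x z => ?_
  rw [toT_cons, act_r _ _ _ had, tmul_tmul]
  rfl

/-- The letters `r_d` and `r_d⁻¹` act by scalars that equal `1` on the generators `t` and `τ`, so
only the letters of the normal form contribute to the image. -/
lemma range_toT (w : Word d) : LinearMap.range (c.toT F w) = prodSub R (nf w).2 := by
  induction w with
  | nil => exact Submodule.one_eq_range.symm
  | cons l w ih =>
    rw [nf_cons]
    cases l with
    | r a h =>
      by_cases had : a = d
      · subst had
        rw [nfCons_rd, ← ih]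
        apply le_antisymm
        · rintro _ ⟨z, rfl⟩
          obtain ⟨y, rfl⟩ := exists_rd_tmul F z
          rw [toT_rd]
          exact ⟨y, rfl⟩
        · rintro _ ⟨y, rfl⟩
          exact ⟨_, c.toT_rd F h w y⟩
      · have had : a < d := by omega
        rw [nfCons_r _ had, toT_r _ _ _ had, range_tmul, ih, Submodule.range_subtype]
        rfl
    | rdInv =>
      rw [nfCons_rdInv, ← ih]
      apply le_antisymm
      · rintro _ ⟨z, rfl⟩
        obtain ⟨y, rfl⟩ := exists_dual_tmul F z
        rw [toT_rdInv]
        exact ⟨y, rfl⟩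
      · rintro _ ⟨y, rfl⟩
        exact ⟨_, c.toT_rdInv F w y⟩

lemma toT_mem (w : Word d) (z : c.M w) : c.toT F w z ∈ prodSub R (nf w).2 :=
  c.range_toT F w ▸ ⟨z, rfl⟩

/-- A letter `r_d^{±1}` is a line, so tensors starting with it have the form `t ⊗ y` or `τ ⊗ y` and
lose nothing. For the other letters, products of homogeneous subspaces are tensor products. -/
lemma toT_injective (w : Word d) : Function.Injective (c.toT F w) := by
  induction w with
  | nil => exact FaithfulSMul.algebraMap_injective k _
  | cons l w ih =>
    rw [injective_iff_map_eq_zero] at ih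
    cases l with
    | r a h =>
      by_cases had : a = d
      · subst had
        rw [injective_iff_map_eq_zero]
        intro z hz
        obtain ⟨y, rfl⟩ := exists_rd_tmul F z
        rw [toT_rd] at hz
        rw [ih y hz, TensorProduct.tmul_zero]
      · rw [toT_r _ _ _ (by omega)]
        exact tmul_injective (Rsub R a).injective_subtype ((injective_iff_map_eq_zero _).2 ih)
          (fun x => Rsub_le a x.2) (fun y => prodSub_le _ (c.toT_mem F w y))
    | rdInv =>
      rw [injective_iff_map_eq_zero]
      intro z hz
      obtain ⟨y, rfl⟩ := exists_dual_tmul F z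
      rw [toT_rdInv] at hz
      rw [ih y hz, TensorProduct.tmul_zero]

/-- The isomorphism `M(u) ⊗ M(v) ≅ M(uv)`. -/
def appendEquiv : (u v : Word d) → c.M u ⊗[k] c.M v ≃ₗ[k] c.M (u ++ v)
  | [], v => TensorProduct.lid k (c.M v)
  | l :: u, v => TensorProduct.assoc k (c.L l) (c.M u) (c.M v) ≪≫ₗ
      (appendEquiv u v).lTensor (c.L l)

lemma appendEquiv_cons (l : Letter d) (u v : Word d) (x : c.L l) (y : c.M u) (z : c.M v) :
    c.appendEquiv (l :: u) v ((x ⊗ₜ[k] y) ⊗ₜ[k] z) = x ⊗ₜ[k] c.appendEquiv u v (y ⊗ₜ[k] z) := rfl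

lemma toT_appendEquiv (u v : Word d) (y : c.M u) (z : c.M v) :
    c.toT F (u ++ v) (c.appendEquiv u v (y ⊗ₜ[k] z)) = c.toT F u y * c.toT F v z := by
  induction u with
  | nil =>
    change c.toT F v (y • z) = _
    rw [map_smul, toT_nil, Algebra.smul_def]
  | cons l u ih =>
    induction y using TensorProduct.induction_on with
    | zero => simp
    | add a b ha hb =>
      simp only [TensorProduct.add_tmul, map_add, ha, hb, add_mul]
    | tmul x y =>
      rw [appendEquiv_cons, toT_cons, ← act_mul, ← ih y]
      rfl

end Coaction
end Realization

/-! ### Comodule morphisms and the coaction on `R_d` -/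

section ComoduleMaps
variable {k : Type u} [Field k] {H : Type u} [Ring H] [HopfAlgebra k H]
namespace Comod
variable {X Y Z W : Comod k H}

lemma isHom_iff {f : X →ₗ[k] Y} : IsHom f ↔ Y.ρ ∘ₗ f = f.lTensor H ∘ₗ X.ρ :=
  ⟨fun h => LinearMap.ext h, fun h => LinearMap.congr_fun h⟩

lemma isHom_id : IsHom (LinearMap.id : X →ₗ[k] X) := fun x => by simp

lemma IsHom.comp {f : X →ₗ[k] Y} {g : Y →ₗ[k] Z} (hg : IsHom g) (hf : IsHom f) :
    IsHom (g ∘ₗ f) := fun x => by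
  rw [LinearMap.comp_apply, hg, hf, LinearMap.lTensor_comp, LinearMap.comp_apply]

lemma IsHom.of_comp {f : X →ₗ[k] Y} {g : Y →ₗ[k] Z} (hg : IsHom g) (hgf : IsHom (g ∘ₗ f))
    (h : Function.Injective g) : IsHom f := fun x => by
  apply Module.Flat.lTensor_preserves_injective_linearMap (M := H) g h
  rw [← hg, ← LinearMap.lTensor_comp_apply]
  exact hgf x

lemma IsHom.of_comp_surjective {f : X →ₗ[k] Y} {g : Y →ₗ[k] Z} (hf : IsHom f)
    (hgf : IsHom (g ∘ₗ f)) (h : Function.Surjective f) : IsHom g := fun y => by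
  obtain ⟨x, rfl⟩ := h y
  rw [hf, ← LinearMap.lTensor_comp_apply]
  exact hgf x

lemma IsHom.symm {e : X ≃ₗ[k] Y} (h : IsHom (e : X →ₗ[k] Y)) : IsHom (e.symm : Y →ₗ[k] X) := by
  refine IsHom.of_comp h ?_ e.injective
  rw [LinearEquiv.comp_symm]
  exact isHom_id

lemma mulTensor_map {A B C D : Type u} [AddCommGroup A] [Module k A] [AddCommGroup B] [Module k B]
    [AddCommGroup C] [Module k C] [AddCommGroup D] [Module k D] (f : A →ₗ[k] C) (g : B →ₗ[k] D)
    (z : H ⊗[k] A) (w : H ⊗[k] B) : mulTensor C D (f.lTensor H z ⊗ₜ g.lTensor H w) =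
      (TensorProduct.map f g).lTensor H (mulTensor A B (z ⊗ₜ w)) := by
  induction z with
  | zero => simp
  | add a b ha hb => simp only [map_add, TensorProduct.add_tmul, ha, hb]
  | tmul h x =>
    induction w with
    | zero => simp
    | add a b ha hb => simp only [map_add, TensorProduct.tmul_add, ha, hb]
    | tmul h' y => simp

lemma tensor_ρ (x : X) (y : Y) : (X.tensor Y).ρ (x ⊗ₜ[k] y) = mulTensor X Y (X.ρ x ⊗ₜ Y.ρ y) := rfl

lemma IsHom.map {f : X →ₗ[k] Y} {g : Z →ₗ[k] W} (hf : IsHom f) (hg : IsHom g) :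
    IsHom (X := X.tensor Z) (Y := Y.tensor W) (TensorProduct.map f g) := by
  refine isHom_iff.2 (TensorProduct.ext' fun x z => ?_)
  rw [LinearMap.comp_apply, TensorProduct.map_tmul, tensor_ρ, hf, hg, mulTensor_map]
  rfl

lemma IsHom.lTensor {g : Z →ₗ[k] W} (hg : IsHom g) (X : Comod k H) :
    IsHom (X := X.tensor Z) (Y := X.tensor W) (g.lTensor X) := IsHom.map isHom_id hg

lemma IsHom.rTensor {g : Z →ₗ[k] W} (hg : IsHom g) (X : Comod k H) :
    IsHom (X := Z.tensor X) (Y := W.tensor X) (g.rTensor X) := IsHom.map hg isHom_id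

lemma isHom_assoc (X Y Z : Comod k H) : IsHom (X := (X.tensor Y).tensor Z) (Y := X.tensor (Y.tensor Z))
    (TensorProduct.assoc k X Y Z : (X ⊗[k] Y) ⊗[k] Z →ₗ[k] X ⊗[k] (Y ⊗[k] Z)) := by
  have h (a : H ⊗[k] X) (b : H ⊗[k] Y) (e : H ⊗[k] Z) :
      mulTensor X (Y ⊗[k] Z) (a ⊗ₜ mulTensor Y Z (b ⊗ₜ e)) =
      (TensorProduct.assoc k X Y Z : (X ⊗[k] Y) ⊗[k] Z →ₗ[k] X ⊗[k] (Y ⊗[k] Z)).lTensor H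
        (mulTensor (X ⊗[k] Y) Z (mulTensor X Y (a ⊗ₜ b) ⊗ₜ e)) := by
    induction a with
    | zero => simp
    | add a b ha hb => simp only [map_add, TensorProduct.add_tmul, ha, hb]
    | tmul g x =>
      induction b with
      | zero => simp
      | add a b ha hb => simp only [map_add, TensorProduct.add_tmul, TensorProduct.tmul_add, ha, hb]
      | tmul g' y =>
        induction e with
        | zero => simp
        | add a b ha hb => simp only [map_add, TensorProduct.tmul_add, ha, hb]
        | tmul g'' z => simp [mul_assoc]
  exact isHom_iff.2 (TensorProduct.ext_threefold fun x y z => h _ _ _)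

lemma isHom_lid (X : Comod k H) : IsHom (X := (unit k H).tensor X) (Y := X)
    (TensorProduct.lid k X : k ⊗[k] X →ₗ[k] X) := by
  refine isHom_iff.2 (TensorProduct.ext' fun r x => ?_)
  have h (a : H ⊗[k] X) : r • a = (TensorProduct.lid k X : k ⊗[k] X →ₗ[k] X).lTensor H
      (mulTensor k X ((1 ⊗ₜ r) ⊗ₜ a)) := by
    induction a with
    | zero => simp
    | add a b ha hb => simp only [smul_add, map_add, TensorProduct.tmul_add, ha, hb]
    | tmul g x => simp
  exact (map_smul _ _ _).trans (h (X.ρ x))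

lemma isHom_subtype (X : Comod k H) (N : Submodule k X) (h : X.Stable N) :
    IsHom (X := X.sub N h) (Y := X) N.subtype := fun x => (restrict_spec X.ρ N h x).symm

lemma isHom_mkQ (X : Comod k H) (N : Submodule k X) (h : X.Stable N) :
    IsHom (X := X) (Y := X.quot N h) N.mkQ := fun _ => rfl

/-- The coaction on the dual, by evaluation at an element. -/
lemma rid_dualρ (X : Comod k H) (f : Module.Dual k X) (x : X) :
    TensorProduct.rid k H ((Module.Dual.eval k X x).lTensor H (X.dualρ f)) =
      HopfAlgebra.antipode k (X.coeff f x) := by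
  have h : (TensorProduct.rid k H).toLinearMap ∘ₗ (LinearMap.lTensorHom H).flip (X.dualρ f) ∘ₗ
      Module.Dual.eval k X = HopfAlgebra.antipode k ∘ₗ (TensorProduct.rid k H).toLinearMap ∘ₗ
        f.lTensor H ∘ₗ X.ρ := by
    refine (Module.finBasis k X).ext fun i => ?_
    simp [dualρ_apply, coeff, Finsupp.single_apply]
  exact LinearMap.congr_fun h x

end Comod

namespace Coaction
variable {V : Type u} [AddCommGroup V] [Module k V] [FiniteDimensional k V]
  {R : Submodule k (V ⊗[k] V)} {d : ℕ} {t : TensorAlgebra k V} (c : Coaction R H)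

lemma RComod_ρ {a : ℕ} (x : Rsub R a) :
    (Rsub R a).subtype.lTensor H ((c.RComod a).ρ x) = c.δT x :=
  Comod.restrict_spec c.δT.toLinearMap (Rsub R a) (c.stableT_Rsub a) x

lemma δT_mulMap {a b : ℕ} (z : Rsub R a ⊗[k] Rsub R b) :
    c.δT (Submodule.mulMap (Rsub R a) (Rsub R b) z) =
      (Submodule.mulMap (Rsub R a) (Rsub R b)).lTensor H
        (((c.RComod a).tensor (c.RComod b)).ρ z) := by
  have h (x : H ⊗[k] Rsub R a) (y : H ⊗[k] Rsub R b) : (Rsub R a).subtype.lTensor H x *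
      (Rsub R b).subtype.lTensor H y = (Submodule.mulMap (Rsub R a) (Rsub R b)).lTensor H
        (Comod.mulTensor _ _ (x ⊗ₜ y)) := by
    induction x with
    | zero => simp
    | add a b ha hb => simp only [map_add, TensorProduct.add_tmul, add_mul, ha, hb]
    | tmul g x =>
      induction y with
      | zero => simp
      | add a b ha hb => simp only [map_add, TensorProduct.tmul_add, mul_add, ha, hb]
      | tmul g' y => simp
  induction z with
  | zero => simp
  | add a b ha hb => simp only [map_add, ha, hb]
  | tmul x y =>
    rw [Submodule.mulMap_tmul, map_mul, Comod.tensor_ρ, ← h, RComod_ρ, RComod_ρ]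

/-- Multiplication `R_a ⊗ R_b → TV` is injective and compatible with the coactions, because the
coaction on `TV` is an algebra morphism. Composed with it, `g` becomes the inclusion of `R_e` in
`TV`. -/
lemma isHom_of_isIncl {a b e : ℕ} {g : Rsub R e →ₗ[k] Rsub R a ⊗[k] Rsub R b} (hg : IsIncl R g) :
    Comod.IsHom (X := c.RComod e) (Y := (c.RComod a).tensor (c.RComod b)) g := by
  have hinj : Function.Injective (Submodule.mulMap (Rsub R a) (Rsub R b)) := by
    have h := tmul_injective (Rsub R a).injective_subtype (Rsub R b).injective_subtype
      (fun x => Rsub_le a x.2) (fun x => Rsub_le b x.2)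
    rwa [show tmul (Rsub R a).subtype (Rsub R b).subtype = Submodule.mulMap (Rsub R a) (Rsub R b) from
      TensorProduct.ext' fun x y => by simp] at h
  intro x
  apply Module.Flat.lTensor_preserves_injective_linearMap (M := H) _ hinj
  rw [← δT_mulMap, hg x, ← RComod_ρ, ← LinearMap.lTensor_comp_apply]
  congr 2
  exact LinearMap.ext fun x => (hg x).symm

/-- `R_d` is spanned by an element with a group-like coefficient. -/
lemma exists_groupLike (F : IsFrob R d t) : ∃ γ : H,
    (c.RComod d).ρ ⟨t, F.mem⟩ = γ ⊗ₜ[k] (⟨t, F.mem⟩ : Rsub R d) ∧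
    (c.RComod d).dualρ (F.tau ∘ₗ (Rsub R d).subtype) =
      HopfAlgebra.antipode k γ ⊗ₜ[k] (F.tau ∘ₗ (Rsub R d).subtype) ∧
    HopfAlgebra.antipode k γ * γ = 1 ∧ γ * HopfAlgebra.antipode k γ = 1 := by
  set t₀ : Rsub R d := ⟨t, F.mem⟩ with ht₀
  set ξ : Module.Dual k (Rsub R d) := F.tau ∘ₗ (Rsub R d).subtype with hξ
  have hξt : ξ t₀ = 1 := F.tau_t
  have h1 (z : H ⊗[k] Rsub R d) : z = TensorProduct.rid k H (ξ.lTensor H z) ⊗ₜ[k] t₀ := by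
    induction z with
    | zero => simp
    | add a b ha hb =>
      conv_lhs => rw [ha, hb]
      rw [map_add, map_add, TensorProduct.add_tmul]
    | tmul g x =>
      have : x = ξ x • t₀ := Subtype.ext (F.eq_tau_smul x.2)
      conv_lhs => rw [this]
      simp [TensorProduct.smul_tmul]
  have h2 (z : H ⊗[k] Module.Dual k (Rsub R d)) :
      z = TensorProduct.rid k H ((Module.Dual.eval k _ t₀).lTensor H z) ⊗ₜ[k] ξ := by
    induction z with
    | zero => simp
    | add a b ha hb =>
      conv_lhs => rw [ha, hb]
      rw [map_add, map_add, TensorProduct.add_tmul]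
    | tmul g η =>
      have : η = η t₀ • ξ := by
        refine LinearMap.ext fun x => ?_
        have h : x = ξ x • t₀ := Subtype.ext (F.eq_tau_smul x.2)
        rw [congrArg η h, map_smul, smul_eq_mul, LinearMap.smul_apply, smul_eq_mul, mul_comm]
      conv_lhs => rw [this]
      simp [TensorProduct.smul_tmul]
  have hγ := h1 ((c.RComod d).ρ t₀)
  set γ : H := (c.RComod d).coeff ξ t₀ with hγdef
  change (c.RComod d).ρ t₀ = γ ⊗ₜ[k] t₀ at hγ
  have h3 : Coalgebra.comul (R := k) γ = γ ⊗ₜ[k] γ := by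
    have h := (c.RComod d).coassoc t₀
    rw [hγ, LinearMap.rTensor_tmul, LinearMap.lTensor_tmul, hγ] at h
    have h' := congrArg (fun z => TensorProduct.rid k (H ⊗[k] H)
      (ξ.lTensor (H ⊗[k] H) ((TensorProduct.assoc k H H (Rsub R d)).symm z))) h
    simpa [hξt] using h'
  have h4 : Coalgebra.counit (R := k) γ = 1 := by
    have h := (c.RComod d).counit t₀
    rw [hγ, LinearMap.rTensor_tmul] at h
    have h' := congrArg ξ h
    simpa [hξt] using h'
  refine ⟨γ, hγ, ?_, ?_, ?_⟩
  · rw [h2 ((c.RComod d).dualρ ξ), (c.RComod d).rid_dualρ ξ t₀]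
  · have h := HopfAlgebra.mul_antipode_rTensor_comul_apply (R := k) γ
    simpa [h3, h4] using h
  · have h := HopfAlgebra.mul_antipode_lTensor_comul_apply (R := k) γ
    simpa [h3, h4] using h

end Coaction
end ComoduleMaps

/-! ### The maps coming from `U` are comodule morphisms -/

section Homs
variable {k : Type u} [Field k] {H : Type u} [Ring H] [HopfAlgebra k H]
  {V : Type u} [AddCommGroup V] [Module k V] [FiniteDimensional k V]
  {R : Submodule k (V ⊗[k] V)} {d : ℕ} {t : TensorAlgebra k V}
namespace Coaction
variable (c : Coaction R H)

/-- The evaluation `R_d ⊗ R_d^* → k`. -/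
def evR (R : Submodule k (V ⊗[k] V)) (d : ℕ) : Rsub R d ⊗[k] Module.Dual k (Rsub R d) →ₗ[k] k :=
  TensorProduct.lift (Module.Dual.eval k (Rsub R d))

/-- The evaluation `R_d^* ⊗ R_d → k`. -/
def evL (R : Submodule k (V ⊗[k] V)) (d : ℕ) : Module.Dual k (Rsub R d) ⊗[k] Rsub R d →ₗ[k] k :=
  TensorProduct.lift LinearMap.id

/-- The coaction multiplies `t` by a group-like `γ` and its dual `τ` by `S(γ)`; colinearity is `γ
S(γ) = 1`. -/
lemma isHom_evR (F : IsFrob R d t) : Comod.IsHom (X := (c.RComod d).tensor (c.RComod d).dual)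
    (Y := Comod.unit k H) (evR R d) := by
  obtain ⟨γ, h1, h2, h3, h4⟩ := c.exists_groupLike F
  intro z
  obtain ⟨ξ, rfl⟩ := exists_rd_tmul F z
  have hξ : ξ = ξ ⟨t, F.mem⟩ • (F.tau ∘ₗ (Rsub R d).subtype) := by
    refine LinearMap.ext fun x => ?_
    have h : x = F.tau x • (⟨t, F.mem⟩ : Rsub R d) := Subtype.ext (F.eq_tau_smul x.2)
    conv_lhs => rw [h]
    rw [map_smul, smul_eq_mul, LinearMap.smul_apply, smul_eq_mul, mul_comm]
    rfl
  rw [hξ, TensorProduct.tmul_smul, map_smul, map_smul, map_smul, map_smul]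
  congr 1
  rw [Comod.tensor_ρ]
  change _ = (evR R d).lTensor H (Comod.mulTensor _ _ ((c.RComod d).ρ _ ⊗ₜ (c.RComod d).dualρ _))
  rw [h1, h2, Comod.mulTensor_tmul, LinearMap.lTensor_tmul, h4]
  rfl

lemma isHom_evL (F : IsFrob R d t) : Comod.IsHom (X := (c.RComod d).dual.tensor (c.RComod d))
    (Y := Comod.unit k H) (evL R d) := by
  obtain ⟨γ, h1, h2, h3, h4⟩ := c.exists_groupLike F
  intro z
  obtain ⟨x, rfl⟩ := exists_dual_tmul F z
  have hx : x = F.tau x • (⟨t, F.mem⟩ : Rsub R d) := Subtype.ext (F.eq_tau_smul x.2)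
  rw [hx, TensorProduct.tmul_smul, map_smul, map_smul, map_smul, map_smul]
  congr 1
  rw [Comod.tensor_ρ]
  change _ = (evL R d).lTensor H (Comod.mulTensor _ _ ((c.RComod d).dualρ _ ⊗ₜ (c.RComod d).ρ _))
  rw [h1, h2, Comod.mulTensor_tmul, LinearMap.lTensor_tmul, h3]
  rfl

/-- A pairing, as a linear map on the tensor product. -/
def pairingMap {a b : ℕ} (e : Rsub R a →ₗ[k] Module.Dual k (Rsub R d) →ₗ[k] Rsub R b →ₗ[k] k) :
    Rsub R a ⊗[k] (Module.Dual k (Rsub R d) ⊗[k] Rsub R b) →ₗ[k] k :=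
  TensorProduct.lift (TensorProduct.uncurry (.id k) _ _ _ ∘ₗ e)

/-- Let `A` and `B` be the coefficient matrices of the coaction in dual bases of `R_a` and `R_b`.
Colinearity of the inclusion `R_d → R_b ⊗ R_a` reads `Bᵀ A = γ`, whereas colinearity of the pairing
reads `A S(γ) Bᵀ = 1`. They are equivalent because `A` is invertible, its inverse being given by the
antipode. -/
lemma isHom_pairingMap (F : IsFrob R d t) {a b : ℕ}
    {e : Rsub R a →ₗ[k] Module.Dual k (Rsub R d) →ₗ[k] Rsub R b →ₗ[k] k} (he : IsPairing R e) :
    Comod.IsHom (X := (c.RComod a).tensor ((c.RComod d).dual.tensor (c.RComod b)))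
      (Y := Comod.unit k H) (pairingMap e) := by
  classical
  obtain ⟨γ, h1, h2, h3, h4⟩ := c.exists_groupLike F
  obtain ⟨g, hg, hg1, hg2⟩ := he
  set t₀ : Rsub R d := ⟨t, F.mem⟩ with ht₀
  set ξ : Module.Dual k (Rsub R d) := F.tau ∘ₗ (Rsub R d).subtype with hξ
  have hξt : ξ t₀ = 1 := F.tau_t
  let x := Module.finBasis k (c.RComod a)
  let A := (c.RComod a).mat
  have hA (i) : (c.RComod a).ρ (x i) = ∑ l, A i l ⊗ₜ[k] x l := (c.RComod a).rho_basis i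
  -- the second factors of the dual element
  obtain ⟨y, hy⟩ : ∃ y : Fin (Module.finrank k (c.RComod a)) → Rsub R b,
      g t₀ = ∑ i, y i ⊗ₜ[k] x i := by
    generalize g t₀ = z
    induction z with
    | zero => exact ⟨0, by simp⟩
    | add a b ha hb =>
      obtain ⟨y, rfl⟩ := ha
      obtain ⟨y', rfl⟩ := hb
      exact ⟨y + y', by simp [TensorProduct.add_tmul, Finset.sum_add_distrib]⟩
    | tmul v w =>
      refine ⟨fun i => x.coord i w • v, ?_⟩
      conv_lhs => rw [← x.sum_repr w, TensorProduct.tmul_sum]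
      exact Finset.sum_congr rfl fun i _ => (TensorProduct.smul_tmul _ _ _).symm
  have hexy (i j) : e (x i) ξ (y j) = if i = j then 1 else 0 := by
    have h := hg2 t₀ ξ (x i)
    rw [hy, hξt, one_smul] at h
    have h' := congrArg (x.coord j) h
    simpa [Finsupp.single_apply] using h'
  have hspan (v : Rsub R b) : v = ∑ l, e (x l) ξ v • y l := by
    have h := hg1 t₀ ξ v
    rw [hy, hξt, one_smul] at h
    conv_lhs => rw [← h]
    simp
  have hspan' (z : H ⊗[k] Rsub R b) :
      z = ∑ l, TensorProduct.rid k H ((e (x l) ξ).lTensor H z) ⊗ₜ[k] y l := by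
    induction z with
    | zero => simp
    | add a b ha hb =>
      conv_lhs => rw [ha, hb]
      simp only [map_add, TensorProduct.add_tmul, Finset.sum_add_distrib]
    | tmul h v =>
      conv_lhs => rw [hspan v]
      simp [TensorProduct.tmul_sum, TensorProduct.smul_tmul]
  let B : Matrix _ _ H := fun j l => (c.RComod b).coeff (e (x l) ξ) (y j)
  have hB (j) : (c.RComod b).ρ (y j) = ∑ l, B j l ⊗ₜ[k] y l := hspan' _
  have hBA : B.transpose * A = Matrix.diagonal fun _ => γ := by
    have h0 (i) : ((c.RComod b).tensor (c.RComod a)).ρ (y i ⊗ₜ[k] x i) =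
        ∑ l, ∑ j, (B i j * A i l) ⊗ₜ[k] (y j ⊗ₜ[k] x l) := by
      rw [Comod.tensor_ρ, hB, hA]
      simp only [TensorProduct.sum_tmul, TensorProduct.tmul_sum, map_sum, Comod.mulTensor_tmul]
    have h := c.isHom_of_isIncl hg t₀
    rw [h1, LinearMap.lTensor_tmul, hy] at h
    replace h := ((map_sum _ _ _).symm.trans h)
    simp only [h0, TensorProduct.tmul_sum] at h
    ext p q
    have h' := congrArg (fun z => TensorProduct.rid k H
      ((TensorProduct.lid k k ∘ₗ TensorProduct.map (e (x p) ξ) (x.coord q)).lTensor H z)) h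
    simp only [map_sum, LinearMap.lTensor_tmul, LinearMap.comp_apply, TensorProduct.map_tmul, hexy,
      TensorProduct.rid_tmul] at h'
    have hx (l) : x.coord q (x l) = if l = q then 1 else 0 := by simp [Finsupp.single_apply]
    simp only [hx, LinearEquiv.coe_coe, TensorProduct.lid_tmul, smul_eq_mul] at h'
    simpa [Matrix.mul_apply, Matrix.diagonal_apply] using h'
  -- Over a noncommutative ring a one-sided inverse does not suffice; it coincides with the
  -- two-sided inverse given by the antipode.
  have hAB : A * (Matrix.diagonal (fun _ => HopfAlgebra.antipode k γ) * B.transpose) = 1 := by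
    have h5 : (Matrix.diagonal (fun _ => HopfAlgebra.antipode k γ) * B.transpose) * A = 1 := by
      rw [Matrix.mul_assoc, hBA, Matrix.diagonal_mul_diagonal, h3, Matrix.diagonal_one]
    rw [left_inv_eq_right_inv h5 (c.RComod a).antipode_mat.2]
    exact (c.RComod a).antipode_mat.2
  have key (i j) : (Comod.unit k H).ρ (pairingMap e (x i ⊗ₜ (ξ ⊗ₜ y j))) = (pairingMap e).lTensor H
      (((c.RComod a).tensor ((c.RComod d).dual.tensor (c.RComod b))).ρ (x i ⊗ₜ (ξ ⊗ₜ y j))) := by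
    have h6 : ((c.RComod d).dual.tensor (c.RComod b)).ρ (ξ ⊗ₜ y j) =
        ∑ m, (HopfAlgebra.antipode k γ * B j m) ⊗ₜ (ξ ⊗ₜ y m) := by
      rw [Comod.tensor_ρ, hB]
      change Comod.mulTensor _ _ ((c.RComod d).dualρ ξ ⊗ₜ _) = _
      simp only [h2, TensorProduct.tmul_sum, map_sum, Comod.mulTensor_tmul]
    rw [Comod.tensor_ρ, hA, h6]
    simp only [TensorProduct.sum_tmul, TensorProduct.tmul_sum, map_sum, Comod.mulTensor_tmul,
      LinearMap.lTensor_tmul]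
    have h7 (l m) : pairingMap e (x l ⊗ₜ (ξ ⊗ₜ y m)) = if l = m then 1 else 0 := hexy l m
    have h8 := congrFun (congrFun hAB i) j
    simp only [h7]
    have h10 : ∑ l, A i l * (HopfAlgebra.antipode k γ * B j l) = if i = j then 1 else 0 := by
      rw [Matrix.mul_apply] at h8
      simpa only [Matrix.diagonal_mul, Matrix.transpose_apply, Matrix.one_apply] using h8
    have h11 (m) : (∑ l, (A i l * (HopfAlgebra.antipode k γ * B j m)) ⊗ₜ[k]
        (if l = m then (1 : k) else 0)) = (A i m * (HopfAlgebra.antipode k γ * B j m)) ⊗ₜ[k] (1 : k) := by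
      rw [Finset.sum_eq_single m]
      · rw [if_pos rfl]
      · intro l _ hl
        rw [if_neg hl, TensorProduct.tmul_zero]
      · simp
    simp only [h11, ← TensorProduct.sum_tmul, h10]
    split_ifs
    · rfl
    · simp
  have hξ' (η : Module.Dual k (Rsub R d)) : η = η t₀ • ξ := by
    refine LinearMap.ext fun x => ?_
    have h : x = F.tau x • t₀ := Subtype.ext (F.eq_tau_smul x.2)
    rw [congrArg η h, map_smul, smul_eq_mul, LinearMap.smul_apply, smul_eq_mul, mul_comm]
    rfl
  refine Comod.isHom_iff.2 (TensorProduct.ext (x.ext fun i => ?_))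
  refine TensorProduct.ext' fun η v => ?_
  have h9 (f f' : Rsub R a ⊗[k] (Module.Dual k (Rsub R d) ⊗[k] Rsub R b) →ₗ[k] H ⊗[k] k)
      (hf : ∀ j, f (x i ⊗ₜ (ξ ⊗ₜ y j)) = f' (x i ⊗ₜ (ξ ⊗ₜ y j))) :
      f (x i ⊗ₜ (η ⊗ₜ v)) = f' (x i ⊗ₜ (η ⊗ₜ v)) := by
    rw [hspan v, hξ' η]
    simp only [TensorProduct.tmul_sum, TensorProduct.tmul_smul, ← TensorProduct.smul_tmul', map_sum,
      map_smul, hf]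
  exact h9 ((Comod.unit k H).ρ ∘ₗ pairingMap e) ((pairingMap e).lTensor H ∘ₗ
    ((c.RComod a).tensor ((c.RComod d).dual.tensor (c.RComod b))).ρ) (key i)

/-- All linear maps coming from `U` are morphisms of comodules. -/
theorem InU.isHom (F : IsFrob R d t) {w w' : Word d} {f : c.M w →ₗ[k] c.M w'} (h : c.InU w w' f) :
    Comod.IsHom f := by
  have mulInv_isHom (h : 1 ≤ d ∧ d ≤ d) (w : Word d) (f : c.M (.r d h :: .rdInv :: w) ≃ₗ[k] c.M w)
      (hf : ∀ (t : Rsub R d) (ξ : Module.Dual k (Rsub R d)) (m : c.M w),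
        f (t ⊗ₜ[k] (ξ ⊗ₜ[k] m)) = ξ t • m) :
      Comod.IsHom (f : c.M (.r d h :: .rdInv :: w) →ₗ[k] c.M w) := by
    have h1 := ((Comod.isHom_lid (c.M w)).comp ((c.isHom_evR F).rTensor (c.M w))).comp
      (Comod.isHom_assoc (c.RComod d) (c.RComod d).dual (c.M w)).symm
    convert h1 using 1
    refine TensorProduct.ext (LinearMap.ext fun x => TensorProduct.ext' fun ξ m => ?_)
    exact hf x ξ m
  have invMul_isHom (h : 1 ≤ d ∧ d ≤ d) (w : Word d) (f : c.M (.rdInv :: .r d h :: w) ≃ₗ[k] c.M w)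
      (hf : ∀ (t : Rsub R d) (ξ : Module.Dual k (Rsub R d)) (m : c.M w),
        f (ξ ⊗ₜ[k] (t ⊗ₜ[k] m)) = ξ t • m) :
      Comod.IsHom (f : c.M (.rdInv :: .r d h :: w) →ₗ[k] c.M w) := by
    have h1 := ((Comod.isHom_lid (c.M w)).comp ((c.isHom_evL F).rTensor (c.M w))).comp
      (Comod.isHom_assoc (c.RComod d).dual (c.RComod d) (c.M w)).symm
    convert h1 using 1
    refine TensorProduct.ext (LinearMap.ext fun ξ => TensorProduct.ext' fun x m => ?_)
    exact hf x ξ m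
  induction h with
  | id w => exact Comod.isHom_id
  | comp _ _ ih ih' => exact ih'.comp ih
  | whisker l _ ih => exact ih.lTensor _
  | phi a b ha hb hab w g hg f hf =>
    have h1 := (Comod.isHom_assoc (c.RComod a) (c.RComod b) (c.M w)).comp
      ((c.isHom_of_isIncl hg).rTensor (c.M w))
    convert h1 using 1
    exact TensorProduct.ext' fun x m => hf x m
  | theta a b ha hb hab w e he f hf =>
    have h1 := (((Comod.isHom_lid (c.M w)).comp ((c.isHom_pairingMap F he).rTensor (c.M w))).comp
      (Comod.isHom_assoc (c.RComod a) ((c.RComod d).dual.tensor (c.RComod b)) (c.M w)).symm).comp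
        ((Comod.isHom_assoc (c.RComod d).dual (c.RComod b) (c.M w)).symm.lTensor (c.RComod a))
    convert h1 using 1
    refine TensorProduct.ext (LinearMap.ext fun x => TensorProduct.ext (LinearMap.ext fun ξ =>
      TensorProduct.ext' fun y m => ?_))
    exact hf x ξ y m
  | mulInv h w f hf => exact mulInv_isHom h w f hf
  | mulInv_symm h w f hf => exact (mulInv_isHom h w f hf).symm
  | invMul h w f hf => exact invMul_isHom h w f hf
  | invMul_symm h w f hf => exact (invMul_isHom h w f hf).symm

lemma isHom_appendEquiv (u v : Word d) : Comod.IsHom (X := (c.M u).tensor (c.M v)) (Y := c.M (u ++ v))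
    (c.appendEquiv u v : _ →ₗ[k] c.M (u ++ v)) := by
  induction u with
  | nil => exact Comod.isHom_lid (c.M v)
  | cons l u ih => exact (ih.lTensor (c.L l)).comp (Comod.isHom_assoc (c.L l) (c.M u) (c.M v))

end Coaction
end Homs

/-! ### Maps coming from `U` in terms of normal forms -/

section Representation
variable {k : Type u} [Field k] {H : Type u} [Ring H] [HopfAlgebra k H]
  {V : Type u} [AddCommGroup V] [Module k V] [FiniteDimensional k V]
  {R : Submodule k (V ⊗[k] V)} {d : ℕ} {t : TensorAlgebra k V}

lemma IsFrob.dual_apply (F : IsFrob R d t) (ξ : Module.Dual k (Rsub R d)) (x : Rsub R d) :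
    ξ x = F.tau x * ξ ⟨t, F.mem⟩ := by
  have h : x = F.tau x • (⟨t, F.mem⟩ : Rsub R d) := Subtype.ext (F.eq_tau_smul x.2)
  rw [congrArg ξ h, map_smul, smul_eq_mul]

lemma exists_isIncl (R : Submodule k (V ⊗[k] V)) {a b e : ℕ} (h : a + b = e) :
    ∃ g : Rsub R e →ₗ[k] Rsub R a ⊗[k] Rsub R b, IsIncl R g := by
  have hinj : Function.Injective (tmul (Rsub R a).subtype (Rsub R b).subtype) :=
    tmul_injective (Rsub R a).injective_subtype (Rsub R b).injective_subtype
      (fun x => Rsub_le a x.2) (fun x => Rsub_le b x.2)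
  have hr : Rsub R e ≤ LinearMap.range (tmul (Rsub R a).subtype (Rsub R b).subtype) := by
    rw [range_tmul, Submodule.range_subtype, Submodule.range_subtype]
    exact Rsub_le_mul h
  refine ⟨(LinearEquiv.ofInjective _ hinj).symm.toLinearMap ∘ₗ Submodule.inclusion hr, fun x => ?_⟩
  have h1 := congrArg Subtype.val
    ((LinearEquiv.ofInjective _ hinj).apply_symm_apply (Submodule.inclusion hr x))
  have h2 : tmul (Rsub R a).subtype (Rsub R b).subtype = Submodule.mulMap (Rsub R a) (Rsub R b) :=
    TensorProduct.ext' fun x y => by simp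
  rw [← h2]
  exact h1

lemma cR_mulMap {a b : ℕ} (φ : Module.Dual k (TensorAlgebra k V)) (z : Rsub R a ⊗[k] Rsub R b) :
    cR b φ (Submodule.mulMap (Rsub R a) (Rsub R b) z) =
      TensorProduct.rid k (Rsub R a) ((φ ∘ₗ (Rsub R b).subtype).lTensor _ z) := by
  induction z with
  | zero => simp
  | add a b ha hb => simp only [map_add, ha, hb, Submodule.coe_add]
  | tmul x y => simp [cR_mul _ _ (Rsub_le b y.2)]

lemma cL_mulMap {a b : ℕ} (φ : Module.Dual k (TensorAlgebra k V)) (z : Rsub R a ⊗[k] Rsub R b) :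
    cL a φ (Submodule.mulMap (Rsub R a) (Rsub R b) z) =
      TensorProduct.lid k (Rsub R b) ((φ ∘ₗ (Rsub R a).subtype).rTensor _ z) := by
  induction z with
  | zero => simp
  | add a b ha hb => simp only [map_add, ha, hb, Submodule.coe_add]
  | tmul x y => simp [cL_mul _ (Rsub_le a x.2)]

/-- A pairing is given by the Frobenius structure. -/
lemma IsFrob.pairing_eq (F : IsFrob R d t) {a b : ℕ} (hab : a + b = d)
    {e : Rsub R a →ₗ[k] Module.Dual k (Rsub R d) →ₗ[k] Rsub R b →ₗ[k] k} (he : IsPairing R e)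
    (x : Rsub R a) (ξ : Module.Dual k (Rsub R d)) (y : Rsub R b) :
    e x ξ y = ξ ⟨t, F.mem⟩ * F.eta b y x := by
  obtain ⟨g, hg, h1, -⟩ := he
  obtain rfl : a = d - b := by omega
  have hb : b ≤ d := by omega
  let φ : Module.Dual k (TensorAlgebra k V) := (e.flip ξ).flip y ∘ₗ projSub (Rsub R (d - b))
  have hφ : φ ∘ₗ (Rsub R (d - b)).subtype = (e.flip ξ).flip y :=
    LinearMap.ext fun z => by simp [φ, projSub_coe]
  have h2 := cR_mulMap φ (g ⟨t, F.mem⟩)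
  rw [hg, hφ, h1] at h2
  have h3 := F.eta_eq hb φ x x.2
  rw [h2] at h3
  simp only [Submodule.coe_smul, map_smul, LinearMap.smul_apply, smul_eq_mul] at h3
  rw [h3]
  simp [φ, projSub_coe]

lemma IsFrob.exists_pairing (F : IsFrob R d t) {a b : ℕ} (hab : a + b = d) :
    ∃ e : Rsub R a →ₗ[k] Module.Dual k (Rsub R d) →ₗ[k] Rsub R b →ₗ[k] k, IsPairing R e := by
  obtain rfl : a = d - b := by omega
  have hb : b ≤ d := by omega
  obtain ⟨g, hg⟩ := exists_isIncl R (show b + (d - b) = d by omega)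
  let e : Rsub R (d - b) →ₗ[k] Module.Dual k (Rsub R d) →ₗ[k] Rsub R b →ₗ[k] k :=
    LinearMap.mk₂ k (fun x ξ => ξ ⟨t, F.mem⟩ • ((F.eta b).flip x ∘ₗ (Rsub R b).subtype))
      (fun x x' ξ => by
        rw [Submodule.coe_add, map_add, LinearMap.add_comp, smul_add])
      (fun r x ξ => by rw [Submodule.coe_smul, map_smul, LinearMap.smul_comp, smul_comm])
      (fun x ξ ξ' => by rw [LinearMap.add_apply, add_smul])
      (fun r x ξ => by rw [LinearMap.smul_apply, smul_assoc])
  refine ⟨e, g, hg, fun T ξ y => ?_, fun T ξ x => ?_⟩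
  · have h1 := cR_mulMap (ξ ⟨t, F.mem⟩ • F.eta b y) (g T)
    rw [hg, F.eq_tau_smul T.2, map_smul, map_smul, LinearMap.smul_apply, F.cR_eta hb y.2] at h1
    rw [F.dual_apply ξ T, mul_smul]
    exact Subtype.ext h1.symm
  · have h1 := cL_mulMap (ξ ⟨t, F.mem⟩ • (F.eta b).flip x) (g T)
    rw [hg, F.eq_tau_smul T.2, map_smul, map_smul, LinearMap.smul_apply, F.cL_eta hb x.2] at h1
    rw [F.dual_apply ξ T, mul_smul]
    exact Subtype.ext h1.symm

namespace Coaction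
variable (c : Coaction R H) (F : IsFrob R d t)

lemma toT_assoc {a b : ℕ} (ha : 1 ≤ a ∧ a ≤ d) (hb : 1 ≤ b ∧ b ≤ d) (had : a < d) (hbd : b < d)
    (w : Word d) (z : Rsub R a ⊗[k] Rsub R b) (m : c.M w) :
    c.toT F (.r a ha :: .r b hb :: w) (TensorProduct.assoc k (Rsub R a) (Rsub R b) (c.M w) (z ⊗ₜ m)) =
      Submodule.mulMap (Rsub R a) (Rsub R b) z * c.toT F w m := by
  induction z with
  | zero => simp
  | add x y hx hy => simp only [TensorProduct.add_tmul, map_add, hx, hy, add_mul]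
  | tmul x y =>
    rw [TensorProduct.assoc_tmul, toT_cons, toT_cons, act_r _ _ _ had, act_r _ _ _ hbd,
      Submodule.mulMap_tmul, mul_assoc]

lemma toT_mulInv (h : 1 ≤ d ∧ d ≤ d) (w : Word d) (t' : Rsub R d) (ξ : Module.Dual k (Rsub R d))
    (m : c.M w) : c.toT F (.r d h :: .rdInv :: w) (t' ⊗ₜ[k] (ξ ⊗ₜ[k] m)) = c.toT F w (ξ t' • m) := by
  rw [toT_cons, toT_cons, act_rd, act_rdInv, smul_smul, map_smul, F.dual_apply ξ t']

lemma toT_invMul (h : 1 ≤ d ∧ d ≤ d) (w : Word d) (t' : Rsub R d) (ξ : Module.Dual k (Rsub R d))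
    (m : c.M w) : c.toT F (.rdInv :: .r d h :: w) (ξ ⊗ₜ[k] (t' ⊗ₜ[k] m)) = c.toT F w (ξ t' • m) := by
  rw [toT_cons, toT_cons, act_rd, act_rdInv, smul_smul, map_smul, F.dual_apply ξ t', mul_comm]

variable {c F}

/-- Words that are linked by cancellations have isomorphic comodules. -/
lemma exists_equiv (F : IsFrob R d t) {u v : Word d} (h : WordEquiv d u v) :
    ∃ e : c.M u ≃ₗ[k] c.M v, c.InU u v e ∧ c.InU v u e.symm ∧ ∀ z, c.toT F v (e z) = c.toT F u z := by
  induction h with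
  | refl w => exact ⟨.refl _ _, .id w, .id w, fun _ => rfl⟩
  | symm _ ih =>
    obtain ⟨e, h1, h2, h3⟩ := ih
    exact ⟨e.symm, h2, h1, fun z => by rw [← h3, e.apply_symm_apply]⟩
  | trans _ _ ih ih' =>
    obtain ⟨e, h1, h2, h3⟩ := ih
    obtain ⟨e', h1', h2', h3'⟩ := ih'
    exact ⟨e.trans e', h1.comp h1', h2'.comp h2, fun z => by rw [LinearEquiv.trans_apply, h3', h3]⟩
  | cons l _ ih =>
    obtain ⟨e, h1, h2, h3⟩ := ih
    refine ⟨e.lTensor (c.L l), h1.whisker l, h2.whisker l, fun z => ?_⟩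
    induction z using TensorProduct.induction_on with
    | zero => simp
    | add a b ha hb => simp only [map_add, ha, hb]
    | tmul x y => rw [LinearEquiv.lTensor_tmul, toT_cons, toT_cons, h3]
  | mulInv h w =>
    let f : c.M (.r d h :: .rdInv :: w) →ₗ[k] c.M w :=
      (TensorProduct.lid k (c.M w)).toLinearMap ∘ₗ (evR R d).rTensor (c.M w) ∘ₗ
        (TensorProduct.assoc k (Rsub R d) (Module.Dual k (Rsub R d)) (c.M w)).symm.toLinearMap
    have hf (t' : Rsub R d) (ξ : Module.Dual k (Rsub R d)) (m : c.M w) :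
      f (t' ⊗ₜ[k] (ξ ⊗ₜ[k] m)) = ξ t' • m := rfl
    have hT (z) : c.toT F w (f z) = c.toT F _ z := by
      refine LinearMap.congr_fun (f := c.toT F w ∘ₗ f) (g := c.toT F _)
        (TensorProduct.ext (LinearMap.ext fun x => TensorProduct.ext' fun ξ m => ?_)) z
      exact (c.toT_mulInv F h w x ξ m).symm
    have hinj : Function.Injective f := fun x y hxy => c.toT_injective F _ (by rw [← hT, hxy, hT])
    have hsurj : Function.Surjective f := fun m =>
      ⟨(⟨t, F.mem⟩ : Rsub R d) ⊗ₜ ((F.tau ∘ₗ (Rsub R d).subtype) ⊗ₜ m), by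
        rw [hf, LinearMap.comp_apply, Submodule.subtype_apply, F.tau_t, one_smul]⟩
    exact ⟨.ofBijective f ⟨hinj, hsurj⟩, .mulInv h w _ hf, .mulInv_symm h w _ hf, hT⟩
  | invMul h w =>
    let f : c.M (.rdInv :: .r d h :: w) →ₗ[k] c.M w :=
      (TensorProduct.lid k (c.M w)).toLinearMap ∘ₗ (evL R d).rTensor (c.M w) ∘ₗ
        (TensorProduct.assoc k (Module.Dual k (Rsub R d)) (Rsub R d) (c.M w)).symm.toLinearMap
    have hf (t' : Rsub R d) (ξ : Module.Dual k (Rsub R d)) (m : c.M w) :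
      f (ξ ⊗ₜ[k] (t' ⊗ₜ[k] m)) = ξ t' • m := rfl
    have hT (z) : c.toT F w (f z) = c.toT F _ z := by
      refine LinearMap.congr_fun (f := c.toT F w ∘ₗ f) (g := c.toT F _)
        (TensorProduct.ext (LinearMap.ext fun ξ => TensorProduct.ext' fun x m => ?_)) z
      exact (c.toT_invMul F h w x ξ m).symm
    have hinj : Function.Injective f := fun x y hxy => c.toT_injective F _ (by rw [← hT, hxy, hT])
    have hsurj : Function.Surjective f := fun m =>
      ⟨(F.tau ∘ₗ (Rsub R d).subtype) ⊗ₜ ((⟨t, F.mem⟩ : Rsub R d) ⊗ₜ m), by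
        rw [hf, LinearMap.comp_apply, Submodule.subtype_apply, F.tau_t, one_smul]⟩
    exact ⟨.ofBijective f ⟨hinj, hsurj⟩, .invMul h w _ hf, .invMul_symm h w _ hf, hT⟩

/-- All linear maps coming from `U` are products of maps between normal forms. -/
theorem InU.exists_sortedMap (F : IsFrob R d t) {w w' : Word d} {f : c.M w →ₗ[k] c.M w'}
    (h : c.InU w w' f) :
    ∃ g, SortedMap F (nf w) (nf w') g ∧ ∀ z, c.toT F w' (f z) = g (c.toT F w z) := by
  have hrefl {w w' : Word d} {f : c.M w →ₗ[k] c.M w'} (hw : nf w = nf w')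
      (hf : ∀ z, c.toT F w' (f z) = c.toT F w z) :
      ∃ g, SortedMap F (nf w) (nf w') g ∧ ∀ z, c.toT F w' (f z) = g (c.toT F w z) :=
    ⟨LinearMap.id, hw ▸ .refl fun z _ => rfl, hf⟩
  have hmulInv (h : 1 ≤ d ∧ d ≤ d) (w : Word d) (f : c.M (.r d h :: .rdInv :: w) ≃ₗ[k] c.M w)
      (hf : ∀ (t : Rsub R d) (ξ : Module.Dual k (Rsub R d)) (m : c.M w),
        f (t ⊗ₜ[k] (ξ ⊗ₜ[k] m)) = ξ t • m) (z) : c.toT F w (f z) = c.toT F _ z := by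
    refine LinearMap.congr_fun (f := c.toT F w ∘ₗ f.toLinearMap) (g := c.toT F _)
      (TensorProduct.ext (LinearMap.ext fun x => TensorProduct.ext' fun ξ m => ?_)) z
    exact (congrArg (c.toT F w) (hf x ξ m)).trans (c.toT_mulInv F h w x ξ m).symm
  have hinvMul (h : 1 ≤ d ∧ d ≤ d) (w : Word d) (f : c.M (.rdInv :: .r d h :: w) ≃ₗ[k] c.M w)
      (hf : ∀ (t : Rsub R d) (ξ : Module.Dual k (Rsub R d)) (m : c.M w),
        f (ξ ⊗ₜ[k] (t ⊗ₜ[k] m)) = ξ t • m) (z) : c.toT F w (f z) = c.toT F _ z := by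
    refine LinearMap.congr_fun (f := c.toT F w ∘ₗ f.toLinearMap) (g := c.toT F _)
      (TensorProduct.ext (LinearMap.ext fun ξ => TensorProduct.ext' fun x m => ?_)) z
    exact (congrArg (c.toT F w) (hf x ξ m)).trans (c.toT_invMul F h w x ξ m).symm
  induction h with
  | id w => exact hrefl rfl fun _ => rfl
  | comp _ _ ih ih' =>
    obtain ⟨g, h1, h2⟩ := ih
    obtain ⟨g', h1', h2'⟩ := ih'
    exact ⟨g' ∘ₗ g, h1.comp h1', fun z => by rw [LinearMap.comp_apply, h2', h2]; rfl⟩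
  | @whisker l w w' f _ ih =>
    obtain ⟨g, h1, h2⟩ := ih
    have hT (g' : TensorAlgebra k V →ₗ[k] TensorAlgebra k V)
        (h : ∀ x m, c.act F l x (g (c.toT F w m)) = g' (c.act F l x (c.toT F w m))) (z) :
        c.toT F (l :: w') (f.lTensor (c.L l) z) = g' (c.toT F (l :: w) z) := by
      refine LinearMap.congr_fun (f := c.toT F (l :: w') ∘ₗ f.lTensor (c.L l))
        (g := g' ∘ₗ c.toT F (l :: w)) (TensorProduct.ext' fun x m => ?_) z
      rw [LinearMap.comp_apply, LinearMap.lTensor_tmul, toT_cons, h2, LinearMap.comp_apply, toT_cons, h]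
    simp only [nf_cons]
    cases l with
    | r a h =>
      by_cases had : a = d
      · subst had
        rw [nfCons_rd, nfCons_rd]
        exact ⟨g, h1.shift 1, hT g fun x m => by rw [act_rd, act_rd, map_smul]⟩
      · have had : a < d := by omega
        rw [nfCons_r _ had, nfCons_r _ had]
        obtain ⟨g', h3, h4⟩ := h1.exists_whisker 0 h.1 had
        exact ⟨g', h3, hT g' fun x m => by
          rw [act_r _ _ _ had, act_r _ _ _ had, h4 _ x.2 _ (c.toT_mem F w m)]⟩
    | rdInv =>
      exact ⟨g, h1.shift (-1), hT g fun x m => by rw [act_rdInv, act_rdInv, map_smul]⟩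
  | phi a b ha hb hab w g hg f hf =>
    have had : a < d := by omega
    have hbd : b < d := by omega
    have hT (x : Rsub R (a + b)) (m : c.M w) :
        c.toT F (.r a ha :: .r b hb :: w) (f (x ⊗ₜ m)) = x * c.toT F w m := by
      rw [hf, c.toT_assoc F ha hb had hbd, hg]
    simp only [nf_cons]
    rw [nfCons_r _ had, nfCons_r _ hbd]
    -- If `a + b = d`, the source letter is `r_d` and does not appear in the normal form, so the map
    -- inserts `t`. Otherwise it is the plain inclusion of a merged letter.
    by_cases h : a + b = d
    · have hnf : nfCons (.r (a + b) hab) (nf w) = ((nf w).1 + 1, (nf w).2) := if_pos h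
      rw [hnf]
      refine ⟨LinearMap.mulLeft k t, .of_up (.insert ha.1 hb.1 h (by ring) fun _ _ => rfl), fun z => ?_⟩
      refine LinearMap.congr_fun (f := c.toT F _ ∘ₗ f) (g := LinearMap.mulLeft k t ∘ₗ c.toT F _)
        (TensorProduct.ext' fun x m => ?_) z
      rw [LinearMap.comp_apply, hT, LinearMap.comp_apply, toT_cons, act, if_pos h]
      have hx : (x : TensorAlgebra k V) = F.tau x • t := F.eq_tau_smul (by rw [← h]; exact x.2)
      change _ = t * (F.tau x • c.toT F w m)
      rw [mul_smul_comm, ← smul_mul_assoc, ← hx]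
    · rw [nfCons_r _ (by omega)]
      refine ⟨LinearMap.id, .of_up (.merge ha.1 hb.1 rfl (by omega) fun _ _ => rfl), fun z => ?_⟩
      refine LinearMap.congr_fun (f := c.toT F _ ∘ₗ f) (g := c.toT F _)
        (TensorProduct.ext' fun x m => ?_) z
      rw [LinearMap.comp_apply, hT, toT_cons, act_r _ _ _ (by omega)]
  | theta a b ha hb hab w e he f hf =>
    have had : a < d := by omega
    have hbd : b < d := by omega
    simp only [nf_cons]
    rw [nfCons_r _ had, nfCons_rdInv, nfCons_r _ hbd]
    refine ⟨F.contract a b, .of_down (.delete had hbd hab (by simp) (by simp [nf]) fun p hp q hq w _ =>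
      F.contract_mul hp hq w), fun z => ?_⟩
    refine LinearMap.congr_fun (f := c.toT F _ ∘ₗ f) (g := F.contract a b ∘ₗ c.toT F _)
      (TensorProduct.ext (LinearMap.ext fun x => TensorProduct.ext (LinearMap.ext fun ξ =>
        TensorProduct.ext' fun y m => ?_))) z
    refine (congrArg (c.toT F w) (hf x ξ y m)).trans ?_
    change _ = F.contract a b (c.toT F (.r a ha :: .rdInv :: .r b hb :: w) (x ⊗ₜ[k] (ξ ⊗ₜ[k] (y ⊗ₜ[k] m))))
    rw [toT_cons, toT_cons, toT_cons, act_r _ _ _ had, act_rdInv, act_r _ _ _ hbd, mul_smul_comm,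
      map_smul, map_smul (F.contract a b), F.contract_mul x.2 y.2, IsFrob.D_apply, show d - b = a by omega,
      cR_self _ (Rsub_le a x.2), F.pairing_eq hab he, mul_smul, smul_mul_assoc, one_mul]
  | mulInv h w f hf =>
    exact hrefl (by simp [nfCons_rd, nfCons_rdInv]) (hmulInv h w f hf)
  | mulInv_symm h w f hf =>
    refine hrefl (by simp [nfCons_rd, nfCons_rdInv]) fun z => ?_
    rw [← hmulInv h w f hf]
    exact congrArg _ (f.apply_symm_apply z)
  | invMul h w f hf =>
    exact hrefl (by simp [nfCons_rd, nfCons_rdInv]) (hinvMul h w f hf)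
  | invMul_symm h w f hf =>
    refine hrefl (by simp [nfCons_rd, nfCons_rdInv]) fun z => ?_
    rw [← hinvMul h w f hf]
    exact congrArg _ (f.apply_symm_apply z)

end Coaction
end Representation

/-! ### The maps between normal forms come from `U` -/

section Generators
variable {k : Type u} [Field k] {H : Type u} [Ring H] [HopfAlgebra k H]
  {V : Type u} [AddCommGroup V] [Module k V] [FiniteDimensional k V]
  {R : Submodule k (V ⊗[k] V)} {d : ℕ} {t : TensorAlgebra k V} {s s' : NForm}
  {f : TensorAlgebra k V →ₗ[k] TensorAlgebra k V}

lemma UpMap.apply_mem_imT (h : UpMap R d t s s' f) (ht : t ∈ Rsub R d) {z} (hz : z ∈ prodSub R s.2) :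
    f z ∈ imT R s'.2 := by
  induction h generalizing z with
  | @merge x y L a b c f ha hb h hc hf =>
    subst h
    rw [hf z hz, imT_cons, headIm, if_pos rfl]
    exact Submodule.mem_sup_left hz
  | @insert x y z' L a b f ha hb h hz' hf =>
    rw [hf z hz, imT_cons, headIm, if_pos rfl, h]
    exact Submodule.mem_sup_left (Submodule.mul_mem_mul ht hz)
  | whisker ha had hU hg ih =>
    refine apply_mem_of_mul (fun p hp w hw => ?_) hz
    rw [hg p hp w hw, imT_cons]
    exact Submodule.mem_sup_right (Submodule.mul_mem_mul hp (ih hw))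

/-- `imT` is spanned by the images of the maps `UpMap`. -/
lemma IsFrob.imT_le_of (F : IsFrob R d t) {L : List (ℕ × ℤ)} (hL : IsFrob.LtList d L) (x : ℤ)
    (N : Submodule k (TensorAlgebra k V))
    (h : ∀ s f, UpMap R d t s (x, L) f → ∀ z ∈ prodSub R s.2, f z ∈ N) : imT R L ≤ N := by
  induction L generalizing x N with
  | nil => exact bot_le
  | cons p L ih =>
    obtain ⟨a, x₀⟩ := p
    obtain ⟨⟨ha, had⟩, hL2⟩ := hL.of_cons
    rw [imT_cons]
    refine sup_le ?_ (Submodule.mul_le.2 fun p hp w hw => ?_)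
    · rcases L with - | ⟨⟨b, y⟩, B⟩
      · exact bot_le
      rw [headIm]
      split_ifs with h0
      · subst h0
        have hb : 1 ≤ b := hL2.of_cons.1.1
        change 1 ≤ a at ha
        rcases lt_trichotomy (a + b) d with h1 | h1 | h1
        · intro z hz
          exact h (x, (a + b, y) :: B) LinearMap.id (.merge ha hb rfl h1 fun _ _ => rfl) z hz
        · rw [h1]
          refine Submodule.mul_le.2 fun p hp w hw => ?_
          rw [F.eq_tau_smul hp, smul_mul_assoc]
          exact N.smul_mem _ (h (x + y + 1, B) (LinearMap.mulLeft k t)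
            (.insert ha hb h1 rfl fun _ _ => rfl) w hw)
        · rw [F.eq_bot _ h1, Submodule.bot_mul]
          exact bot_le
      · exact bot_le
    · refine ih hL2 x₀ (N.comap (LinearMap.mulLeft k p)) (fun s f hf z hz => ?_) hw
      obtain ⟨g, hg, hg'⟩ := UpMap.exists_whisker (x := s.1) (L := s.2) x ha had hf
      have := h _ g hg (p * z) (Submodule.mul_mem_mul hp hz)
      rwa [hg' p hp z hz] at this

lemma nfWord_cons_of (hd : 1 ≤ d) {a : ℕ} (ha : 1 ≤ a ∧ a ≤ d) (x y : ℤ) (L : List (ℕ × ℤ)) :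
    nfWord hd (x, (a, y) :: L) = rdPow ⟨hd, le_rfl⟩ x ++ .r a ha :: nfWord hd (y, L) := by
  rw [nfWord_cons, ltr_eq ha, List.singleton_append]

namespace Coaction
variable {c : Coaction R H}

/-- Multiplication by powers of `r_d` on the left of a map from `U`. -/
lemma InU.exists_rdPow (F : IsFrob R d t) (hd : 1 ≤ d) {w w' : Word d} {φ : c.M w →ₗ[k] c.M w'}
    (h : c.InU w w' φ) (hT : ∀ z, c.toT F w' (φ z) = f (c.toT F w z)) (x : ℤ) :
    ∃ ψ : c.M (rdPow ⟨hd, le_rfl⟩ x ++ w) →ₗ[k] c.M (rdPow ⟨hd, le_rfl⟩ x ++ w'),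
      c.InU _ _ ψ ∧ ∀ z, c.toT F _ (ψ z) = f (c.toT F _ z) := by
  have key (v : Word d) (hv : ∀ l ∈ v, ∀ (x : c.L l) z, f (c.act F l x z) = c.act F l x (f z)) :
      ∃ ψ : c.M (v ++ w) →ₗ[k] c.M (v ++ w'),
        c.InU _ _ ψ ∧ ∀ z, c.toT F _ (ψ z) = f (c.toT F _ z) := by
    induction v with
    | nil => exact ⟨φ, h, hT⟩
    | cons l v ih =>
      obtain ⟨ψ, h1, h2⟩ := ih fun l hl => hv l (by simp [hl])
      refine ⟨ψ.lTensor (c.L l), h1.whisker l, fun z => ?_⟩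
      refine LinearMap.congr_fun (f := c.toT F (l :: (v ++ w')) ∘ₗ ψ.lTensor (c.L l))
        (g := f ∘ₗ c.toT F (l :: (v ++ w))) (TensorProduct.ext' fun x m => ?_) z
      rw [LinearMap.comp_apply, LinearMap.lTensor_tmul, toT_cons, h2, LinearMap.comp_apply, toT_cons,
        hv l (by simp)]
  refine key _ ?_
  cases x with
  | ofNat n =>
    intro l hl x z
    obtain rfl := (List.mem_replicate.1 hl).2
    rw [act_rd, act_rd, map_smul]
  | negSucc n =>
    intro l hl x z
    obtain rfl := (List.mem_replicate.1 hl).2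
    rw [act_rdInv, act_rdInv, map_smul]

lemma InU.phi' (F : IsFrob R d t) {a b : ℕ} (ha : 1 ≤ a ∧ a ≤ d) (hb : 1 ≤ b ∧ b ≤ d)
    (hab : 1 ≤ a + b ∧ a + b ≤ d) (w : Word d) :
    ∃ φ : c.M (.r (a + b) hab :: w) →ₗ[k] c.M (.r a ha :: .r b hb :: w), c.InU _ _ φ ∧
      (∀ (x : Rsub R (a + b)) (m : c.M w), c.toT F _ (φ (x ⊗ₜ m)) = x * c.toT F w m) ∧
      ∃ g : Rsub R (a + b) →ₗ[k] Rsub R a ⊗[k] Rsub R b, IsIncl R g ∧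
        ∀ (x : Rsub R (a + b)) (m : c.M w),
          φ (x ⊗ₜ[k] m) = TensorProduct.assoc k (Rsub R a) (Rsub R b) (c.M w) (g x ⊗ₜ[k] m) := by
  obtain ⟨g, hg⟩ := exists_isIncl R (rfl : a + b = a + b)
  let φ : c.M (.r (a + b) hab :: w) →ₗ[k] c.M (.r a ha :: .r b hb :: w) :=
    (TensorProduct.assoc k (Rsub R a) (Rsub R b) (c.M w)).toLinearMap ∘ₗ g.rTensor (c.M w)
  have hφ (x : Rsub R (a + b)) (m : c.M w) :
      φ (x ⊗ₜ[k] m) = TensorProduct.assoc k (Rsub R a) (Rsub R b) (c.M w) (g x ⊗ₜ[k] m) := rfl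
  refine ⟨φ, .phi a b ha hb hab w g hg φ hφ, fun x m => ?_, g, hg, hφ⟩
  rw [hφ, c.toT_assoc F ha hb (by omega) (by omega), hg]

lemma InU.theta' (F : IsFrob R d t) {a b : ℕ} (ha : 1 ≤ a ∧ a ≤ d) (hb : 1 ≤ b ∧ b ≤ d)
    (hab : a + b = d) (w : Word d) :
    ∃ φ : c.M (.r a ha :: .rdInv :: .r b hb :: w) →ₗ[k] c.M w, c.InU _ _ φ ∧
      ∀ (x : Rsub R a) (ξ : Module.Dual k (Rsub R d)) (y : Rsub R b) (m : c.M w),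
        φ (x ⊗ₜ[k] (ξ ⊗ₜ[k] (y ⊗ₜ[k] m))) = (ξ ⟨t, F.mem⟩ * F.eta b y x) • m := by
  obtain ⟨e, he⟩ := F.exists_pairing hab
  let φ : c.M (.r a ha :: .rdInv :: .r b hb :: w) →ₗ[k] c.M w :=
    (TensorProduct.lid k (c.M w)).toLinearMap ∘ₗ (pairingMap e).rTensor (c.M w) ∘ₗ
      (TensorProduct.assoc k (Rsub R a) (Module.Dual k (Rsub R d) ⊗[k] Rsub R b)
        (c.M w)).symm.toLinearMap ∘ₗ
      (TensorProduct.assoc k (Module.Dual k (Rsub R d)) (Rsub R b)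
        (c.M w)).symm.toLinearMap.lTensor (Rsub R a)
  have hφ (x : Rsub R a) (ξ : Module.Dual k (Rsub R d)) (y : Rsub R b) (m : c.M w) :
      φ (x ⊗ₜ[k] (ξ ⊗ₜ[k] (y ⊗ₜ[k] m))) = e x ξ y • m := rfl
  refine ⟨φ, .theta a b ha hb hab w e he φ hφ, fun x ξ y m => ?_⟩
  rw [hφ, F.pairing_eq hab he]

/-- The map `θ_{a,b}` for `a + b > d`. -/
lemma InU.theta_gt (F : IsFrob R d t) {a b e : ℕ} (ha : 1 ≤ a ∧ a ≤ d) (hb : 1 ≤ b ∧ b ≤ d)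
    (he : 1 ≤ e ∧ e ≤ d) (had : a < d) (hbd : b < d) (hab : a + b = e + d) (w : Word d) :
    ∃ φ : c.M (.r a ha :: .rdInv :: .r b hb :: w) →ₗ[k] c.M (.r e he :: w), c.InU _ _ φ ∧
      ∀ (x : Rsub R a) (ξ : Module.Dual k (Rsub R d)) (y : Rsub R b) (m : c.M w),
        c.toT F _ (φ (x ⊗ₜ[k] (ξ ⊗ₜ[k] (y ⊗ₜ[k] m)))) =
          ξ ⟨t, F.mem⟩ • (F.D b y x * c.toT F w m) := by
  -- With `b' = d - a` the letter `R_b` is first split into `R_{b'} R_e`, and `R_a` is then paired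
  -- with `R_{b'}`. By `lm_D` this composite is the contraction `D b`.
  obtain ⟨b', rfl⟩ : ∃ b', b = b' + e := ⟨d - a, by omega⟩
  have hb' : 1 ≤ b' ∧ b' ≤ d := by omega
  obtain ⟨φ, h1, -, g, hg, h2⟩ := InU.phi' (c := c) F hb' he hb w
  obtain ⟨θ, h3, h4⟩ := InU.theta' (c := c) F ha hb' (by omega) (.r e he :: w)
  refine ⟨_, ((h1.whisker .rdInv).whisker (.r a ha)).comp h3, fun x ξ y m => ?_⟩
  rw [LinearMap.comp_apply, LinearMap.lTensor_tmul, LinearMap.lTensor_tmul, h2]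
  have h5 (u : Rsub R b' ⊗[k] Rsub R e) :
      c.toT F (.r e he :: w) (θ (x ⊗ₜ[k] (ξ ⊗ₜ[k]
        TensorProduct.assoc k (Rsub R b') (Rsub R e) (c.M w) (u ⊗ₜ[k] m)))) =
      ξ ⟨t, F.mem⟩ • (lm b' ((F.D b').flip x) (Submodule.mulMap (Rsub R b') (Rsub R e) u) *
        c.toT F w m) := by
    induction u using TensorProduct.induction_on with
    | zero => simp only [TensorProduct.zero_tmul, TensorProduct.tmul_zero, map_zero, zero_mul, smul_zero]
    | add u v hu hv =>
      simp only [TensorProduct.add_tmul, TensorProduct.tmul_add, map_add, add_mul, smul_add, hu, hv]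
    | tmul y' z =>
      rw [TensorProduct.assoc_tmul, h4, map_smul, toT_cons, act_r _ _ _ (show e < d by omega),
        Submodule.mulMap_tmul, lm_mul _ (Rsub_le _ y'.2), LinearMap.flip_apply, IsFrob.D_apply,
        show d - b' = a by omega, cR_self _ (Rsub_le a x.2), smul_mul_assoc, one_mul, smul_mul_assoc,
        mul_smul]
  rw [h5, hg, F.lm_D (c := 0) (h := e) hb.2 rfl (by omega) x.2 y.2]

/-- The map `UpMap` comes from `U`. -/
lemma exists_inU_of_upMap (c : Coaction R H) (F : IsFrob R d t) (hd : 1 ≤ d) (h : UpMap R d t s s' f)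
    (hL : IsFrob.LtList d s'.2) :
    ∃ φ : c.M (nfWord hd s) →ₗ[k] c.M (nfWord hd s'), c.InU _ _ φ ∧
      ∀ z, c.toT F _ (φ z) = f (c.toT F _ z) := by
  induction h with
  | @merge x y L a b e f ha hb h he hf =>
    subst h
    have hφ := InU.phi' (c := c) F ⟨ha, by omega⟩ ⟨hb, by omega⟩ ⟨by omega, he.le⟩ (nfWord hd (y, L))
    obtain ⟨φ, h1, h2, -⟩ := hφ
    have h3 (z) : c.toT F _ (φ z) = f (c.toT F _ z) := by
      have h4 : c.toT F _ (φ z) = c.toT F _ z := by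
        refine LinearMap.congr_fun (f := c.toT F _ ∘ₗ φ) (g := c.toT F _)
          (TensorProduct.ext' fun x m => ?_) z
        rw [LinearMap.comp_apply, h2, toT_cons, act_r _ _ _ he]
      rw [h4, hf]
      have h5 := c.toT_mem F _ z
      rwa [nf_cons, nfCons_r _ he, nf_nfWord hd (fun p hp => hL p (by simp [hp]))] at h5
    have h6 := h1.exists_rdPow F hd h3 x
    rw [nfWord_cons_of hd (show 1 ≤ a + b ∧ a + b ≤ d by omega),
      nfWord_cons_of hd (show 1 ≤ a ∧ a ≤ d by omega),
      nfWord_cons_of hd (show 1 ≤ b ∧ b ≤ d by omega)]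
    exact h6
  | @insert x y z L a b f ha hb h hz hf =>
    obtain ⟨φ, h1, h2, -⟩ := InU.phi' (c := c) F ⟨ha, by omega⟩ ⟨hb, by omega⟩ ⟨by omega, h.le⟩
      (nfWord hd (y, L))
    have hL' : IsFrob.LtList d L := fun p hp => hL p (by simp [hp])
    have hnf : nf (Letter.r (a + b) ⟨by omega, h.le⟩ :: nfWord hd (y, L)) = (y + 1, L) := by
      rw [nf_cons, nf_nfWord hd hL']
      exact if_pos h
    have h3 (z) : c.toT F _ (φ z) = f (c.toT F _ z) := by
      have h4 : c.toT F _ (φ z) = t * c.toT F _ z := by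
        refine LinearMap.congr_fun (f := c.toT F _ ∘ₗ φ) (g := LinearMap.mulLeft k t ∘ₗ c.toT F _)
          (TensorProduct.ext' fun x m => ?_) z
        rw [LinearMap.comp_apply, h2, LinearMap.comp_apply, toT_cons, act, if_pos h]
        have hx : (x : TensorAlgebra k V) = F.tau x • t := F.eq_tau_smul (by rw [← h]; exact x.2)
        change _ = t * (F.tau x • c.toT F _ m)
        rw [mul_smul_comm, ← smul_mul_assoc, ← hx]
      rw [h4, hf]
      have h5 := c.toT_mem F _ z
      rwa [hnf] at h5
    obtain ⟨ψ, h6, h7⟩ := h1.exists_rdPow F hd h3 x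
    obtain ⟨e, h8, -, h9⟩ := exists_equiv (c := c) F (wordEquiv_of_nf hd (u := nfWord hd (z, L))
      (v := rdPow ⟨hd, le_rfl⟩ x ++ Letter.r (a + b) ⟨by omega, h.le⟩ :: nfWord hd (y, L)) (by
        rw [nf_rdPow_append hd, hnf, nf_nfWord hd hL', hz, add_assoc]))
    rw [nfWord_cons_of hd (show 1 ≤ a ∧ a ≤ d by omega),
      nfWord_cons_of hd (show 1 ≤ b ∧ b ≤ d by omega)]
    exact ⟨ψ ∘ₗ e.toLinearMap, h8.comp h6, fun z => (h7 _).trans (congrArg f (h9 z))⟩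
  | @whisker z x x' L L' a f g ha had hU hg ih =>
    obtain ⟨φ, h1, h2⟩ := ih hL.of_cons.2
    have hL1 := hU.ltList hL.of_cons.2
    have h3 (z) : c.toT F (.r a ⟨ha, had.le⟩ :: nfWord hd (x', L')) (φ.lTensor (Rsub R a) z) =
        g (c.toT F (.r a ⟨ha, had.le⟩ :: nfWord hd (x, L)) z) := by
      refine LinearMap.congr_fun (f := c.toT F (.r a ⟨ha, had.le⟩ :: nfWord hd (x', L')) ∘ₗ
        φ.lTensor (Rsub R a)) (g := g ∘ₗ c.toT F (.r a ⟨ha, had.le⟩ :: nfWord hd (x, L)))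
        (TensorProduct.ext' fun x m => ?_) z
      have h5 := c.toT_mem F _ m
      rw [nf_nfWord hd hL1] at h5
      rw [LinearMap.comp_apply, LinearMap.lTensor_tmul, toT_cons, h2, LinearMap.comp_apply, toT_cons,
        act_r _ _ _ had, act_r _ _ _ had, hg _ x.2 _ h5]
    have h6 := (h1.whisker (.r a ⟨ha, had.le⟩)).exists_rdPow F hd h3 z
    rw [nfWord_cons_of hd (show 1 ≤ a ∧ a ≤ d by omega),
      nfWord_cons_of hd (show 1 ≤ a ∧ a ≤ d by omega)]
    exact h6

/-- The map `DownMap` comes from `U`. -/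
lemma exists_inU_of_downMap (c : Coaction R H) {F : IsFrob R d t} (hd : 1 ≤ d)
    (h : DownMap F s s' f) (hL : IsFrob.LtList d s.2) :
    ∃ φ : c.M (nfWord hd s) →ₗ[k] c.M (nfWord hd s'), c.InU _ _ φ ∧
      ∀ z, c.toT F _ (φ z) = f (c.toT F _ z) := by
  have hcontract {a b e : ℕ} (had : a < d) (hbd : b < d) (hab : a + b = e + d) {y : ℤ}
      {L : List (ℕ × ℤ)} {f : TensorAlgebra k V →ₗ[k] TensorAlgebra k V}
      (hL : IsFrob.LtList d L) (hf : ∀ p ∈ Rsub R a, ∀ q ∈ Rsub R b, ∀ w ∈ prodSub R L,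
        f (p * (q * w)) = F.D b q p * w) {v : Word d}
      {φ : c.M (.r a ⟨by omega, had.le⟩ :: .rdInv :: .r b ⟨by omega, hbd.le⟩ ::
        nfWord hd (y, L)) →ₗ[k] c.M v}
      (hφ : ∀ (x : Rsub R a) (ξ : Module.Dual k (Rsub R d)) (q : Rsub R b) (m : c.M (nfWord hd (y, L))),
        c.toT F _ (φ (x ⊗ₜ[k] (ξ ⊗ₜ[k] (q ⊗ₜ[k] m)))) = ξ ⟨t, F.mem⟩ • (F.D b q x * c.toT F _ m)) (z) :
      c.toT F v (φ z) = f (c.toT F _ z) := by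
    refine LinearMap.congr_fun (f := c.toT F _ ∘ₗ φ) (g := f ∘ₗ c.toT F _)
      (TensorProduct.ext (LinearMap.ext fun x => TensorProduct.ext (LinearMap.ext fun ξ =>
        TensorProduct.ext' fun q m => ?_))) z
    refine (hφ x ξ q m).trans ?_
    change _ = f (c.toT F (.r a ⟨by omega, had.le⟩ :: .rdInv :: .r b ⟨by omega, hbd.le⟩ ::
        nfWord hd (y, L)) (x ⊗ₜ[k] (ξ ⊗ₜ[k] (q ⊗ₜ[k] m))))
    have h5 := c.toT_mem F _ m
    rw [nf_nfWord hd hL] at h5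
    rw [toT_cons, toT_cons, toT_cons, act_r _ _ _ had, act_rdInv, act_r _ _ _ hbd, mul_smul_comm,
      map_smul, hf _ x.2 _ q.2 _ h5]
  induction h with
  | @merge x y g L a b e f had hbd he h hg hf =>
    subst hg
    have hL' : IsFrob.LtList d L := fun p hp => hL p (by simp [hp])
    obtain ⟨φ, h1, h2⟩ := InU.theta_gt (c := c) F (show 1 ≤ a ∧ a ≤ d by omega)
      (show 1 ≤ b ∧ b ≤ d by omega) (show 1 ≤ e ∧ e ≤ d by omega) had hbd h (nfWord hd (y, L))
    have h6 := h1.exists_rdPow F hd (hcontract had hbd h hL' hf h2) x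
    rw [nfWord_cons_of hd (show 1 ≤ a ∧ a ≤ d by omega),
      nfWord_cons_of hd (show 1 ≤ b ∧ b ≤ d by omega),
      nfWord_cons_of hd (show 1 ≤ e ∧ e ≤ d by omega)]
    exact h6
  | @delete x y g z L a b f had hbd h hg hz hf =>
    subst hg
    have hL' : IsFrob.LtList d L := fun p hp => hL p (by simp [hp])
    obtain ⟨θ, h3, h4⟩ := InU.theta' (c := c) F (a := a) (b := b) ⟨by omega, by omega⟩
      ⟨by omega, by omega⟩ h (nfWord hd (y, L))
    have h5 := hcontract (e := 0) had hbd (by omega) hL' hf (φ := θ) fun x ξ q m => by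
      rw [h4, IsFrob.D_apply, show d - b = a by omega, cR_self _ (Rsub_le a x.2), map_smul,
        smul_mul_assoc, one_mul, mul_smul]
    obtain ⟨ψ, h6, h7⟩ := h3.exists_rdPow F hd h5 x
    obtain ⟨e, h8, -, h9⟩ := exists_equiv (c := c) F (wordEquiv_of_nf hd
      (u := rdPow ⟨hd, le_rfl⟩ x ++ nfWord hd (y, L)) (v := nfWord hd (z, L)) (by
        rw [nf_rdPow_append hd, nf_nfWord hd hL', nf_nfWord hd hL', hz]))
    rw [nfWord_cons_of hd (show 1 ≤ a ∧ a ≤ d by omega),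
      nfWord_cons_of hd (show 1 ≤ b ∧ b ≤ d by omega)]
    exact ⟨e.toLinearMap ∘ₗ ψ, h6.comp h8, fun z => (h9 _).trans (h7 z)⟩
  | @whisker z x x' L L' a f g ha had hU hg ih =>
    obtain ⟨φ, h1, h2⟩ := ih hL.of_cons.2
    have h3 (z) : c.toT F (.r a ⟨ha, had.le⟩ :: nfWord hd (x', L')) (φ.lTensor (Rsub R a) z) =
        g (c.toT F (.r a ⟨ha, had.le⟩ :: nfWord hd (x, L)) z) := by
      refine LinearMap.congr_fun (f := c.toT F (.r a ⟨ha, had.le⟩ :: nfWord hd (x', L')) ∘ₗ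
        φ.lTensor (Rsub R a)) (g := g ∘ₗ c.toT F (.r a ⟨ha, had.le⟩ :: nfWord hd (x, L)))
        (TensorProduct.ext' fun x m => ?_) z
      have h5 := c.toT_mem F _ m
      rw [nf_nfWord hd hL.of_cons.2] at h5
      rw [LinearMap.comp_apply, LinearMap.lTensor_tmul, toT_cons, h2, LinearMap.comp_apply, toT_cons,
        act_r _ _ _ had, act_r _ _ _ had, hg _ x.2 _ h5]
    have h6 := (h1.whisker (.r a ⟨ha, had.le⟩)).exists_rdPow F hd h3 z
    rw [nfWord_cons_of hd (show 1 ≤ a ∧ a ≤ d by omega),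
      nfWord_cons_of hd (show 1 ≤ a ∧ a ≤ d by omega)]
    exact h6

end Coaction
end Generators

/-! ### The subspaces that define `∇` and `Δ` -/

section ImageKernel
variable {k : Type u} [Field k] {H : Type u} [Ring H] [HopfAlgebra k H]
  {V : Type u} [AddCommGroup V] [Module k V] [FiniteDimensional k V]
  {R : Submodule k (V ⊗[k] V)} {d : ℕ} {t : TensorAlgebra k V}

namespace Coaction
variable (c : Coaction R H)

lemma range_le_imSub (w w' : Word d) (F : IsFrob R d t) {f : c.M w' →ₗ[k] c.M w} (hf : c.InU w' w f)
    (h : (cls w').LT (cls w)) : LinearMap.range f ≤ c.imSub w := by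
  rw [imSub]
  exact le_iSup_of_le ⟨⟨w', h⟩, ⟨f, hf, InU.isHom c F hf⟩⟩ le_rfl

/-- A morphism from a smaller object goes to a longer normal form, so its sorted version ends with
an inclusion and its image lies in `imT`. Conversely `imT` is spanned by images of single
inclusions, which come from `U` and strictly raise the order. -/
theorem imSub_eq (F : IsFrob R d t) (hd : 1 ≤ d) (w : Word d) :
    c.imSub w = (imT R (nf w).2).comap (c.toT F w) := by
  apply le_antisymm
  · refine iSup_le fun ⟨⟨w', h⟩, f, hf, _⟩ => ?_
    rintro _ ⟨z, rfl⟩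
    obtain ⟨g, h1, h2⟩ := hf.exists_sortedMap F
    obtain ⟨s, g', h3, h4⟩ := h1.exists_up (length_lt_of_lt h)
    rw [Submodule.mem_comap, h2]
    obtain ⟨y, hy, h5⟩ := h4 _ (c.toT_mem F w' z)
    rw [h5]
    exact h3.apply_mem_imT F.mem hy
  · have key : imT R (nf w).2 ≤ (c.imSub w).map (c.toT F w) := by
      refine F.imT_le_of (nf_lt w) (nf w).1 _ fun s f hf y hy => ?_
      have hs := hf.ltList (nf_lt w)
      obtain ⟨φ, h1, h2⟩ := exists_inU_of_upMap c F hd hf (nf_lt w)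
      obtain ⟨e, h3, -, h4⟩ := exists_equiv (c := c) F (wordEquiv_nfWord hd w).symm
      have h5 : y ∈ LinearMap.range (c.toT F (nfWord hd s)) := by
        rwa [range_toT, nf_nfWord hd hs]
      obtain ⟨y, rfl⟩ := h5
      refine ⟨e (φ y), c.range_le_imSub w _ F (h1.comp h3) ?_ ⟨y, rfl⟩, (h4 _).trans (h2 y)⟩
      have h6 := hf.lt hd (nf_lt w)
      rwa [(wordEquiv_nfWord hd w).cls_eq]
    intro z hz
    obtain ⟨y, hy, h⟩ := key hz
    rwa [← c.toT_injective F w h]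

/-- Each contraction comes from `U` and strictly lowers the order. Conversely a morphism to a
smaller object starts, after sorting, with a contraction, so it kills whatever all contractions
kill; these elements form `annT`. -/
theorem kerSub_eq (F : IsFrob R d t) (hd : 1 ≤ d) (w : Word d) :
    c.kerSub w = (F.annT (nf w).2).comap (c.toT F w) := by
  ext z
  rw [Submodule.mem_comap, F.mem_annT_iff (nf_lt w) (nf w).1 (c.toT_mem F w z), kerSub,
    Submodule.mem_iInf]
  constructor
  · intro h s f hf
    obtain ⟨φ, h1, h2⟩ := exists_inU_of_downMap c hd hf (nf_lt w)
    obtain ⟨e, h3, -, h4⟩ := exists_equiv (c := c) F (wordEquiv_nfWord hd w)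
    have h5 : (cls (nfWord hd s)).LT (cls w) := by
      have h6 := hf.lt hd (nf_lt w)
      rwa [(wordEquiv_nfWord hd w).cls_eq]
    have h6 := h3.comp h1
    have h7 : φ (e z) = 0 := h ⟨⟨nfWord hd s, h5⟩, ⟨φ ∘ₗ e.toLinearMap, h6, InU.isHom c F h6⟩⟩
    rw [← h4 z]
    refine (h2 (e z)).symm.trans ?_
    rw [h7, map_zero]
  · rintro h ⟨⟨w', hw⟩, f, hf, _⟩
    obtain ⟨g, h1, h2⟩ := hf.exists_sortedMap F
    obtain ⟨s, g', h3, h4⟩ := h1.exists_down (length_lt_of_lt hw)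
    apply c.toT_injective F w'
    rw [map_zero]
    exact (h2 z).trans (h4 _ (c.toT_mem F w z) (h s g' h3))

end Coaction
end ImageKernel

/-! ### Exact sequences and filtrations of comodules -/

section Exact
variable {k : Type u} [Field k] {H : Type u} [Ring H] [HopfAlgebra k H]

namespace Comod
variable {X Y Z A B C : Comod k H}

lemma Iso.refl (X : Comod k H) : Iso X X := ⟨.refl k X, isHom_id⟩

lemma Iso.symm (h : Iso X Y) : Iso Y X := by
  obtain ⟨e, he⟩ := h
  exact ⟨e.symm, he.symm⟩

lemma Iso.trans (h : Iso X Y) (h' : Iso Y Z) : Iso X Z := by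
  obtain ⟨e, he⟩ := h
  obtain ⟨e', he'⟩ := h'
  exact ⟨e.trans e', he'.comp he⟩

lemma Iso.tensor (h : Iso X Y) (h' : Iso A B) : Iso (X.tensor A) (Y.tensor B) := by
  obtain ⟨e, he⟩ := h
  obtain ⟨e', he'⟩ := h'
  exact ⟨TensorProduct.congr e e', he.map he'⟩

lemma ShortExact.congr_middle {Y' : Comod k H} (h : ShortExact X Y Z) (e : Iso Y Y') :
    ShortExact X Y' Z := by
  obtain ⟨i, p, hi, hp, h1, h2, h3⟩ := h
  obtain ⟨e, he⟩ := e
  refine ⟨e.toLinearMap ∘ₗ i, p ∘ₗ e.symm.toLinearMap, he.comp hi, hp.comp he.symm,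
    e.injective.comp h1, ?_, h3.comp e.symm.surjective⟩
  rw [LinearMap.range_comp, h2, LinearMap.ker_comp]
  exact Submodule.map_equiv_eq_comap_symm e _

/-- A morphism out of a comodule induces a morphism out of a quotient. -/
lemma exists_lift {q : X →ₗ[k] A} (hq : IsHom q) (hs : Function.Surjective q) {g : X →ₗ[k] B}
    (hg : IsHom g) (h : LinearMap.ker q ≤ LinearMap.ker g) :
    ∃ i : A →ₗ[k] B, IsHom i ∧ ∀ x, i (q x) = g x := by
  obtain ⟨s, hs'⟩ := q.exists_rightInverse_of_surjective (LinearMap.range_eq_top.2 hs)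
  have h1 (x) : (g ∘ₗ s) (q x) = g x := by
    have h2 : s (q x) - x ∈ LinearMap.ker q := by
      rw [LinearMap.mem_ker, map_sub, sub_eq_zero]
      exact LinearMap.congr_fun hs' (q x)
    have h3 := h h2
    rwa [LinearMap.mem_ker, map_sub, sub_eq_zero] at h3
  refine ⟨g ∘ₗ s, IsHom.of_comp_surjective hq ?_ hs, h1⟩
  rwa [show (g ∘ₗ s) ∘ₗ q = g from LinearMap.ext h1]

/-- A morphism into a comodule factors over a subcomodule. -/
lemma exists_factor {j : A →ₗ[k] X} (hj : IsHom j) (hi : Function.Injective j) {g : B →ₗ[k] X}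
    (hg : IsHom g) (h : LinearMap.range g ≤ LinearMap.range j) :
    ∃ i : B →ₗ[k] A, IsHom i ∧ ∀ x, j (i x) = g x := by
  obtain ⟨s, hs⟩ := j.exists_leftInverse_of_injective (LinearMap.ker_eq_bot.2 hi)
  have h1 (x) : j ((s ∘ₗ g) x) = g x := by
    obtain ⟨y, hy⟩ := h ⟨x, rfl⟩
    rw [LinearMap.comp_apply, ← hy]
    exact congrArg j (LinearMap.congr_fun hs y)
  refine ⟨s ∘ₗ g, IsHom.of_comp hj ?_ hi, h1⟩
  rwa [show j ∘ₗ (s ∘ₗ g) = g from LinearMap.ext h1]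

lemma Iso.of_surjective {q : X →ₗ[k] A} {q' : X →ₗ[k] B} (hq : IsHom q) (hq' : IsHom q')
    (h : Function.Surjective q) (h' : Function.Surjective q')
    (hk : LinearMap.ker q = LinearMap.ker q') : Iso A B := by
  obtain ⟨i, h1, h2⟩ := exists_lift hq h hq' hk.le
  refine ⟨LinearEquiv.ofBijective i ⟨?_, fun b => ?_⟩, h1⟩
  · rw [injective_iff_map_eq_zero]
    intro a ha
    obtain ⟨x, rfl⟩ := h a
    rw [h2] at ha
    exact hk.ge ha
  · obtain ⟨x, rfl⟩ := h' b
    exact ⟨q x, h2 x⟩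

lemma Iso.of_injective {j : A →ₗ[k] X} {j' : B →ₗ[k] X} (hj : IsHom j) (hj' : IsHom j')
    (h : Function.Injective j) (h' : Function.Injective j')
    (hk : LinearMap.range j = LinearMap.range j') : Iso A B := by
  obtain ⟨i, h1, h2⟩ := exists_factor hj' h' hj hk.le
  refine ⟨LinearEquiv.ofBijective i ⟨fun a a' ha => h ?_, fun b => ?_⟩, h1⟩
  · rw [← h2, ha, h2]
  · obtain ⟨a, ha⟩ := hk.ge ⟨b, rfl⟩
    exact ⟨a, h' (by rw [h2, ha])⟩

/-- All terms are presented as quotients of `X` and `Y`, so that exactness reduces to two identities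
between kernels. These are then checked inside the tensor algebra. -/
lemma ShortExact.of_surjective {q₁ : X →ₗ[k] A} {q₂ : Y →ₗ[k] B} {q₃ : Y →ₗ[k] C} {f : X →ₗ[k] Y}
    (h₁ : IsHom q₁) (h₂ : IsHom q₂) (h₃ : IsHom q₃) (hf : IsHom f)
    (hs₁ : Function.Surjective q₁) (hs₂ : Function.Surjective q₂) (hs₃ : Function.Surjective q₃)
    (hk : LinearMap.ker q₁ = (LinearMap.ker q₂).comap f)
    (hk' : LinearMap.ker q₃ = LinearMap.ker q₂ ⊔ LinearMap.range f) : ShortExact A B C := by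
  obtain ⟨i, hi, hi'⟩ := exists_lift h₁ hs₁ (h₂.comp hf) (by rw [LinearMap.ker_comp]; exact hk.le)
  obtain ⟨p, hp, hp'⟩ := exists_lift h₂ hs₂ h₃ (hk'.ge.trans' le_sup_left)
  refine ⟨i, p, hi, hp, ?_, ?_, fun c => ?_⟩
  · rw [injective_iff_map_eq_zero]
    intro a ha
    obtain ⟨x, rfl⟩ := hs₁ a
    rw [hi'] at ha
    exact hk.ge ha
  · apply le_antisymm
    · rintro _ ⟨a, rfl⟩
      obtain ⟨x, rfl⟩ := hs₁ a
      rw [LinearMap.mem_ker, hi', LinearMap.comp_apply, hp']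
      exact hk'.ge (Submodule.mem_sup_right ⟨x, rfl⟩)
    · intro b hb
      obtain ⟨y, rfl⟩ := hs₂ b
      rw [LinearMap.mem_ker, hp'] at hb
      obtain ⟨z, hz, _, ⟨x, rfl⟩, rfl⟩ := Submodule.mem_sup.1 (hk'.le hb)
      refine ⟨q₁ x, ?_⟩
      rw [hi', map_add, LinearMap.mem_ker.1 hz, zero_add]
      rfl
  · obtain ⟨y, rfl⟩ := hs₃ c
    exact ⟨q₂ y, hp' y⟩

/-- The dual form: all terms are subcomodules of `X` and `Y`, and exactness reduces to identities
between ranges. -/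
lemma ShortExact.of_injective {j₁ : A →ₗ[k] X} {j₂ : B →ₗ[k] Y} {j₃ : C →ₗ[k] Y} {f : Y →ₗ[k] X}
    (h₁ : IsHom j₁) (h₂ : IsHom j₂) (h₃ : IsHom j₃) (hf : IsHom f)
    (hi₁ : Function.Injective j₁) (hi₂ : Function.Injective j₂) (hi₃ : Function.Injective j₃)
    (hk : LinearMap.range j₃ = LinearMap.range j₂ ⊓ LinearMap.ker f)
    (hk' : LinearMap.range j₁ = (LinearMap.range j₂).map f) : ShortExact C B A := by
  obtain ⟨i, hi, hi'⟩ := exists_factor h₂ hi₂ h₃ (hk.le.trans inf_le_left)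
  obtain ⟨p, hp, hp'⟩ := exists_factor h₁ hi₁ (hf.comp h₂)
    (by rw [LinearMap.range_comp]; exact hk'.ge)
  refine ⟨i, p, hi, hp, fun x y h => hi₃ ?_, ?_, fun a => ?_⟩
  · rw [← hi', h, hi']
  · apply le_antisymm
    · rintro _ ⟨x, rfl⟩
      apply hi₁
      rw [map_zero, hp', LinearMap.comp_apply, hi']
      exact (hk.le ⟨x, rfl⟩).2
    · intro b hb
      have h : f (j₂ b) = 0 := by
        rw [← LinearMap.comp_apply, ← hp', LinearMap.mem_ker.1 hb, map_zero]
      obtain ⟨x, hx⟩ := hk.ge ⟨⟨b, rfl⟩, h⟩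
      exact ⟨x, hi₂ (by rw [hi', hx])⟩
  · obtain ⟨_, ⟨b, rfl⟩, hb⟩ := hk'.le ⟨a, rfl⟩
    exact ⟨b, hi₁ (by rw [hp']; exact hb)⟩

lemma ShortExact.tensor_left (h : ShortExact X Y Z) (A : Comod k H) :
    ShortExact (A.tensor X) (A.tensor Y) (A.tensor Z) := by
  obtain ⟨i, p, hi, hp, h1, h2, h3⟩ := h
  refine ⟨i.lTensor A, p.lTensor A, hi.lTensor A, hp.lTensor A,
    Module.Flat.lTensor_preserves_injective_linearMap i h1, ?_, LinearMap.lTensor_surjective A h3⟩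
  exact ((LinearMap.exact_iff.1 (lTensor_exact A (LinearMap.exact_iff.2 h2.symm) h3))).symm

lemma ShortExact.tensor_right (h : ShortExact X Y Z) (A : Comod k H) :
    ShortExact (X.tensor A) (Y.tensor A) (Z.tensor A) := by
  obtain ⟨i, p, hi, hp, h1, h2, h3⟩ := h
  refine ⟨i.rTensor A, p.rTensor A, hi.rTensor A, hp.rTensor A,
    Module.Flat.rTensor_preserves_injective_linearMap i h1, ?_, LinearMap.rTensor_surjective A h3⟩
  exact ((LinearMap.exact_iff.1 (rTensor_exact A (LinearMap.exact_iff.2 h2.symm) h3))).symm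

section Filtered
variable {ι : Type*} {S : ι → Comod k H}

/-- The class of comodules generated by zero under extensions by members of `S`. -/
inductive Filtered (S : ι → Comod k H) : Comod k H → Prop
  | zero (X : Comod k H) (h : Subsingleton X) : Filtered S X
  | step (X' X : Comod k H) (j : ι) (hX : Filtered S X') (h : ShortExact X' X (S j)) : Filtered S X

lemma Filtered.of_iso (h : Filtered S X) (e : Iso X Y) : Filtered S Y := by
  cases h with
  | zero _ h =>
    obtain ⟨e, -⟩ := e
    exact .zero Y e.symm.injective.subsingleton
  | step X' _ j hX h => exact .step X' Y j hX (h.congr_middle e)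

lemma Filtered.of_mem (j : ι) (e : Iso (S j) X) : Filtered S X := by
  have h0 : X.Stable ⊥ := by
    rw [stable_iff]
    rintro _ rfl φ
    simp
  refine Filtered.of_iso (.step (X.sub ⊥ h0) X j (.zero _ inferInstance) ?_) (.refl X)
  obtain ⟨e, he⟩ := e
  refine ⟨(⊥ : Submodule k X).subtype, e.symm.toLinearMap, isHom_subtype X ⊥ h0, he.symm,
    Subtype.val_injective, ?_, e.symm.surjective⟩
  rw [Submodule.range_subtype, LinearEquiv.ker]

/-- Induction on the filtration of `Z`: the kernel of `Y → Z → S j` is an extension of `Z'` by `X`,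
hence filtered, and `Y` has one further step `S j` on top of it. -/
lemma Filtered.extension (h : Filtered S X) (h' : Filtered S Z) (hY : ShortExact X Y Z) :
    Filtered S Y := by
  induction h' generalizing Y with
  | zero Z hZ =>
    obtain ⟨i, p, hi, hp, h1, h2, h3⟩ := hY
    refine h.of_iso ⟨LinearEquiv.ofBijective i ⟨h1, LinearMap.range_eq_top.1 ?_⟩, hi⟩
    rw [h2, LinearMap.ker_eq_top]
    exact LinearMap.ext fun _ => Subsingleton.elim _ _
  | step Z' Z j hZ' hZ ih =>
    obtain ⟨i, p, hi, hp, h1, h2, h3⟩ := hY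
    obtain ⟨i', p', hi', hp', h1', h2', h3'⟩ := hZ
    have hs := stable_ker (p' ∘ₗ p) (hp'.comp hp)
    have hsub := isHom_subtype Y _ hs
    refine .step (Y.sub (LinearMap.ker (p' ∘ₗ p)) hs) Y j (ih ?_) ⟨Submodule.subtype _, p' ∘ₗ p, hsub,
      hp'.comp hp, Subtype.val_injective, Submodule.range_subtype _, h3'.comp h3⟩
    obtain ⟨a, ha, ha'⟩ := exists_factor hsub Subtype.val_injective hi (by
      rw [Submodule.range_subtype, h2, LinearMap.ker_comp]
      exact fun y hy => by rw [Submodule.mem_comap, LinearMap.mem_ker.1 hy]; exact zero_mem _)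
    obtain ⟨b, hb, hb'⟩ := exists_factor hi' h1' (hp.comp hsub) (by
      rintro _ ⟨y, rfl⟩
      rw [h2']
      exact y.2)
    refine ⟨a, b, ha, hb, fun x y h => h1 ?_, ?_, fun z => ?_⟩
    · rw [← ha', h, ha']
    · ext y
      constructor
      · rintro ⟨x, rfl⟩
        apply h1'
        rw [map_zero, hb', LinearMap.comp_apply, ha']
        exact h2.le ⟨x, rfl⟩
      · intro hy
        have h4 : p y = 0 := by
          have := hb' y
          rw [LinearMap.mem_ker.1 hy, map_zero] at this
          exact this.symm
        obtain ⟨x, hx⟩ := h2.ge h4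
        exact ⟨x, Subtype.ext ((ha' x).trans hx)⟩
    · obtain ⟨y, hy⟩ := h3 (i' z)
      have h4 : y ∈ LinearMap.ker (p' ∘ₗ p) := by
        rw [LinearMap.mem_ker, LinearMap.comp_apply, hy]
        exact h2'.le ⟨z, rfl⟩
      exact ⟨⟨y, h4⟩, h1' ((hb' _).trans hy)⟩

/-- Tensoring over a field is exact, so filtrations of the factors can be refined one factor at a
time, down to products of two members of `S`. -/
theorem Filtered.tensor (hS : ∀ i j, Filtered S ((S i).tensor (S j))) (hX : Filtered S X)
    (hY : Filtered S Y) : Filtered S (X.tensor Y) := by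
  have h1 (j : ι) : Filtered S (X.tensor (S j)) := by
    induction hX with
    | zero X h => exact .zero _ (inferInstanceAs (Subsingleton (X ⊗[k] S j)))
    | step X' X i _ h ih => exact ih.extension (hS i j) (h.tensor_right (S j))
  induction hY with
  | zero Y h => exact .zero _ (inferInstanceAs (Subsingleton (X ⊗[k] Y)))
  | step Y' Y j _ h ih => exact ih.extension (h1 j) (h.tensor_left X)

lemma HasFiltration.filtered (h : X.HasFiltration S) : Filtered S X := by
  obtain ⟨n, N, hN, h0, hn, h⟩ := h
  have key (i : ℕ) (hi : i ≤ n) : Filtered S (X.sub (N i) (hN i)) := by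
    induction i with
    | zero => exact .zero _ ⟨fun x y => Subtype.ext
        (((Submodule.mem_bot k).1 (h0.le x.2)).trans ((Submodule.mem_bot k).1 (h0.le y.2)).symm)⟩
    | succ i ih =>
      obtain ⟨hle, j, p, h1, h2, h3⟩ := h i hi
      refine .step _ _ j (ih (by omega)) ⟨Submodule.inclusion hle, p, ?_, h1,
        Submodule.inclusion_injective hle, ?_, h2⟩
      · exact IsHom.of_comp (isHom_subtype X _ (hN (i + 1))) (isHom_subtype X _ (hN i))
          Subtype.val_injective
      · rw [h3, Submodule.range_inclusion]
  refine (key n le_rfl).of_iso ⟨LinearEquiv.ofTop _ hn, isHom_subtype X _ (hN n)⟩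

lemma Filtered.hasFiltration (h : Filtered S X) : X.HasFiltration S := by
  induction h with
  | zero X h =>
    exact ⟨0, fun _ => ⊤, fun i => by rw [stable_iff]; exact fun _ _ _ => trivial,
      Subsingleton.elim _ _, rfl, fun i hi => absurd hi (by omega)⟩
  | step X' X j _ hX ih =>
    obtain ⟨i, p, hi, hp, h1, h2, h3⟩ := hX
    obtain ⟨n, N, hN, h0, hn, h⟩ := ih
    have hmap (m : ℕ) : X.Stable ((N m).map i) := by
      have := stable_range (X := X'.sub (N m) (hN m)) (i ∘ₗ (N m).subtype)
        (hi.comp (isHom_subtype X' _ (hN m)))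
      rwa [LinearMap.range_comp, Submodule.range_subtype] at this
    have htop : X.Stable ⊤ := by rw [stable_iff]; exact fun _ _ _ => trivial
    -- The filtration of `X'` is pushed forward along `i`, with `X` as the last step. The indices
    -- beyond `n` get the value `⊤` because the sequence must consist of subcomodules everywhere.
    refine ⟨n + 1, fun m => if m ≤ n then (N m).map i else ⊤, fun m => ?_, ?_, ?_, fun m hm => ?_⟩
    · dsimp only
      split_ifs
      exacts [hmap m, htop]
    · simp [h0]
    · simp
    · have key (P Q : Submodule k X) (hQ : X.Stable Q) (hPdef : (if m ≤ n then (N m).map i else ⊤) = P)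
          (hQdef : (if m + 1 ≤ n then (N (m + 1)).map i else ⊤) = Q) : P ≤ Q ∧
          ∃ (j : ι) (p : X.sub Q hQ →ₗ[k] S j), IsHom p ∧ Function.Surjective p ∧
            LinearMap.ker p = P.comap Q.subtype := by
        rw [if_pos (by omega)] at hPdef
        subst hPdef
        rcases Nat.lt_succ_iff_lt_or_eq.1 hm with hm | rfl
        · rw [if_pos (by omega)] at hQdef
          subst hQdef
          obtain ⟨hle, j', p', hp', hs', hk⟩ := h m hm
          have hsub := isHom_subtype X' _ (hN (m + 1))
          obtain ⟨e, he, he'⟩ := exists_factor (isHom_subtype X _ hQ) Subtype.val_injective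
            (hi.comp hsub) (by
              rw [LinearMap.range_comp, Submodule.range_subtype, Submodule.range_subtype])
          have hes : Function.Surjective e := by
            rintro ⟨_, x, hx, rfl⟩
            exact ⟨⟨x, hx⟩, Subtype.ext (he' _)⟩
          have hei : LinearMap.ker e = ⊥ := LinearMap.ker_eq_bot.2 fun x y h =>
            Subtype.ext (h1 (((he' x).symm.trans (congrArg Subtype.val h)).trans (he' y)))
          obtain ⟨r, hr, hr'⟩ := exists_lift he hes hp' (hei.le.trans bot_le)
          refine ⟨Submodule.map_mono hle, j', r, hr, fun z => ?_, ?_⟩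
          · obtain ⟨y, rfl⟩ := hs' z
            exact ⟨e y, hr' y⟩
          · ext x
            obtain ⟨y, rfl⟩ := hes x
            rw [LinearMap.mem_ker, hr', ← LinearMap.mem_ker, hk, Submodule.mem_comap, Submodule.mem_comap]
            have : ((N (m + 1)).map i).subtype (e y) = i y := he' y
            rw [this]
            refine ⟨fun hy => ⟨y, hy, rfl⟩, fun ⟨y', hy', h⟩ => ?_⟩
            rwa [h1 h] at hy'
        · rw [if_neg (by omega)] at hQdef
          subst hQdef
          refine ⟨le_top, j, p ∘ₗ Submodule.subtype _, hp.comp (isHom_subtype X _ hQ), fun z => ?_, ?_⟩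
          · obtain ⟨x, rfl⟩ := h3 z
            exact ⟨⟨x, trivial⟩, rfl⟩
          · rw [LinearMap.ker_comp, ← h2, hn, Submodule.map_top]
      exact key _ _ _ rfl rfl

end Filtered
end Comod
end Exact

/-! ### Tensor products of costandard comodules: the split case -/

section Costandard
variable {k : Type u} [Field k] {V : Type u} [AddCommGroup V] [Module k V]

/-- The kernel of a tensor product of projections, read inside `TV`: a sum of two products of
subspaces. In this form it can be compared with `imT` of a concatenated list. -/
lemma ker_map_eq_comap_tmul {X Y A B : Type*} [AddCommGroup X] [Module k X] [AddCommGroup Y]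
    [Module k Y] [AddCommGroup A] [Module k A] [AddCommGroup B] [Module k B]
    {α : X →ₗ[k] TensorAlgebra k V} {β : Y →ₗ[k] TensorAlgebra k V} {q : X →ₗ[k] A} {q' : Y →ₗ[k] B}
    (hq : Function.Surjective q) (hq' : Function.Surjective q') (h : Function.Injective (tmul α β)) :
    LinearMap.ker (TensorProduct.map q q') = ((LinearMap.ker q).map α * LinearMap.range β ⊔
      LinearMap.range α * (LinearMap.ker q').map β).comap (tmul α β) := by
  have h1 : tmul α β ∘ₗ (LinearMap.ker q').subtype.lTensor X =
      tmul α (β ∘ₗ (LinearMap.ker q').subtype) := TensorProduct.ext' fun x y => by simp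
  have h2 : tmul α β ∘ₗ (LinearMap.ker q).subtype.rTensor Y =
      tmul (α ∘ₗ (LinearMap.ker q).subtype) β := TensorProduct.ext' fun x y => by simp
  rw [TensorProduct.map_ker q.exact_subtype_ker_map hq
    q'.exact_subtype_ker_map hq', ← Submodule.comap_map_eq_of_injective h (_ ⊔ _),
    Submodule.map_sup, ← LinearMap.range_comp, ← LinearMap.range_comp, h1, h2, range_tmul, range_tmul,
    LinearMap.range_comp, LinearMap.range_comp, Submodule.range_subtype, Submodule.range_subtype,
    sup_comm]

lemma range_map_eq_comap_tmul {X Y A B : Type*} [AddCommGroup X] [Module k X] [AddCommGroup Y]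
    [Module k Y] [AddCommGroup A] [Module k A] [AddCommGroup B] [Module k B]
    {α : X →ₗ[k] TensorAlgebra k V} {β : Y →ₗ[k] TensorAlgebra k V} (j : A →ₗ[k] X) (j' : B →ₗ[k] Y)
    (h : Function.Injective (tmul α β)) : LinearMap.range (TensorProduct.map j j') =
      ((LinearMap.range j).map α * (LinearMap.range j').map β).comap (tmul α β) := by
  have h1 : tmul α β ∘ₗ TensorProduct.map j j' = tmul (α ∘ₗ j) (β ∘ₗ j') :=
    TensorProduct.ext' fun x y => by simp
  rw [← LinearMap.range_comp, ← LinearMap.range_comp, ← range_tmul, ← h1, LinearMap.range_comp,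
    Submodule.comap_map_eq_of_injective h]

variable {H : Type u} [Ring H] [HopfAlgebra k H] [FiniteDimensional k V]
  {R : Submodule k (V ⊗[k] V)} {d : ℕ} {t : TensorAlgebra k V} {A B : List (ℕ × ℤ)}
  {a b : ℕ} {x y : ℤ}

lemma IsFrob.LtList.posList {L : List (ℕ × ℤ)} (h : IsFrob.LtList d L) : PosList L :=
  fun p hp => (h p hp).1

/-- The junction contributes nothing if its gap is nonzero or if the merged letter would have degree
above `d`. The gap after a last letter never matters, hence the free `x'`. -/
lemma IsFrob.imT_append_eq (F : IsFrob R d t) (x' : ℤ) (h : x ≠ 0 ∨ d < a + b) :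
    imT R (A ++ (a, x) :: (b, y) :: B) =
      imT R (A ++ [(a, x')]) * prodSub R ((b, y) :: B) ⊔
        prodSub R (A ++ [(a, x')]) * imT R ((b, y) :: B) := by
  have h1 : headIm R a x ((b, y) :: B) = ⊥ := by
    rw [headIm]
    split_ifs with hx
    · rw [F.eq_bot _ (h.resolve_left fun h => h hx), Submodule.bot_mul]
    · rfl
  have h2 : prodSub R (A ++ [(a, x)]) = prodSub R (A ++ [(a, x')]) := by
    simp only [prodSub_append, prodSub_cons]
  rw [imT_append, h1, Submodule.mul_bot, sup_bot_eq, imT_append_last A x', h2]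

/-- A letter of degree `d` cannot merge with either neighbour, since `R_n = 0` for `n > d`; so the
image splits at it. This is the case `a + b = d` of the exact sequence. -/
lemma IsFrob.imT_top (F : IsFrob R d t) (hA : PosList A) (hB : PosList B) :
    imT R (A ++ (d, y) :: B) =
      imT R A * (Rsub R d * prodSub R B) ⊔ prodSub R A * (Rsub R d * imT R B) := by
  have h1 : headIm R d y B = ⊥ := by
    rcases B with - | ⟨⟨b, z⟩, B⟩
    · rfl
    rw [headIm]
    split_ifs
    · have hb : 1 ≤ b := hB.of_cons.1
      rw [F.eq_bot _ (by omega), Submodule.bot_mul]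
    · rfl
  have h2 : imT R (A ++ [(d, y)]) = imT R A * Rsub R d := by
    rcases A.eq_nil_or_concat with rfl | ⟨A, ⟨a, x⟩, rfl⟩
    · simp
    · have ha : 1 ≤ a := hA (a, x) (by simp)
      have h3 : headIm R a x [(d, y)] = ⊥ := by
        rw [headIm]
        split_ifs
        · rw [F.eq_bot _ (by omega), Submodule.bot_mul]
        · rfl
      rw [List.concat_eq_append, List.append_assoc, List.singleton_append, imT_append, h3,
        imT_singleton, Submodule.mul_bot, Submodule.mul_bot, sup_bot_eq, sup_bot_eq, prodSub_cons,
        prodSub_nil, mul_one]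
  rw [imT_append, h1, Submodule.mul_bot, sup_bot_eq, h2, prodSub_append, prodSub_cons, prodSub_nil,
    mul_one, mul_assoc, mul_assoc]

namespace Coaction
variable (c : Coaction R H)

/-- The product `M(u) ⊗ M(v) → TV` of the maps `toT`. -/
def mulT (F : IsFrob R d t) (u v : Word d) : c.M u ⊗[k] c.M v →ₗ[k] TensorAlgebra k V :=
  tmul (c.toT F u) (c.toT F v)

lemma toT_appendEquiv' (F : IsFrob R d t) (u v : Word d) (z) :
    c.toT F (u ++ v) (c.appendEquiv u v z) = c.mulT F u v z := by
  refine LinearMap.congr_fun (f := c.toT F (u ++ v) ∘ₗ (c.appendEquiv u v).toLinearMap)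
    (g := c.mulT F u v) (TensorProduct.ext' fun y z => ?_) z
  rw [mulT, tmul_tmul]
  exact c.toT_appendEquiv F u v y z

lemma mulT_injective (F : IsFrob R d t) (u v : Word d) : Function.Injective (c.mulT F u v) := by
  intro z w h
  rw [← toT_appendEquiv', ← toT_appendEquiv'] at h
  exact (c.appendEquiv u v).injective (c.toT_injective F _ h)

lemma map_imSub (F : IsFrob R d t) (hd : 1 ≤ d) (w : Word d) :
    (c.imSub w).map (c.toT F w) = imT R (nf w).2 := by
  rw [c.imSub_eq F hd, Submodule.map_comap_eq, range_toT, inf_eq_right.2 (imT_le _)]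

lemma ker_mkQ_tensor (F : IsFrob R d t) (hd : 1 ≤ d) (u v : Word d) :
    LinearMap.ker (TensorProduct.map (c.imSub u).mkQ (c.imSub v).mkQ) =
      (imT R (nf u).2 * prodSub R (nf v).2 ⊔ prodSub R (nf u).2 * imT R (nf v).2).comap
        (c.mulT F u v) := by
  rw [ker_map_eq_comap_tmul (Submodule.mkQ_surjective _) (Submodule.mkQ_surjective _)
    (c.mulT_injective F u v), Submodule.ker_mkQ, Submodule.ker_mkQ, range_toT, range_toT,
    c.map_imSub F hd, c.map_imSub F hd]
  rfl

lemma ker_mkQ_append (F : IsFrob R d t) (hd : 1 ≤ d) (u v : Word d) :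
    LinearMap.ker ((c.imSub (u ++ v)).mkQ ∘ₗ (c.appendEquiv u v).toLinearMap) =
      (imT R (nf (u ++ v)).2).comap (c.mulT F u v) := by
  rw [LinearMap.ker_comp, Submodule.ker_mkQ, c.imSub_eq F hd]
  ext z
  simp only [Submodule.mem_comap]
  rw [← toT_appendEquiv']
  rfl

lemma isHom_mkQ_tensor (u v : Word d) :
    Comod.IsHom (X := (c.M u).tensor (c.M v)) (Y := (c.nabla u).tensor (c.nabla v))
      (TensorProduct.map (c.imSub u).mkQ (c.imSub v).mkQ) :=
  (Comod.isHom_mkQ _ _ (c.stable_imSub u)).map (Comod.isHom_mkQ _ _ (c.stable_imSub v))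

lemma isHom_mkQ_append (u v : Word d) :
    Comod.IsHom (X := (c.M u).tensor (c.M v)) (Y := c.nabla (u ++ v))
      ((c.imSub (u ++ v)).mkQ ∘ₗ (c.appendEquiv u v).toLinearMap) :=
  (Comod.isHom_mkQ _ _ (c.stable_imSub (u ++ v))).comp (c.isHom_appendEquiv u v)

lemma surjective_mkQ_append (u v : Word d) : Function.Surjective
    ((c.imSub (u ++ v)).mkQ ∘ₗ (c.appendEquiv u v).toLinearMap) :=
  (Submodule.mkQ_surjective _).comp (c.appendEquiv u v).surjective

lemma surjective_mkQ_tensor (u v : Word d) : Function.Surjective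
    (TensorProduct.map (c.imSub u).mkQ (c.imSub v).mkQ) :=
  TensorProduct.map_surjective (Submodule.mkQ_surjective _) (Submodule.mkQ_surjective _)

lemma nabla_tensor_iso (F : IsFrob R d t) (hd : 1 ≤ d) (u v : Word d)
    (h : imT R (nf (u ++ v)).2 =
      imT R (nf u).2 * prodSub R (nf v).2 ⊔ prodSub R (nf u).2 * imT R (nf v).2) :
    Comod.Iso ((c.nabla u).tensor (c.nabla v)) (c.nabla (u ++ v)) :=
  Comod.Iso.of_surjective (c.isHom_mkQ_tensor u v) (c.isHom_mkQ_append u v)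
    (c.surjective_mkQ_tensor u v) (c.surjective_mkQ_append u v)
    (by rw [c.ker_mkQ_tensor F hd, c.ker_mkQ_append F hd, h])

lemma nabla_iso_of_nf (F : IsFrob R d t) (hd : 1 ≤ d) {u v : Word d} (h : nf u = nf v) :
    Comod.Iso (c.nabla u) (c.nabla v) := by
  obtain ⟨e, h1, -, h2⟩ := exists_equiv (c := c) F (wordEquiv_of_nf hd h)
  refine Comod.Iso.of_surjective (X := c.M u) (Comod.isHom_mkQ _ _ (c.stable_imSub u))
    ((Comod.isHom_mkQ _ _ (c.stable_imSub v)).comp (InU.isHom c F h1)) (Submodule.mkQ_surjective _)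
    ((Submodule.mkQ_surjective _).comp e.surjective) ?_
  rw [LinearMap.ker_comp, Submodule.ker_mkQ, Submodule.ker_mkQ, c.imSub_eq F hd, c.imSub_eq F hd, h]
  ext z
  simp only [Submodule.mem_comap]
  rw [← h2]
  rfl

end Coaction

lemma nf_wordL (hd : 1 ≤ d) (w : Word d) (ha : 1 ≤ a ∧ a ≤ d) (had : a < d) (x : ℤ) :
    nf (wordL hd w a ha x) = ((nf w).1, (nf w).2 ++ [(a, x)]) := by
  have h0 : nf (rdPow ⟨hd, le_rfl⟩ x : Word d) = (x, []) := by
    have := nf_rdPow_append hd x []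
    rwa [List.append_nil, nf_nil, add_zero] at this
  rw [wordL, nf_append, nf_cons, h0, nfCons_r _ had]
  obtain ⟨z, L⟩ := nf w
  rcases L.eq_nil_or_concat with rfl | ⟨L, ⟨e, g⟩, rfl⟩
  · simp [nfMul_nil]
  · simp only [List.concat_eq_append]
    rw [nfMul_append, add_zero, List.append_assoc, List.singleton_append]

lemma nf_wordR (hd : 1 ≤ d) (w : Word d) (hb : 1 ≤ b ∧ b ≤ d) (hbd : b < d) (x : ℤ) :
    nf (wordR hd x b hb w) = (x, (b, (nf w).1) :: (nf w).2) := by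
  rw [wordR, nf_rdPow_append hd, nf_cons, nfCons_r _ hbd, add_zero]

lemma nf_append_cons (w w' : Word d) (ha : 1 ≤ a ∧ a ≤ d) (had : a < d) :
    nf (w ++ .r a ha :: w') = ((nf w).1, (nf w).2 ++ (a, (nf w').1) :: (nf w').2) := by
  rw [nf_append, nf_cons, nfCons_r _ had]
  obtain ⟨z, L⟩ := nf w
  rcases L.eq_nil_or_concat with rfl | ⟨L, ⟨e, g⟩, rfl⟩
  · simp [nfMul_nil]
  · simp only [List.concat_eq_append]
    rw [nfMul_append, add_zero, List.append_assoc, List.singleton_append]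

/-- Let `a` and `b` be the letters at the junction of the two normal forms. An inclusion there needs
total gap `0` and `a + b ≤ d`, which is precisely what is excluded. So `imT` of the product is the
kernel of the projection to the tensor product. -/
theorem Coaction.nabla_tensor_iso_of_not_meets (c : Coaction R H) (F : IsFrob R d t) (hd : 1 ≤ d)
    (u v : Word d) (h : ¬ Meets hd u v) :
    Comod.Iso ((c.nabla u).tensor (c.nabla v)) (c.nabla (u ++ v)) := by
  apply c.nabla_tensor_iso F hd
  have hu := nf_lt u
  have hv := nf_lt v
  rw [nf_append]
  rcases hnu : nf u with ⟨z, L⟩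
  rcases hnv : nf v with ⟨x, L'⟩
  rw [hnu] at hu
  rw [hnv] at hv
  dsimp only at hu hv ⊢
  rcases L.eq_nil_or_concat with rfl | ⟨A, ⟨a, g⟩, rfl⟩
  · simp [nfMul_nil]
  rw [List.concat_eq_append] at *
  rw [nfMul_append]
  rcases L' with - | ⟨⟨b, y⟩, B⟩
  · simp only [prodSub_nil, mul_one, imT_nil, Submodule.mul_bot, sup_bot_eq]
    rw [imT_append_last A g]
  refine F.imT_append_eq g ?_
  by_contra hc
  rw [not_or, not_not, not_lt] at hc
  have hA : IsFrob.LtList d A := fun p hp => hu p (by simp [hp])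
  have ha := hu (a, g) (by simp)
  obtain ⟨hb, hB⟩ := hv.of_cons
  refine h ⟨nfWord hd (z, A), nfWord hd (y, B), x, a, b, ⟨ha.1, ha.2.le⟩, ⟨hb.1, hb.2.le⟩, hc.2,
    cls_eq_of_nf hd ?_, cls_eq_of_nf hd ?_⟩
  · rw [nf_wordL hd _ _ ha.2, nf_nfWord hd hA, hnu, show -x = g by omega]
  · rw [nf_wordR hd _ _ hb.2, nf_nfWord hd hB, hnv]

end Costandard

/-! ### The exact sequences for costandard comodules -/

section CostandardSequence
variable {k : Type u} [Field k] {V : Type u} [AddCommGroup V] [Module k V]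
  {H : Type u} [Ring H] [HopfAlgebra k H] [FiniteDimensional k V]
  {R : Submodule k (V ⊗[k] V)} {d : ℕ} {t : TensorAlgebra k V} {a b : ℕ} {x y : ℤ}

namespace Coaction
variable (c : Coaction R H)

/-- The product `M(w) ⊗ R_e ⊗ M(w') → TV`. -/
def mulT₃ (F : IsFrob R d t) (w : Word d) (e : ℕ) (w' : Word d) :
    (c.M w ⊗[k] Rsub R e) ⊗[k] c.M w' →ₗ[k] TensorAlgebra k V :=
  tmul (tmul (c.toT F w) (Rsub R e).subtype) (c.toT F w')

lemma range_mulT₃ (F : IsFrob R d t) (w : Word d) (e : ℕ) (w' : Word d) :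
    LinearMap.range (c.mulT₃ F w e w') =
      prodSub R (nf w).2 * (Rsub R e * prodSub R (nf w').2) := by
  rw [mulT₃, range_tmul, range_tmul, range_toT, range_toT, Submodule.range_subtype, mul_assoc]

lemma mulT₃_injective (F : IsFrob R d t) (w : Word d) (e : ℕ) (w' : Word d) :
    Function.Injective (tmul (c.toT F w) (Rsub R e).subtype) ∧
      Function.Injective (c.mulT₃ F w e w') := by
  have h := tmul_injective (c.toT_injective F w) (Rsub R e).injective_subtype
    (fun x => prodSub_le _ (c.toT_mem F w x)) (fun x => Rsub_le e x.2)
  refine ⟨h, tmul_injective h (c.toT_injective F w') (l := listDeg (nf w).2 + e) (fun x => ?_)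
    (fun x => prodSub_le _ (c.toT_mem F w' x))⟩
  have h1 : LinearMap.range (tmul (c.toT F w) (Rsub R e).subtype) = prodSub R (nf w).2 * Rsub R e := by
    rw [range_tmul, range_toT, Submodule.range_subtype]
  rw [Vpow, pow_add]
  exact mul_le_mul' (prodSub_le _) (Rsub_le e) (h1.le ⟨x, rfl⟩)

/-- The inclusion of `M(w) ⊗ R_{a+b} ⊗ M(w')` in `M(u) ⊗ M(v)`. -/
lemma exists_merge (F : IsFrob R d t) (hd : 1 ≤ d) (w w' : Word d) (ha : 1 ≤ a ∧ a ≤ d)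
    (hb : 1 ≤ b ∧ b ≤ d) (hab : 1 ≤ a + b ∧ a + b ≤ d) {u v : Word d}
    (h : nf (w ++ .r a ha :: .r b hb :: w') = nf (u ++ v)) :
    ∃ f : (c.M w ⊗[k] Rsub R (a + b)) ⊗[k] c.M w' →ₗ[k] c.M u ⊗[k] c.M v,
      Comod.IsHom (X := ((c.M w).tensor (c.RComod (a + b))).tensor (c.M w'))
        (Y := (c.M u).tensor (c.M v)) f ∧
      ∀ z, c.mulT F u v (f z) = c.mulT₃ F w (a + b) w' z := by
  obtain ⟨φ, h1, h2, -⟩ := InU.phi' (c := c) F ha hb hab w'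
  obtain ⟨e, h3, -, h4⟩ := exists_equiv (c := c) F (wordEquiv_of_nf hd h)
  refine ⟨(c.appendEquiv u v).symm.toLinearMap ∘ₗ e.toLinearMap ∘ₗ
    (c.appendEquiv w (.r a ha :: .r b hb :: w')).toLinearMap ∘ₗ φ.lTensor (c.M w) ∘ₗ
    (TensorProduct.assoc k (c.M w) (Rsub R (a + b)) (c.M w')).toLinearMap, ?_, fun z => ?_⟩
  · exact (c.isHom_appendEquiv u v).symm.comp ((InU.isHom c F h3).comp
      ((c.isHom_appendEquiv w (.r a ha :: .r b hb :: w')).comp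
      (((InU.isHom c F h1).lTensor (c.M w)).comp
        (Comod.isHom_assoc (c.M w) (c.RComod (a + b)) (c.M w')))))
  · rw [← toT_appendEquiv']
    have h5 (z) : c.mulT F w (.r a ha :: .r b hb :: w') (φ.lTensor (c.M w)
        (TensorProduct.assoc k (c.M w) (Rsub R (a + b)) (c.M w') z)) =
          c.mulT₃ F w (a + b) w' z := by
      refine LinearMap.congr_fun (f := c.mulT F w (.r a ha :: .r b hb :: w') ∘ₗ φ.lTensor (c.M w) ∘ₗ
        (TensorProduct.assoc k (c.M w) (Rsub R (a + b)) (c.M w')).toLinearMap)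
        (g := c.mulT₃ F w (a + b) w')
        (TensorProduct.ext_threefold fun m r m' => ?_) z
      rw [mulT₃, tmul_tmul, tmul_tmul, mul_assoc]
      change c.toT F w m * c.toT F (.r a ha :: .r b hb :: w') (φ (r ⊗ₜ[k] m')) = _
      rw [h2]
      rfl
    rw [← h5, ← toT_appendEquiv']
    refine Eq.trans ?_ (h4 _)
    exact congrArg _ ((c.appendEquiv u v).apply_symm_apply _)

/-- Both cases share the inclusion of `M(w) ⊗ R_{a+b} ⊗ M(w')` in `M(u) ⊗ M(v)`. Injectivity of the
first map is `merge_inf_imT` together with `imT_merge_le`, and exactness in the middle is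
`imT_gap_zero`. Only the presentation `q` of the first term depends on whether `a + b < d`. -/
lemma nabla_shortExact_of_surjective (K : LinRes R) (F : IsFrob R d t) (hd : 1 ≤ d) (w w' : Word d)
    (ha : 1 ≤ a ∧ a ≤ d) (hb : 1 ≤ b ∧ b ≤ d) (hab : 1 ≤ a + b ∧ a + b ≤ d) {X : Comod k H}
    {q : (c.M w ⊗[k] Rsub R (a + b)) ⊗[k] c.M w' →ₗ[k] X}
    (hq : Comod.IsHom (X := ((c.M w).tensor (c.RComod (a + b))).tensor (c.M w')) q)
    (hs : Function.Surjective q) (hk : LinearMap.ker q =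
      (imT R ((nf w).2 ++ (a + b, (nf w').1) :: (nf w').2)).comap (c.mulT₃ F w (a + b) w')) :
    Comod.ShortExact X ((c.nabla (wordL hd w a ha (-x))).tensor (c.nabla (wordR hd x b hb w')))
      (c.nabla (wordL hd w a ha (-x) ++ wordR hd x b hb w')) := by
  have had : a < d := by omega
  have hbd : b < d := by omega
  have hu := nf_wordL hd w ha had (-x)
  have hv := nf_wordR hd w' hb hbd x
  have huv : nf (wordL hd w a ha (-x) ++ wordR hd x b hb w') =
      ((nf w).1, (nf w).2 ++ (a, 0) :: (b, (nf w').1) :: (nf w').2) := by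
    rw [nf_append, hu, hv, nfMul_append, neg_add_cancel]
  have hw : nf (w ++ .r a ha :: .r b hb :: w') =
      ((nf w).1, (nf w).2 ++ (a, 0) :: (b, (nf w').1) :: (nf w').2) := by
    rw [nf_append_cons _ _ _ had, nf_cons, nfCons_r _ hbd]
  obtain ⟨f, hf, hf'⟩ := c.exists_merge F hd w w' ha hb hab (hw.trans huv.symm)
  have hA : PosList (nf w).2 := (nf_lt w).posList
  have hB : PosList (nf w').2 := (nf_lt w').posList
  have h2 := c.ker_mkQ_tensor F hd (wordL hd w a ha (-x)) (wordR hd x b hb w')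
  -- Any nonzero gap at the junction describes the kernel for the tensor product; the gap `1` is
  -- used.
  rw [hu, hv, ← F.imT_append_eq (x := 1) (-x) (Or.inl one_ne_zero)] at h2
  have h3 := c.ker_mkQ_append F hd (wordL hd w a ha (-x)) (wordR hd x b hb w')
  rw [huv, imT_gap_zero one_ne_zero] at h3
  have hP : LinearMap.range (c.mulT₃ F w (a + b) w') =
      prodSub R ((nf w).2 ++ (a + b, (nf w').1) :: (nf w').2) := by
    rw [range_mulT₃, prodSub_append, prodSub_cons]
  refine .of_surjective hq (c.isHom_mkQ_tensor _ _) (c.isHom_mkQ_append _ _) hf hs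
    (c.surjective_mkQ_tensor _ _) (c.surjective_mkQ_append _ _) ?_ ?_
  · rw [hk, h2]
    ext z
    simp only [Submodule.mem_comap]
    rw [hf']
    exact ⟨fun h => imT_merge_le ha.1 hb.1 hA hB one_ne_zero h, fun h =>
      K.merge_inf_imT ha.1 hb.1 hA hB one_ne_zero ⟨hP.le ⟨z, rfl⟩, h⟩⟩
  · rw [h2, h3]
    ext z
    constructor
    · intro h
      obtain ⟨p, hp, q, hq, hpq⟩ := Submodule.mem_sup.1 (Submodule.mem_comap.1 h)
      obtain ⟨y, rfl⟩ := hP.ge hq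
      rw [← hf'] at hpq
      refine Submodule.mem_sup.2 ⟨z - f y, ?_, f y, ⟨y, rfl⟩, sub_add_cancel _ _⟩
      rw [Submodule.mem_comap, map_sub, ← hpq, add_sub_cancel_right]
      exact hp
    · intro h
      obtain ⟨p, hp, _, ⟨y, rfl⟩, rfl⟩ := Submodule.mem_sup.1 h
      rw [Submodule.mem_comap, map_add, hf']
      exact Submodule.add_mem_sup hp (hP.le ⟨y, rfl⟩)

theorem nabla_shortExact_lt (K : LinRes R) (F : IsFrob R d t) (hd : 1 ≤ d) (w w' : Word d) (x : ℤ)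
    (ha : 1 ≤ a ∧ a ≤ d) (hb : 1 ≤ b ∧ b ≤ d) (hab : 1 ≤ a + b ∧ a + b ≤ d) (h : a + b < d) :
    Comod.ShortExact (c.nabla (w ++ .r (a + b) hab :: w'))
      ((c.nabla (wordL hd w a ha (-x))).tensor (c.nabla (wordR hd x b hb w')))
      (c.nabla (wordL hd w a ha (-x) ++ wordR hd x b hb w')) := by
  let l : Letter d := .r (a + b) hab
  refine c.nabla_shortExact_of_surjective K F hd w w' ha hb hab
    (q := ((c.imSub (w ++ l :: w')).mkQ ∘ₗ (c.appendEquiv w (l :: w')).toLinearMap) ∘ₗ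
      (TensorProduct.assoc k (c.M w) (Rsub R (a + b)) (c.M w')).toLinearMap) ?_ ?_ ?_
  · exact (c.isHom_mkQ_append w (l :: w')).comp
      (Comod.isHom_assoc (c.M w) (c.RComod (a + b)) (c.M w'))
  · exact (c.surjective_mkQ_append w (l :: w')).comp (LinearEquiv.surjective _)
  · have h1 : c.mulT F w (l :: w') ∘ₗ
        (TensorProduct.assoc k (c.M w) (Rsub R (a + b)) (c.M w')).toLinearMap =
          c.mulT₃ F w (a + b) w' := by
      refine TensorProduct.ext_threefold fun m r m' => ?_
      rw [mulT₃, tmul_tmul, tmul_tmul, mul_assoc]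
      change c.toT F w m * c.act F l r (c.toT F w' m') = _
      rw [act_r _ _ _ h]
      rfl
    rw [LinearMap.ker_comp, c.ker_mkQ_append F hd, nf_append_cons _ _ _ h, ← h1,
      Submodule.comap_comp]

/-- The letter `R_d` receives no relation with its neighbours, so the quotient of the merged product
is a tensor product of three separate quotients, the middle one trivial. -/
theorem nabla_shortExact_eq (K : LinRes R) (F : IsFrob R d t) (hd : 1 ≤ d) (w w' : Word d) (x : ℤ)
    (ha : 1 ≤ a ∧ a ≤ d) (hb : 1 ≤ b ∧ b ≤ d) (h : a + b = d) :
    Comod.ShortExact (((c.nabla w).tensor (c.RComod d)).tensor (c.nabla w'))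
      ((c.nabla (wordL hd w a ha (-x))).tensor (c.nabla (wordR hd x b hb w')))
      (c.nabla (wordL hd w a ha (-x) ++ wordR hd x b hb w')) := by
  subst h
  have hs : Function.Surjective ((c.imSub w).mkQ.rTensor (Rsub R (a + b))) :=
    LinearMap.rTensor_surjective _ (Submodule.mkQ_surjective _)
  refine c.nabla_shortExact_of_surjective K F hd w w' ha hb ⟨hd, le_rfl⟩
    (q := TensorProduct.map ((c.imSub w).mkQ.rTensor (Rsub R (a + b))) (c.imSub w').mkQ) ?_ ?_ ?_
  · exact ((Comod.isHom_mkQ _ _ (c.stable_imSub w)).rTensor (c.RComod (a + b))).map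
      (Comod.isHom_mkQ _ _ (c.stable_imSub w'))
  · exact TensorProduct.map_surjective hs (Submodule.mkQ_surjective _)
  · obtain ⟨hi, hi'⟩ := c.mulT₃_injective F w (a + b) w'
    have h1 : (LinearMap.ker ((c.imSub w).mkQ.rTensor (Rsub R (a + b)))).map
        (tmul (c.toT F w) (Rsub R (a + b)).subtype) = imT R (nf w).2 * Rsub R (a + b) := by
      rw [LinearMap.rTensor, ker_map_eq_comap_tmul (Submodule.mkQ_surjective _)
        Function.surjective_id hi, Submodule.ker_mkQ, c.map_imSub F hd, LinearMap.ker_id,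
        Submodule.map_bot, Submodule.mul_bot, sup_bot_eq, Submodule.range_subtype,
        Submodule.map_comap_eq, range_tmul, range_toT, Submodule.range_subtype]
      exact inf_eq_right.2 (mul_le_mul' (imT_le _) le_rfl)
    rw [ker_map_eq_comap_tmul hs (Submodule.mkQ_surjective _) hi', h1, Submodule.ker_mkQ,
      c.map_imSub F hd, range_toT, range_tmul, range_toT, Submodule.range_subtype,
      F.imT_top (nf_lt w).posList (nf_lt w').posList, mul_assoc, mul_assoc]
    rfl

end Coaction
end CostandardSequence

/-! ### Tensor products and exact sequences for standard comodules -/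

section Standard
variable {k : Type u} [Field k] {V : Type u} [AddCommGroup V] [Module k V]
  {H : Type u} [Ring H] [HopfAlgebra k H] [FiniteDimensional k V]
  {R : Submodule k (V ⊗[k] V)} {d : ℕ} {t : TensorAlgebra k V} {a b e : ℕ} {x y : ℤ}

lemma IsFrob.annT_nil (F : IsFrob R d t) : F.annT [] = 1 := by
  refine le_antisymm F.annT_le (le_inf le_rfl ?_)
  refine le_iInf₂ fun u hu => ?_
  rw [show dualList d 1 [] = [] from rfl, imT_nil, Submodule.mem_bot] at hu
  rw [hu, map_zero, LinearMap.ker_zero]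
  exact le_top

namespace Coaction
variable (c : Coaction R H)

lemma map_kerSub (F : IsFrob R d t) (hd : 1 ≤ d) (w : Word d) :
    (c.kerSub w).map (c.toT F w) = F.annT (nf w).2 := by
  rw [c.kerSub_eq F hd, Submodule.map_comap_eq, range_toT, inf_eq_right.2 F.annT_le]

lemma range_subtype_tensor (F : IsFrob R d t) (hd : 1 ≤ d) (u v : Word d) :
    LinearMap.range (TensorProduct.map (c.kerSub u).subtype (c.kerSub v).subtype) =
      (F.annT (nf u).2 * F.annT (nf v).2).comap (c.mulT F u v) := by
  rw [range_map_eq_comap_tmul _ _ (c.mulT_injective F u v), Submodule.range_subtype,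
    Submodule.range_subtype, c.map_kerSub F hd, c.map_kerSub F hd]
  rfl

lemma range_subtype_append (F : IsFrob R d t) (hd : 1 ≤ d) (u v : Word d) :
    LinearMap.range ((c.appendEquiv u v).symm.toLinearMap ∘ₗ (c.kerSub (u ++ v)).subtype) =
      (F.annT (nf (u ++ v)).2).comap (c.mulT F u v) := by
  rw [LinearMap.range_comp, Submodule.range_subtype, c.kerSub_eq F hd]
  ext z
  rw [Submodule.mem_comap, ← toT_appendEquiv']
  constructor
  · rintro ⟨y, hy, rfl⟩
    rw [LinearEquiv.coe_coe, LinearEquiv.apply_symm_apply]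
    exact hy
  · exact fun h => ⟨c.appendEquiv u v z, h, (c.appendEquiv u v).symm_apply_apply z⟩

lemma isHom_subtype_tensor (u v : Word d) :
    Comod.IsHom (X := (c.delta u).tensor (c.delta v)) (Y := (c.M u).tensor (c.M v))
      (TensorProduct.map (c.kerSub u).subtype (c.kerSub v).subtype) :=
  (Comod.isHom_subtype _ _ (c.stable_kerSub u)).map (Comod.isHom_subtype _ _ (c.stable_kerSub v))

lemma isHom_subtype_append (u v : Word d) :
    Comod.IsHom (X := c.delta (u ++ v)) (Y := (c.M u).tensor (c.M v))
      ((c.appendEquiv u v).symm.toLinearMap ∘ₗ (c.kerSub (u ++ v)).subtype) :=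
  (c.isHom_appendEquiv u v).symm.comp (Comod.isHom_subtype _ _ (c.stable_kerSub (u ++ v)))

lemma injective_subtype_append (u v : Word d) : Function.Injective
    ((c.appendEquiv u v).symm.toLinearMap ∘ₗ (c.kerSub (u ++ v)).subtype) :=
  (c.appendEquiv u v).symm.injective.comp (Submodule.injective_subtype _)

lemma injective_subtype_tensor (u v : Word d) : Function.Injective
    (TensorProduct.map (c.kerSub u).subtype (c.kerSub v).subtype) :=
  TensorProduct.map_injective_of_flat_flat _ _ (Submodule.injective_subtype _)
    (Submodule.injective_subtype _)

lemma delta_tensor_iso (F : IsFrob R d t) (hd : 1 ≤ d) (u v : Word d)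
    (h : F.annT (nf (u ++ v)).2 = F.annT (nf u).2 * F.annT (nf v).2) :
    Comod.Iso ((c.delta u).tensor (c.delta v)) (c.delta (u ++ v)) :=
  Comod.Iso.of_injective (c.isHom_subtype_tensor u v) (c.isHom_subtype_append u v)
    (c.injective_subtype_tensor u v) (c.injective_subtype_append u v)
    (by rw [c.range_subtype_tensor F hd, c.range_subtype_append F hd, h])

lemma delta_iso_of_nf (F : IsFrob R d t) (hd : 1 ≤ d) {u v : Word d} (h : nf u = nf v) :
    Comod.Iso (c.delta u) (c.delta v) := by
  obtain ⟨e, h1, -, h2⟩ := exists_equiv (c := c) F (wordEquiv_of_nf hd h)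
  refine Comod.Iso.of_injective (X := c.M v)
    ((InU.isHom c F h1).comp (Comod.isHom_subtype _ _ (c.stable_kerSub u)))
    (Comod.isHom_subtype _ _ (c.stable_kerSub v)) (e.injective.comp (Submodule.injective_subtype _))
    (Submodule.injective_subtype _) ?_
  rw [LinearMap.range_comp, Submodule.range_subtype, Submodule.range_subtype, c.kerSub_eq F hd,
    c.kerSub_eq F hd, h]
  ext z
  constructor
  · rintro ⟨y, hy, rfl⟩
    exact Submodule.mem_comap.2 ((h2 y).symm ▸ hy)
  · intro hz
    refine ⟨e.symm z, Submodule.mem_comap.2 ?_, e.apply_symm_apply z⟩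
    rw [← h2, e.apply_symm_apply]
    exact hz

/-- A contraction across the junction needs total gap `-1` and `a + b ≥ d`. If this is excluded, the
annihilators of both factors multiply. -/
theorem delta_tensor_iso_of_not_joins (F : IsFrob R d t) (hd : 1 ≤ d) (u v : Word d)
    (h : ¬ Joins hd u v) : Comod.Iso ((c.delta u).tensor (c.delta v)) (c.delta (u ++ v)) := by
  apply c.delta_tensor_iso F hd
  have hu := nf_lt u
  have hv := nf_lt v
  rw [nf_append]
  rcases hnu : nf u with ⟨z, L⟩
  rcases hnv : nf v with ⟨x, L'⟩
  rw [hnu] at hu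
  rw [hnv] at hv
  dsimp only at hu hv ⊢
  rcases L.eq_nil_or_concat with rfl | ⟨A, ⟨a, g⟩, rfl⟩
  · rw [nfMul_nil, F.annT_nil, one_mul]
  rw [List.concat_eq_append] at *
  rw [nfMul_append]
  rcases L' with - | ⟨⟨b, y⟩, B⟩
  · rw [F.annT_nil, mul_one, F.annT_last A g]
  rw [F.annT_last A g (g + x)]
  have hL : IsFrob.LeList d (A ++ [(a, g + x)]) := by
    intro p hp
    rcases List.mem_append.1 hp with hp | hp
    · exact hu.le p (by simp [hp])
    · rw [List.mem_singleton.1 hp]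
      exact hu.le (a, g) (by simp)
  refine F.annT_append hL hv.le ?_
  by_contra hc
  rw [not_or, not_not, not_lt] at hc
  have hA : IsFrob.LtList d A := fun p hp => hu p (by simp [hp])
  have ha := hu (a, g) (by simp)
  obtain ⟨hb, hB⟩ := hv.of_cons
  refine h ⟨nfWord hd (z, A), nfWord hd (y, B), x, a, b, ⟨ha.1, ha.2.le⟩, ⟨hb.1, hb.2.le⟩, ha.2, hb.2,
    hc.2, cls_eq_of_nf hd ?_, cls_eq_of_nf hd ?_⟩
  · rw [nf_wordL hd _ _ ha.2, nf_nfWord hd hA, hnu, show -x - 1 = g by omega]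
  · rw [nf_wordR hd _ _ hb.2, nf_nfWord hd hB, hnv]

/-- A contraction `M(u) ⊗ M(v) → M(w) ⊗ M(v')`. -/
lemma exists_contract (F : IsFrob R d t) (hd : 1 ≤ d) (w w' v' : Word d) (ha : 1 ≤ a ∧ a ≤ d)
    (hb : 1 ≤ b ∧ b ≤ d) (had : a < d) (hbd : b < d)
    {θ : c.M (.r a ha :: .rdInv :: .r b hb :: w') →ₗ[k] c.M v'} (hθ : c.InU _ _ θ)
    (hθ' : ∀ (x : Rsub R a) (ξ : Module.Dual k (Rsub R d)) (y : Rsub R b) (m : c.M w'),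
      c.toT F v' (θ (x ⊗ₜ[k] (ξ ⊗ₜ[k] (y ⊗ₜ[k] m)))) = ξ ⟨t, F.mem⟩ • (F.D b y x * c.toT F w' m))
    {u v : Word d} (h : nf (u ++ v) = nf (w ++ .r a ha :: .rdInv :: .r b hb :: w')) :
    ∃ f : c.M u ⊗[k] c.M v →ₗ[k] c.M w ⊗[k] c.M v',
      Comod.IsHom (X := (c.M u).tensor (c.M v)) (Y := (c.M w).tensor (c.M v')) f ∧
      ∀ z, c.mulT F w v' (f z) = lw (listDeg (nf w).2) (F.contract a b) (c.mulT F u v z) := by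
  let s : Word d := .r a ha :: .rdInv :: .r b hb :: w'
  obtain ⟨e, h3, -, h4⟩ := exists_equiv (c := c) F (wordEquiv_of_nf hd h)
  have h1 (z) : c.toT F v' (θ z) = F.contract a b (c.toT F s z) := by
    refine LinearMap.congr_fun (f := c.toT F v' ∘ₗ θ) (g := F.contract a b ∘ₗ c.toT F s)
      (TensorProduct.ext (LinearMap.ext fun x => TensorProduct.ext (LinearMap.ext fun ξ =>
        TensorProduct.ext' fun q m => ?_))) z
    refine (hθ' x ξ q m).trans ?_
    change _ = F.contract a b (c.toT F s (x ⊗ₜ[k] (ξ ⊗ₜ[k] (q ⊗ₜ[k] m))))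
    rw [toT_cons, toT_cons, toT_cons, act_r _ _ _ had, act_rdInv, act_r _ _ _ hbd, mul_smul_comm,
      map_smul, F.contract_mul x.2 q.2]
  have h2 (z) : c.mulT F w v' (θ.lTensor (c.M w) z) =
      lw (listDeg (nf w).2) (F.contract a b) (c.mulT F w s z) := by
    refine LinearMap.congr_fun (f := c.mulT F w v' ∘ₗ θ.lTensor (c.M w))
      (g := lw (listDeg (nf w).2) (F.contract a b) ∘ₗ c.mulT F w s)
      (TensorProduct.ext' fun m z => ?_) z
    rw [LinearMap.comp_apply, LinearMap.lTensor_tmul, LinearMap.comp_apply, mulT, mulT, tmul_tmul,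
      tmul_tmul, lw_mul _ (prodSub_le _ (c.toT_mem F w m)), h1]
  refine ⟨θ.lTensor (c.M w) ∘ₗ (c.appendEquiv w s).symm.toLinearMap ∘ₗ e.toLinearMap ∘ₗ
    (c.appendEquiv u v).toLinearMap, ?_, fun z => ?_⟩
  · exact ((InU.isHom c F hθ).lTensor (c.M w)).comp ((c.isHom_appendEquiv w s).symm.comp
      ((InU.isHom c F h3).comp (c.isHom_appendEquiv u v)))
  · refine (h2 _).trans ?_
    rw [← toT_appendEquiv', ← toT_appendEquiv', ← h4]
    exact congrArg _ (congrArg _ ((c.appendEquiv w s).apply_symm_apply _))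

/-- The sequence is read inside `M(u) ⊗ M(v)` along the contraction `f` at the junction. By
`annT_contract` the kernel of `f` on `Δ(u) ⊗ Δ(v)` is `Δ(uv)`, and its image is the annihilator of
the contracted list; `j` describes that annihilator in both cases. -/
lemma delta_shortExact_of_injective (K : LinRes R) (F : IsFrob R d t) (hd : 1 ≤ d) (w w' v' : Word d)
    (ha : 1 ≤ a ∧ a ≤ d) (hb : 1 ≤ b ∧ b ≤ d) (had : a < d) (hbd : b < d) (hab : a + b = e + d)
    {θ : c.M (.r a ha :: .rdInv :: .r b hb :: w') →ₗ[k] c.M v'} (hθ : c.InU _ _ θ)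
    (hθ' : ∀ (x : Rsub R a) (ξ : Module.Dual k (Rsub R d)) (y : Rsub R b) (m : c.M w'),
      c.toT F v' (θ (x ⊗ₜ[k] (ξ ⊗ₜ[k] (y ⊗ₜ[k] m)))) = ξ ⟨t, F.mem⟩ • (F.D b y x * c.toT F w' m))
    {X : Comod k H} {j : X →ₗ[k] c.M w ⊗[k] c.M v'}
    (hj : Comod.IsHom (Y := (c.M w).tensor (c.M v')) j) (hi : Function.Injective j)
    (hr : LinearMap.range j =
      (F.annT ((nf w).2 ++ (e, (nf w').1) :: (nf w').2)).comap (c.mulT F w v')) :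
    Comod.ShortExact (c.delta (wordL hd w a ha (-x - 1) ++ wordR hd x b hb w'))
      ((c.delta (wordL hd w a ha (-x - 1))).tensor (c.delta (wordR hd x b hb w'))) X := by
  have hu := nf_wordL hd w ha had (-x - 1)
  have hv := nf_wordR hd w' hb hbd x
  have huv : nf (wordL hd w a ha (-x - 1) ++ wordR hd x b hb w') =
      ((nf w).1, (nf w).2 ++ (a, -1) :: (b, (nf w').1) :: (nf w').2) := by
    rw [nf_append, hu, hv, nfMul_append, show -x - 1 + x = -1 by ring]
  have hw : nf (w ++ .r a ha :: .rdInv :: .r b hb :: w') =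
      ((nf w).1, (nf w).2 ++ (a, -1) :: (b, (nf w').1) :: (nf w').2) := by
    rw [nf_append_cons _ _ _ had, nf_cons .rdInv, nfCons_rdInv, nf_cons, nfCons_r _ hbd]
    rfl
  obtain ⟨f, hf, hf'⟩ := c.exists_contract F hd w w' v' ha hb had hbd hθ hθ' (huv.trans hw.symm)
  have h2 := c.range_subtype_tensor F hd (wordL hd w a ha (-x - 1)) (wordR hd x b hb w')
  have hL : IsFrob.LeList d ((nf w).2 ++ [(a, 0)]) := by
    intro p hp
    rcases List.mem_append.1 hp with hp | hp
    · exact (nf_lt w).le p hp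
    · rw [List.mem_singleton.1 hp]
      exact had.le
  have hL' : IsFrob.LeList d ((b, (nf w').1) :: (nf w').2) := by
    intro p hp
    rcases List.mem_cons.1 hp with rfl | hp
    · exact hbd.le
    · exact (nf_lt w').le p hp
  -- The gap `0` at the junction stands for a generic one: contractions require the gap `-1`.
  rw [hu, hv, F.annT_last _ _ 0, ← F.annT_append hL hL' (Or.inl (by omega))] at h2
  have h3 := c.range_subtype_append F hd (wordL hd w a ha (-x - 1)) (wordR hd x b hb w')
  obtain ⟨h4, h5⟩ := F.annT_contract K (nf_lt w) (nf_lt w') had hbd hab (x := 0) (y := (nf w').1)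
    (f := lw (listDeg (nf w).2) (F.contract a b)) (by omega)
    (fun p hp z _ => lw_mul _ (prodSub_le _ hp) z)
  rw [huv, ← h5] at h3
  refine .of_injective hj (c.isHom_subtype_tensor _ _) (c.isHom_subtype_append _ _) hf hi
    (c.injective_subtype_tensor _ _) (c.injective_subtype_append _ _) ?_ ?_
  · rw [h2, h3]
    ext z
    simp only [Submodule.mem_comap, Submodule.mem_inf, LinearMap.mem_ker]
    rw [← hf', map_eq_zero_iff _ (c.mulT_injective F w v')]
  · rw [hr, h2, ← h4]
    ext z
    constructor
    · rintro ⟨s, hs, hs'⟩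
      have h6 : s ∈ LinearMap.range (c.mulT F (wordL hd w a ha (-x - 1)) (wordR hd x b hb w')) := by
        rw [mulT, range_tmul, range_toT, range_toT, hu, hv]
        have h7 := F.annT_le hs
        simpa only [prodSub_append, prodSub_cons, prodSub_nil, mul_one, mul_assoc] using h7
      obtain ⟨s, rfl⟩ := h6
      refine ⟨s, hs, c.mulT_injective F w v' ?_⟩
      rw [hf', hs']
    · rintro ⟨s, hs, rfl⟩
      rw [Submodule.mem_comap, hf']
      exact ⟨_, hs, rfl⟩

theorem delta_shortExact_gt (K : LinRes R) (F : IsFrob R d t) (hd : 1 ≤ d) (w w' : Word d) (x : ℤ)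
    (ha : 1 ≤ a ∧ a ≤ d) (hb : 1 ≤ b ∧ b ≤ d) (had : a < d) (hbd : b < d)
    (hab : 1 ≤ a + b - d ∧ a + b - d ≤ d) :
    Comod.ShortExact (c.delta (wordL hd w a ha (-x - 1) ++ wordR hd x b hb w'))
      ((c.delta (wordL hd w a ha (-x - 1))).tensor (c.delta (wordR hd x b hb w')))
      (c.delta (w ++ .r (a + b - d) hab :: w')) := by
  obtain ⟨θ, h1, h2⟩ := InU.theta_gt (c := c) F ha hb hab had hbd (by omega) w'
  refine c.delta_shortExact_of_injective K F hd w w' _ ha hb had hbd (e := a + b - d) (by omega) h1 h2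
    (c.isHom_subtype_append _ _) (c.injective_subtype_append _ _) ?_
  rw [c.range_subtype_append F hd, nf_append_cons _ _ _ (show a + b - d < d by omega)]

/-- Contraction leaves a letter of degree `0`, and `annT_zero` splits the annihilator into those of
`w` and `w'`. -/
theorem delta_shortExact_eq (K : LinRes R) (F : IsFrob R d t) (hd : 1 ≤ d) (w w' : Word d) (x : ℤ)
    (ha : 1 ≤ a ∧ a ≤ d) (hb : 1 ≤ b ∧ b ≤ d) (had : a < d) (hbd : b < d) (hab : a + b = d) :
    Comod.ShortExact (c.delta (wordL hd w a ha (-x - 1) ++ wordR hd x b hb w'))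
      ((c.delta (wordL hd w a ha (-x - 1))).tensor (c.delta (wordR hd x b hb w')))
      ((c.delta w).tensor (c.delta w')) := by
  obtain ⟨θ, h1, h2⟩ := InU.theta' (c := c) F ha hb hab w'
  refine c.delta_shortExact_of_injective K F hd w w' w' ha hb had hbd (e := 0) (by omega) h1
    (fun x ξ q m => ?_) (c.isHom_subtype_tensor w w') (c.injective_subtype_tensor w w') ?_
  · rw [h2, IsFrob.D_apply, show d - b = a by omega, cR_self _ (Rsub_le a x.2), map_smul,
      smul_mul_assoc, one_mul, mul_smul]
  · rw [c.range_subtype_tensor F hd, F.annT_zero (nf_lt w) (nf_lt w')]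

end Coaction
end Standard

/-! ### Filtrations of tensor products and of the comodules `M(λ)` -/

section Filtrations
variable {k : Type u} [Field k] {V : Type u} [AddCommGroup V] [Module k V]
  {H : Type u} [Ring H] [HopfAlgebra k H] [FiniteDimensional k V]
  {R : Submodule k (V ⊗[k] V)} {d : ℕ} {t : TensorAlgebra k V}

lemma Comod.iso_tensor_unit (X : Comod k H) : Comod.Iso X (X.tensor (Comod.unit k H)) := by
  refine ⟨(TensorProduct.rid k X).symm, fun x => ?_⟩
  have h (z : H ⊗[k] X) : Comod.mulTensor X k (z ⊗ₜ[k] ((1 : H) ⊗ₜ[k] (1 : k))) =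
      ((TensorProduct.rid k X).symm : X →ₗ[k] X ⊗[k] k).lTensor H z := by
    induction z with
    | zero => simp
    | add a b ha hb => simp only [TensorProduct.add_tmul, map_add, ha, hb]
    | tmul a x => simp
  exact h (X.ρ x)

lemma nf_singleton (l : Letter d) : (nf [l]).2 = [] ∨ ∃ a, (nf [l]).2 = [(a, 0)] := by
  rw [nf_cons]
  cases l with
  | r a h =>
    rcases h.2.eq_or_lt with rfl | had
    · exact Or.inl (by rw [nfCons_rd, nf_nil])
    · exact Or.inr ⟨a, by rw [nfCons_r _ had, nf_nil]⟩
  | rdInv => exact Or.inl (by rw [nfCons_rdInv, nf_nil])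

namespace Coaction
variable (c : Coaction R H)

lemma iso_nabla (F : IsFrob R d t) (hd : 1 ≤ d) (w : Word d) (h : imT R (nf w).2 = ⊥) :
    Comod.Iso (c.M w) (c.nabla w) := by
  refine Comod.Iso.of_surjective (X := c.M w) Comod.isHom_id
    (Comod.isHom_mkQ _ _ (c.stable_imSub w)) Function.surjective_id (Submodule.mkQ_surjective _) ?_
  rw [LinearMap.ker_id, Submodule.ker_mkQ, c.imSub_eq F hd, h, ← LinearMap.ker,
    LinearMap.ker_eq_bot.2 (c.toT_injective F w)]

lemma delta_iso (F : IsFrob R d t) (hd : 1 ≤ d) (w : Word d)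
    (h : F.annT (nf w).2 = prodSub R (nf w).2) : Comod.Iso (c.delta w) (c.M w) := by
  refine Comod.Iso.of_injective (X := c.M w) (Comod.isHom_subtype _ _ (c.stable_kerSub w))
    Comod.isHom_id (Submodule.injective_subtype _) Function.injective_id ?_
  rw [LinearMap.range_id, Submodule.range_subtype, c.kerSub_eq F hd, h, eq_top_iff]
  exact fun z _ => c.toT_mem F w z

lemma letter_iso_nabla (F : IsFrob R d t) (hd : 1 ≤ d) (l : Letter d) :
    Comod.Iso (c.L l) (c.nabla [l]) := by
  refine (c.L l).iso_tensor_unit.trans (c.iso_nabla F hd [l] ?_)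
  rcases nf_singleton l with h | ⟨a, h⟩ <;> rw [h] <;> simp

lemma delta_iso_letter (F : IsFrob R d t) (hd : 1 ≤ d) (l : Letter d) :
    Comod.Iso (c.delta [l]) (c.L l) := by
  refine (c.delta_iso F hd [l] ?_).trans (c.L l).iso_tensor_unit.symm
  rcases nf_singleton l with h | ⟨a, h⟩ <;> rw [h]
  · rw [F.annT_nil, prodSub_nil]
  · rw [F.annT_singleton, prodSub_cons, prodSub_nil, mul_one]

/-- The normal form of `r_d` has no letter, whereas `Meets` would provide a first letter `b ≤ d - a
< d`. -/
lemma not_meets_rd (hd : 1 ≤ d) (w : Word d) : ¬ Meets hd w [.r d ⟨hd, le_rfl⟩] := by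
  rintro ⟨u, v, x, a, b, ha, hb, hab, -, h⟩
  have h1 := nf_eq_of_cls h
  rw [nf_wordR hd _ _ (by omega), nf_cons, nfCons_rd] at h1
  cases (Prod.ext_iff.1 h1).2

open Comod in
-- Induction on the total number of letters. In the sequence for `a + b < d` both outer terms are
-- costandard. For `a + b = d` the first term is a tensor product with two letters fewer, so the
-- induction hypothesis applies to it.
theorem filtered_nabla_tensor (K : LinRes R) (F : IsFrob R d t) (hd : 1 ≤ d) (u v : Word d) :
    Filtered (c.nabla (d := d)) ((c.nabla u).tensor (c.nabla v)) := by
  induction hn : (nf u).2.length + (nf v).2.length using Nat.strong_induction_on generalizing u v with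
  | _ n ih =>
  by_cases h : Meets hd u v
  · obtain ⟨w, w', x, a, b, ha, hb, hab, h1, h2⟩ := h
    have hu := nf_eq_of_cls h1
    have hv := nf_eq_of_cls h2
    refine Filtered.of_iso ?_
      ((c.nabla_iso_of_nf F hd hu).tensor (c.nabla_iso_of_nf F hd hv)).symm
    rw [hu, hv, nf_wordL hd _ _ (by omega), nf_wordR hd _ _ (by omega)] at hn
    simp only [List.length_append, List.length_cons, List.length_nil] at hn
    rcases hab.eq_or_lt with hab | hab
    · refine Filtered.extension ?_ (.of_mem _ (.refl _)) (c.nabla_shortExact_eq K F hd w w' x ha hb hab)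
      -- The factor `R_d` is absorbed: `∇(w) ⊗ R_d` is `∇(w r_d)`, which has as many letters as
      -- `∇(w)`.
      let l : Letter d := .r d ⟨hd, le_rfl⟩
      have hl : (nf (w ++ [l])).2.length = (nf w).2.length := by
        have h3 : nf [l] = (1, []) := by rw [nf_cons, nfCons_rd, nf_nil, zero_add]
        rw [nf_append, h3]
        rcases nf w with ⟨z, L⟩
        rcases L.eq_nil_or_concat with rfl | ⟨L, ⟨e, g⟩, rfl⟩
        · rfl
        · simp only [List.concat_eq_append]
          rw [nfMul_append]
          simp
      refine Filtered.of_iso (ih _ ?_ (w ++ [l]) w' rfl) (Iso.symm (.tensor ?_ (.refl _)))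
      · rw [hl]
        omega
      · exact ((Iso.refl _).tensor (c.letter_iso_nabla F hd l)).trans
          (c.nabla_tensor_iso_of_not_meets F hd w [l] (not_meets_rd hd w))
    · exact Filtered.extension (.of_mem _ (.refl _)) (.of_mem _ (.refl _))
        (c.nabla_shortExact_lt K F hd w w' x ha hb ⟨by omega, hab.le⟩ hab)
  · exact .of_mem _ (c.nabla_tensor_iso_of_not_meets F hd u v h).symm

open Comod in
-- Induction on the number of letters as for `∇`. For `a + b = d` the quotient `Δ(w) ⊗ Δ(w')` has
-- two letters fewer.
theorem filtered_delta_tensor (K : LinRes R) (F : IsFrob R d t) (hd : 1 ≤ d) (u v : Word d) :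
    Filtered (c.delta (d := d)) ((c.delta u).tensor (c.delta v)) := by
  induction hn : (nf u).2.length + (nf v).2.length using Nat.strong_induction_on generalizing u v with
  | _ n ih =>
  by_cases h : Joins hd u v
  · obtain ⟨w, w', x, a, b, ha, hb, had, hbd, hab, h1, h2⟩ := h
    have hu := nf_eq_of_cls h1
    have hv := nf_eq_of_cls h2
    refine Filtered.of_iso ?_
      ((c.delta_iso_of_nf F hd hu).tensor (c.delta_iso_of_nf F hd hv)).symm
    rw [hu, hv, nf_wordL hd _ _ had, nf_wordR hd _ _ hbd] at hn
    simp only [List.length_append, List.length_cons, List.length_nil] at hn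
    rcases hab.eq_or_lt with hab | hab
    · exact Filtered.extension (.of_mem _ (.refl _)) (ih _ (by omega) w w' rfl)
        (c.delta_shortExact_eq K F hd w w' x ha hb had hbd hab.symm)
    · exact Filtered.extension (.of_mem _ (.refl _)) (.of_mem _ (.refl _))
        (c.delta_shortExact_gt K F hd w w' x ha hb had hbd ⟨by omega, by omega⟩)
  · exact .of_mem _ (c.delta_tensor_iso_of_not_joins F hd u v h).symm

open Comod in
-- A single letter admits no inclusion into it, so it is its own costandard comodule; `M(w)` is a
-- tensor product of letters.
theorem filtered_nabla_M (K : LinRes R) (F : IsFrob R d t) (hd : 1 ≤ d) (w : Word d) :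
    Filtered (c.nabla (d := d)) (c.M w) := by
  induction w with
  | nil => exact .of_mem [] (c.iso_nabla F hd [] imT_nil).symm
  | cons l w ih =>
    exact .tensor (c.filtered_nabla_tensor K F hd) (.of_mem _ (c.letter_iso_nabla F hd l).symm) ih

open Comod in
theorem filtered_delta_M (K : LinRes R) (F : IsFrob R d t) (hd : 1 ≤ d) (w : Word d) :
    Filtered (c.delta (d := d)) (c.M w) := by
  induction w with
  | nil => exact .of_mem [] (c.delta_iso F hd [] F.annT_nil)
  | cons l w ih =>
    exact .tensor (c.filtered_delta_tensor K F hd) (.of_mem _ (c.delta_iso_letter F hd l)) ih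

end Coaction
end Filtrations

end KoszulAS

end

open KoszulAS

theorem corollary1p2p2 {k : Type u} [Field k] [IsAlgClosed k] {V : Type u} [AddCommGroup V]
    [Module k V] [FiniteDimensional k V] (R : Submodule k (V ⊗[k] V)) (d : ℕ) (hd : 1 ≤ d)
    (hK : IsKoszul R) (hAS : IsASRegular R d)
    {H : Type u} [Ring H] [HopfAlgebra k H] (c : Coaction R H) (hc : c.IsUniversal) :
    -- closure of the two categories under tensor products
    (∀ X Y : Comod k H, X.HasFiltration (c.delta (d := d)) → Y.HasFiltration (c.delta (d := d)) →
      (X.tensor Y).HasFiltration (c.delta (d := d))) ∧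
    (∀ X Y : Comod k H, X.HasFiltration (c.nabla (d := d)) → Y.HasFiltration (c.nabla (d := d)) →
      (X.tensor Y).HasFiltration (c.nabla (d := d))) ∧
    -- every `M(λ)` has both kinds of filtration
    (∀ w : Word d, (c.M w).HasFiltration (c.delta (d := d)) ∧
      (c.M w).HasFiltration (c.nabla (d := d))) ∧
    -- the exact sequences for `∇`
    (∀ (w w' : Word d) (x : ℤ) (a b : ℕ) (ha : 1 ≤ a ∧ a ≤ d) (hb : 1 ≤ b ∧ b ≤ d),
      (∀ hab : 1 ≤ a + b ∧ a + b ≤ d, a + b < d →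
        Comod.ShortExact (c.nabla (w ++ .r (a + b) hab :: w'))
          ((c.nabla (wordL hd w a ha (-x))).tensor (c.nabla (wordR hd x b hb w')))
          (c.nabla (wordL hd w a ha (-x) ++ wordR hd x b hb w'))) ∧
      (a + b = d →
        Comod.ShortExact (((c.nabla w).tensor (c.RComod d)).tensor (c.nabla w'))
          ((c.nabla (wordL hd w a ha (-x))).tensor (c.nabla (wordR hd x b hb w')))
          (c.nabla (wordL hd w a ha (-x) ++ wordR hd x b hb w')))) ∧
    (∀ u v : Word d, ¬ Meets hd u v →
      Comod.Iso ((c.nabla u).tensor (c.nabla v)) (c.nabla (u ++ v))) ∧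
    -- the exact sequences for `Δ`
    (∀ (w w' : Word d) (x : ℤ) (a b : ℕ) (ha : 1 ≤ a ∧ a ≤ d) (hb : 1 ≤ b ∧ b ≤ d),
      a < d → b < d →
      (∀ hab : 1 ≤ a + b - d ∧ a + b - d ≤ d,
        Comod.ShortExact (c.delta (wordL hd w a ha (-x - 1) ++ wordR hd x b hb w'))
          ((c.delta (wordL hd w a ha (-x - 1))).tensor (c.delta (wordR hd x b hb w')))
          (c.delta (w ++ .r (a + b - d) hab :: w'))) ∧
      (a + b = d →
        Comod.ShortExact (c.delta (wordL hd w a ha (-x - 1) ++ wordR hd x b hb w'))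
          ((c.delta (wordL hd w a ha (-x - 1))).tensor (c.delta (wordR hd x b hb w')))
          ((c.delta w).tensor (c.delta w')))) ∧
    (∀ u v : Word d, ¬ Joins hd u v →
      Comod.Iso ((c.delta u).tensor (c.delta v)) (c.delta (u ++ v))) := by
  obtain ⟨K⟩ := hK.nonempty_linRes
  obtain ⟨t, F⟩ := K.exists_isFrob hd hAS
  refine ⟨fun X Y hX hY => ?_, fun X Y hX hY => ?_, fun w => ⟨?_, ?_⟩,
    fun w w' x a b ha hb => ⟨fun hab h => ?_, fun h => ?_⟩, fun u v h => ?_,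
    fun w w' x a b ha hb had hbd => ⟨fun hab => ?_, fun hab => ?_⟩, fun u v h => ?_⟩
  · exact (hX.filtered.tensor (c.filtered_delta_tensor K F hd) hY.filtered).hasFiltration
  · exact (hX.filtered.tensor (c.filtered_nabla_tensor K F hd) hY.filtered).hasFiltration
  · exact (c.filtered_delta_M K F hd w).hasFiltration
  · exact (c.filtered_nabla_M K F hd w).hasFiltration
  · exact c.nabla_shortExact_lt K F hd w w' x ha hb hab h
  · exact c.nabla_shortExact_eq K F hd w w' x ha hb h
  · exact c.nabla_tensor_iso_of_not_meets F hd u v h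
  · exact c.delta_shortExact_gt K F hd w w' x ha hb had hbd hab
  · exact c.delta_shortExact_eq K F hd w w' x ha hb had hbd hab
  · exact c.delta_tensor_iso_of_not_joins F hd u v h
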